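/- Conventions. Let $V$ be a category. A multitensor $(E,u,\sigma)$ on $V$ consists of functors $E_n : V^n \to V$ for all $n \ge 0$ (we write $E_i Z_i$ for $E_n(Z_1,\dots,Z_n)$), natural maps $u_Z : Z \to E_1(Z)$ and natural maps $\sigma : E_i E_j Z_{ij} \to E_{ij} Z_{ij}$, where $Z_{ij}$ ($1\le i\le m$, $1\le j\le n_i$) is a sequence of finite sequences and $E_{ij}Z_{ij}$ is the value of $E$ on the concatenated sequence, such that $\sigma\circ u_{E_iZ_i} = 1$, $\sigma\circ E_i(u_{Z_i}) = 1$, and the two composites $E_iE_jE_kZ_{ijk} \to E_{ijk}Z_{ijk}$ of substitution maps agree. Then $E_1$ is a monad on $V$ with unit $u$ and multiplication given by $\sigma$; $V^{E_1}$ denotes its category of algebras. $E$ is normal if $u$ is the identity. $E$ is distributive if $V$ has small coproducts and every $E_n$ preserves small coproducts in each variable. $E$ is accessible in each variable if there is a regular cardinal $\lambda$ such that every $E_n$ preserves $\lambda$-filtered colimits in each variable. An isomorphism of multitensors $E \cong F$ on $V$ is a family of natural isomorphisms $E_n \cong F_n$ compatible with the units and the substitutions. A $V$-graph $X$ is a (small)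 set $X_0$ with an object $X(a,b)$ of $V$ for all $a,b \in X_0$; a map $f : X \to Y$ of $V$-graphs is a function $f : X_0 \to Y_0$ with maps $X(a,b) \to Y(fa,fb)$. These form the category $\mathcal G V$. A category enriched in $E$ is a $V$-graph $X$ with maps $\kappa : E_i X(x_{i-1},x_i) \to X(x_0,x_n)$ for all $n\ge 0$ and $x_0,\dots,x_n \in X_0$, such that $\kappa\circ u = 1$ on each $X(x_0,x_1)$, and $\kappa\circ\sigma = \kappa\circ E_i\kappa$ as maps $E_iE_jX(x_{ij-1},x_{ij}) \to X(x_0,x_N)$ for each path $x_0,\dots,x_N$ cut into $m$ consecutive subpaths. An $E$-functor is a map of $V$-graphs compatible with the maps $\kappa$. These form the category $\mathrm{Enrich}\,E$. The maps $\kappa$ for $n=1$ make the homs of an $E$-category $E_1$-algebras, so besides the forgetful functor $\mathrm{Enrich}\,E \to \mathcal G V$ there is a forgetful functor $\mathrm{Enrich}\,E \to \mathcal G(V^{E_1})$. A lift of $E$ is a normal multitensor $E'$ on $V^{E_1}$ together with an isomorphism of categories $\mathrm{Enrich}\,E \cong \mathrm{Enrich}\,E'$ commuting with the forgetful functors to $\mathcal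 G(V^{E_1})$. It is a distributive lift if $E'$ is distributive. Theorem. Let $V$ be a locally presentable category and let $(E,u,\sigma)$ be a distributive multitensor on $V$ which is accessible in each variable. Then $E$ has a distributive lift $E'$, and it is unique up to isomorphism: for any two distributive lifts $E'$ and $E''$ of $E$ there is an isomorphism of multitensors $E' \cong E''$ on $V^{E_1}$ whose induced isomorphism $\mathrm{Enrich}\,E'' \cong \mathrm{Enrich}\,E'$ is compatible with the given isomorphisms of both with $\mathrm{Enrich}\,E$. -/

import Mathlib

open CategoryTheory CategoryTheory.Limits

universe w u u₁ u₂ u₃ v₁ v₂ v₃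

namespace MultitensorLifting

section Positions

/-! Positions in a concatenated sequence. A sequence of `m` sequences of lengths
`k 0, ..., k (m - 1)` has a concatenation of length `N = ∑ i, k i`; its entry `(i, j)` stands at
position `k 0 + ... + k (i - 1) + j`. Recall that `Fin.partialSum k t` is
`k 0 + ... + k (t - 1)`. -/

variable {m N : ℕ} {k : Fin m → ℕ}

theorem partialSum_last (h : ∑ i, k i = N) : Fin.partialSum k (Fin.last m) = N := by
  rw [← h, ← List.sum_ofFn, Fin.partialSum]
  congr 1
  exact List.take_of_length_le (by simp)

theorem partialSum_castSucc_le (k : Fin m → ℕ) (i : Fin m) :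
    Fin.partialSum k i.castSucc ≤ Fin.partialSum k i.succ := by
  rw [Fin.partialSum_succ]
  exact Nat.le_add_right _ _

theorem partialSum_le (h : ∑ i, k i = N) (t : Fin (m + 1)) : Fin.partialSum k t ≤ N := by
  rw [← partialSum_last h]
  exact Fin.monotone_iff_le_succ.2 (partialSum_castSucc_le k) (Fin.le_last t)

theorem partialSum_add_le (h : ∑ i, k i = N) (i : Fin m) :
    Fin.partialSum k i.castSucc + k i ≤ N := by
  rw [← Fin.partialSum_succ]
  exact partialSum_le h _

/-- The position of the entry `(i, j)` in the concatenation. -/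
def pos (h : ∑ i, k i = N) (i : Fin m) (j : Fin (k i)) : Fin N :=
  ⟨Fin.partialSum k i.castSucc + j, by have := partialSum_add_le h i; have := j.2; omega⟩

/-- A path with `N` steps has `N + 1` vertices. When it is cut into `m` consecutive subpaths with
`k 0, ..., k (m - 1)` steps, this is the `t`-th vertex of the `i`-th subpath. -/
def subVertex (h : ∑ i, k i = N) (i : Fin m) (t : Fin (k i + 1)) : Fin (N + 1) :=
  ⟨Fin.partialSum k i.castSucc + t, by have := partialSum_add_le h i; have := t.2; omega⟩

/-- The `t`-th of the `m + 1` vertices at which such a path is cut (its endpoints included). -/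
def cutVertex (h : ∑ i, k i = N) (t : Fin (m + 1)) : Fin (N + 1) :=
  ⟨Fin.partialSum k t, Nat.lt_succ_of_le (partialSum_le h t)⟩

theorem subVertex_last (h : ∑ i, k i = N) (i : Fin m) :
    subVertex h i (Fin.last (k i)) = cutVertex h i.succ :=
  Fin.ext (Fin.partialSum_succ k i).symm

theorem cutVertex_zero (h : ∑ i, k i = N) : cutVertex h 0 = 0 :=
  Fin.ext (Fin.partialSum_zero k)

theorem cutVertex_last (h : ∑ i, k i = N) : cutVertex h (Fin.last m) = Fin.last N :=
  Fin.ext (partialSum_last h)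

theorem pos_one {n : ℕ} (h : ∑ _i : Fin 1, n = n) (i : Fin 1) (j : Fin n) :
    pos (k := fun _ => n) h i j = j := by
  obtain rfl : i = 0 := Subsingleton.elim _ _
  apply Fin.ext
  have : Fin.partialSum (fun _ : Fin 1 => n) (Fin.castSucc 0) = 0 := Fin.partialSum_zero _
  simp only [pos, this, Nat.zero_add]

theorem partialSum_const_one {n : ℕ} (t : Fin (n + 1)) :
    Fin.partialSum (fun _ : Fin n => (1 : ℕ)) t = (t : ℕ) := by
  induction t using Fin.induction with
  | zero => exact Fin.partialSum_zero _
  | succ i ih => rw [Fin.partialSum_succ, ih]; rfl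

theorem pos_const_one {n : ℕ} (h : ∑ _i : Fin n, 1 = n) (i : Fin n) (j : Fin 1) :
    pos (k := fun _ => 1) h i j = i := by
  obtain rfl : j = 0 := Subsingleton.elim _ _
  apply Fin.ext
  exact congrArg (· + 0) (partialSum_const_one i.castSucc)

theorem partialSum_subVertex {K : ℕ} (hk : ∑ i, k i = K) (l : Fin K → ℕ) (i : Fin m)
    (t : Fin (k i + 1)) :
    Fin.partialSum l (subVertex hk i t) =
      Fin.partialSum l (cutVertex hk i.castSucc) +
        Fin.partialSum (fun j => l (pos hk i j)) t := by
  induction t using Fin.induction with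
  | zero =>
    rw [Fin.partialSum_zero]
    rfl
  | succ j ih =>
    rw [Fin.partialSum_succ, ← Nat.add_assoc, ← ih]
    exact Fin.partialSum_succ l (pos hk i j)

theorem partialSum_cutVertex {K : ℕ} (hk : ∑ i, k i = K) (l : Fin K → ℕ) {n : Fin m → ℕ}
    (hn : ∀ i, ∑ j, l (pos hk i j) = n i) (t : Fin (m + 1)) :
    Fin.partialSum l (cutVertex hk t) = Fin.partialSum n t := by
  induction t using Fin.induction with
  | zero => rw [cutVertex_zero, Fin.partialSum_zero, Fin.partialSum_zero]
  | succ i ih =>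
    rw [← subVertex_last, partialSum_subVertex, ih, Fin.partialSum_succ, partialSum_last (hn i)]

/-- The two ways of concatenating a triply indexed sequence agree. -/
theorem pos_pos {K : ℕ} (hk : ∑ i, k i = K) {l : Fin K → ℕ} (hl : ∑ q, l q = N) {n : Fin m → ℕ}
    (hn : ∀ i, ∑ j, l (pos hk i j) = n i) (hN : ∑ i, n i = N) (i : Fin m) (j : Fin (k i))
    (p : Fin (l (pos hk i j))) :
    pos hl (pos hk i j) p =
      pos hN i (pos (k := fun j => l (pos hk i j)) (hn i) j p) := by
  apply Fin.ext
  have h1 := partialSum_subVertex hk l i j.castSucc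
  rw [partialSum_cutVertex hk l hn] at h1
  have h2 : Fin.partialSum l (pos hk i j).castSucc =
      Fin.partialSum l (subVertex hk i j.castSucc) := rfl
  simp only [pos] at h1 h2 ⊢
  rw [h2, h1, Nat.add_assoc]

end Positions

/-- A multitensor `(E, u, σ)` on `V` (a lax monoidal structure): functors `E_n : Vⁿ ⥤ V` for all
`n ≥ 0`, that is a functor on the category of finite sequences in `V`, with a unit
`u_Z : Z ⟶ E_1 (Z)` and a substitution `σ : E_i E_j Z_{ij} ⟶ E_{ij} Z_{ij}`.
The substitution is indexed by the concatenated sequence `W`, so that `Z_{ij}` is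
`W (pos h i j)`. The `eqToHom`s are identities between equal objects: they only re-index. -/
structure Multitensor (V : Type u) [Category.{w} V] where
  /-- the functors `E_n` -/
  tensor (n : ℕ) : (Fin n → V) ⥤ V
  /-- the unit -/
  unit (X : V) : X ⟶ (tensor 1).obj fun _ => X
  /-- the substitution -/
  subst {m : ℕ} {k : Fin m → ℕ} {N : ℕ} (h : ∑ i, k i = N) (W : Fin N → V) :
    ((tensor m).obj fun i => (tensor (k i)).obj fun j => W (pos h i j)) ⟶ (tensor N).obj W
  unit_naturality {X Y : V} (f : X ⟶ Y) :
    unit X ≫ (tensor 1).map (X := fun _ => X) (Y := fun _ => Y) (fun _ => f) = f ≫ unit Y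
  subst_naturality {m : ℕ} {k : Fin m → ℕ} {N : ℕ} (h : ∑ i, k i = N) {W W' : Fin N → V}
    (f : W ⟶ W') :
    (tensor m).map (X := fun i => (tensor (k i)).obj fun j => W (pos h i j))
        (Y := fun i => (tensor (k i)).obj fun j => W' (pos h i j))
        (fun i => (tensor (k i)).map (X := fun j => W (pos h i j)) (Y := fun j => W' (pos h i j))
          fun j => f (pos h i j)) ≫ subst h W' =
      subst h W ≫ (tensor N).map f
  unit_subst {n : ℕ} (h : ∑ _i : Fin 1, n = n) (W : Fin n → V) :
    unit ((tensor n).obj W) ≫ eqToHom (by simp only [pos_one]) ≫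
      subst (k := fun _ => n) h W = 𝟙 ((tensor n).obj W)
  tensor_unit_subst {n : ℕ} (h : ∑ _i : Fin n, 1 = n) (W : Fin n → V) :
    (tensor n).map (X := W) (Y := fun i => (tensor 1).obj fun _ => W i) (fun i => unit (W i)) ≫
      eqToHom (by simp only [pos_const_one]) ≫
      subst (k := fun _ => 1) h W = 𝟙 ((tensor n).obj W)
  subst_subst {m K N : ℕ} {k : Fin m → ℕ} (hk : ∑ i, k i = K) {l : Fin K → ℕ}
    (hl : ∑ q, l q = N) {n : Fin m → ℕ} (hn : ∀ i, ∑ j, l (pos hk i j) = n i)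
    (hN : ∑ i, n i = N) (W : Fin N → V) :
    subst hk (fun q => (tensor (l q)).obj fun p => W (pos hl q p)) ≫ subst hl W =
      eqToHom (by simp only [pos_pos hk hl hn hN]) ≫
        (tensor m).map
          (X := fun i => (tensor (k i)).obj fun j => (tensor (l (pos hk i j))).obj fun p =>
            W (pos hN i (pos (k := fun j => l (pos hk i j)) (hn i) j p)))
          (Y := fun i => (tensor (n i)).obj fun q => W (pos hN i q))
          (fun i => subst (k := fun j => l (pos hk i j)) (hn i) fun q => W (pos hN i q)) ≫
        subst hN W

namespace Multitensor

variable {V : Type u} [Category.{w} V]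

/-- `E` is normal when its unit is the identity. -/
def IsNormal (E : Multitensor V) : Prop :=
  ∀ X : V, ∃ h : X = (E.tensor 1).obj (fun _ => X), E.unit X = eqToHom h

/-- The functor `V ⥤ Vⁿ` which puts the variable in place `i` and keeps the entries of `Z` in all
other places. -/
def variableAt {n : ℕ} (Z : Fin n → V) (i : Fin n) : V ⥤ (Fin n → V) :=
  Functor.pi' fun j => if j = i then 𝟭 V else (Functor.const V).obj (Z j)

/-- `E` is distributive when `V` has small coproducts and each `E_n` preserves them in each
variable. -/
def IsDistributive (E : Multitensor V) : Prop :=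
  HasCoproducts.{w} V ∧ ∀ (n : ℕ) (Z : Fin n → V) (i : Fin n) (J : Type w),
    PreservesColimitsOfShape (Discrete J) (variableAt Z i ⋙ E.tensor n)

/-- `E` is accessible in each variable: it preserves `κ`-filtered colimits in each variable, for
some regular cardinal `κ`. -/
def IsAccessibleInEachVariable (E : Multitensor V) : Prop :=
  ∃ (κ : Cardinal.{w}) (_ : Fact κ.IsRegular), ∀ (n : ℕ) (Z : Fin n → V) (i : Fin n),
    (variableAt Z i ⋙ E.tensor n).IsCardinalAccessible κ

/-- The endofunctor `E_1` of `V`. -/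
@[simps]
def unary (E : Multitensor V) : V ⥤ V where
  obj X := (E.tensor 1).obj fun _ => X
  map {X Y} f := (E.tensor 1).map (X := fun _ => X) (Y := fun _ => Y) fun _ => f
  map_id X := (E.tensor 1).map_id fun _ => X
  map_comp {X Y Z} f g :=
    (E.tensor 1).map_comp (X := fun _ => X) (Y := fun _ => Y) (Z := fun _ => Z)
      (fun _ => f) (fun _ => g)

/-- The monad structure on `E_1` given by the unit and the substitution of `E`. -/
def unaryMonad (E : Multitensor V) : Monad V where
  toFunctor := E.unary
  η := { app := E.unit, naturality := fun _ _ f => (E.unit_naturality f).symm }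
  μ :=
    { app := fun X => E.subst (m := 1) (k := fun _ => 1) (N := 1) (by simp) fun _ => X
      naturality := fun X Y f =>
        E.subst_naturality (m := 1) (k := fun _ => 1) (N := 1) (by simp)
          (W := fun _ => X) (W' := fun _ => Y) fun _ => f }
  assoc X := by
    have := E.subst_subst (m := 1) (K := 1) (N := 1) (k := fun _ => 1) (by simp)
      (l := fun _ => 1) (by simp) (n := fun _ => 1) (by simp) (by simp) (fun _ => X)
    rw [eqToHom_refl, Category.id_comp] at this
    exact this.symm
  left_unit X := by
    have := E.unit_subst (n := 1) (by simp) (fun _ => X)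
    rw [eqToHom_refl, Category.id_comp] at this
    exact this
  right_unit X := by
    have := E.tensor_unit_subst (n := 1) (by simp) (fun _ => X)
    rw [eqToHom_refl, Category.id_comp] at this
    exact this

/-- The category `V^{E_1}` of algebras of the monad `E_1`. -/
abbrev UnaryAlgebra (E : Multitensor V) : Type (max u w) := E.unaryMonad.Algebra

/-- An isomorphism of multitensors on `V`: natural isomorphisms `E_n ≅ F_n` compatible with the
units and the substitutions. -/
structure Iso (E F : Multitensor V) where
  /-- the natural isomorphisms -/
  iso (n : ℕ) : E.tensor n ≅ F.tensor n
  unit_iso (X : V) : E.unit X ≫ (iso 1).hom.app (fun _ => X) = F.unit X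
  subst_iso {m : ℕ} {k : Fin m → ℕ} {N : ℕ} (h : ∑ i, k i = N) (W : Fin N → V) :
    E.subst h W ≫ (iso N).hom.app W =
      (E.tensor m).map (X := fun i => (E.tensor (k i)).obj fun j => W (pos h i j))
          (Y := fun i => (F.tensor (k i)).obj fun j => W (pos h i j))
          (fun i => (iso (k i)).hom.app fun j => W (pos h i j)) ≫
        (iso m).hom.app (fun i => (F.tensor (k i)).obj fun j => W (pos h i j)) ≫ F.subst h W

end Multitensor

/-- A graph enriched in `V`: a (small) set of objects, and an object of `V` for each ordered pair
of objects. -/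
structure EGraph (V : Type u) [Category.{w} V] where
  /-- the objects of the graph -/
  Obj : Type w
  /-- the homs of the graph -/
  Hom : Obj → Obj → V

namespace EGraph

/-- A morphism of `V`-graphs. -/
structure Map {V : Type u} [Category.{w} V] (X Y : EGraph V) where
  /-- the object function -/
  obj : X.Obj → Y.Obj
  /-- the hom maps -/
  map (a b : X.Obj) : X.Hom a b ⟶ Y.Hom (obj a) (obj b)

/-- The category `𝒢V` of `V`-graphs. -/
instance {V : Type u} [Category.{w} V] : Category (EGraph V) where
  Hom := Map
  id X := ⟨id, fun _ _ => 𝟙 _⟩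
  comp f g := ⟨g.obj ∘ f.obj, fun a b => f.map a b ≫ g.map (f.obj a) (f.obj b)⟩
  id_comp f := by
    obtain ⟨o, p⟩ := f
    simp only [Category.id_comp]
    rfl
  comp_id f := by
    obtain ⟨o, p⟩ := f
    simp only [Category.comp_id]
    rfl
  assoc f g h := by
    simp only [Category.assoc]
    rfl

end EGraph

/-- A category enriched in `E`. A path `x` of `n + 1` objects gives a composition map
`E_i X(x_{i-1}, x_i) ⟶ X(x_0, x_n)`. The `eqToHom`s are identities between equal objects. -/
structure ECategory {V : Type u} [Category.{w} V] (E : Multitensor V) extends EGraph V where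
  /-- the composition maps -/
  comp {n : ℕ} (x : Fin (n + 1) → Obj) :
    ((E.tensor n).obj fun i => Hom (x i.castSucc) (x i.succ)) ⟶ Hom (x 0) (x (Fin.last n))
  unit_comp (x : Fin 2 → Obj) :
    E.unit (Hom (x 0) (x 1)) ≫
      eqToHom (by congr 1; funext i; rw [Subsingleton.elim i 0]; rfl) ≫ comp x = 𝟙 _
  subst_comp {m : ℕ} {k : Fin m → ℕ} {N : ℕ} (h : ∑ i, k i = N) (x : Fin (N + 1) → Obj) :
    E.subst h (fun q => Hom (x q.castSucc) (x q.succ)) ≫ comp x =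
      (E.tensor m).map
          (X := fun i => (E.tensor (k i)).obj fun j =>
            Hom (x (subVertex h i j.castSucc)) (x (subVertex h i j.succ)))
          (Y := fun i => Hom (x (cutVertex h i.castSucc)) (x (cutVertex h i.succ)))
          (fun i => comp (fun t => x (subVertex h i t)) ≫
            eqToHom (by rw [subVertex_last]; rfl)) ≫
        comp (fun t => x (cutVertex h t)) ≫
        eqToHom (by rw [cutVertex_zero, cutVertex_last])

namespace ECategory

section

variable {V : Type u} [Category.{w} V] {E : Multitensor V}

/-- An `E`-functor: a morphism of the underlying graphs which respects the compositions. -/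
structure EFunctor (X Y : ECategory E) extends EGraph.Map X.toEGraph Y.toEGraph where
  comp_map {n : ℕ} (x : Fin (n + 1) → X.Obj) :
    X.comp x ≫ map (x 0) (x (Fin.last n)) =
      (E.tensor n).map (X := fun i => X.Hom (x i.castSucc) (x i.succ))
          (Y := fun i => Y.Hom (obj (x i.castSucc)) (obj (x i.succ)))
          (fun i => map (x i.castSucc) (x i.succ)) ≫
        Y.comp (fun t => obj (x t))

theorem EFunctor.ext {X Y : ECategory E} {f g : EFunctor X Y} (h : f.toMap = g.toMap) :
    f = g := by
  cases f; cases g; cases h; rfl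

/-- The category `Enrich E` of `E`-categories and `E`-functors. -/
instance : Category (ECategory E) where
  Hom := EFunctor
  id X :=
    { toMap := 𝟙 X.toEGraph
      comp_map := fun x => by
        refine (Category.comp_id _).trans ?_
        refine Eq.trans (Category.id_comp _).symm (congrArg (· ≫ X.comp x) ?_)
        exact ((E.tensor _).map_id _).symm }
  comp {X Y Z} f g :=
    { toMap := (show X.toEGraph ⟶ Y.toEGraph from f.toMap) ≫ g.toMap
      comp_map := fun {n} x => by
        have h1 := f.comp_map x
        have h2 := g.comp_map (fun t => f.obj (x t))
        have h3 := (E.tensor n).map_comp (X := fun i => X.Hom (x i.castSucc) (x i.succ))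
          (Y := fun i => Y.Hom (f.obj (x i.castSucc)) (f.obj (x i.succ)))
          (Z := fun i => Z.Hom (g.obj (f.obj (x i.castSucc))) (g.obj (f.obj (x i.succ))))
          (fun i => f.map (x i.castSucc) (x i.succ))
          (fun i => g.map (f.obj (x i.castSucc)) (f.obj (x i.succ)))
        refine ((Category.assoc _ _ _).symm.trans (congrArg (· ≫ g.map _ _) h1)).trans ?_
        refine (Category.assoc _ _ _).trans ?_
        refine (congrArg (_ ≫ ·) h2).trans ?_
        refine (Category.assoc _ _ _).symm.trans ?_
        exact congrArg (· ≫ Z.comp (fun t => g.obj (f.obj (x t)))) h3.symm }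
  id_comp {X Y} f :=
    EFunctor.ext (Category.id_comp (show X.toEGraph ⟶ Y.toEGraph from f.toMap))
  comp_id {X Y} f :=
    EFunctor.ext (Category.comp_id (show X.toEGraph ⟶ Y.toEGraph from f.toMap))
  assoc {X Y Z T} f g h :=
    EFunctor.ext (Category.assoc (show X.toEGraph ⟶ Y.toEGraph from f.toMap)
      (show Y.toEGraph ⟶ Z.toEGraph from g.toMap) (show Z.toEGraph ⟶ T.toEGraph from h.toMap))

/-- The forgetful functor `U^E : Enrich E ⥤ 𝒢V`. -/
def forget (E : Multitensor V) : ECategory E ⥤ EGraph V where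
  obj X := X.toEGraph
  map f := f.toMap

theorem heq_comp {A A' B B' C C' : V} (hA : A = A') (hB : B = B') (hC : C = C')
    {f : A ⟶ B} {f' : A' ⟶ B'} {g : B ⟶ C} {g' : B' ⟶ C'} (hf : f ≍ f') (hg : g ≍ g') :
    f ≫ g ≍ f' ≫ g' := by
  subst hA hB hC hf hg
  rfl

theorem heq_tensor_map {n : ℕ} {A A' B B' : Fin n → V} (hA : ∀ i, A i = A' i)
    (hB : ∀ i, B i = B' i) {g : ∀ i, A i ⟶ B i} {g' : ∀ i, A' i ⟶ B' i}
    (hg : ∀ i, g i ≍ g' i) :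
    (E.tensor n).map (X := A) (Y := B) g ≍ (E.tensor n).map (X := A') (Y := B') g' := by
  obtain rfl : A = A' := funext hA
  obtain rfl : B = B' := funext hB
  obtain rfl : g = g' := funext fun i => eq_of_heq (hg i)
  rfl

/-- The composition map `E_1 X(a, b) ⟶ X(a, b)` of the path `(a, b)`. -/
def unaryComp (X : ECategory E) (a b : X.Obj) :
    ((E.tensor 1).obj fun _ => X.Hom a b) ⟶ X.Hom a b :=
  eqToHom (by congr 1; funext i; rw [Subsingleton.elim i 0]; rfl) ≫ X.comp ![a, b]

theorem heq_path (X : ECategory E) {n : ℕ} {x y : Fin (n + 1) → X.Obj} (e : ∀ t, x t = y t) :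
    X.comp x ≍ X.comp y := by
  obtain rfl : x = y := funext e
  rfl

theorem heq_subst {m : ℕ} {k : Fin m → ℕ} {N : ℕ} (h : ∑ i, k i = N) {W W' : Fin N → V}
    (e : ∀ q, W q = W' q) : E.subst h W ≍ E.subst h W' := by
  obtain rfl : W = W' := funext e
  rfl

theorem heq_unaryComp (X : ECategory E) (a b : X.Obj) : X.comp ![a, b] ≍ X.unaryComp a b :=
  (eqToHom_comp_heq _ _).symm

theorem unit_unaryComp (X : ECategory E) (a b : X.Obj) :
    E.unit (X.Hom a b) ≫ X.unaryComp a b = 𝟙 _ :=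
  X.unit_comp ![a, b]

theorem subst_unaryComp (X : ECategory E) (a b : X.Obj) (h : ∑ _i : Fin 1, 1 = 1) :
    E.subst (k := fun _ => 1) h (fun _ => X.Hom a b) ≫ X.unaryComp a b =
      (E.tensor 1).map (X := fun _ => (E.tensor 1).obj fun _ => X.Hom a b)
        (Y := fun _ => X.Hom a b) (fun _ => X.unaryComp a b) ≫ X.unaryComp a b := by
  have hcut (t : Fin 2) : cutVertex (k := fun _ : Fin 1 => 1) h t = t :=
    Fin.ext (partialSum_const_one t)
  have hsub (i : Fin 1) (t : Fin 2) : subVertex (k := fun _ : Fin 1 => 1) h i t = t := by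
    apply Fin.ext
    rw [Subsingleton.elim i 0]
    exact Nat.zero_add _
  have hW (q : Fin 1) : X.Hom (![a, b] q.castSucc) (![a, b] q.succ) = X.Hom a b := by
    rw [Subsingleton.elim q 0]
    rfl
  have hcut' (t : Fin 2) : ![a, b] (cutVertex (k := fun _ : Fin 1 => 1) h t) = ![a, b] t :=
    congrArg _ (hcut t)
  have hsub' (i : Fin 1) (t : Fin 2) :
      ![a, b] (subVertex (k := fun _ : Fin 1 => 1) h i t) = ![a, b] t :=
    congrArg _ (hsub i t)
  have hcutW (i : Fin 1) : X.Hom (![a, b] (cutVertex (k := fun _ : Fin 1 => 1) h i.castSucc))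
      (![a, b] (cutVertex (k := fun _ : Fin 1 => 1) h i.succ)) = X.Hom a b := by
    rw [hcut', hcut', hW]
  have hsubW (i j : Fin 1) :
      X.Hom (![a, b] (subVertex (k := fun _ : Fin 1 => 1) h i j.castSucc))
        (![a, b] (subVertex (k := fun _ : Fin 1 => 1) h i j.succ)) = X.Hom a b := by
    rw [hsub', hsub', hW]
  have key := X.subst_comp (k := fun _ => 1) h ![a, b]
  apply eq_of_heq
  refine HEq.trans (HEq.symm ?_) ((heq_of_eq key).trans ?_)
  · refine heq_comp ?_ ?_ rfl (heq_subst h hW) (X.heq_unaryComp a b)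
    · exact congrArg _ (funext fun i => congrArg _ (funext fun j => hW (pos h i j)))
    · exact congrArg _ (funext hW)
  · refine heq_comp ?_ ?_ rfl (heq_tensor_map ?_ hcutW fun i => ?_) ?_
    · exact congrArg _ (funext fun i => congrArg _ (funext fun j => hsubW i j))
    · exact congrArg _ (funext hcutW)
    · exact fun i => congrArg _ (funext fun j => hsubW i j)
    · refine (comp_eqToHom_heq _ _).trans ?_
      exact (X.heq_path (hsub' i)).trans (X.heq_unaryComp a b)
    · refine (comp_eqToHom_heq _ _).trans ?_
      exact (X.heq_path hcut').trans (X.heq_unaryComp a b)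

theorem unaryComp_map {X Y : ECategory E} (f : EFunctor X Y) (a b : X.Obj) :
    (E.tensor 1).map (X := fun _ => X.Hom a b) (Y := fun _ => Y.Hom (f.obj a) (f.obj b))
        (fun _ => f.map a b) ≫ Y.unaryComp (f.obj a) (f.obj b) =
      X.unaryComp a b ≫ f.map a b := by
  have key := f.comp_map ![a, b]
  have h0 : ∀ i : Fin 1, i = 0 := fun i => Subsingleton.elim i 0
  have hX (i : Fin 1) : X.Hom (![a, b] i.castSucc) (![a, b] i.succ) = X.Hom a b := by
    rw [h0 i]
    rfl
  have hY (i : Fin 1) : Y.Hom (f.obj (![a, b] i.castSucc)) (f.obj (![a, b] i.succ)) =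
      Y.Hom (f.obj a) (f.obj b) := by
    rw [h0 i]
    rfl
  have hf : ∀ t : Fin 2, f.obj (![a, b] t) = ![f.obj a, f.obj b] t := by
    intro t
    fin_cases t <;> rfl
  apply eq_of_heq
  refine HEq.trans (HEq.symm ?_) ((heq_of_eq key.symm).trans ?_)
  · refine heq_comp ?_ ?_ rfl (heq_tensor_map hX hY fun i => ?_)
      ((Y.heq_path hf).trans (Y.heq_unaryComp _ _))
    · exact congrArg _ (funext hX)
    · exact congrArg _ (funext hY)
    · rw [h0 i]
      rfl
  · exact heq_comp (congrArg _ (funext hX)) rfl rfl (X.heq_unaryComp a b) HEq.rfl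

/-- The homs of an `E`-category are `E_1`-algebras. -/
@[simps]
def homAlgebra (X : ECategory E) (a b : X.Obj) : E.UnaryAlgebra where
  A := X.Hom a b
  a := X.unaryComp a b
  unit := X.unit_unaryComp a b
  assoc := X.subst_unaryComp a b (by simp)

/-- The forgetful functor `Enrich E ⥤ 𝒢(V^{E_1})`, which remembers the homs of an `E`-category
with their `E_1`-algebra structures. -/
def forgetToUnary (E : Multitensor V) : ECategory E ⥤ EGraph E.UnaryAlgebra where
  obj X := { Obj := X.Obj, Hom := X.homAlgebra }
  map {X Y} f :=
    { obj := f.obj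
      map := fun a b => { f := f.map a b, h := unaryComp_map f a b } }

end

end ECategory

namespace Multitensor

variable {V : Type u} [Category.{w} V]

theorem eqToHom_app {n : ℕ} {G H : (Fin n → V) ⥤ V} (α : G ⟶ H) {W W' : Fin n → V}
    (e : W = W') (e' : G.obj W = G.obj W') :
    eqToHom e' ≫ α.app W' = α.app W ≫ eqToHom (by rw [e]) := by
  subst e
  simp

/-- An isomorphism `φ : E ≅ F` of multitensors turns a category enriched in `F` into a category
enriched in `E`: compose its composition maps with `φ`. -/
def Iso.pullback {E F : Multitensor V} (φ : E.Iso F) : ECategory F ⥤ ECategory E where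
  obj X :=
    { toEGraph := X.toEGraph
      comp := fun {n} x =>
        (φ.iso n).hom.app (fun i => X.Hom (x i.castSucc) (x i.succ)) ≫ X.comp x
      unit_comp := fun x => by
        have e : (fun _ : Fin 1 => X.Hom (x 0) (x 1)) =
            fun i => X.Hom (x i.castSucc) (x i.succ) := by
          funext i
          rw [Subsingleton.elim i 0]
          rfl
        have h1 := eqToHom_app (φ.iso 1).hom e (congrArg _ e)
        have h2 := φ.unit_iso (X.Hom (x 0) (x 1))
        refine Eq.trans ?_ (X.unit_comp x)
        rw [← h2]
        exact (congrArg (E.unit _ ≫ ·) (((Category.assoc _ _ _).symm.trans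
          (congrArg (· ≫ X.comp x) h1)).trans (Category.assoc _ _ _))).trans
          (Category.assoc _ _ _).symm
      subst_comp := fun {m k N} h x => by
        have h1 := φ.subst_iso h (fun q => X.Hom (x q.castSucc) (x q.succ))
        have h2 := X.subst_comp h x
        have h3 := (φ.iso m).hom.naturality
          (X := fun i => (F.tensor (k i)).obj fun j =>
            X.Hom (x (subVertex h i j.castSucc)) (x (subVertex h i j.succ)))
          (Y := fun i => X.Hom (x (cutVertex h i.castSucc)) (x (cutVertex h i.succ)))
          (fun i => X.comp (fun t => x (subVertex h i t)) ≫
            eqToHom (by rw [subVertex_last]; rfl))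
        have h4 := (E.tensor m).map_comp
          (X := fun i => (E.tensor (k i)).obj fun j =>
            X.Hom (x (subVertex h i j.castSucc)) (x (subVertex h i j.succ)))
          (Y := fun i => (F.tensor (k i)).obj fun j =>
            X.Hom (x (subVertex h i j.castSucc)) (x (subVertex h i j.succ)))
          (Z := fun i => X.Hom (x (cutVertex h i.castSucc)) (x (cutVertex h i.succ)))
          (fun i => (φ.iso (k i)).hom.app fun j =>
            X.Hom (x (subVertex h i j.castSucc)) (x (subVertex h i j.succ)))
          (fun i => X.comp (fun t => x (subVertex h i t)) ≫
            eqToHom (by rw [subVertex_last]; rfl))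
        refine (Category.assoc _ _ _).symm.trans ((congrArg (· ≫ X.comp x) h1).trans ?_)
        refine (Category.assoc _ _ _).trans ?_
        refine (congrArg (_ ≫ ·) ((Category.assoc _ _ _).trans (congrArg (_ ≫ ·) h2))).trans ?_
        refine (congrArg (_ ≫ ·) ((Category.assoc _ _ _).symm.trans
          (congrArg (· ≫ _) h3.symm))).trans ?_
        refine (congrArg (_ ≫ ·) (Category.assoc _ _ _)).trans ?_
        refine (Category.assoc _ _ _).symm.trans ?_
        refine (congrArg (· ≫ _) h4.symm).trans ?_
        simp only [Category.assoc]
        rfl }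
  map {X Y} f :=
    { toMap := f.toMap
      comp_map := fun {n} x => by
        have h1 := f.comp_map x
        have h2 := (φ.iso n).hom.naturality (X := fun i => X.Hom (x i.castSucc) (x i.succ))
          (Y := fun i => Y.Hom (f.obj (x i.castSucc)) (f.obj (x i.succ)))
          (fun i => f.map (x i.castSucc) (x i.succ))
        refine (Category.assoc _ _ _).trans ((congrArg (_ ≫ ·) h1).trans ?_)
        refine (Category.assoc _ _ _).symm.trans ((congrArg (· ≫ _) h2.symm).trans ?_)
        exact Category.assoc _ _ _ }

end Multitensor

/-- Two categories `P : A ⥤ C` and `Q : B ⥤ C` over `C` are isomorphic over `C`: an isomorphism of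
categories `A ≅ B` which commutes with `P` and `Q`. -/
structure IsoOver {A : Type u₁} [Category.{v₁} A] {B : Type u₂} [Category.{v₂} B]
    {C : Type u₃} [Category.{v₃} C] (P : A ⥤ C) (Q : B ⥤ C) where
  /-- the isomorphism -/
  hom : A ⥤ B
  /-- its inverse -/
  inv : B ⥤ A
  hom_inv : hom ⋙ inv = 𝟭 A
  inv_hom : inv ⋙ hom = 𝟭 B
  comm : hom ⋙ Q = P

/-- A lift of `E`: a normal multitensor `E'` on `V^{E_1}` together with an isomorphism
`Enrich E ≅ Enrich E'` over `𝒢(V^{E_1})`. -/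
structure Lift {V : Type u} [Category.{w} V] (E : Multitensor V) where
  /-- the multitensor `E'` -/
  lifted : Multitensor E.UnaryAlgebra
  normal : lifted.IsNormal
  /-- the isomorphism `Enrich E ≅ Enrich E'` -/
  enrichIso : IsoOver (ECategory.forgetToUnary E) (ECategory.forget lifted)

end MultitensorLifting

/-! Existence. For `E_1`-algebras `Z_1, ..., Z_n`, the lifted tensor `E'_n(Z)` is the hom from the
first to the last vertex of the `E`-category freely generated by the path with edges `Z_i`, where
the `E_1`-actions that the `Z_i` already carry are kept. All these homs are constructed at once. An
`EModule` is a family of functors `W_n` of `n` algebras with values in `V`, with an action `E_m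
W_{k_i} ⟶ W_N` that is unital and associative; `Letters` are natural `E_1`-linear maps `Z ⟶ W_1(Z)`.
The required object is the initial module with letters, given by `exists_initial_module`.

Modules are algebras for equations between terms of depth two. `Presentation.exists_reflection`
produces the reflection of a partial algebra `T X ⟶ Y` by iterating transfinitely a coequalizer
which identifies the two ways of evaluating terms of depth two. The iteration stops at a regular
cardinal because the operations preserve long chains jointly in all variables;
`preservesColimitsOfShape_of_variables` deduces this from accessibility in each variable. Every
stage is a colimit of families that preserve coproducts in each variable, and such families are
closed under colimits, so the result is distributive.

The initial module is related to `E`-categories in two ways. First, for an `E`-category `X`, the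
product of the homs `X(x_0, x_n)` over all paths `x` equipped with maps `Z_i ⟶ X(x_{i-1}, x_i)` is a
module with letters (`pathModule`; limits in `V` are used here). Initiality therefore gives an
interpretation `W_n(Z) ⟶ X(x_0, x_n)` for each such path. Second, the values of `W` on the intervals
of a sequence `Z` are the homs of an `E`-category (`intervals`), with the initial object as hom from
a later vertex to an earlier one; this is consistent because `E_n` is initial as soon as one entry
is. The interpretation along the generating path of this category is the identity, by initiality
(`reflect_eq_id`). So maps into `W_n(Z)` are detected by interpretations (`lift_hom_ext`). The
substitution of `W` is its interpretation along the cut vertices, and each multitensor axiom is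
checked after interpretation in an arbitrary `E`-category by `substHom_pathHom`. Interpreting turns
`E`-categories into categories enriched in the lift; applying `E_n` to letters goes back, and the
two are inverse (`enrichIso`).

The unit of this multitensor is the letter map. It is invertible (`isIso_nat`) because one can glue
a module with letters that has `Z` itself in degree one and is a retract through which the identity
of `W` factors. Transport along this isomorphism makes the unit an identity.

Uniqueness. A multitensor `F` that absorbs initial objects is recovered from its enriched categories
over graphs: `F_n(Z)` is a hom of the free `F`-category on a path. Given an isomorphism between the
categories of enriched categories of `F'` and `F` over graphs, composing the steps of the free
`F'`-category by its `F`-structure gives the `comparison` `F_n(Z) ⟶ F'_n(Z)`. Its inverse, its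
compatibility with units and substitutions, and the fact that it induces the given isomorphism all
follow from `comparison_compose`. -/

namespace MultitensorLifting

/-! ### Colimits of partial algebras `T X ⟶ Y`. -/

section CommaColimits

variable {C : Type u} [Category.{v₁} C] {T : C ⥤ C} {K : Type u₁} [Category.{v₂} K]

/-- A colimit cocone in `Comma T (𝟭 C)`, where `T` need not preserve colimits. -/
noncomputable def commaCocone [HasColimitsOfShape K C] [HasPushouts C]
    (F : K ⥤ Comma T (𝟭 C)) : Cocone F where
  pt :=
    { left := colimit (F ⋙ Comma.fst T (𝟭 C))
      right := pushout (colimit.post (F ⋙ Comma.fst T (𝟭 C)) T)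
        (colimMap (Functor.whiskerLeft F (Comma.natTrans T (𝟭 C)) :
          (F ⋙ Comma.fst T (𝟭 C)) ⋙ T ⟶ F ⋙ Comma.snd T (𝟭 C)))
      hom := pushout.inl _ _ }
  ι :=
    { app := fun k =>
        { left := colimit.ι (F ⋙ Comma.fst T (𝟭 C)) k
          right := colimit.ι (F ⋙ Comma.snd T (𝟭 C)) k ≫ pushout.inr _ _
          w := by
            have h1 := colimit.ι_post (F ⋙ Comma.fst T (𝟭 C)) T k
            have h2 := ι_colimMap (Functor.whiskerLeft F (Comma.natTrans T (𝟭 C)) :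
              (F ⋙ Comma.fst T (𝟭 C)) ⋙ T ⟶ F ⋙ Comma.snd T (𝟭 C)) k
            have h3 := pushout.condition (f := colimit.post (F ⋙ Comma.fst T (𝟭 C)) T)
              (g := colimMap (Functor.whiskerLeft F (Comma.natTrans T (𝟭 C)) :
                (F ⋙ Comma.fst T (𝟭 C)) ⋙ T ⟶ F ⋙ Comma.snd T (𝟭 C)))
            have h4 : (F.obj k).hom ≫ colimit.ι (F ⋙ Comma.snd T (𝟭 C)) k =
              colimit.ι ((F ⋙ Comma.fst T (𝟭 C)) ⋙ T) k ≫ colimMap _ := h2.symm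
            change T.map (colimit.ι (F ⋙ Comma.fst T (𝟭 C)) k) ≫ pushout.inl _ _ =
              (F.obj k).hom ≫ colimit.ι (F ⋙ Comma.snd T (𝟭 C)) k ≫ pushout.inr _ _
            rw [← Category.assoc, h4, Category.assoc, ← h3, ← Category.assoc]
            exact congrArg (· ≫ pushout.inl _ _) h1.symm }
      naturality := fun k k' f => by
        ext
        · exact (colimit.w (F ⋙ Comma.fst T (𝟭 C)) f).trans (Category.comp_id _).symm
        · have := colimit.w (F ⋙ Comma.snd T (𝟭 C)) f
          change (F.map f).right ≫ colimit.ι (F ⋙ Comma.snd T (𝟭 C)) k' ≫ pushout.inr _ _ =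
            (colimit.ι (F ⋙ Comma.snd T (𝟭 C)) k ≫ pushout.inr _ _) ≫ 𝟙 _
          rw [Category.comp_id, ← Category.assoc]
          exact congrArg (· ≫ pushout.inr _ _) this }

/-- The pushout compensates for `T` not preserving the colimit: a cocone supplies one map out of `T`
of the colimit through its own structure map and one out of the colimit of the right-hand objects,
and these agree on the colimit of the `T` of the left-hand objects. -/
noncomputable def commaCoconeIsColimit [HasColimitsOfShape K C] [HasPushouts C]
    (F : K ⥤ Comma T (𝟭 C)) : IsColimit (commaCocone F) where
  desc s :=
    { left := colimit.desc (F ⋙ Comma.fst T (𝟭 C)) ((Comma.fst T (𝟭 C)).mapCocone s)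
      right := pushout.desc
        (T.map (colimit.desc (F ⋙ Comma.fst T (𝟭 C)) ((Comma.fst T (𝟭 C)).mapCocone s)) ≫
          s.pt.hom)
        (colimit.desc (F ⋙ Comma.snd T (𝟭 C)) ((Comma.snd T (𝟭 C)).mapCocone s)) (by
          apply colimit.hom_ext
          intro k
          have h1 := colimit.ι_post (F ⋙ Comma.fst T (𝟭 C)) T k
          have h2 := ι_colimMap (Functor.whiskerLeft F (Comma.natTrans T (𝟭 C)) :
            (F ⋙ Comma.fst T (𝟭 C)) ⋙ T ⟶ F ⋙ Comma.snd T (𝟭 C)) k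
          have h3 := colimit.ι_desc ((Comma.fst T (𝟭 C)).mapCocone s) k
          have h4 := colimit.ι_desc ((Comma.snd T (𝟭 C)).mapCocone s) k
          refine ((Category.assoc _ _ _).symm.trans (congrArg (· ≫ T.map _ ≫ s.pt.hom) h1)).trans ?_
          refine Eq.trans ?_ ((congrArg (· ≫ _) h2).symm.trans (Category.assoc _ _ _))
          refine Eq.trans ?_ ((Category.assoc _ _ _).trans (congrArg (_ ≫ ·) h4)).symm
          rw [← T.map_comp_assoc, h3]
          exact (s.ι.app k).w)
      w := (pushout.inl_desc _ _ _).symm }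
  fac s k := by
    ext
    · exact colimit.ι_desc ((Comma.fst T (𝟭 C)).mapCocone s) k
    · refine (Category.assoc _ _ _).trans ?_
      refine (congrArg (_ ≫ ·) (pushout.inr_desc _ _ _)).trans ?_
      exact colimit.ι_desc ((Comma.snd T (𝟭 C)).mapCocone s) k
  uniq s m hm := by
    have hl : m.left = colimit.desc (F ⋙ Comma.fst T (𝟭 C)) ((Comma.fst T (𝟭 C)).mapCocone s) := by
      apply colimit.hom_ext
      intro k
      refine Eq.trans ?_ (colimit.ι_desc ((Comma.fst T (𝟭 C)).mapCocone s) k).symm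
      exact congrArg CommaMorphism.left (hm k)
    ext
    · exact hl
    · apply pushout.hom_ext
      · refine Eq.trans ?_ (pushout.inl_desc _ _ _).symm
        rw [← hl]
        exact m.w.symm
      · refine Eq.trans ?_ (pushout.inr_desc _ _ _).symm
        apply colimit.hom_ext
        intro k
        refine Eq.trans ?_ (colimit.ι_desc ((Comma.snd T (𝟭 C)).mapCocone s) k).symm
        exact (Category.assoc _ _ _).symm.trans (congrArg CommaMorphism.right (hm k))

theorem hasColimitsOfShape_comma [HasColimitsOfShape K C] [HasPushouts C] :
    HasColimitsOfShape K (Comma T (𝟭 C)) where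
  has_colimit F := ⟨⟨_, commaCoconeIsColimit F⟩⟩

/-- The explicit colimit is assembled from values satisfying `P` by colimits of shape `K`, by `T`
and by one pushout. This is the limit step when a property is carried through the transfinite
construction. -/
theorem prop_comma_of_isColimit [HasColimitsOfShape K C] [HasPushouts C] (P : ObjectProperty C)
    [P.IsClosedUnderIsomorphisms] [P.IsClosedUnderColimitsOfShape K]
    [P.IsClosedUnderColimitsOfShape WalkingSpan] (hT : ∀ X, P X → P (T.obj X))
    {F : K ⥤ Comma T (𝟭 C)} {c : Cocone F} (hc : IsColimit c)
    (hF : ∀ k, P (F.obj k).left ∧ P (F.obj k).right) : P c.pt.left ∧ P c.pt.right := by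
  let e := (commaCoconeIsColimit F).coconePointUniqueUpToIso hc
  have hl : P (commaCocone F).pt.left := P.prop_colimit _ fun k => (hF k).1
  refine ⟨P.prop_of_iso ((Comma.fst _ _).mapIso e) hl,
    P.prop_of_iso ((Comma.snd _ _).mapIso e) ?_⟩
  refine P.prop_colimit _ ?_
  -- The corners of the span: the colimit of the `T`-images, `T` of the colimit, and the colimit of
  -- the right-hand objects.
  rintro (_ | _ | _)
  · exact P.prop_colimit _ fun k => hT _ (hF k).1
  · exact hT _ hl
  · exact P.prop_colimit _ fun k => (hF k).2

end CommaColimits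

/-! ### Reflecting partial algebras into the algebras of a presentation. -/

/-- A presentation of a class of algebras of an endofunctor `T` by equations between terms of
depth two: `S X` indexes such terms, `flatten` turns them into terms of depth one, and `eval`
evaluates their inner operations in a partial algebra `T X ⟶ Y`. -/
structure Presentation {C : Type u} [Category.{v₁} C] (T S : C ⥤ C) where
  η : 𝟭 C ⟶ T
  flatten : S ⟶ T
  outer : T ⟶ S
  eval : Comma.fst T (𝟭 C) ⋙ S ⟶ Comma.snd T (𝟭 C) ⋙ T
  outer_flatten (X : C) : outer.app X ≫ flatten.app X = 𝟙 _
  outer_eval (p : Comma T (𝟭 C)) : outer.app p.left ≫ eval.app p = p.hom ≫ η.app p.right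

namespace Presentation

variable {C : Type u} [Category.{v₁} C] {T S : C ⥤ C} (R : Presentation T S)

/-- The evaluation of inner operations in a partial algebra. -/
def evalHom (p : Comma T (𝟭 C)) : S.obj p.left ⟶ T.obj p.right := R.eval.app p

/-- The algebras of a presentation, as partial algebras. -/
structure IsAlgebra (D : C) (d : T.obj D ⟶ D) : Prop where
  unit : R.η.app D ≫ d = 𝟙 D
  eval : R.evalHom (Comma.mk D D d) ≫ d = R.flatten.app D ≫ d

/-- The comparison map of a partial algebra. -/
def q (p : Comma T (𝟭 C)) : p.left ⟶ p.right := R.η.app p.left ≫ p.hom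

theorem q_naturality {p p' : Comma T (𝟭 C)} (f : p ⟶ p') :
    f.left ≫ R.q p' = R.q p ≫ f.right := by
  have h1 := R.η.naturality f.left
  have h2 := f.w
  dsimp at h1 h2
  rw [q, q, Category.assoc, ← h2, ← Category.assoc, ← Category.assoc, h1]

section

variable [HasCoequalizers C]

/-- The next partial algebra. -/
noncomputable def succ (p : Comma T (𝟭 C)) : Comma T (𝟭 C) where
  left := p.right
  right := coequalizer (R.evalHom p) (R.flatten.app p.left ≫ T.map (R.q p))
  hom := coequalizer.π (R.evalHom p) (R.flatten.app p.left ≫ T.map (R.q p))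

/-- The structure map of the next partial algebra. -/
noncomputable def succHom (p : Comma T (𝟭 C)) : T.obj p.right ⟶ (R.succ p).right :=
  (R.succ p).hom

theorem eval_succ_hom (p : Comma T (𝟭 C)) :
    R.evalHom p ≫ R.succHom p = R.flatten.app p.left ≫ T.map (R.q p) ≫ R.succHom p :=
  (coequalizer.condition (R.evalHom p) (R.flatten.app p.left ≫ T.map (R.q p))).trans
    (Category.assoc _ _ _)

/-- The map to the next partial algebra. -/
noncomputable def toSucc (p : Comma T (𝟭 C)) : p ⟶ R.succ p where
  left := R.q p
  right := R.q (R.succ p)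
  w := by
    have h1 : R.outer.app p.left ≫ R.evalHom p = p.hom ≫ R.η.app p.right := R.outer_eval p
    have h2 := R.eval_succ_hom p
    have h3 := R.outer_flatten p.left
    refine Eq.trans ?_ (Category.assoc _ _ _)
    refine Eq.trans ?_ (congrArg (· ≫ R.succHom p) h1)
    rw [Category.assoc, h2, ← Category.assoc, h3, Category.id_comp]
    rfl

/-- The algebras of the presentation among the partial algebras. -/
def algebras : ObjectProperty (Comma T (𝟭 C)) :=
  fun p => ∃ (D : C) (d : T.obj D ⟶ D), R.IsAlgebra D d ∧ p = Comma.mk D D d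

/-- An algebra has the identity as comparison map, so a map from `p` into it is determined by its
right component `g`, the left one being `R.q p ≫ g`. The map `T g ≫ d` coequalizes the two
evaluations of terms of depth two because the algebra satisfies the equations, hence it factors
uniquely through the next stage. -/
theorem isLocal_toSucc (p : Comma T (𝟭 C)) : R.algebras.isLocal (R.toSucc p) := by
  rintro _ ⟨D, d, hD, rfl⟩
  have hq : R.q (Comma.mk D D d) = 𝟙 D := hD.unit
  constructor
  · intro f g h
    have hl : f.left = g.left := by
      have hf := R.q_naturality f
      have hg := R.q_naturality g
      rw [hq] at hf hg
      have h' := congrArg CommaMorphism.right h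
      change R.q (R.succ p) ≫ f.right = R.q (R.succ p) ≫ g.right at h'
      rw [← hf, ← hg] at h'
      exact (Category.comp_id _).symm.trans (h'.trans (Category.comp_id _))
    ext
    · exact hl
    · apply coequalizer.hom_ext
      have hf := f.w
      have hg := g.w
      rw [hl] at hf
      exact hf.symm.trans hg
  · intro f
    have hf : f.left = R.q p ≫ f.right :=
      ((Category.comp_id _).symm.trans (congrArg (f.left ≫ ·) hq.symm)).trans (R.q_naturality f)
    have hw : T.map f.left ≫ d = p.hom ≫ f.right := f.w
    have h1 : R.evalHom p ≫ T.map f.right = S.map f.left ≫ R.evalHom (Comma.mk D D d) :=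
      (R.eval.naturality f).symm
    have h2 : S.map f.left ≫ R.flatten.app D = R.flatten.app p.left ≫ T.map f.left :=
      R.flatten.naturality f.left
    have h3 : R.evalHom p ≫ T.map f.right ≫ d =
        (R.flatten.app p.left ≫ T.map (R.q p)) ≫ T.map f.right ≫ d := by
      rw [← Category.assoc, h1, Category.assoc, hD.eval, ← Category.assoc, h2, Category.assoc,
        Category.assoc, ← T.map_comp_assoc, ← hf]
    have h4 : R.succHom p ≫ coequalizer.desc (T.map f.right ≫ d) h3 = T.map f.right ≫ d :=
      coequalizer.π_desc _ _
    have h5 : R.η.app p.right ≫ T.map f.right ≫ d = f.right := by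
      have h6 : f.right ≫ R.η.app D = R.η.app p.right ≫ T.map f.right := R.η.naturality f.right
      rw [← Category.assoc, ← h6, Category.assoc, hD.unit]
      exact Category.comp_id _
    refine ⟨{ left := f.right, right := coequalizer.desc (T.map f.right ≫ d) h3, w := h4.symm }, ?_⟩
    ext
    · exact hf.symm
    · exact (Category.assoc _ _ _).trans ((congrArg (_ ≫ ·) h4).trans h5)


/-- The transfinite iteration of the construction of the next partial algebra. -/
noncomputable def succStruct (p : Comma T (𝟭 C)) : SmallObject.SuccStruct (Comma T (𝟭 C)) where
  X₀ := p
  succ := R.succ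
  toSucc := R.toSucc

variable (J : Type w) [LinearOrder J] [OrderBot J] [SuccOrder J] [WellFoundedLT J]

theorem isLocal_ιIteration [HasIterationOfShape J (Comma T (𝟭 C))]
    (p : Comma T (𝟭 C)) : R.algebras.isLocal ((R.succStruct p).ιIteration J) := by
  refine R.algebras.isLocal.transfiniteCompositionsOfShape_le J _
    ⟨((R.succStruct p).transfiniteCompositionOfShapeιIteration J).ofLE ?_⟩
  rintro _ _ _ ⟨_⟩
  exact R.isLocal_toSucc _

/-- The left object of stage `j + 1` is the right object of stage `j`. The map `r` is this
identification, which one step later inverts the comparison map; the last equation says that the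
equation of the presentation holds one step later. -/
theorem exists_section_succ [HasIterationOfShape J (Comma T (𝟭 C))]
    [NoMaxOrder J] (p : Comma T (𝟭 C)) (j : J) :
    ∃ r : (((R.succStruct p).iterationFunctor J).obj j).right ⟶
        (((R.succStruct p).iterationFunctor J).obj (Order.succ j)).left,
      R.q _ ≫ r = (((R.succStruct p).iterationFunctor J).map (homOfLE (Order.le_succ j))).left ∧
      r ≫ R.q _ =
        (((R.succStruct p).iterationFunctor J).map (homOfLE (Order.le_succ j))).right ∧
      R.evalHom _ ≫ T.map r ≫ (((R.succStruct p).iterationFunctor J).obj (Order.succ j)).hom =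
        R.flatten.app _ ≫ T.map
          (((R.succStruct p).iterationFunctor J).map (homOfLE (Order.le_succ j))).left ≫
            (((R.succStruct p).iterationFunctor J).obj (Order.succ j)).hom := by
  have hm := (R.succStruct p).iterationFunctor_map_succ j (not_isMax j)
  set F := (R.succStruct p).iterationFunctor J
  let e : R.succ (F.obj j) ⟶ F.obj (Order.succ j) :=
    ((R.succStruct p).iterationFunctorObjSuccIso j (not_isMax j)).inv
  have hm' : F.map (homOfLE (Order.le_succ j)) = R.toSucc (F.obj j) ≫ e := hm
  have hl : (F.map (homOfLE (Order.le_succ j))).left = R.q (F.obj j) ≫ e.left :=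
    congrArg CommaMorphism.left hm'
  let el : (F.obj j).right ⟶ (F.obj (Order.succ j)).left := e.left
  have hl' : (F.map (homOfLE (Order.le_succ j))).left = R.q (F.obj j) ≫ el := hl
  have hw : T.map el ≫ (F.obj (Order.succ j)).hom = R.succHom (F.obj j) ≫ e.right := e.w
  refine ⟨el, hl.symm, ?_, ?_⟩
  · rw [hm']
    exact R.q_naturality e
  · rw [hl', T.map_comp, Category.assoc, hw, ← Category.assoc, R.eval_succ_hom]
    simp only [Category.assoc]

/-- The transfinite iteration of the construction of the next partial algebra gives an algebra. -/
theorem exists_isAlgebra_iteration [HasIterationOfShape J C] [HasPushouts C]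
    [HasIterationOfShape J (Comma T (𝟭 C))] [PreservesColimitsOfShape J T]
    [PreservesColimitsOfShape J S] [NoMaxOrder J] (p : Comma T (𝟭 C)) :
    ∃ (D : C) (d : T.obj D ⟶ D), R.IsAlgebra D d ∧
      Nonempty ((R.succStruct p).iteration J ≅ Comma.mk D D d) := by
  let F := (R.succStruct p).iterationFunctor J
  let c : Cocone F := (R.succStruct p).iterationCocone J
  have hc : IsColimit c := (R.succStruct p).isColimitIterationCocone J
  have hX : IsColimit ((Comma.fst T (𝟭 C)).mapCocone c) := isColimitOfPreserves _ hc
  have hY : IsColimit ((Comma.snd T (𝟭 C)).mapCocone c) := isColimitOfPreserves _ hc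
  have hSX : IsColimit (S.mapCocone ((Comma.fst T (𝟭 C)).mapCocone c)) := isColimitOfPreserves _ hX
  choose r hr1 hr2 hr3 using fun j => R.exists_section_succ J p j
  let X := c.pt.left
  let Y := c.pt.right
  let x : T.obj X ⟶ Y := c.pt.hom
  let ιX (j : J) : (F.obj j).left ⟶ X := (c.ι.app j).left
  let ιY (j : J) : (F.obj j).right ⟶ Y := (c.ι.app j).right
  have hιX {j j' : J} (f : j ⟶ j') : (F.map f).left ≫ ιX j' = ιX j :=
    congrArg CommaMorphism.left (c.w f)
  have hιY {j j' : J} (f : j ⟶ j') : (F.map f).right ≫ ιY j' = ιY j :=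
    congrArg CommaMorphism.right (c.w f)
  have hq (j : J) : ιX j ≫ R.q c.pt = R.q (F.obj j) ≫ ιY j := R.q_naturality (c.ι.app j)
  have hr {j j' : J} (f : j ⟶ j') :
      (F.map f).right ≫ r j' ≫ ιX (Order.succ j') = r j ≫ ιX (Order.succ j) := by
    rcases (leOfHom f).eq_or_lt with h | h
    · subst h
      obtain rfl : f = 𝟙 _ := Subsingleton.elim _ _
      rw [F.map_id]
      exact Category.id_comp _
    -- For `j < j'` the transition factors through the successor of `j`, which is where `r j` lands.
    · have hs : Order.succ j ≤ j' := Order.succ_le_of_lt h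
      obtain rfl : f = homOfLE (Order.le_succ j) ≫ homOfLE hs := Subsingleton.elim _ _
      have h1 := R.q_naturality (F.map (homOfLE hs))
      have h2 : (F.map (homOfLE (Order.le_succ j) ≫ homOfLE hs)).right =
          r j ≫ (F.map (homOfLE hs)).left ≫ R.q (F.obj j') := by
        rw [F.map_comp, h1, ← Category.assoc, hr2]
        rfl
      rw [h2]
      simp only [Category.assoc]
      rw [← Category.assoc (R.q (F.obj j')), hr1, hιX, hιX]
  -- In the colimit the maps `r j` glue to an inverse of the comparison map, so the limit stage is a
  -- total algebra up to isomorphism.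
  let s : Y ⟶ X := hY.desc (Cocone.mk X
    { app := fun j => r j ≫ ιX (Order.succ j)
      naturality := fun j j' f => (hr f).trans (Category.comp_id _).symm })
  have hs (j : J) : ιY j ≫ s = r j ≫ ιX (Order.succ j) := hY.fac _ j
  have hqs : R.q c.pt ≫ s = 𝟙 X := hX.hom_ext fun j => by
    change ιX j ≫ R.q c.pt ≫ s = ιX j ≫ 𝟙 X
    rw [← Category.assoc, hq, Category.assoc, hs, ← Category.assoc, hr1, hιX, Category.comp_id]
  have hsq : s ≫ R.q c.pt = 𝟙 Y := hY.hom_ext fun j => by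
    change ιY j ≫ s ≫ R.q c.pt = ιY j ≫ 𝟙 Y
    rw [← Category.assoc, hs, Category.assoc, hq, ← Category.assoc, hr2, hιY, Category.comp_id]
  let e : c.pt ≅ Comma.mk X X (x ≫ s) :=
    Comma.isoMk (Iso.refl X) ⟨s, R.q c.pt, hsq, hqs⟩ (by
      change T.map (𝟙 X) ≫ x ≫ s = x ≫ s
      rw [T.map_id, Category.id_comp])
  refine ⟨X, x ≫ s, ⟨?_, ?_⟩, ⟨e⟩⟩
  · exact (Category.assoc _ _ _).symm.trans hqs
  · have he : R.evalHom c.pt ≫ T.map s = R.evalHom (Comma.mk X X (x ≫ s)) := by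
      have h1 : S.map (𝟙 X) ≫ R.evalHom (Comma.mk X X (x ≫ s)) = R.evalHom c.pt ≫ T.map s :=
        R.eval.naturality e.hom
      rw [← h1, S.map_id]
      exact Category.id_comp (R.evalHom (Comma.mk X X (x ≫ s)))
    rw [← he]
    -- Since `S` preserves the colimit of the chain, the equation can be tested on stage `j`, where
    -- it holds after passing to the next stage.
    refine hSX.hom_ext fun j => ?_
    have h1 : S.map (ιX j) ≫ R.evalHom c.pt = R.evalHom (F.obj j) ≫ T.map (ιY j) :=
      R.eval.naturality (c.ι.app j)
    have h2 : S.map (ιX j) ≫ R.flatten.app X = R.flatten.app (F.obj j).left ≫ T.map (ιX j) :=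
      R.flatten.naturality (ιX j)
    have h3 (j : J) : T.map (ιX j) ≫ x = (F.obj j).hom ≫ ιY j := (c.ι.app j).w
    change S.map (ιX j) ≫ (R.evalHom c.pt ≫ T.map s) ≫ x ≫ s =
      S.map (ιX j) ≫ R.flatten.app X ≫ x ≫ s
    have h4 : T.map (ιX (Order.succ j)) ≫ x ≫ s =
        (F.obj (Order.succ j)).hom ≫ ιY (Order.succ j) ≫ s := by
      rw [← Category.assoc, h3]
      exact Category.assoc _ _ _
    calc S.map (ιX j) ≫ (R.evalHom c.pt ≫ T.map s) ≫ x ≫ s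
        = (S.map (ιX j) ≫ R.evalHom c.pt) ≫ T.map s ≫ x ≫ s := by simp only [Category.assoc]
      _ = R.evalHom (F.obj j) ≫ T.map (ιY j ≫ s) ≫ x ≫ s := by
        rw [h1, T.map_comp]
        simp only [Category.assoc]
      _ = (R.evalHom (F.obj j) ≫ T.map (r j) ≫ (F.obj (Order.succ j)).hom) ≫
            ιY (Order.succ j) ≫ s := by
        rw [hs, T.map_comp]
        simp only [Category.assoc]
        rw [h4]
      _ = R.flatten.app _ ≫ T.map (ιX j) ≫ x ≫ s := by
        refine (congrArg (· ≫ ιY (Order.succ j) ≫ s) (hr3 j)).trans ?_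
        rw [← hιX (homOfLE (Order.le_succ j)), T.map_comp]
        simp only [Category.assoc]
        rw [h4]
      _ = S.map (ιX j) ≫ R.flatten.app X ≫ x ≫ s := by
        rw [← Category.assoc, ← h2, Category.assoc]

/-- Each stage arises from the previous ones by `S`, `T`, coequalizers, pushouts and colimits of
chains, and `P` is closed under all of these. It is applied to the property of preserving coproducts
in each variable. -/
theorem prop_iteration [HasColimitsOfSize.{w, w} C] [HasPushouts C]
    [HasIterationOfShape J (Comma T (𝟭 C))] (P : ObjectProperty C)
    [P.IsClosedUnderIsomorphisms] [∀ (K : Type w) [SmallCategory K], P.IsClosedUnderColimitsOfShape K]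
    [P.IsClosedUnderColimitsOfShape WalkingSpan]
    [P.IsClosedUnderColimitsOfShape WalkingParallelPair]
    (hT : ∀ X, P X → P (T.obj X)) (hS : ∀ X, P X → P (S.obj X))
    (p : Comma T (𝟭 C)) (hp : P p.left ∧ P p.right) :
    P ((R.succStruct p).iteration J).left ∧ P ((R.succStruct p).iteration J).right := by
  have hsucc (p : Comma T (𝟭 C)) (hp : P p.left ∧ P p.right) :
      P (R.succ p).left ∧ P (R.succ p).right := by
    refine ⟨hp.2, P.prop_colimit _ ?_⟩
    rintro (_ | _)
    · exact hS _ hp.1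
    · exact hT _ hp.2
  have hiso {p p' : Comma T (𝟭 C)} (e : p ≅ p') (hp : P p.left ∧ P p.right) :
      P p'.left ∧ P p'.right :=
    ⟨P.prop_of_iso ((Comma.fst _ _).mapIso e) hp.1, P.prop_of_iso ((Comma.snd _ _).mapIso e) hp.2⟩
  have key (j : J) : P (((R.succStruct p).iterationFunctor J).obj j).left ∧
      P (((R.succStruct p).iterationFunctor J).obj j).right := by
    induction j using SuccOrder.limitRecOn with
    | isMin j hj =>
      obtain rfl := hj.eq_bot
      exact hiso ((R.succStruct p).iterationFunctorObjBotIso J).symm hp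
    | succ j hj ih =>
      exact hiso ((R.succStruct p).iterationFunctorObjSuccIso j hj).symm (hsucc _ ih)
    | isSuccLimit j hj ih =>
      exact prop_comma_of_isColimit P hT
        (((R.succStruct p).iterationFunctor J).isColimitOfIsWellOrderContinuous j hj)
        fun k => ih k.1 k.2
  exact prop_comma_of_isColimit P hT ((R.succStruct p).isColimitIterationCocone J) key

end

/-- Every partial algebra has a universal map to an algebra. -/
theorem exists_reflection [HasColimitsOfSize.{w, w} C] [HasPushouts C] [HasCoequalizers C]
    (κ : Cardinal.{w}) [Fact κ.IsRegular] [PreservesColimitsOfShape κ.ord.ToType T]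
    [PreservesColimitsOfShape κ.ord.ToType S] (P : ObjectProperty C)
    [P.IsClosedUnderIsomorphisms] [∀ (K : Type w) [SmallCategory K], P.IsClosedUnderColimitsOfShape K]
    [P.IsClosedUnderColimitsOfShape WalkingSpan]
    [P.IsClosedUnderColimitsOfShape WalkingParallelPair]
    (hT : ∀ X, P X → P (T.obj X)) (hS : ∀ X, P X → P (S.obj X))
    (p : Comma T (𝟭 C)) (hp : P p.left ∧ P p.right) :
    ∃ (D : C) (d : T.obj D ⟶ D) (f : p ⟶ Comma.mk D D d), R.IsAlgebra D d ∧ P D ∧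
      ∀ (D' : C) (d' : T.obj D' ⟶ D'), R.IsAlgebra D' d' →
        ∀ g : p ⟶ Comma.mk D' D' d', ∃! h : D ⟶ D',
          T.map h ≫ d' = d ≫ h ∧ f.left ≫ h = g.left ∧ f.right ≫ h = g.right := by
  have : Nonempty κ.ord.ToType := by simpa using Cardinal.IsRegular.ne_zero Fact.out
  let _ := WellFoundedLT.toOrderBot κ.ord.ToType
  have : NoMaxOrder κ.ord.ToType :=
    Cardinal.noMaxOrder (Fact.elim inferInstance : κ.IsRegular).aleph0_le
  have : HasIterationOfShape κ.ord.ToType (Comma T (𝟭 C)) :=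
    { hasColimitsOfShape_of_isSuccLimit := fun _ _ => hasColimitsOfShape_comma
      hasColimitsOfShape := hasColimitsOfShape_comma }
  obtain ⟨D, d, hD, ⟨e⟩⟩ := R.exists_isAlgebra_iteration κ.ord.ToType p
  have hloc := R.isLocal_ιIteration κ.ord.ToType p
  refine ⟨D, d, (R.succStruct p).ιIteration κ.ord.ToType ≫ e.hom, hD,
    P.prop_of_iso ((Comma.fst _ _).mapIso e) (R.prop_iteration _ P hT hS p hp).1, ?_⟩
  intro D' d' hD' g
  have hq {D : C} {d : T.obj D ⟶ D} (hD : R.IsAlgebra D d) : R.q (Comma.mk D D d) = 𝟙 D := hD.unit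
  have hloc' := hloc _ ⟨D', d', hD', rfl⟩
  obtain ⟨h, hh⟩ := hloc'.2 g
  -- Between algebras the comparison maps are identities, so a morphism of partial algebras has
  -- equal components.
  have hlr : (e.inv ≫ h).left = (e.inv ≫ h).right := by
    have := R.q_naturality (e.inv ≫ h)
    rw [hq hD, hq hD'] at this
    exact (Category.comp_id _).symm.trans (this.trans (Category.id_comp _))
  have hf : ((R.succStruct p).ιIteration κ.ord.ToType ≫ e.hom) ≫ e.inv ≫ h = g := by
    refine Eq.trans ?_ hh
    rw [Category.assoc, e.hom_inv_id_assoc]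
  refine ⟨(e.inv ≫ h).left, ⟨?_, ?_, ?_⟩, ?_⟩
  · refine (e.inv ≫ h).w.trans ?_
    rw [hlr]
    rfl
  · exact congrArg CommaMorphism.left hf
  · rw [hlr]
    exact congrArg CommaMorphism.right hf
  · rintro k ⟨hk, hk', hk''⟩
    let k' : Comma.mk (L := T) (R := 𝟭 C) D D d ⟶ Comma.mk D' D' d' :=
      { left := k, right := k, w := hk }
    have h1 : e.hom ≫ k' = h := by
      apply hloc'.1
      refine Eq.trans ?_ hh.symm
      refine (Category.assoc _ _ _).symm.trans ?_
      ext
      · exact hk'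
      · exact hk''
    rw [← h1, e.inv_hom_id_assoc]

end Presentation
-- Completeness of locally presentable categories.
section Limits

/-- Locally presentable categories are complete. -/
theorem hasLimitsOfSize_of_isLocallyPresentable (V : Type u) [Category.{w} V]
    [IsLocallyPresentable.{w} V] : HasLimitsOfSize.{w, w} V := by
  obtain ⟨κ, _, _⟩ := IsLocallyPresentable.exists_cardinal.{w} V
  -- The presentable objects form an essentially small dense subcategory, and the restricted Yoneda
  -- functor makes `V` reflective in presheaves on a small model of it.
  let F : SmallModel.{w} (isCardinalPresentable V κ).FullSubcategory ⥤ V :=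
    (equivSmallModel.{w} _).inverse ⋙ (isCardinalPresentable V κ).ι
  have : F.IsDense := inferInstance
  let adj := Presheaf.uliftYonedaAdjunction.{w} (uliftYoneda.{w}.leftKanExtension F)
    (uliftYoneda.{w}.leftKanExtensionUnit F)
  have : Reflective (Presheaf.restrictedULiftYoneda.{w} F) := { L := _, adj := adj }
  exact hasLimits_of_reflective (Presheaf.restrictedULiftYoneda.{w} F)

end Limits

/-! ### Colimits in products of categories. -/

section Pi

variable {I : Type u₁} {C : I → Type u₂} [∀ i, Category.{v₁} (C i)] {J : Type u₃} [Category.{v₂} J]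

/-- Colimits in a product of categories are computed componentwise. -/
def piIsColimit {F : J ⥤ ∀ i, C i} {c : Cocone F}
    (hc : ∀ i, IsColimit ((Pi.eval C i).mapCocone c)) : IsColimit c where
  desc s i := (hc i).desc ((Pi.eval C i).mapCocone s)
  fac s j := by
    funext i
    exact (hc i).fac ((Pi.eval C i).mapCocone s) j
  uniq s m hm := by
    funext i
    exact (hc i).uniq ((Pi.eval C i).mapCocone s) (m i) fun j => congrFun (hm j) i

variable [∀ i, HasColimitsOfShape J (C i)]

/-- The componentwise colimit cocone in a product of categories. -/
noncomputable def piColimitCocone (F : J ⥤ ∀ i, C i) : Cocone F where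
  pt i := colimit (F ⋙ Pi.eval C i)
  ι :=
    { app := fun j i => colimit.ι (F ⋙ Pi.eval C i) j
      naturality := fun j j' f => by
        funext i
        exact (colimit.w (F ⋙ Pi.eval C i) f).trans (Category.comp_id _).symm }

noncomputable def piColimitCoconeEval (F : J ⥤ ∀ i, C i) (i : I) :
    IsColimit ((Pi.eval C i).mapCocone (piColimitCocone F)) :=
  (colimit.isColimit (F ⋙ Pi.eval C i)).ofIsoColimit (Cocone.ext (Iso.refl _) fun _ =>
    Category.comp_id _)

theorem hasColimitsOfShape_pi : HasColimitsOfShape J (∀ i, C i) where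
  has_colimit F := ⟨⟨piColimitCocone F, piIsColimit (piColimitCoconeEval F)⟩⟩

theorem preservesColimitsOfShape_eval (i : I) : PreservesColimitsOfShape J (Pi.eval C i) where
  preservesColimit {F} := preservesColimit_of_preserves_colimit_cocone
    (piIsColimit (piColimitCoconeEval F)) (piColimitCoconeEval F i)

omit [∀ i, HasColimitsOfShape J (C i)] in
theorem preservesColimitsOfShape_pi {D : Type u} [Category.{v₃} D] (G : D ⥤ ∀ i, C i)
    (hG : ∀ i, PreservesColimitsOfShape J (G ⋙ Pi.eval C i)) : PreservesColimitsOfShape J G where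
  preservesColimit := ⟨fun hc => ⟨piIsColimit fun i => isColimitOfPreserves (G ⋙ Pi.eval C i) hc⟩⟩

end Pi

/-! ### Joint preservation of directed colimits from preservation in each variable. -/

section Variables

open Multitensor

variable {V : Type u} [Category.{w} V]

theorem variableAt_eval_self {n : ℕ} (Z : Fin n → V) (s : Fin n) :
    variableAt Z s ⋙ Pi.eval _ s = 𝟭 V :=
  if_pos (c := s = s) (t := 𝟭 V) (e := (Functor.const V).obj (Z s)) rfl

theorem variableAt_eval_of_ne {n : ℕ} (Z : Fin n → V) {s t : Fin n} (h : t ≠ s) :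
    variableAt Z s ⋙ Pi.eval _ t = (Functor.const V).obj (Z t) :=
  if_neg (c := t = s) (t := 𝟭 V) (e := (Functor.const V).obj (Z t)) h

/-- A functor into `Vⁿ` all of whose components but one are constant. -/
noncomputable def variableAtIso {D : Type u₁} [Category.{v₁} D] {n : ℕ} (Q : D ⥤ (Fin n → V))
    (s : Fin n) (Z : Fin n → V)
    (e : ∀ t, t ≠ s → (Q ⋙ Pi.eval _ t ≅ (Functor.const D).obj (Z t))) :
    Q ≅ (Q ⋙ Pi.eval _ s) ⋙ variableAt Z s :=
  NatIso.pi' (F := Q) (G := (Q ⋙ Pi.eval _ s) ⋙ variableAt Z s) fun t =>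
    if h : t = s then
      eqToIso (by rw [h]; rfl) ≪≫ Functor.isoWhiskerLeft (Q ⋙ Pi.eval _ s)
        (eqToIso (by subst h; exact (variableAt_eval_self Z t).symm) : 𝟭 V ≅ variableAt Z s ⋙ Pi.eval _ t)
    else e t h ≪≫ Functor.isoWhiskerLeft (Q ⋙ Pi.eval _ s)
      (eqToIso (variableAt_eval_of_ne Z h).symm)

/-- The objects of the initial segment of `WithTop J`. -/
def inclTop (J : Type u₁) [Preorder J] : J ⥤ WithTop J where
  obj j := (j : WithTop J)
  map f := homOfLE (WithTop.coe_le_coe.2 (leOfHom f))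

/-- A functor on `WithTop J` is a functor on `J` with a cocone. -/
def topCocone {J : Type u₁} [Preorder J] {D : Type u₂} [Category.{v₂} D] (R : WithTop J ⥤ D) :
    Cocone (inclTop J ⋙ R) where
  pt := R.obj ⊤
  ι :=
    { app := fun j => R.map (homOfLE le_top)
      naturality := fun j j' f => by
        refine (R.map_comp _ _).symm.trans (Eq.trans ?_ (Category.comp_id _).symm)
        exact congrArg R.map (Subsingleton.elim _ _) }

/-- The functor on `WithTop J` given by a cocone. -/
def withTopFunctor {J : Type u₁} [Preorder J] {D : Type u₂} [Category.{v₂} D] {F : J ⥤ D}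
    (c : Cocone F) : WithTop J ⥤ D where
  obj a := match a with
    | ⊤ => c.pt
    | (j : J) => F.obj j
  map {a b} f := match a, b, f with
    | ⊤, ⊤, _ => 𝟙 _
    | (j : J), ⊤, _ => c.ι.app j
    | (j : J), (j' : J), f => F.map (homOfLE (WithTop.coe_le_coe.1 (leOfHom f)))
    | ⊤, (j : J), f => absurd (leOfHom f) (WithTop.not_top_le_coe j)
  map_id a := match a with
    | ⊤ => rfl
    | (j : J) => F.map_id j
  map_comp {a b d} f g := match a, b, d, f, g with
    | ⊤, ⊤, ⊤, _, _ => (Category.comp_id _).symm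
    | ⊤, (j : J), _, f, _ => absurd (leOfHom f) (WithTop.not_top_le_coe j)
    | _, ⊤, (j : J), _, g => absurd (leOfHom g) (WithTop.not_top_le_coe j)
    | (j : J), ⊤, ⊤, _, _ => (Category.comp_id _).symm
    | (j : J), (j' : J), ⊤, _, _ => (c.w _).symm
    | (j : J), (j' : J), (j'' : J), _, _ => F.map_comp (homOfLE _) (homOfLE _)

theorem isColimit_topCocone_of_iso {J : Type u₁} [Preorder J] {D : Type u₂} [Category.{v₂} D]
    {R R' : WithTop J ⥤ D} (e : R ≅ R') (h : IsColimit (topCocone R)) :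
    Nonempty (IsColimit (topCocone R')) := by
  refine ⟨((IsColimit.precomposeInvEquiv (Functor.isoWhiskerLeft (inclTop J) e) _).symm
    h).ofIsoColimit (Cocone.ext (e.app ⊤) fun j => ?_)⟩
  refine (Category.assoc _ _ _).trans ?_
  refine (congrArg (_ ≫ ·) (e.hom.naturality (homOfLE (le_top : (j : WithTop J) ≤ ⊤)))).trans ?_
  exact e.inv_hom_id_app_assoc _ _

/-- The multi-indexed diagram of a functor of several variables and a family of cocones. -/
def multiIndex {J : Type u₁} [Preorder J] {n : ℕ} (R : WithTop J ⥤ (Fin n → V)) :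
    (Fin n → WithTop J) ⥤ (Fin n → V) where
  obj a t := R.obj (a t) t
  map f t := R.map (f t) t
  map_id a := by
    funext t
    exact congrFun (R.map_id (a t)) t
  map_comp f g := by
    funext t
    exact congrFun (R.map_comp (f t) (g t)) t

/-- Updating one index. -/
def updateFunctor {J : Type u₁} [Preorder J] {n : ℕ} (a : Fin n → WithTop J) (s : Fin n) :
    WithTop J ⥤ (Fin n → WithTop J) where
  obj b := Function.update a s b
  map f t := homOfLE (Function.update_mono (leOfHom f) t)

/-- Varying the index `s` alone changes only the entry `s` of the sequence, so the diagram is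
`variableAt` applied to the component `s` of `R`, whose cocone is a colimit and is preserved by
assumption. -/
theorem isColimit_multiIndex_update {J : Type u₁} [Preorder J] {n : ℕ}
    (R : WithTop J ⥤ (Fin n → V)) (hR : ∀ t, Nonempty (IsColimit (topCocone (R ⋙ Pi.eval _ t))))
    {D : Type u₂} [Category.{v₂} D] (G : (Fin n → V) ⥤ D)
    (hG : ∀ Z i, PreservesColimitsOfShape J (variableAt Z i ⋙ G)) (a : Fin n → WithTop J)
    (s : Fin n) :
    Nonempty (IsColimit (topCocone (updateFunctor a s ⋙ multiIndex R ⋙ G))) := by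
  let U := updateFunctor a s ⋙ multiIndex R
  have ho (t : Fin n) (h : t ≠ s) (b : WithTop J) : Function.update a s b t = a t :=
    Function.update_of_ne h b a
  have hs (b : WithTop J) : Function.update a s b s = b := Function.update_self s b a
  have hU (t : Fin n) (h : t ≠ s) (b : WithTop J) : U.obj b t = R.obj (a t) t :=
    congrArg (fun x => R.obj x t) (ho t h b)
  have hUs (b : WithTop J) : U.obj b s = R.obj b s :=
    congrArg (fun x => R.obj x s) (hs b)
  have hmap {x x' y y' : WithTop J} (f : x ⟶ y) (f' : x' ⟶ y') (hx : x = x') (hy : y = y')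
      (t : Fin n) : R.map f t ≫ eqToHom (by rw [hy]) = eqToHom (by rw [hx]) ≫ R.map f' t := by
    subst hx hy
    obtain rfl : f = f' := Subsingleton.elim _ _
    simp
  let e₁ : U ≅ (U ⋙ Pi.eval _ s) ⋙ variableAt (fun t => R.obj (a t) t) s :=
    variableAtIso U s _ fun t h => NatIso.ofComponents (fun b => eqToIso (hU t h b)) fun {b b'} f => by
      refine (hmap ((updateFunctor a s).map f t) (𝟙 (a t)) (ho t h b) (ho t h b') t).trans ?_
      refine congrArg (_ ≫ ·) (congrFun (R.map_id (a t)) t)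
  let e₂ : U ⋙ Pi.eval _ s ≅ R ⋙ Pi.eval _ s := NatIso.ofComponents (fun b => eqToIso (hUs b))
    fun {b b'} f => hmap ((updateFunctor a s).map f s) f (hs b) (hs b') s
  let e : (R ⋙ Pi.eval _ s) ⋙ variableAt (fun t => R.obj (a t) t) s ⋙ G ≅ U ⋙ G :=
    (Functor.isoWhiskerRight e₁ G ≪≫ Functor.isoWhiskerRight e₂ (variableAt _ s ⋙ G)).symm
  have := hG (fun t => R.obj (a t) t) s
  obtain ⟨h⟩ := hR s
  exact isColimit_topCocone_of_iso e (isColimitOfPreserves (variableAt _ s ⋙ G) h)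


theorem pi_hom_eq {J : Type u₁} [Preorder J] {n : ℕ} {a b : Fin n → J} (f g : a ⟶ b) : f = g := by
  funext t
  exact Subsingleton.elim _ _

/-- If the value of a multi-indexed diagram is a colimit in each index, it is the colimit of the
values at finite indices below. -/
theorem multiIndex_induction {J : Type u₁} [Preorder J] {n : ℕ} {D : Type u₂} [Category.{v₂} D]
    (H : (Fin n → WithTop J) ⥤ D) (B : D)
    (hext : ∀ (a : Fin n → WithTop J) (s : Fin n), a s = ⊤ → ∀ f g : H.obj a ⟶ B,
      (∀ (j : J) (m : Function.update a s ↑j ⟶ a), H.map m ≫ f = H.map m ≫ g) → f = g)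
    (hdesc : ∀ (a : Fin n → WithTop J) (s : Fin n), a s = ⊤ →
      ∀ d : ∀ j : J, H.obj (Function.update a s ↑j) ⟶ B,
      (∀ (j j' : J) (m : Function.update a s (j : WithTop J) ⟶ Function.update a s ↑j'),
        H.map m ≫ d j' = d j) →
      ∃ f : H.obj a ⟶ B, ∀ (j : J) (m : Function.update a s (j : WithTop J) ⟶ a), H.map m ≫ f = d j)
    (S : Finset (Fin n)) :
    ∀ a : Fin n → WithTop J, (∀ t, a t = ⊤ ↔ t ∈ S) →
      (∀ f g : H.obj a ⟶ B,
        (∀ (b : Fin n → WithTop J) (_ : ∀ t, b t ≠ ⊤) (l : b ⟶ a),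
          H.map l ≫ f = H.map l ≫ g) → f = g) ∧
      ∀ τ : ∀ (b : Fin n → WithTop J) (_ : ∀ t, b t ≠ ⊤) (_ : b ⟶ a), (H.obj b ⟶ B),
        (∀ b hb l b' hb' l' (m : b ⟶ b'), H.map m ≫ τ b' hb' l' = τ b hb l) →
        ∃ f : H.obj a ⟶ B, ∀ b hb l, H.map l ≫ f = τ b hb l := by
  -- `S` is the set of indices at which `a` equals `⊤`; each step lowers one of them to elements of
  -- `J`. Uniqueness and existence are proved together because the second needs the first.
  induction S using Finset.induction with
  | empty =>
    intro a ha
    have ha' (t) : a t ≠ ⊤ := fun h => by simpa using (ha t).1 h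
    refine ⟨fun f g h => ?_, fun τ hτ => ⟨τ a ha' (𝟙 a), fun b hb l => hτ _ _ _ _ _ _ _⟩⟩
    have := h a ha' (𝟙 a)
    rw [H.map_id, Category.id_comp, Category.id_comp] at this
    exact this
  | insert s S hs ih =>
    intro a ha
    have has : a s = ⊤ := (ha s).2 (Finset.mem_insert_self _ _)
    have hU (j : J) (t) : Function.update a s (j : WithTop J) t = ⊤ ↔ t ∈ S := by
      by_cases h : t = s
      · subst h
        simp [hs]
      · simp only [Function.update_of_ne h, ha t, Finset.mem_insert, h, false_or]
    have hbU (b : Fin n → WithTop J) (hb : ∀ t, b t ≠ ⊤) (l : b ⟶ a) :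
        ∃ j : J, Nonempty (b ⟶ Function.update a s (j : WithTop J)) := by
      obtain ⟨j, hj⟩ := WithTop.ne_top_iff_exists.1 (hb s)
      refine ⟨j, ⟨fun t => homOfLE ?_⟩⟩
      by_cases h : t = s
      · subst h
        exact (hj.symm.trans (Function.update_self t (j : WithTop J) a).symm).le
      · exact (leOfHom (l t)).trans (Function.update_of_ne h (j : WithTop J) a).ge
    have hle (j : J) : Nonempty (Function.update a s (j : WithTop J) ⟶ a) := by
      refine ⟨fun t => homOfLE ?_⟩
      by_cases h : t = s
      · subst h
        rw [has]
        exact le_top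
      · exact (Function.update_of_ne h (j : WithTop J) a).le
    refine ⟨fun f g h => ?_, fun τ hτ => ?_⟩
    · refine hext a s has f g fun j m => (ih _ (hU j)).1 _ _ fun b hb l => ?_
      rw [← Category.assoc, ← Category.assoc, ← H.map_comp]
      exact h b hb _
    · have i := fun j : J => hle j
      choose d hd using fun j : J => (ih _ (hU j)).2 (fun b hb l => τ b hb (l ≫ (i j).some))
        fun b hb l b' hb' l' m => hτ _ _ _ _ _ _ _
      -- The maps obtained for the different values `j` of the index `s` form a cocone by the
      -- uniqueness part of the induction hypothesis.
      obtain ⟨f, hf⟩ := hdesc a s has d fun j j' m => (ih _ (hU j)).1 _ _ fun b hb l => by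
        refine Eq.trans ?_ ((hd j' b hb (l ≫ m)).trans ?_)
        · rw [H.map_comp, Category.assoc]
        · exact (congrArg (τ b hb) (pi_hom_eq _ _)).trans (hd j b hb l).symm
      refine ⟨f, fun b hb l => ?_⟩
      obtain ⟨j, ⟨m⟩⟩ := hbU b hb l
      rw [pi_hom_eq l (m ≫ (i j).some), H.map_comp, Category.assoc, hf, hd]

/-- A functor of several variables which preserves the colimits of a directed diagram in each
variable preserves them jointly. -/
theorem preservesColimitsOfShape_of_variables {J : Type u₁} [Preorder J] [IsDirectedOrder J]
    [Nonempty J] [HasColimitsOfShape J V] {n : ℕ} {D : Type u₂} [Category.{v₂} D]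
    (G : (Fin n → V) ⥤ D) (hG : ∀ Z i, PreservesColimitsOfShape J (variableAt Z i ⋙ G)) :
    PreservesColimitsOfShape J G where
  preservesColimit {F} := ⟨fun {c} hc => ⟨by
    let R : WithTop J ⥤ (Fin n → V) := withTopFunctor c
    have hR (t) : Nonempty (IsColimit (topCocone (R ⋙ Pi.eval _ t))) := by
      have := preservesColimitsOfShape_eval (J := J) (C := fun _ : Fin n => V) t
      exact ⟨isColimitOfPreserves (Pi.eval _ t) hc⟩
    have key (H : (Fin n → WithTop J) ⥤ D) (hc' : ∀ (a : Fin n → WithTop J) (s : Fin n),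
        Nonempty (IsColimit (topCocone (updateFunctor a s ⋙ H)))) (B : D) := multiIndex_induction H B
      (fun a s has f g h => by
        obtain ⟨hc⟩ := hc' a s
        have e : Function.update a s ⊤ = a := by rw [← has, Function.update_eq_self]
        have : H.map (eqToHom e) ≫ f = H.map (eqToHom e) ≫ g := hc.hom_ext fun j => by
          have h1 (f : H.obj a ⟶ B) : (topCocone (updateFunctor a s ⋙ H)).ι.app j ≫
              H.map (eqToHom e) ≫ f = H.map ((updateFunctor a s).map (homOfLE le_top) ≫ eqToHom e) ≫ f := by
            rw [H.map_comp, Category.assoc]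
            rfl
          exact (h1 f).trans ((h j _).trans (h1 g).symm)
        exact (cancel_epi _).1 this)
      (fun a s has d hd => by
        obtain ⟨hc⟩ := hc' a s
        have e : a = Function.update a s ⊤ := by rw [← has, Function.update_eq_self]
        let t : Cocone (inclTop J ⋙ updateFunctor a s ⋙ H) :=
          { pt := B
            ι :=
              { app := d
                naturality := fun j j' m => (hd j j' _).trans (Category.comp_id _).symm } }
        obtain ⟨g, hg⟩ : ∃ g : H.obj (Function.update a s ⊤) ⟶ B,
            ∀ (j : J) (m : Function.update a s (j : WithTop J) ⟶ Function.update a s ⊤),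
              H.map m ≫ g = d j :=
          ⟨hc.desc t, fun j m => (congrArg (fun m => H.map m ≫ hc.desc t)
            (pi_hom_eq _ _)).trans (hc.fac t j)⟩
        refine ⟨H.map (eqToHom e) ≫ g, fun j m => ?_⟩
        rw [← Category.assoc, ← H.map_comp, hg]) Finset.univ (fun _ => ⊤) fun _ => by simp
    let δ (j : J) : Fin n → WithTop J := fun _ => j
    let δt (j : J) : δ j ⟶ (fun _ => ⊤) := fun t => homOfLE le_top
    -- Directedness makes the diagonal cofinal among finite multi-indices, so the colimit over
    -- multi-indices is the colimit over `J`.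
    have hb (b : Fin n → WithTop J) (hb : ∀ t, b t ≠ ⊤) : ∃ j : J, Nonempty (b ⟶ δ j) := by
      choose x hx using fun t => WithTop.ne_top_iff_exists.1 (hb t)
      obtain ⟨j, hj⟩ := Finite.exists_le x
      exact ⟨j, ⟨fun t => homOfLE ((hx t).symm.le.trans (WithTop.coe_le_coe.2 (hj t)))⟩⟩
    replace key := key _ (isColimit_multiIndex_update R hR G hG)
    let H := multiIndex R ⋙ G
    have hs {s : Cocone (F ⋙ G)} {j j' : J} (h : j ≤ j') (m : δ j ⟶ δ j') :
        H.map m ≫ (show H.obj (δ j') ⟶ s.pt from s.ι.app j') = s.ι.app j :=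
      s.w (homOfLE h)
    have hs' {s : Cocone (F ⋙ G)} (b : Fin n → WithTop J) {j j' : J} (m : b ⟶ δ j)
        (m' : b ⟶ δ j') :
        H.map m ≫ (show H.obj (δ j) ⟶ s.pt from s.ι.app j) =
          H.map m' ≫ (show H.obj (δ j') ⟶ s.pt from s.ι.app j') := by
      obtain ⟨j'', h1, h2⟩ := exists_ge_ge j j'
      let d (j : J) : H.obj (δ j) ⟶ s.pt := s.ι.app j
      let q : δ j ⟶ δ j'' := fun t => homOfLE (WithTop.coe_le_coe.2 h1)
      let q' : δ j' ⟶ δ j'' := fun t => homOfLE (WithTop.coe_le_coe.2 h2)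
      have e1 : H.map q ≫ d j'' = d j := hs h1 q
      have e2 : H.map q' ≫ d j'' = d j' := hs h2 q'
      change H.map m ≫ d j = H.map m' ≫ d j'
      rw [← e1, ← e2, ← Category.assoc, ← Category.assoc, ← H.map_comp, ← H.map_comp,
        pi_hom_eq (m ≫ q)]
    have hτ (s : Cocone (F ⋙ G)) : ∃ f : H.obj (fun _ => ⊤) ⟶ s.pt,
        ∀ j, H.map (δt j) ≫ f = s.ι.app j := by
      choose J₀ hJ₀ using hb
      obtain ⟨f, hf⟩ := (key s.pt).2 (fun b hb l => H.map (hJ₀ b hb).some ≫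
        (show H.obj (δ (J₀ b hb)) ⟶ s.pt from s.ι.app (J₀ b hb))) (by
        intro b hb l b' hb' l' m
        rw [← Category.assoc]
        refine (congrArg (· ≫ _) (H.map_comp _ _).symm).trans ?_
        exact hs' b _ _)
      refine ⟨f, fun j => ?_⟩
      refine (hf (δ j) (fun _ => WithTop.coe_ne_top) (δt j)).trans ?_
      refine (hs' (δ j) _ (𝟙 _)).trans ?_
      exact (congrArg (· ≫ _) (H.map_id _)).trans (Category.id_comp _)
    choose f hf using hτ
    exact
      { desc := f
        fac := hf
        uniq := fun s m hm => (key s.pt).1 m (f s) fun b hb' l => by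
          obtain ⟨j, ⟨q⟩⟩ := hb b hb'
          have e : H.map l = H.map q ≫ H.map (δt j) := by
            rw [← H.map_comp]
            exact congrArg H.map (pi_hom_eq _ _)
          refine (congrArg (· ≫ m) e).trans (Eq.trans ?_ (congrArg (· ≫ f s) e.symm))
          refine (Category.assoc _ _ _).trans (Eq.trans ?_ (Category.assoc _ _ _).symm)
          exact congrArg (_ ≫ ·) ((hm j).trans (hf s j).symm) }⟩⟩

end Variables
-- Colimits of functors inherit preservation of colimits.
section Sigma

variable {C : Type u₁} [Category.{v₁} C] {D : Type u₂} [Category.{v₂} D] {I : Type u₃}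

/-- The pointwise coproduct of a family of functors. -/
noncomputable def sigmaFunctor [HasColimitsOfShape (Discrete I) D] (F : I → C ⥤ D) : C ⥤ D where
  obj X := ∐ fun i => (F i).obj X
  map f := Sigma.desc fun i => (F i).map f ≫ Sigma.ι (fun i => (F i).obj _) i
  map_id X := Sigma.hom_ext _ _ fun i => by simp
  map_comp f g := Sigma.hom_ext _ _ fun i => by simp

theorem sigmaFunctor_ι_map [HasColimitsOfShape (Discrete I) D] (F : I → C ⥤ D) {X Y : C}
    (f : X ⟶ Y) (i : I) : Sigma.ι (fun i => (F i).obj X) i ≫ (sigmaFunctor F).map f =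
      (F i).map f ≫ Sigma.ι (fun i => (F i).obj Y) i :=
  Sigma.ι_desc _ _

/-- Colimits commute with coproducts: a cocone on the coproduct is a family of cocones on the
summands. -/
theorem preservesColimitsOfShape_sigmaFunctor {J : Type u} [Category.{w} J]
    [HasColimitsOfShape (Discrete I) D] (F : I → C ⥤ D)
    (hF : ∀ i, PreservesColimitsOfShape J (F i)) : PreservesColimitsOfShape J (sigmaFunctor F) where
  preservesColimit {K} := ⟨fun {c} hc => ⟨by
    let t (s : Cocone (K ⋙ sigmaFunctor F)) (i : I) : Cocone (K ⋙ F i) :=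
      { pt := s.pt
        ι :=
          { app := fun k => Sigma.ι (fun i => (F i).obj (K.obj k)) i ≫ s.ι.app k
            naturality := fun k k' f => by
              have h := s.w f
              have h2 := sigmaFunctor_ι_map F (K.map f) i
              refine Eq.trans ?_ (Category.comp_id _).symm
              refine Eq.trans ?_ (congrArg (_ ≫ ·) h)
              refine Eq.trans ?_ (Category.assoc _ _ _)
              exact (Category.assoc _ _ _).symm.trans (congrArg (· ≫ s.ι.app k') h2.symm) } }
    have fac (s : Cocone (K ⋙ sigmaFunctor F)) (i : I) (k : J) : (F i).map (c.ι.app k) ≫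
        (isColimitOfPreserves (F i) hc).desc (t s i) =
          Sigma.ι (fun i => (F i).obj (K.obj k)) i ≫ s.ι.app k :=
      (isColimitOfPreserves (F i) hc).fac (t s i) k
    exact
      { desc := fun s => Sigma.desc fun i => (isColimitOfPreserves (F i) hc).desc (t s i)
        fac := fun s k => Sigma.hom_ext _ _ fun i => by
          refine (Category.assoc _ _ _).symm.trans ?_
          refine (congrArg (· ≫ _) (sigmaFunctor_ι_map F (c.ι.app k) i)).trans ?_
          refine (Category.assoc _ _ _).trans ?_
          have h2 : Sigma.ι (fun i => (F i).obj c.pt) i ≫ Sigma.desc (fun i =>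
            (isColimitOfPreserves (F i) hc).desc (t s i)) = _ := Sigma.ι_desc _ _
          exact (congrArg (_ ≫ ·) h2).trans (fac s i k)
        uniq := fun s m hm => Sigma.hom_ext _ _ fun i => by
          have h2 : Sigma.ι (fun i => (F i).obj c.pt) i ≫ Sigma.desc (fun i =>
            (isColimitOfPreserves (F i) hc).desc (t s i)) = _ := Sigma.ι_desc _ _
          refine Eq.trans ?_ h2.symm
          refine (isColimitOfPreserves (F i) hc).hom_ext fun k => ?_
          refine Eq.trans ?_ (fac s i k).symm
          refine Eq.trans ?_ (congrArg (_ ≫ ·) (hm k))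
          refine Eq.trans ?_ (Category.assoc _ _ _)
          refine (Category.assoc _ _ _).symm.trans ?_
          exact congrArg (· ≫ m) (sigmaFunctor_ι_map F (c.ι.app k) i).symm }⟩⟩

/-- A colimit of functors which preserve colimits preserves them. -/
theorem preservesColimitsOfShape_of_isColimit {J : Type u} [Category.{w} J] {K : Type u₃}
    [Category.{v₃} K] [HasColimitsOfShape K D] {H : K ⥤ C ⥤ D} {c : Cocone H} (hc : IsColimit c)
    (hH : ∀ k, PreservesColimitsOfShape J (H.obj k)) : PreservesColimitsOfShape J c.pt where
  preservesColimit {F} := ⟨fun {d} hd => ⟨by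
    have hp (X : C) : IsColimit (((evaluation C D).obj X).mapCocone c) :=
      isColimitOfPreserves ((evaluation C D).obj X) hc
    let t (s : Cocone (F ⋙ c.pt)) (k : K) : Cocone (F ⋙ H.obj k) :=
      { pt := s.pt
        ι :=
          { app := fun j => (c.ι.app k).app (F.obj j) ≫ s.ι.app j
            naturality := fun j j' f => by
              refine Eq.trans ?_ (Category.comp_id _).symm
              refine Eq.trans ?_ (congrArg (_ ≫ ·) (s.w f))
              refine (Category.assoc _ _ _).symm.trans (Eq.trans ?_ (Category.assoc _ _ _))
              exact congrArg (· ≫ s.ι.app j') ((c.ι.app k).naturality (F.map f)) } }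
    have fac (s : Cocone (F ⋙ c.pt)) (k : K) (j : J) : (H.obj k).map (d.ι.app j) ≫
        (isColimitOfPreserves (H.obj k) hd).desc (t s k) =
          (c.ι.app k).app (F.obj j) ≫ s.ι.app j :=
      (isColimitOfPreserves (H.obj k) hd).fac (t s k) j
    let t' (s : Cocone (F ⋙ c.pt)) : Cocone (H ⋙ (evaluation C D).obj d.pt) :=
      { pt := s.pt
        ι :=
          { app := fun k => (isColimitOfPreserves (H.obj k) hd).desc (t s k)
            naturality := fun k k' f => by
              refine Eq.trans ?_ (Category.comp_id _).symm
              refine (isColimitOfPreserves (H.obj k) hd).hom_ext fun j => ?_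
              refine Eq.trans ?_ (fac s k j).symm
              refine (Category.assoc _ _ _).symm.trans ?_
              refine (congrArg (· ≫ _) ((H.map f).naturality (d.ι.app j))).trans ?_
              refine (Category.assoc _ _ _).trans ?_
              refine (congrArg (_ ≫ ·) (fac s k' j)).trans ?_
              refine (Category.assoc _ _ _).symm.trans ?_
              exact congrArg (· ≫ s.ι.app j) (congrArg (fun α => α.app (F.obj j)) (c.w f)) } }
    have fac' (s : Cocone (F ⋙ c.pt)) (k : K) : (c.ι.app k).app d.pt ≫ (hp d.pt).desc (t' s) =
        (isColimitOfPreserves (H.obj k) hd).desc (t s k) := (hp d.pt).fac (t' s) k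
    exact
      { desc := fun s => (hp d.pt).desc (t' s)
        fac := fun s j => (hp (F.obj j)).hom_ext fun k => by
          refine (Category.assoc _ _ _).symm.trans ?_
          refine (congrArg (· ≫ _) ((c.ι.app k).naturality (d.ι.app j)).symm).trans ?_
          refine (Category.assoc _ _ _).trans ?_
          exact (congrArg (_ ≫ ·) (fac' s k)).trans (fac s k j)
        uniq := fun s m hm => (hp d.pt).hom_ext fun k => by
          refine Eq.trans ?_ (fac' s k).symm
          refine (isColimitOfPreserves (H.obj k) hd).hom_ext fun j => ?_
          refine Eq.trans ?_ (fac s k j).symm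
          refine Eq.trans ?_ (congrArg (_ ≫ ·) (hm j))
          refine (Category.assoc _ _ _).symm.trans (Eq.trans ?_ (Category.assoc _ _ _))
          exact congrArg (· ≫ m) ((c.ι.app k).naturality (d.ι.app j)) }⟩⟩

end Sigma

/-! ### Families of functors of several variables, and operations on blocks. -/

section Families

variable (A : Type u₁) [Category.{v₁} A] (V : Type u) [Category.{w} V]

/-- Families of functors of several variables. -/
abbrev OpFamily := ∀ n : ℕ, (Fin n → A) ⥤ V

variable {A V}

/-- The blocks of a sequence cut into consecutive subsequences. -/
def blockFunctor {m N : ℕ} {k : Fin m → ℕ} (h : ∑ i, k i = N) :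
    OpFamily A V ⥤ ((Fin N → A) ⥤ (Fin m → V)) where
  obj X :=
    { obj := fun Z i => (X (k i)).obj fun j => Z (pos h i j)
      map := fun {Z Z'} f i => (X (k i)).map (X := fun j => Z (pos h i j))
        (Y := fun j => Z' (pos h i j)) fun j => f (pos h i j)
      map_id := fun Z => funext fun i => (X (k i)).map_id _
      map_comp := fun f g => funext fun i => (X (k i)).map_comp _ _ }
  map φ :=
    { app := fun Z i => (φ (k i)).app fun j => Z (pos h i j)
      naturality := fun Z Z' f => funext fun i => (φ (k i)).naturality _ }

/-- An operation applied to blocks. -/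
def blockOp {m N : ℕ} {k : Fin m → ℕ} (h : ∑ i, k i = N) (G : (Fin m → V) ⥤ V) :
    OpFamily A V ⥤ ((Fin N → A) ⥤ V) :=
  blockFunctor h ⋙ (Functor.whiskeringRight _ _ _).obj G

/-- A family of functors of several variables each of which preserves small coproducts in each
variable. -/
def preservesCoproductsInVariables : ObjectProperty (OpFamily A V) :=
  fun X => ∀ (n : ℕ) (Z : Fin n → A) (s : Fin n) (J : Type v₁),
    PreservesColimitsOfShape (Discrete J) (Multitensor.variableAt Z s ⋙ X n)

theorem exists_pos_eq {m N : ℕ} {k : Fin m → ℕ} (h : ∑ i, k i = N) (s : Fin N) :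
    ∃ i j, pos h i j = s := by
  have key (t : Fin (m + 1)) : (s : ℕ) < Fin.partialSum k t → ∃ i j, pos h i j = s := by
    induction t using Fin.induction with
    | zero => simp [Fin.partialSum_zero]
    | succ i ih =>
      intro hs
      by_cases h' : (s : ℕ) < Fin.partialSum k i.castSucc
      · exact ih h'
      · rw [Fin.partialSum_succ] at hs
        exact ⟨i, ⟨s - Fin.partialSum k i.castSucc, by omega⟩, Fin.ext (by simp [pos]; omega)⟩
  exact key (Fin.last m) (by rw [partialSum_last h]; exact s.2)

theorem pos_lt_pos {m N : ℕ} {k : Fin m → ℕ} (h : ∑ i, k i = N) {i i' : Fin m} (hi : i < i')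
    (j : Fin (k i)) (j' : Fin (k i')) : pos h i j < pos h i' j' := by
  have h1 : Fin.partialSum k i.succ ≤ Fin.partialSum k i'.castSucc :=
    Fin.monotone_iff_le_succ.2 (partialSum_castSucc_le k) (Fin.succ_le_castSucc_iff.2 hi)
  rw [Fin.partialSum_succ] at h1
  have := j.2
  simp only [pos, Fin.mk_lt_mk]
  omega

theorem fst_eq_of_pos_eq {m N : ℕ} {k : Fin m → ℕ} (h : ∑ i, k i = N) {i i' : Fin m}
    {j : Fin (k i)} {j' : Fin (k i')} (e : pos h i j = pos h i' j') : i = i' := by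
  rcases lt_trichotomy i i' with hi | hi | hi
  · exact absurd e (pos_lt_pos h hi j j').ne
  · exact hi
  · exact absurd e (pos_lt_pos h hi j' j).ne'

theorem pos_injective {m N : ℕ} {k : Fin m → ℕ} (h : ∑ i, k i = N) (i : Fin m) :
    Function.Injective (pos h i) := fun j j' e => by
  have := congrArg Fin.val e
  exact Fin.ext (by simpa [pos] using this)

open Multitensor in
-- Hypotheses in one variable at a time suffice because each position lies in exactly one block:
-- varying the position `(i, j)` changes only the block `i`, and there only the entry `j`. The
-- functor is thus `X (k i)` in its variable `j` followed by `G` in its variable `i`.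
theorem preservesColimitsOfShape_blockOp {m N : ℕ} {k : Fin m → ℕ} (h : ∑ i, k i = N)
    {J : Type u₂} [Category.{v₂} J] (G : (Fin m → V) ⥤ V)
    (hG : ∀ Z i, PreservesColimitsOfShape J (variableAt Z i ⋙ G)) (X : OpFamily A V)
    (hX : ∀ n Z i, PreservesColimitsOfShape J (variableAt Z i ⋙ X n)) (Z : Fin N → A) (s : Fin N) :
    PreservesColimitsOfShape J (variableAt Z s ⋙ (blockOp h G).obj X) := by
  obtain ⟨i, j, rfl⟩ := exists_pos_eq h s
  let r (t : Fin m) : (Fin N → A) ⥤ (Fin (k t) → A) := Functor.pi' fun j => Pi.eval _ (pos h t j)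
  let Q : A ⥤ (Fin m → V) := variableAt Z (pos h i j) ⋙ (blockFunctor h).obj X
  let e₁ : Q ≅ (Q ⋙ Pi.eval _ i) ⋙ variableAt (fun t => (X (k t)).obj fun j => Z (pos h t j)) i :=
    variableAtIso Q i _ fun t ht =>
      let e : variableAt Z (pos h i j) ⋙ r t ≅ (Functor.const A).obj fun j => Z (pos h t j) :=
        NatIso.pi' fun j' => eqToIso
          (variableAt_eval_of_ne Z fun e => ht (fst_eq_of_pos_eq h e))
      Functor.isoWhiskerRight e (X (k t)) ≪≫ NatIso.ofComponents fun _ => Iso.refl _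
  let e₂ : variableAt Z (pos h i j) ⋙ r i ≅ variableAt (fun j => Z (pos h i j)) j :=
    variableAtIso _ j (fun j => Z (pos h i j)) (fun t ht => eqToIso
      (variableAt_eval_of_ne Z fun e => ht (pos_injective h i e))) ≪≫
      Functor.isoWhiskerRight (eqToIso (variableAt_eval_self Z (pos h i j))) _ ≪≫
      Functor.leftUnitor _
  let e : (variableAt (fun j => Z (pos h i j)) j ⋙ X (k i)) ⋙
      variableAt (fun t => (X (k t)).obj fun j => Z (pos h t j)) i ⋙ G ≅ Q ⋙ G :=
    (Functor.isoWhiskerRight e₁ G ≪≫ Functor.isoWhiskerRight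
      (Functor.isoWhiskerRight e₂ (X (k i))) (variableAt _ i ⋙ G)).symm
  have := hX (k i) (fun j => Z (pos h i j)) j
  have := hG (fun t => (X (k t)).obj fun j => Z (pos h t j)) i
  exact preservesColimitsOfShape_of_natIso e

end Families

/-! ### Comparison of maps between re-indexed sequences. -/

section HEq

variable {A : Type u₁} [Category.{v₁} A] {V : Type u} [Category.{w} V]

theorem heq_map {n : ℕ} (G : (Fin n → A) ⥤ V) {Z Z' Y Y' : Fin n → A} (hZ : Z = Z') (hY : Y = Y')
    {f : Z ⟶ Y} {f' : Z' ⟶ Y'} (hf : ∀ i, f i ≍ f' i) : G.map f ≍ G.map f' := by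
  subst hZ hY
  obtain rfl : f = f' := funext fun i => eq_of_heq (hf i)
  rfl

theorem heq_app {n : ℕ} {G H : (Fin n → A) ⥤ V} (α : G ⟶ H) {Z Z' : Fin n → A} (hZ : Z = Z') :
    α.app Z ≍ α.app Z' := by
  subst hZ
  rfl

theorem heq_pi_app {n : ℕ} {Z Z' : Fin n → A} (f : Z ⟶ Z') {i j : Fin n} (h : i = j) :
    f i ≍ f j := by
  subst h
  rfl

/-- Re-indexed maps are compared by heterogeneous equality; this turns such a comparison into a
commuting square of the re-indexing identities. -/
theorem eqToHom_comp_eq_comp_eqToHom {X X' Y Y' : V} (hX : X = X') (hY : Y = Y') {f : X ⟶ Y}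
    {f' : X' ⟶ Y'} (hf : f ≍ f') : eqToHom hX ≫ f' = f ≫ eqToHom hY := by
  subst hX hY hf
  simp

end HEq

/-! ### Maps of blocks that need not come from a morphism of families. -/

section BlockMap

variable {V : Type u} [Category.{w} V] {A : Type u₁} [Category.{v₁} A]
  {m N : ℕ} {k : Fin m → ℕ} (h : ∑ i, k i = N) (G : (Fin m → V) ⥤ V)

/-- An operation applied to maps of blocks. -/
def blockMap {X Y : OpFamily A V} (β : ∀ i, X (k i) ⟶ Y (k i)) :
    (blockOp h G).obj X ⟶ (blockOp h G).obj Y where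
  app Z := G.map (X := fun i => (X (k i)).obj fun j => Z (pos h i j))
    (Y := fun i => (Y (k i)).obj fun j => Z (pos h i j)) fun i => (β i).app fun j => Z (pos h i j)
  naturality Z Z' f := by
    refine (G.map_comp _ _).symm.trans (Eq.trans ?_ (G.map_comp _ _))
    exact congrArg _ (funext fun i => (β i).naturality _)

theorem blockMap_comp {X Y Y' : OpFamily A V} (β : ∀ i, X (k i) ⟶ Y (k i))
    (γ : ∀ i, Y (k i) ⟶ Y' (k i)) :
    blockMap h G (fun i => β i ≫ γ i) = blockMap h G β ≫ blockMap h G γ := by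
  ext Z
  exact G.map_comp _ _

theorem blockMap_id (X : OpFamily A V) : blockMap h G (fun i => 𝟙 (X (k i))) = 𝟙 _ := by
  ext Z
  exact G.map_id _

theorem blockMap_eq_map {X Y : OpFamily A V} (φ : X ⟶ Y) :
    blockMap h G (fun i => φ (k i)) = (blockOp h G).map φ :=
  rfl

end BlockMap

/-! ### Units, evaluations and substitutions on blocks. -/

namespace Multitensor

variable {V : Type u} [Category.{w} V] (E : Multitensor V) {A : Type u₁} [Category.{v₁} A]

/-- The functor `E_i E_j W_{ij}`. -/
abbrev double {m K : ℕ} {k : Fin m → ℕ} (h : ∑ i, k i = K) : (Fin K → V) ⥤ V :=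
  (blockOp h (E.tensor m)).obj E.tensor

/-- The substitution as a natural transformation. -/
def substNat {m K : ℕ} {k : Fin m → ℕ} (h : ∑ i, k i = K) : E.double h ⟶ E.tensor K where
  app W := E.subst h W
  naturality _ _ f := E.subst_naturality h f

/-- The unit as a natural transformation to a family of one block. -/
def unitBlock {N : ℕ} (h : ∑ _i : Fin 1, N = N) (X : OpFamily A V) :
    X N ⟶ (blockOp (k := fun _ => N) h (E.tensor 1)).obj X where
  app Z := E.unit ((X N).obj Z) ≫ eqToHom (by
    change _ = (E.tensor 1).obj fun i => (X N).obj fun j => Z (pos h i j)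
    simp only [pos_one])
  naturality Z Z' f := by
    have h1 := E.unit_naturality ((X N).map f)
    refine (Category.assoc _ _ _).symm.trans ((congrArg (· ≫ _) h1.symm).trans ?_)
    refine (Category.assoc _ _ _).trans (Eq.trans ?_ (Category.assoc _ _ _).symm)
    refine congrArg (_ ≫ ·) (Eq.symm ?_)
    have hp (Z : Fin N → A) (i : Fin 1) : Z = fun j => Z (pos (k := fun _ => N) h i j) :=
      funext fun j => by rw [pos_one]
    refine eqToHom_comp_eq_comp_eqToHom _ _ (ECategory.heq_tensor_map
      (fun i => congrArg (X N).obj (hp Z i)) (fun i => congrArg (X N).obj (hp Z' i)) fun i => ?_)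
    exact heq_map _ (hp Z i) (hp Z' i) fun j => heq_pi_app f (pos_one h i j).symm

theorem unitBlock_blockMap {N : ℕ} (h : ∑ _i : Fin 1, N = N) {X Y : OpFamily A V} (β : X N ⟶ Y N) :
    β ≫ E.unitBlock h Y = E.unitBlock h X ≫ blockMap (k := fun _ => N) h (E.tensor 1) fun _ => β := by
  ext Z
  have h1 := E.unit_naturality (β.app Z)
  refine (Category.assoc _ _ _).symm.trans ((congrArg (· ≫ _) h1.symm).trans ?_)
  refine (Category.assoc _ _ _).trans (Eq.trans ?_ (Category.assoc _ _ _).symm)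
  refine congrArg (_ ≫ ·) (Eq.symm ?_)
  have hp (Z : Fin N → A) (i : Fin 1) : Z = fun j => Z (pos (k := fun _ => N) h i j) :=
    funext fun j => by rw [pos_one]
  exact eqToHom_comp_eq_comp_eqToHom _ _ (ECategory.heq_tensor_map
    (fun i => congrArg (X N).obj (hp Z i)) (fun i => congrArg (Y N).obj (hp Z i)) fun i =>
      heq_app _ (hp Z i))

theorem unitBlock_naturality {N : ℕ} (h : ∑ _i : Fin 1, N = N) {X Y : OpFamily A V} (φ : X ⟶ Y) :
    φ N ≫ E.unitBlock h Y =
      E.unitBlock h X ≫ (blockOp (k := fun _ => N) h (E.tensor 1)).map φ :=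
  E.unitBlock_blockMap h (φ N)

/-- The evaluation of the inner operations of a family of double blocks. -/
def evalBlock {m K N : ℕ} {k : Fin m → ℕ} (hk : ∑ i, k i = K) {l : Fin K → ℕ}
    (hl : ∑ q, l q = N) {n : Fin m → ℕ} (hn : ∀ i, ∑ j, l (pos hk i j) = n i)
    (hN : ∑ i, n i = N) {X Y : OpFamily A V}
    (α : ∀ i, (blockOp (hn i) (E.tensor (k i))).obj X ⟶ Y (n i)) :
    (blockOp hl (E.double hk)).obj X ⟶ (blockOp hN (E.tensor m)).obj Y where
  app Z := eqToHom (by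
      change ((E.tensor m).obj fun i => (E.tensor (k i)).obj fun j => (X (l (pos hk i j))).obj fun p =>
        Z (pos hl (pos hk i j) p)) = ((E.tensor m).obj fun i => (E.tensor (k i)).obj fun j =>
          (X (l (pos hk i j))).obj fun p =>
            Z (pos hN i (pos (k := fun j => l (pos hk i j)) (hn i) j p)))
      simp only [pos_pos hk hl hn hN]) ≫
    (E.tensor m).map (X := fun i => ((blockOp (hn i) (E.tensor (k i))).obj X).obj fun q =>
        Z (pos hN i q)) (Y := fun i => (Y (n i)).obj fun q => Z (pos hN i q))
      fun i => (α i).app fun q => Z (pos hN i q)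
  naturality Z Z' f := by
    have hp (Z : Fin N → A) (i : Fin m) (j : Fin (k i)) : (fun p => Z (pos hl (pos hk i j) p)) =
        fun p => Z (pos hN i (pos (k := fun j => l (pos hk i j)) (hn i) j p)) :=
      funext fun p => by rw [pos_pos hk hl hn hN]
    have h1 (Z : Fin N → A) (i : Fin m) : ((E.tensor (k i)).obj fun j =>
        (X (l (pos hk i j))).obj fun p => Z (pos hl (pos hk i j) p)) =
        (E.tensor (k i)).obj fun j => (X (l (pos hk i j))).obj fun p =>
            Z (pos hN i (pos (k := fun j => l (pos hk i j)) (hn i) j p)) :=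
      congrArg _ (funext fun j => congrArg _ (hp Z i j))
    have h2 : (E.tensor m).map (X := fun i => ((blockOp (hn i) (E.tensor (k i))).obj X).obj fun q =>
        Z (pos hN i q)) (Y := fun i => ((blockOp (hn i) (E.tensor (k i))).obj X).obj fun q =>
        Z' (pos hN i q)) (fun i => ((blockOp (hn i) (E.tensor (k i))).obj X).map fun q =>
          f (pos hN i q)) ≫ (E.tensor m).map (Y := fun i => (Y (n i)).obj fun q => Z' (pos hN i q))
        (fun i => (α i).app fun q => Z' (pos hN i q)) =
        (E.tensor m).map (X := fun i => ((blockOp (hn i) (E.tensor (k i))).obj X).obj fun q =>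
        Z (pos hN i q)) (Y := fun i => (Y (n i)).obj fun q => Z (pos hN i q))
        (fun i => (α i).app fun q => Z (pos hN i q)) ≫ ((blockOp hN (E.tensor m)).obj Y).map f := by
      refine ((E.tensor m).map_comp _ _).symm.trans (Eq.trans ?_ ((E.tensor m).map_comp _ _))
      exact congrArg _ (funext fun i => (α i).naturality _)
    refine Eq.trans ?_ ((congrArg (_ ≫ ·) h2).trans (Category.assoc _ _ _).symm)
    refine (Category.assoc _ _ _).symm.trans (Eq.trans ?_ (Category.assoc _ _ _))
    refine congrArg (· ≫ _) (Eq.symm ?_)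
    refine eqToHom_comp_eq_comp_eqToHom _ _ (ECategory.heq_tensor_map (h1 Z) (h1 Z') fun i => ?_)
    exact ECategory.heq_tensor_map (fun j => congrArg _ (hp Z i j)) (fun j => congrArg _ (hp Z' i j))
      fun j => heq_map _ (hp Z i j) (hp Z' i j) fun p => heq_pi_app f (pos_pos hk hl hn hN i j p)

/-- The maps `β` and `γ` are only given in the degrees that occur. The gluing of modules needs this
generality, since its retractions and sections exist only in low degrees. -/
theorem blockMap_evalBlock {m K N : ℕ} {k : Fin m → ℕ} (hk : ∑ i, k i = K) {l : Fin K → ℕ}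
    (hl : ∑ q, l q = N) {n : Fin m → ℕ} (hn : ∀ i, ∑ j, l (pos hk i j) = n i)
    (hN : ∑ i, n i = N) {X Y X' Y' : OpFamily A V}
    (α : ∀ i, (blockOp (hn i) (E.tensor (k i))).obj X ⟶ Y (n i))
    (α' : ∀ i, (blockOp (hn i) (E.tensor (k i))).obj X' ⟶ Y' (n i))
    (β : ∀ q, X (l q) ⟶ X' (l q)) (γ : ∀ i, Y (n i) ⟶ Y' (n i))
    (hα : ∀ i, blockMap (hn i) (E.tensor (k i)) (fun j => β (pos hk i j)) ≫ α' i = α i ≫ γ i) :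
    blockMap hl (E.double hk) β ≫ E.evalBlock hk hl hn hN α' =
      E.evalBlock hk hl hn hN α ≫ blockMap hN (E.tensor m) γ := by
  ext Z
  have hp (i : Fin m) (j : Fin (k i)) : (fun p => Z (pos hl (pos hk i j) p)) =
      fun p => Z (pos hN i (pos (k := fun j => l (pos hk i j)) (hn i) j p)) :=
    funext fun p => by rw [pos_pos hk hl hn hN]
  have h1 (X : OpFamily A V) (i : Fin m) : ((E.tensor (k i)).obj fun j =>
      (X (l (pos hk i j))).obj fun p => Z (pos hl (pos hk i j) p)) =
      (E.tensor (k i)).obj fun j => (X (l (pos hk i j))).obj fun p =>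
          Z (pos hN i (pos (k := fun j => l (pos hk i j)) (hn i) j p)) :=
    congrArg _ (funext fun j => congrArg _ (hp i j))
  have h2 : (E.tensor m).map (X := fun i => ((blockOp (hn i) (E.tensor (k i))).obj X).obj fun q =>
      Z (pos hN i q)) (Y := fun i => ((blockOp (hn i) (E.tensor (k i))).obj X').obj fun q =>
      Z (pos hN i q)) (fun i => (blockMap (hn i) (E.tensor (k i)) fun j => β (pos hk i j)).app
        fun q => Z (pos hN i q)) ≫
      (E.tensor m).map (Y := fun i => (Y' (n i)).obj fun q => Z (pos hN i q))
      (fun i => (α' i).app fun q => Z (pos hN i q)) =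
      (E.tensor m).map (X := fun i => ((blockOp (hn i) (E.tensor (k i))).obj X).obj fun q =>
      Z (pos hN i q)) (Y := fun i => (Y (n i)).obj fun q => Z (pos hN i q))
      (fun i => (α i).app fun q => Z (pos hN i q)) ≫ (blockMap hN (E.tensor m) γ).app Z := by
    refine ((E.tensor m).map_comp _ _).symm.trans (Eq.trans ?_ ((E.tensor m).map_comp _ _))
    exact congrArg _ (funext fun i => congrArg (fun β => β.app fun q => Z (pos hN i q)) (hα i))
  refine Eq.trans ?_ ((congrArg (_ ≫ ·) h2).trans (Category.assoc _ _ _).symm)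
  refine (Category.assoc _ _ _).symm.trans (Eq.trans ?_ (Category.assoc _ _ _))
  refine congrArg (· ≫ _) (Eq.symm ?_)
  refine eqToHom_comp_eq_comp_eqToHom _ _ (ECategory.heq_tensor_map (h1 X) (h1 X') fun i => ?_)
  exact ECategory.heq_tensor_map (fun j => congrArg _ (hp i j)) (fun j => congrArg _ (hp i j))
    fun j => heq_app _ (hp i j)

theorem evalBlock_naturality {m K N : ℕ} {k : Fin m → ℕ} (hk : ∑ i, k i = K) {l : Fin K → ℕ}
    (hl : ∑ q, l q = N) {n : Fin m → ℕ} (hn : ∀ i, ∑ j, l (pos hk i j) = n i)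
    (hN : ∑ i, n i = N) {X Y X' Y' : OpFamily A V}
    (α : ∀ i, (blockOp (hn i) (E.tensor (k i))).obj X ⟶ Y (n i))
    (α' : ∀ i, (blockOp (hn i) (E.tensor (k i))).obj X' ⟶ Y' (n i)) (φ : X ⟶ X') (ψ : Y ⟶ Y')
    (hα : ∀ i, (blockOp (hn i) (E.tensor (k i))).map φ ≫ α' i = α i ≫ ψ (n i)) :
    (blockOp hl (E.double hk)).map φ ≫ E.evalBlock hk hl hn hN α' =
      E.evalBlock hk hl hn hN α ≫ (blockOp hN (E.tensor m)).map ψ :=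
  E.blockMap_evalBlock hk hl hn hN α α' (fun q => φ (l q)) (fun i => ψ (n i)) hα

end Multitensor

namespace Multitensor

variable {V : Type u} [Category.{w} V] (E : Multitensor V) {A : Type u₁} [Category.{v₁} A]

/-- The substitution of operations in a family of double blocks. -/
def substBlock {m K N : ℕ} {k : Fin m → ℕ} (hk : ∑ i, k i = K) {l : Fin K → ℕ}
    (hl : ∑ q, l q = N) (X : OpFamily A V) :
    (blockOp hl (E.double hk)).obj X ⟶ (blockOp hl (E.tensor K)).obj X :=
  Functor.whiskerLeft ((blockFunctor hl).obj X) (E.substNat hk)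

theorem blockMap_substBlock {m K N : ℕ} {k : Fin m → ℕ} (hk : ∑ i, k i = K) {l : Fin K → ℕ}
    (hl : ∑ q, l q = N) {X Y : OpFamily A V} (β : ∀ q, X (l q) ⟶ Y (l q)) :
    blockMap hl (E.double hk) β ≫ E.substBlock hk hl Y =
      E.substBlock hk hl X ≫ blockMap hl (E.tensor K) β := by
  ext Z
  exact (E.substNat hk).naturality _

theorem substBlock_naturality {m K N : ℕ} {k : Fin m → ℕ} (hk : ∑ i, k i = K) {l : Fin K → ℕ}
    (hl : ∑ q, l q = N) {X Y : OpFamily A V} (φ : X ⟶ Y) :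
    (blockOp hl (E.double hk)).map φ ≫ E.substBlock hk hl Y =
      E.substBlock hk hl X ≫ (blockOp hl (E.tensor K)).map φ :=
  E.blockMap_substBlock hk hl fun q => φ (l q)

/-- The unit at a family of blocks. -/
def unitOuter {m N : ℕ} (h : ∑ _i : Fin 1, m = m) {l : Fin m → ℕ} (hl : ∑ q, l q = N)
    (X : OpFamily A V) :
    (blockOp hl (E.tensor m)).obj X ⟶ (blockOp hl (E.double (k := fun _ => m) h)).obj X :=
  Functor.whiskerLeft ((blockFunctor hl).obj X) (E.unitBlock h E.tensor)

theorem unitOuter_naturality {m N : ℕ} (h : ∑ _i : Fin 1, m = m) {l : Fin m → ℕ}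
    (hl : ∑ q, l q = N) {X Y : OpFamily A V} (φ : X ⟶ Y) :
    (blockOp hl (E.tensor m)).map φ ≫ E.unitOuter h hl Y =
      E.unitOuter h hl X ≫ (blockOp hl (E.double (k := fun _ => m) h)).map φ := by
  ext Z
  exact (E.unitBlock h E.tensor).naturality _

theorem unitOuter_substBlock {m N : ℕ} (h : ∑ _i : Fin 1, m = m) {l : Fin m → ℕ}
    (hl : ∑ q, l q = N) (X : OpFamily A V) :
    E.unitOuter h hl X ≫ E.substBlock (k := fun _ => m) h hl X = 𝟙 _ := by
  ext Z
  exact (Category.assoc _ _ _).trans (E.unit_subst h _)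

end Multitensor

/-! ### Modules over a multitensor. -/

/-- A family of functors of several variables on which the operations `E_n` act by substitution. -/
structure EModule {V : Type u} [Category.{w} V] (E : Multitensor V) (A : Type u₁)
    [Category.{v₁} A] where
  /-- the functors -/
  obj : OpFamily A V
  /-- the action -/
  act {m N : ℕ} {k : Fin m → ℕ} (h : ∑ i, k i = N) : (blockOp h (E.tensor m)).obj obj ⟶ obj N
  unit_act {N : ℕ} (h : ∑ _i : Fin 1, N = N) : E.unitBlock h obj ≫ act (k := fun _ => N) h = 𝟙 _
  subst_act {m K N : ℕ} {k : Fin m → ℕ} (hk : ∑ i, k i = K) {l : Fin K → ℕ} (hl : ∑ q, l q = N)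
    {n : Fin m → ℕ} (hn : ∀ i, ∑ j, l (pos hk i j) = n i) (hN : ∑ i, n i = N) :
    E.substBlock hk hl obj ≫ act hl =
      E.evalBlock hk hl hn hN (fun i => act (hn i)) ≫ act hN

/-- The compatibility of a morphism of families with the actions of two modules. -/
def EModule.IsHom {V : Type u} [Category.{w} V] {E : Multitensor V} {A : Type u₁}
    [Category.{v₁} A] (M M' : EModule E A) (φ : M.obj ⟶ M'.obj) : Prop :=
  ∀ ⦃m N : ℕ⦄ ⦃k : Fin m → ℕ⦄ (h : ∑ i, k i = N),
    (blockOp h (E.tensor m)).map φ ≫ M'.act h = M.act h ≫ φ N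

/-! ### Modules as the algebras of a presentation by terms of depth two. -/

namespace Multitensor

/-- A cut of a sequence of length `N` into consecutive subsequences. -/
structure Cut (N : ℕ) : Type where
  {m : ℕ}
  {k : Fin m → ℕ}
  sum : ∑ i, k i = N

/-- A double cut of a sequence of length `N`. -/
structure DoubleCut (N : ℕ) : Type where
  {m : ℕ}
  {K : ℕ}
  {k : Fin m → ℕ}
  hk : ∑ i, k i = K
  {l : Fin K → ℕ}
  hl : ∑ q, l q = N
  {n : Fin m → ℕ}
  hn : ∀ i, ∑ j, l (pos hk i j) = n i
  hN : ∑ i, n i = N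

variable {V : Type u} [Category.{w} V] (E : Multitensor V) (A : Type u₁) [Category.{v₁} A]
variable [HasColimitsOfSize.{0, 0} V]

/-- The terms `E_i X_{k i}` of depth one. -/
noncomputable def terms : OpFamily A V ⥤ OpFamily A V :=
  Functor.pi' fun N => sigmaFunctor fun d : Cut N => blockOp d.sum (E.tensor d.m)

/-- The terms `E_i E_j X_{l i j}` of depth two. -/
noncomputable def doubleTerms : OpFamily A V ⥤ OpFamily A V :=
  Functor.pi' fun N => sigmaFunctor fun d : DoubleCut N => blockOp d.hl (E.double d.hk)

variable {A}

/-- The inclusion of the terms with a given cut. -/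
noncomputable def term {m N : ℕ} {k : Fin m → ℕ} (h : ∑ i, k i = N) (X : OpFamily A V) :
    (blockOp h (E.tensor m)).obj X ⟶ (E.terms A).obj X N :=
  Sigma.ι (fun d : Cut N => (blockOp d.sum (E.tensor d.m)).obj X) ⟨h⟩

/-- The inclusion of the terms of depth two with a given double cut. -/
noncomputable def doubleTerm {N : ℕ} (d : DoubleCut N) (X : OpFamily A V) :
    (blockOp d.hl (E.double d.hk)).obj X ⟶ (E.doubleTerms A).obj X N :=
  Sigma.ι (fun d : DoubleCut N => (blockOp d.hl (E.double d.hk)).obj X) d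

theorem term_naturality {m N : ℕ} {k : Fin m → ℕ} (h : ∑ i, k i = N) {X Y : OpFamily A V}
    (φ : X ⟶ Y) : E.term h X ≫ (E.terms A).map φ N =
      (blockOp h (E.tensor m)).map φ ≫ E.term h Y :=
  sigmaFunctor_ι_map (fun d : Cut N => blockOp d.sum (E.tensor d.m)) φ ⟨h⟩

theorem doubleTerm_naturality {N : ℕ} (d : DoubleCut N) {X Y : OpFamily A V} (φ : X ⟶ Y) :
    E.doubleTerm d X ≫ (E.doubleTerms A).map φ N =
      (blockOp d.hl (E.double d.hk)).map φ ≫ E.doubleTerm d Y :=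
  sigmaFunctor_ι_map (fun d : DoubleCut N => blockOp d.hl (E.double d.hk)) φ d

variable {E} in
theorem terms_hom_ext {X : OpFamily A V} {N : ℕ} {B : (Fin N → A) ⥤ V}
    {f g : (E.terms A).obj X N ⟶ B}
    (h : ∀ {m : ℕ} {k : Fin m → ℕ} (h : ∑ i, k i = N), E.term h X ≫ f = E.term h X ≫ g) : f = g :=
  Sigma.hom_ext _ _ fun d => h d.sum

variable {E} in
theorem doubleTerms_hom_ext {X : OpFamily A V} {N : ℕ} {B : (Fin N → A) ⥤ V}
    {f g : (E.doubleTerms A).obj X N ⟶ B}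
    (h : ∀ d, E.doubleTerm d X ≫ f = E.doubleTerm d X ≫ g) : f = g :=
  Sigma.hom_ext _ _ h

/-- A morphism out of the terms. -/
noncomputable def termsDesc {X : OpFamily A V} {N : ℕ} {B : (Fin N → A) ⥤ V}
    (f : ∀ {m : ℕ} {k : Fin m → ℕ} (h : ∑ i, k i = N), (blockOp h (E.tensor m)).obj X ⟶ B) :
    (E.terms A).obj X N ⟶ B :=
  Sigma.desc fun d : Cut N => f d.sum

/-- A morphism out of the terms of depth two. -/
noncomputable def doubleTermsDesc {X : OpFamily A V} {N : ℕ} {B : (Fin N → A) ⥤ V}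
    (f : ∀ d : DoubleCut N, (blockOp d.hl (E.double d.hk)).obj X ⟶ B) :
    (E.doubleTerms A).obj X N ⟶ B :=
  Sigma.desc f

theorem term_desc {X : OpFamily A V} {N : ℕ} {B : (Fin N → A) ⥤ V}
    (f : ∀ {m : ℕ} {k : Fin m → ℕ} (h : ∑ i, k i = N), (blockOp h (E.tensor m)).obj X ⟶ B)
    {m : ℕ} {k : Fin m → ℕ} (h : ∑ i, k i = N) : E.term h X ≫ E.termsDesc f = f h :=
  Sigma.ι_desc (fun d : Cut N => f d.sum) ⟨h⟩

theorem doubleTerm_desc {X : OpFamily A V} {N : ℕ} {B : (Fin N → A) ⥤ V}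
    (f : ∀ d : DoubleCut N, (blockOp d.hl (E.double d.hk)).obj X ⟶ B) (d : DoubleCut N) :
    E.doubleTerm d X ≫ E.doubleTermsDesc f = f d :=
  Sigma.ι_desc f d

/-- The action on a partial module. -/
noncomputable def partialAct {X Y : OpFamily A V} (x : (E.terms A).obj X ⟶ Y) {m N : ℕ}
    {k : Fin m → ℕ} (h : ∑ i, k i = N) : (blockOp h (E.tensor m)).obj X ⟶ Y N :=
  E.term h X ≫ x N

theorem sum_const_one_eq (N : ℕ) : ∑ _i : Fin 1, N = N := by simp

/-- The double cut whose outer cut is trivial. -/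
abbrev Cut.toDouble {N : ℕ} (d : Cut N) : DoubleCut N where
  hk := sum_const_one_eq d.m
  hl := d.sum
  n _ := N
  hn i := by
    simp only [pos_one]
    exact d.sum
  hN := sum_const_one_eq N

-- This is naturality of the unit of `E` at the inner operation `α`; everything else re-indexes
-- along the trivial cut into one block.
omit [HasColimitsOfSize.{0, 0} V] in
theorem unitBlock_evalBlock {m N : ℕ} {l : Fin m → ℕ} (hk : ∑ _i : Fin 1, m = m)
    (hl : ∑ q, l q = N) (hn : ∀ i : Fin 1, ∑ j, l (pos (k := fun _ => m) hk i j) = N)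
    (hN : ∑ _i : Fin 1, N = N) {X Y : OpFamily A V}
    (α : ∀ {k : Fin m → ℕ} (h : ∑ i, k i = N), (blockOp h (E.tensor m)).obj X ⟶ Y N) :
    E.unitOuter hk hl X ≫ E.evalBlock (k := fun _ => m) hk hl (n := fun _ => N) hn hN (fun i => α (hn i)) =
        α hl ≫ E.unitBlock hN Y := by
  ext Z
  let B : V := ((blockOp hl (E.tensor m)).obj X).obj Z
  have h1 : E.unit B ≫ (E.tensor 1).map (X := fun _ => B) (Y := fun _ => (Y N).obj Z)
      (fun _ => (α hl).app Z) = (α hl).app Z ≫ E.unit ((Y N).obj Z) := E.unit_naturality _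
  refine Eq.trans ?_ (((congrArg (· ≫ _) h1).trans (Category.assoc _ _ _)))
  refine (Category.assoc _ _ _).trans (Eq.trans ?_ (Category.assoc _ _ _).symm)
  refine congrArg (E.unit B ≫ ·) ?_
  refine (Category.assoc _ _ _).symm.trans ?_
  have hp (i : Fin 1) : (fun q => Z (pos (k := fun _ => N) hN i q)) = Z :=
    funext fun q => by rw [pos_one]
  have key : ∀ (l' : Fin m → ℕ) (h' : ∑ i, l' i = N) (Z' : Fin N → A), l' = l → Z' = Z →
      (α h').app Z' ≍ (α hl).app Z := by
    rintro l' h' Z' rfl rfl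
    rfl
  have hl' (i : Fin 1) : (fun j => l (pos (k := fun _ => m) hk i j)) = l :=
    funext fun j => by rw [pos_one]
  have key2 : ∀ (l' : Fin m → ℕ) (h' : ∑ i, l' i = N) (Z' : Fin N → A), l' = l → Z' = Z →
      B = ((blockOp h' (E.tensor m)).obj X).obj Z' := by
    rintro l' h' Z' rfl rfl
    rfl
  refine (congrArg (· ≫ _) (eqToHom_trans _ _)).trans ?_
  refine eqToHom_comp_eq_comp_eqToHom _ _ (ECategory.heq_tensor_map
    (fun i => key2 _ _ _ (hl' i) (hp i)) (fun i => congrArg _ (hp i).symm)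
    fun i => (key _ _ _ (hl' i) (hp i)).symm)

/-- The unit of the terms. -/
noncomputable def unitTerm (X : OpFamily A V) (N : ℕ) : X N ⟶ (E.terms A).obj X N :=
  E.unitBlock (sum_const_one_eq N) X ≫ E.term (k := fun _ => N) _ X

/-- The substitution of terms. -/
noncomputable def flattenMap (X : OpFamily A V) (N : ℕ) :
    (E.doubleTerms A).obj X N ⟶ (E.terms A).obj X N :=
  E.doubleTermsDesc fun d =>
    E.substBlock d.hk d.hl X ≫ E.term d.hl X

/-- The terms as terms of depth two. -/
noncomputable def outerMap (X : OpFamily A V) (N : ℕ) :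
    (E.terms A).obj X N ⟶ (E.doubleTerms A).obj X N :=
  E.termsDesc fun {m k} h => E.unitOuter (sum_const_one_eq m) h X ≫
    E.doubleTerm (Cut.mk (k := k) h).toDouble X

/-- The evaluation of inner terms in a partial module. -/
noncomputable def evalMap {X Y : OpFamily A V} (x : (E.terms A).obj X ⟶ Y) (N : ℕ) :
    (E.doubleTerms A).obj X N ⟶ (E.terms A).obj Y N :=
  E.doubleTermsDesc fun d =>
    E.evalBlock d.hk d.hl d.hn d.hN (fun i => E.partialAct x (d.hn i)) ≫ E.term d.hN Y

theorem unitTerm_naturality {X Y : OpFamily A V} (φ : X ⟶ Y) (N : ℕ) :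
    φ N ≫ E.unitTerm Y N = E.unitTerm X N ≫ (E.terms A).map φ N := by
  rw [unitTerm, unitTerm, ← Category.assoc, E.unitBlock_naturality, Category.assoc, Category.assoc,
    E.term_naturality]

theorem flattenMap_naturality {X Y : OpFamily A V} (φ : X ⟶ Y) (N : ℕ) :
    (E.doubleTerms A).map φ N ≫ E.flattenMap Y N =
      E.flattenMap X N ≫ (E.terms A).map φ N := by
  refine doubleTerms_hom_ext fun d => ?_
  rw [← Category.assoc, E.doubleTerm_naturality, Category.assoc, flattenMap, E.doubleTerm_desc,
    flattenMap, ← Category.assoc (E.doubleTerm d X), E.doubleTerm_desc, Category.assoc,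
    E.term_naturality, ← Category.assoc, ← Category.assoc, E.substBlock_naturality]

theorem term_outerMap {m N : ℕ} {k : Fin m → ℕ} (h : ∑ i, k i = N) (X : OpFamily A V) :
    E.term h X ≫ E.outerMap X N = E.unitOuter (sum_const_one_eq m) h X ≫
      E.doubleTerm (Cut.mk (k := k) h).toDouble X :=
  E.term_desc _ h

theorem outerMap_naturality {X Y : OpFamily A V} (φ : X ⟶ Y) (N : ℕ) :
    (E.terms A).map φ N ≫ E.outerMap Y N = E.outerMap X N ≫ (E.doubleTerms A).map φ N := by
  refine terms_hom_ext fun {m k} h => ?_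
  have h1 := E.doubleTerm_naturality (Cut.mk (k := k) h).toDouble φ
  have h2 := E.unitOuter_naturality (sum_const_one_eq m) h φ
  refine (Category.assoc _ _ _).symm.trans ((congrArg (· ≫ _) (E.term_naturality h φ)).trans ?_)
  refine (Category.assoc _ _ _).trans ((congrArg (_ ≫ ·) (E.term_outerMap h Y)).trans ?_)
  refine (Category.assoc _ _ _).symm.trans ((congrArg (· ≫ _) h2).trans ?_)
  refine (Category.assoc _ _ _).trans ((congrArg (_ ≫ ·) h1.symm).trans ?_)
  refine (Category.assoc _ _ _).symm.trans ((congrArg (· ≫ _) (E.term_outerMap h X).symm).trans ?_)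
  exact Category.assoc _ _ _

theorem evalMap_naturality {X Y X' Y' : OpFamily A V} (x : (E.terms A).obj X ⟶ Y)
    (x' : (E.terms A).obj X' ⟶ Y') (φ : X ⟶ X') (ψ : Y ⟶ Y')
    (w : (E.terms A).map φ ≫ x' = x ≫ ψ) (N : ℕ) :
    (E.doubleTerms A).map φ N ≫ E.evalMap x' N = E.evalMap x N ≫ (E.terms A).map ψ N := by
  refine doubleTerms_hom_ext fun d => ?_
  rw [← Category.assoc, E.doubleTerm_naturality, Category.assoc, evalMap, E.doubleTerm_desc,
    evalMap, ← Category.assoc (E.doubleTerm d X), E.doubleTerm_desc, Category.assoc,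
    E.term_naturality, ← Category.assoc, ← Category.assoc]
  refine congrArg (· ≫ _) (E.evalBlock_naturality _ _ _ _ _ _ _ _ fun i => ?_)
  have h1 : (E.terms A).map φ _ ≫ x' _ = x _ ≫ ψ (d.n i) := congrFun w (d.n i)
  rw [partialAct, partialAct, ← Category.assoc, ← E.term_naturality, Category.assoc, h1,
    Category.assoc]

theorem outerMap_flattenMap (X : OpFamily A V) (N : ℕ) :
    E.outerMap X N ≫ E.flattenMap X N = 𝟙 _ := by
  refine terms_hom_ext fun {m k} h => ?_
  have h1 := E.doubleTerm_desc (X := X) (fun d =>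
    E.substBlock d.hk d.hl X ≫ E.term d.hl X)
    (Cut.mk (k := k) h).toDouble
  rw [← Category.assoc, E.term_outerMap, Category.assoc, flattenMap, h1, ← Category.assoc,
    Category.comp_id, E.unitOuter_substBlock, Category.id_comp]

/-- A term regarded as a term of depth two with trivial outer operation is evaluated by applying the
whole operation and then the unit, by `unitBlock_evalBlock`. This is the condition that lets a
partial algebra map to its successor stage. -/
theorem outerMap_evalMap {X Y : OpFamily A V} (x : (E.terms A).obj X ⟶ Y) (N : ℕ) :
    E.outerMap X N ≫ E.evalMap x N = x N ≫ E.unitTerm Y N := by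
  refine terms_hom_ext fun {m k} h => ?_
  have h1 := E.doubleTerm_desc (X := X) (fun d =>
    E.evalBlock d.hk d.hl d.hn d.hN (fun i => E.partialAct x (d.hn i)) ≫ E.term d.hN Y)
    (Cut.mk (k := k) h).toDouble
  rw [← Category.assoc, E.term_outerMap, Category.assoc, evalMap, h1, ← Category.assoc]
  refine (congrArg (· ≫ _) (E.unitBlock_evalBlock (sum_const_one_eq _) h
    (Cut.mk h).toDouble.hn (sum_const_one_eq N) fun h => E.partialAct x h)).trans ?_
  rw [partialAct, Category.assoc, Category.assoc]
  rfl

variable (A)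

/-- The presentation of the theory of modules by terms of depth at most two. -/
noncomputable def presentation : Presentation (E.terms A) (E.doubleTerms A) where
  η := { app := E.unitTerm, naturality := fun _ _ φ => funext (E.unitTerm_naturality φ) }
  flatten := { app := E.flattenMap, naturality := fun _ _ φ => funext (E.flattenMap_naturality φ) }
  outer := { app := E.outerMap, naturality := fun _ _ φ => funext (E.outerMap_naturality φ) }
  eval :=
    { app := fun p => E.evalMap p.hom
      naturality := fun p p' f =>
        funext (E.evalMap_naturality p.hom p'.hom f.left f.right f.w) }
  outer_flatten X := funext (E.outerMap_flattenMap X)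
  outer_eval p := funext (E.outerMap_evalMap p.hom)

variable {A}

/-- The algebras of the presentation are modules. -/
noncomputable def moduleOfAlgebra {D : OpFamily A V} {d : (E.terms A).obj D ⟶ D}
    (hd : (E.presentation A).IsAlgebra D d) : EModule E A where
  obj := D
  act h := E.partialAct d h
  unit_act {N} h := (Category.assoc _ _ _).symm.trans (congrFun hd.unit N)
  subst_act {m K N k} hk {l} hl {n} hn hN := by
    let c : DoubleCut N := ⟨hk, hl, hn, hN⟩
    have h1 : E.evalMap d N ≫ d N = E.flattenMap D N ≫ d N := congrFun hd.eval N
    have h2 := E.doubleTerm_desc (X := D) (fun d =>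
      E.substBlock d.hk d.hl D ≫ E.term d.hl D) c
    have h3 := E.doubleTerm_desc (X := D) (fun c =>
      E.evalBlock c.hk c.hl c.hn c.hN (fun i => E.partialAct d (c.hn i)) ≫ E.term c.hN D) c
    have h4 := congrArg (E.doubleTerm c D ≫ ·) h1
    simp only [← Category.assoc] at h4
    rw [evalMap, h3, flattenMap, h2, Category.assoc, Category.assoc] at h4
    exact h4.symm

/-- The structure map of a module. -/
noncomputable def algebraMap (M : EModule E A) : (E.terms A).obj M.obj ⟶ M.obj :=
  fun _ => E.termsDesc fun h => M.act h

theorem term_algebraMap (M : EModule E A) {m N : ℕ} {k : Fin m → ℕ} (h : ∑ i, k i = N) :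
    E.partialAct (E.algebraMap M) h = M.act h :=
  E.term_desc _ h

/-- Modules are algebras of the presentation. -/
theorem isAlgebra_algebraMap (M : EModule E A) :
    (E.presentation A).IsAlgebra M.obj (E.algebraMap M) where
  unit := by
    funext N
    have h1 : E.unitTerm M.obj N ≫ E.algebraMap M N = 𝟙 _ := by
      rw [unitTerm, Category.assoc]
      exact (congrArg (E.unitBlock _ M.obj ≫ ·) (E.term_algebraMap M _)).trans (M.unit_act _)
    exact h1
  eval := by
    funext N
    refine doubleTerms_hom_ext (E := E) (A := A) (X := M.obj) (B := M.obj N) fun c => ?_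
    have h2 := E.doubleTerm_desc (X := M.obj) (fun d =>
      E.substBlock d.hk d.hl M.obj ≫ E.term d.hl M.obj) c
    have h3 := E.doubleTerm_desc (X := M.obj) (fun c =>
      E.evalBlock c.hk c.hl c.hn c.hN (fun i => E.partialAct (E.algebraMap M) (c.hn i)) ≫
        E.term c.hN M.obj) c
    change E.doubleTerm c (EModule.obj M) ≫ E.evalMap (E.algebraMap M) N ≫ E.algebraMap M N =
      E.doubleTerm c M.obj ≫ E.flattenMap M.obj N ≫ E.algebraMap M N
    rw [← Category.assoc, ← Category.assoc, evalMap, h3, flattenMap, h2, Category.assoc,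
      Category.assoc]
    have h4 := M.subst_act c.hk c.hl c.hn c.hN
    simp only [← term_algebraMap] at h4
    exact h4.symm

/-- Maps out of the terms are tested cut by cut. This passes between morphisms of algebras, for
which the reflection has its universal property, and morphisms of modules. -/
theorem map_comp_algebraMap_iff {X : OpFamily A V} (x : (E.terms A).obj X ⟶ X) (M : EModule E A)
    (φ : X ⟶ M.obj) : (E.terms A).map φ ≫ E.algebraMap M = x ≫ φ ↔
      ∀ ⦃m N : ℕ⦄ ⦃k : Fin m → ℕ⦄ (h : ∑ i, k i = N),
        (blockOp h (E.tensor m)).map φ ≫ M.act h = E.partialAct x h ≫ φ N := by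
  constructor
  · intro h m N k hk
    have h1 : (E.terms A).map φ N ≫ E.algebraMap M N = x N ≫ φ N := congrFun h N
    rw [← term_algebraMap, partialAct, ← Category.assoc, ← E.term_naturality, Category.assoc, h1,
      partialAct, Category.assoc]
  · intro h
    funext N
    refine terms_hom_ext fun {m k} hk => ?_
    have h1 := h hk
    rw [← term_algebraMap, partialAct, ← Category.assoc, ← E.term_naturality, Category.assoc,
      partialAct, Category.assoc] at h1
    exact h1

end Multitensor

/-! ### Closure of coproduct preservation under colimits, and preservation of chains by the terms.
-/

section Closure

open Multitensor

variable {A : Type u₁} [Category.{v₁} A] {V : Type u} [Category.{w} V]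

/-- A constant functor need not preserve coproducts, but one with initial values does. This is what
allows a family to be concentrated in degree one. -/
theorem preservesColimitsOfShape_of_isInitial {C : Type u₁} [Category.{v₁} C] {D : Type u₂}
    [Category.{v₂} D] {J : Type u₃} [Category.{v₃} J] (F : C ⥤ D) (h : ∀ X, IsInitial (F.obj X)) :
    PreservesColimitsOfShape J F where
  preservesColimit := ⟨fun {c} _ => ⟨
    { desc := fun _ => (h c.pt).to _
      fac := fun _ _ => (h _).hom_ext _ _
      uniq := fun _ _ _ => (h c.pt).hom_ext _ _ }⟩⟩

theorem preservesColimitsOfShape_whiskerLeft_of_isColimit {B : Type u₂} [Category.{v₂} B]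
    {C : Type u₁} [Category.{v₁} C] {J : Type u₃} [Category.{v₃} J] {K : Type*} [Category* K]
    [HasColimitsOfShape K V] (Q : B ⥤ C) {H : K ⥤ C ⥤ V} {c : Cocone H} (hc : IsColimit c)
    (hH : ∀ k, PreservesColimitsOfShape J (Q ⋙ H.obj k)) :
    PreservesColimitsOfShape J (Q ⋙ c.pt) :=
  preservesColimitsOfShape_of_isColimit
    (isColimitOfPreserves ((Functor.whiskeringLeft B C V).obj Q) hc) hH

/-- Colimits of families are computed in each degree and at each sequence, and colimits commute with
coproducts. -/
theorem isClosedUnderColimitsOfShape_preservesCoproductsInVariables (K : Type*) [Category* K]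
    [HasColimitsOfShape K V] :
    (preservesCoproductsInVariables (A := A) (V := V)).IsClosedUnderColimitsOfShape K where
  colimitsOfShape_le X := by
    rintro ⟨h⟩ n Z s J
    have := preservesColimitsOfShape_eval (J := K) (C := fun n => (Fin n → A) ⥤ V) n
    exact preservesColimitsOfShape_whiskerLeft_of_isColimit (variableAt Z s)
      (isColimitOfPreserves (Pi.eval (fun n => (Fin n → A) ⥤ V) n) h.isColimit) fun k =>
        h.prop_diag_obj k n Z s J

instance : (preservesCoproductsInVariables (A := A) (V := V)).IsClosedUnderIsomorphisms where
  of_iso {X _} e h n Z s J := by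
    have : PreservesColimitsOfShape (Discrete J)
      (variableAt Z s ⋙ (Pi.eval (fun n => (Fin n → A) ⥤ V) n).obj X) := h n Z s J
    exact preservesColimitsOfShape_of_natIso (Functor.isoWhiskerLeft (variableAt Z s)
      ((Pi.eval (fun n => (Fin n → A) ⥤ V) n).mapIso e))

theorem preservesColimitsOfShape_whiskerLeft_sigma {B : Type u₂} [Category.{v₂} B]
    {C : Type u₁} [Category.{v₁} C] {J : Type u₃} [Category.{v₃} J] {I : Type}
    [HasColimitsOfShape (Discrete I) V] (Q : B ⥤ C) (F : I → C ⥤ V)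
    (hF : ∀ i, PreservesColimitsOfShape J (Q ⋙ F i)) :
    PreservesColimitsOfShape J (Q ⋙ ∐ F) :=
  preservesColimitsOfShape_whiskerLeft_of_isColimit Q (colimit.isColimit (Discrete.functor F))
    fun i => hF i.as

theorem preservesColimitsOfShape_blockFunctor_obj_comp {B : Type u₂} [Category.{v₂} B] {m N : ℕ}
    {k : Fin m → ℕ} (h : ∑ i, k i = N) {J : Type u₃} [Category.{v₃} J] [HasColimitsOfShape J V]
    (E : OpFamily V V) (hE : ∀ n, PreservesColimitsOfShape J (E n)) (G : (Fin m → V) ⥤ B)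
    (hG : PreservesColimitsOfShape J G) :
    PreservesColimitsOfShape J ((blockFunctor h).obj E ⋙ G) := by
  have : PreservesColimitsOfShape J ((blockFunctor h).obj E) := by
    refine preservesColimitsOfShape_pi _ fun i => ?_
    have : PreservesColimitsOfShape J
        (Functor.pi' fun j => Pi.eval (fun _ : Fin N => V) (pos h i j)) :=
      preservesColimitsOfShape_pi _ fun j => preservesColimitsOfShape_eval (pos h i j)
    have := hE (k i)
    exact inferInstanceAs (PreservesColimitsOfShape J
      ((Functor.pi' fun j => Pi.eval (fun _ : Fin N => V) (pos h i j)) ⋙ E (k i)))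
  infer_instance

/-- The family enters all blocks at once, so `G` must preserve the colimit jointly in its variables;
preservation in each variable would not be enough as such. -/
theorem preservesColimitsOfShape_blockOp_functor {m N : ℕ} {k : Fin m → ℕ} (h : ∑ i, k i = N)
    {J : Type u₃} [Category.{v₃} J] [HasColimitsOfShape J V] (G : (Fin m → V) ⥤ V)
    (hG : PreservesColimitsOfShape J G) :
    PreservesColimitsOfShape J (blockOp (A := A) h G) := by
  refine preservesColimitsOfShape_of_evaluation _ _ fun Z => ?_
  have : PreservesColimitsOfShape J
      (blockFunctor (A := A) (V := V) h ⋙ (evaluation _ _).obj Z) := by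
    refine preservesColimitsOfShape_pi _ fun i => ?_
    have := preservesColimitsOfShape_eval (J := J) (C := fun n => (Fin n → A) ⥤ V) (k i)
    exact inferInstanceAs (PreservesColimitsOfShape J
      (Pi.eval (fun n => (Fin n → A) ⥤ V) (k i) ⋙ (evaluation _ _).obj fun j => Z (pos h i j)))
  exact inferInstanceAs (PreservesColimitsOfShape J
    ((blockFunctor (A := A) (V := V) h ⋙ (evaluation _ _).obj Z) ⋙ G))

end Closure

namespace Multitensor

variable {V : Type u} [Category.{w} V] (E : Multitensor V) {A : Type u₁} [Category.{v₁} A]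
  [HasColimitsOfSize.{0, 0} V]

omit [HasColimitsOfSize.{0, 0} V] in
theorem preservesColimitsOfShape_double {J : Type u₃} [Category.{v₃} J] [HasColimitsOfShape J V]
    (hE : ∀ n, PreservesColimitsOfShape J (E.tensor n)) {m K : ℕ} {k : Fin m → ℕ}
    (h : ∑ i, k i = K) : PreservesColimitsOfShape J (E.double h) :=
  preservesColimitsOfShape_blockFunctor_obj_comp h E.tensor hE _ (hE m)

theorem preservesColimitsOfShape_terms {J : Type u₃} [Category.{v₃} J] [HasColimitsOfShape J V]
    (hE : ∀ n, PreservesColimitsOfShape J (E.tensor n)) :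
    PreservesColimitsOfShape J (E.terms A) :=
  preservesColimitsOfShape_pi _ fun _ => preservesColimitsOfShape_sigmaFunctor _ fun d =>
    preservesColimitsOfShape_blockOp_functor d.sum _ (hE d.m)

theorem preservesColimitsOfShape_doubleTerms {J : Type u₃} [Category.{v₃} J]
    [HasColimitsOfShape J V] (hE : ∀ n, PreservesColimitsOfShape J (E.tensor n)) :
    PreservesColimitsOfShape J (E.doubleTerms A) :=
  preservesColimitsOfShape_pi _ fun _ => preservesColimitsOfShape_sigmaFunctor _ fun d =>
    preservesColimitsOfShape_blockOp_functor d.hl _ (E.preservesColimitsOfShape_double hE d.hk)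

theorem preservesCoproductsInVariables_terms {A : Type u₁} [Category.{w} A]
    (hE : preservesCoproductsInVariables E.tensor)
    (X : OpFamily A V) (hX : preservesCoproductsInVariables X) :
    preservesCoproductsInVariables ((E.terms A).obj X) := fun _ Z s J =>
  preservesColimitsOfShape_whiskerLeft_sigma _ _ fun d =>
    preservesColimitsOfShape_blockOp d.sum _ (fun Z i => hE d.m Z i J) X
      (fun n Z i => hX n Z i J) Z s

theorem preservesCoproductsInVariables_doubleTerms {A : Type u₁} [Category.{w} A]
    (hE : preservesCoproductsInVariables E.tensor)
    (X : OpFamily A V) (hX : preservesCoproductsInVariables X) :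
    preservesCoproductsInVariables ((E.doubleTerms A).obj X) := fun _ Z s J =>
  preservesColimitsOfShape_whiskerLeft_sigma _ _ fun d =>
    preservesColimitsOfShape_blockOp d.hl _ (fun Z i =>
      preservesColimitsOfShape_blockOp d.hk _ (fun Z i => hE d.m Z i J) E.tensor
        (fun n Z i => hE n Z i J) Z i) X (fun n Z i => hX n Z i J) Z s

omit [HasColimitsOfSize.{0, 0} V] in
/-- The operations of an accessible multitensor preserve the colimits of sufficiently long chains
of sequences. -/
theorem exists_preservesColimitsOfShape_tensor [HasColimitsOfSize.{w, w} V]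
    (ha : E.IsAccessibleInEachVariable) : ∃ (κ : Cardinal.{w}) (_ : Fact κ.IsRegular),
      ∀ n, PreservesColimitsOfShape κ.ord.ToType (E.tensor n) := by
  obtain ⟨κ, hκ, h⟩ := ha
  refine ⟨κ, hκ, fun n => ?_⟩
  have : Nonempty κ.ord.ToType := by simpa using Cardinal.IsRegular.ne_zero Fact.out
  exact preservesColimitsOfShape_of_variables _ fun Z i =>
    (h n Z i).preservesColimitOfShape κ.ord.ToType

end Multitensor

/-! ### Families concentrated in degree one. -/

section Single

variable {A : Type u₁} [Category.{v₁} A] {V : Type u} [Category.{w} V] [HasInitial V]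

/-- The family concentrated in degree one. -/
noncomputable def singleFamily (L : (Fin 1 → A) ⥤ V) : OpFamily A V
  | 1 => L
  | 0 => (Functor.const _).obj (⊥_ V)
  | _ + 2 => (Functor.const _).obj (⊥_ V)

/-- A morphism out of a family concentrated in degree one. -/
noncomputable def singleDesc {L : (Fin 1 → A) ⥤ V} {X : OpFamily A V} (f : L ⟶ X 1) :
    singleFamily L ⟶ X
  | 1 => f
  | 0 => { app := fun _ => initial.to _, naturality := fun _ _ _ => initialIsInitial.hom_ext _ _ }
  | _ + 2 =>
    { app := fun _ => initial.to _, naturality := fun _ _ _ => initialIsInitial.hom_ext _ _ }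

theorem singleFamily_hom_ext {L : (Fin 1 → A) ⥤ V} {X : OpFamily A V} {f g : singleFamily L ⟶ X}
    (h : f 1 = g 1) : f = g := by
  funext n
  match n with
  | 1 => exact h
  | 0 =>
    ext Z
    exact initialIsInitial.hom_ext _ _
  | n + 2 =>
    ext Z
    exact initialIsInitial.hom_ext _ _

theorem preservesCoproductsInVariables_singleFamily {L : (Fin 1 → A) ⥤ V}
    (hL : ∀ (Z : Fin 1 → A) (J : Type v₁),
      PreservesColimitsOfShape (Discrete J) (Multitensor.variableAt Z 0 ⋙ L)) :
    preservesCoproductsInVariables (singleFamily L) := by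
  intro n Z s J
  match n with
  | 1 =>
    rw [Subsingleton.elim s 0]
    exact hL Z J
  | 0 => exact s.elim0
  | n + 2 => exact preservesColimitsOfShape_of_isInitial _ fun _ => initialIsInitial

end Single

/-! ### The initial module with letters. -/

namespace Multitensor

variable {V : Type u} [Category.{w} V] (E : Multitensor V)

/-- The functor which sends a sequence of one algebra to its underlying object. -/
def letterFunctor : (Fin 1 → E.UnaryAlgebra) ⥤ V := Pi.eval _ 0 ⋙ E.unaryMonad.forget

variable {E} in
/-- The letters of a module over `V^{E_1}`: a natural `E_1`-linear map `Z ⟶ M_1(Z)`. -/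
structure Letters (M : EModule E E.UnaryAlgebra) where
  /-- the natural transformation -/
  nat : E.letterFunctor ⟶ M.obj 1
  linear (h : ∑ _i : Fin 1, 1 = 1) (X : E.UnaryAlgebra) :
    X.a ≫ nat.app (fun _ => X) = (E.tensor 1).map (X := fun _ => X.A)
      (Y := fun _ => (M.obj 1).obj fun _ => X) (fun _ => nat.app fun _ => X) ≫
      (M.act (k := fun _ => 1) h).app fun _ => X

variable [HasInitial V]

/-- The unary operation applied to letters. -/
noncomputable abbrev letterBlock : (Fin 1 → E.UnaryAlgebra) ⥤ V :=
  (blockOp (k := fun _ : Fin 1 => 1) (sum_const_one_eq 1) (E.tensor 1)).obj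
    (singleFamily E.letterFunctor)

/-- The action of the unary operation on letters. -/
noncomputable def letterAction : E.letterBlock ⟶ E.letterFunctor where
  app Z := eqToHom (by
    change ((E.tensor 1).obj fun i => (Z (pos (k := fun _ => 1) (sum_const_one_eq 1) i 0)).A) =
      (E.tensor 1).obj fun _ => (Z 0).A
    simp only [pos_one]) ≫ (Z 0).a
  naturality Z Z' f := by
    obtain ⟨X, rfl⟩ : ∃ X, Z = fun _ => X := ⟨Z 0, funext fun i => by rw [Subsingleton.elim i 0]⟩
    obtain ⟨X', rfl⟩ : ∃ X, Z' = fun _ => X := ⟨Z' 0, funext fun i => by rw [Subsingleton.elim i 0]⟩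
    obtain ⟨f, rfl⟩ : ∃ g : X ⟶ X', f = fun _ => g :=
      ⟨f 0, funext fun i => by rw [Subsingleton.elim i 0]⟩
    refine (congrArg (_ ≫ ·) (Category.id_comp _)).trans ?_
    exact f.h.trans (congrArg (· ≫ f.f) (Category.id_comp _).symm)

/-- Rewrites linearity as a square of natural transformations in degree one, the form in which the
pushout below imposes it. -/
theorem letters_linear_iff (M : EModule E E.UnaryAlgebra) (f : E.letterFunctor ⟶ M.obj 1) :
    (E.letterAction ≫ f = (blockOp (k := fun _ : Fin 1 => 1) (sum_const_one_eq 1)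
      (E.tensor 1)).map (singleDesc f) ≫ M.act _) ↔
    ∀ X : E.UnaryAlgebra, X.a ≫ f.app (fun _ => X) = (E.tensor 1).map (X := fun _ => X.A)
      (Y := fun _ => (M.obj 1).obj fun _ => X) (fun _ => f.app fun _ => X) ≫
      (M.act (k := fun _ => 1) (sum_const_one_eq 1)).app fun _ => X := by
  constructor
  · intro h X
    refine Eq.trans ?_ (congrArg (fun α => α.app fun _ => X) h)
    exact congrArg (· ≫ _) (Category.id_comp _).symm
  · intro h
    ext Z
    obtain ⟨X, rfl⟩ : ∃ X, Z = fun _ => X := ⟨Z 0, funext fun i => by rw [Subsingleton.elim i 0]⟩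
    exact (congrArg (· ≫ _) (Category.id_comp _)).trans (h X)

theorem unitBlock_letterAction :
    E.unitBlock (sum_const_one_eq 1) (singleFamily E.letterFunctor) ≫ E.letterAction = 𝟙 _ := by
  ext Z
  obtain ⟨X, rfl⟩ : ∃ X, Z = fun _ => X := ⟨Z 0, funext fun i => by rw [Subsingleton.elim i 0]⟩
  refine Eq.trans ?_ X.unit
  refine (congrArg (_ ≫ ·) (Category.id_comp _)).trans ?_
  exact congrArg (· ≫ X.a) (Category.comp_id _)

section

variable [HasColimitsOfSize.{0, 0} V]

/-- The inclusion of the terms of depth one in letters. -/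
noncomputable def letterTerm :
    singleFamily E.letterBlock ⟶ (E.terms _).obj (singleFamily E.letterFunctor) :=
  singleDesc (E.term _ _)

/-- The action of the unary operation on letters, as a morphism of families. -/
noncomputable def letterSingleAction :
    singleFamily E.letterBlock ⟶ singleFamily E.letterFunctor :=
  singleDesc E.letterAction

variable {E} {P : OpFamily E.UnaryAlgebra V}
  {inl : (E.terms _).obj (singleFamily E.letterFunctor) ⟶ P}
  {inr : singleFamily E.letterFunctor ⟶ P}
  (hP : IsPushout E.letterTerm E.letterSingleAction inl inr)

include hP

/-- The pushout `P` makes a unary operation applied to a letter equal to the action on that letter.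
The unit of the terms on letters passes through this unary operation, and the unit followed by the
action of an algebra is the identity. So the comparison map of the starting partial algebra is
`inr`. -/
theorem unitTerm_inl : (fun n => E.unitTerm _ n ≫ inl n) = inr := by
  apply singleFamily_hom_ext
  have h1 : E.letterTerm 1 ≫ inl 1 = E.letterSingleAction 1 ≫ inr 1 := congrFun hP.w 1
  have h2 : E.unitBlock (sum_const_one_eq 1) (singleFamily E.letterFunctor) ≫
      E.letterTerm 1 ≫ inl 1 = inr 1 := by
    refine (congrArg (E.unitBlock _ _ ≫ ·) h1).trans ?_
    refine (Category.assoc _ _ _).symm.trans ?_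
    exact (congrArg (· ≫ inr 1) E.unitBlock_letterAction).trans (Category.id_comp _)
  exact (Category.assoc _ _ _).trans h2

theorem left_eq_of_isAlgebra {D : OpFamily E.UnaryAlgebra V} {d : (E.terms _).obj D ⟶ D}
    (hD : (E.presentation _).IsAlgebra D d)
    (f : Comma.mk (R := 𝟭 _) (singleFamily E.letterFunctor) P inl ⟶ Comma.mk D D d) :
    f.left = inr ≫ f.right := by
  have h1 := (E.presentation _).q_naturality f
  have h2 : (E.presentation _).q (Comma.mk (R := 𝟭 _) (singleFamily E.letterFunctor) P inl) = inr :=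
    unitTerm_inl hP
  have h3 : (E.presentation _).q (Comma.mk (R := 𝟭 _) D D d) = 𝟙 D := hD.unit
  rw [h2, h3] at h1
  exact (Category.comp_id _).symm.trans h1

/-- The pushout square, read through a map to an algebra, is exactly the linearity of the letters.
-/
theorem linear_of_isAlgebra {D : OpFamily E.UnaryAlgebra V} {d : (E.terms _).obj D ⟶ D}
    (hD : (E.presentation _).IsAlgebra D d)
    (f : Comma.mk (R := 𝟭 _) (singleFamily E.letterFunctor) P inl ⟶ Comma.mk D D d) :
    E.letterAction ≫ f.left 1 = (blockOp (k := fun _ : Fin 1 => 1) (sum_const_one_eq 1)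
      (E.tensor 1)).map (singleDesc (f.left 1)) ≫ E.partialAct d _ := by
  have h0 := left_eq_of_isAlgebra hP hD f
  have h1 : (E.terms _).map f.left ≫ d = inl ≫ f.right := f.w
  have h2 : E.letterTerm ≫ (E.terms _).map f.left ≫ d = E.letterSingleAction ≫ f.left := by
    rw [h1, ← Category.assoc, hP.w, Category.assoc, ← h0]
  have h3 : E.term (k := fun _ : Fin 1 => 1) (sum_const_one_eq 1) (singleFamily E.letterFunctor) ≫
      (E.terms _).map f.left 1 ≫ d 1 = E.letterAction ≫ f.left 1 := congrFun h2 1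
  have h4 : singleDesc (f.left 1) = f.left := singleFamily_hom_ext rfl
  rw [← h3, h4, partialAct, ← Category.assoc, E.term_naturality, Category.assoc]
  rfl

/-- Linear letters make the square under the pushout commute, so they extend to it. Together with
`linear_of_isAlgebra`, this identifies maps from the starting partial algebra with letters. -/
theorem exists_hom_of_letters (M : EModule E E.UnaryAlgebra) (lam : Letters M) :
    ∃ g : Comma.mk (R := 𝟭 _) (singleFamily E.letterFunctor) P inl ⟶
      Comma.mk M.obj M.obj (E.algebraMap M), g.left 1 = lam.nat := by
  let φ : singleFamily E.letterFunctor ⟶ M.obj := singleDesc lam.nat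
  have h1 : E.letterTerm ≫ (E.terms _).map φ ≫ E.algebraMap M = E.letterSingleAction ≫ φ := by
    apply singleFamily_hom_ext
    have h2 := (E.letters_linear_iff M lam.nat).2 (lam.linear _)
    have h3 := E.term_naturality (k := fun _ : Fin 1 => 1) (sum_const_one_eq 1) φ
    have h4 := E.term_algebraMap M (k := fun _ : Fin 1 => 1) (sum_const_one_eq 1)
    change E.term _ _ ≫ (E.terms _).map φ 1 ≫ E.algebraMap M 1 = E.letterAction ≫ lam.nat
    rw [h2, ← h4, partialAct, ← Category.assoc, h3, Category.assoc]
  exact ⟨{ left := φ, right := hP.desc ((E.terms _).map φ ≫ E.algebraMap M) φ h1,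
           w := (hP.inl_desc _ _ _).symm }, rfl⟩

end

variable [HasColimitsOfSize.{w, w} V]

omit [HasColimitsOfSize.{w, w} V] in
theorem preservesColimitsOfShape_unaryMonad {J : Type u₁} [Category.{v₁} J]
    (hE : ∀ (Z : Fin 1 → V) i, PreservesColimitsOfShape J (variableAt Z i ⋙ E.tensor 1)) :
    PreservesColimitsOfShape J E.unaryMonad.toFunctor := by
  let Q : V ⥤ (Fin 1 → V) := Functor.pi' fun _ => 𝟭 V
  let e : Q ≅ variableAt (fun _ => ⊥_ V) 0 :=
    variableAtIso Q 0 _ fun t ht => absurd (Subsingleton.elim t 0) ht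
  have := hE (fun _ => ⊥_ V) 0
  have : PreservesColimitsOfShape J (Q ⋙ E.tensor 1) :=
    preservesColimitsOfShape_of_natIso (Functor.isoWhiskerRight e.symm (E.tensor 1))
  exact inferInstanceAs (PreservesColimitsOfShape J (Q ⋙ E.tensor 1))

/-- The letters form a family of functors which preserve coproducts. -/
theorem preservesCoproductsInVariables_letters
    (hE : preservesCoproductsInVariables E.tensor) :
    preservesCoproductsInVariables (singleFamily E.letterFunctor) := by
  refine preservesCoproductsInVariables_singleFamily fun Z J => ?_
  have : PreservesColimitsOfShape (Discrete J) E.unaryMonad.toFunctor :=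
    E.preservesColimitsOfShape_unaryMonad fun Z i => hE 1 Z i J
  have : PreservesColimitsOfShape (Discrete J) E.unaryMonad.forget := inferInstance
  exact inferInstanceAs (PreservesColimitsOfShape (Discrete J) E.unaryMonad.forget)

/-- The module is the reflection of the partial algebra with the letters on the left and, on the
right, the terms in letters modulo linearity. The preservation of coproducts in each variable is
carried through the iteration as the closed property `P`. -/
theorem exists_initial_module (hd : preservesCoproductsInVariables E.tensor)
    (ha : E.IsAccessibleInEachVariable) :
    ∃ (W : EModule E E.UnaryAlgebra) (ι : Letters W), preservesCoproductsInVariables W.obj ∧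
      ∀ (M : EModule E E.UnaryAlgebra) (lam : Letters M), ∃! φ : W.obj ⟶ M.obj,
        W.IsHom M φ ∧ ι.nat ≫ φ 1 = lam.nat := by
  have : HasColimitsOfSize.{0, 0} V := hasColimitsOfSizeShrink.{0, 0, w, w} V
  obtain ⟨κ, _, hκ⟩ := E.exists_preservesColimitsOfShape_tensor ha
  have := E.preservesColimitsOfShape_terms (A := E.UnaryAlgebra) hκ
  have := E.preservesColimitsOfShape_doubleTerms (A := E.UnaryAlgebra) hκ
  have : HasColimitsOfSize.{w, w} (OpFamily E.UnaryAlgebra V) := ⟨fun _ _ => hasColimitsOfShape_pi⟩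
  have : HasPushouts (OpFamily E.UnaryAlgebra V) := hasColimitsOfShape_pi
  have : HasCoequalizers (OpFamily E.UnaryAlgebra V) := hasColimitsOfShape_pi
  have hcl (K : Type w) [SmallCategory K] := isClosedUnderColimitsOfShape_preservesCoproductsInVariables
    (A := E.UnaryAlgebra) (V := V) K
  have := isClosedUnderColimitsOfShape_preservesCoproductsInVariables
    (A := E.UnaryAlgebra) (V := V) WalkingSpan
  have := isClosedUnderColimitsOfShape_preservesCoproductsInVariables
    (A := E.UnaryAlgebra) (V := V) WalkingParallelPair
  have hL := E.preservesCoproductsInVariables_letters hd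
  have hL' : preservesCoproductsInVariables (singleFamily E.letterBlock) :=
    preservesCoproductsInVariables_singleFamily fun Z J =>
      preservesColimitsOfShape_blockOp (k := fun _ : Fin 1 => 1) (sum_const_one_eq 1) _
        (fun Z i => hd 1 Z i J) _ (fun n Z i => hL n Z i J) Z 0
  have hT := E.preservesCoproductsInVariables_terms hd _ hL
  have hP := IsPushout.of_hasPushout E.letterTerm E.letterSingleAction
  have hPP : preservesCoproductsInVariables (pushout E.letterTerm E.letterSingleAction) :=
    ObjectProperty.prop_colimit _ _ (by rintro (_ | _ | _); exacts [hL', hT, hL])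
  obtain ⟨D, d, f, hD, hDP, huniv⟩ := (E.presentation E.UnaryAlgebra).exists_reflection κ
    preservesCoproductsInVariables (E.preservesCoproductsInVariables_terms hd)
    (E.preservesCoproductsInVariables_doubleTerms hd)
    (Comma.mk (R := 𝟭 _) (singleFamily E.letterFunctor) _ (pushout.inl E.letterTerm
      E.letterSingleAction)) ⟨hL, hPP⟩
  refine ⟨E.moduleOfAlgebra hD, ⟨f.left 1, fun _ =>
    (E.letters_linear_iff (E.moduleOfAlgebra hD) _).1 (linear_of_isAlgebra hP hD f)⟩, hDP,
    fun M lam => ?_⟩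
  obtain ⟨g, hg⟩ := exists_hom_of_letters hP M lam
  obtain ⟨φ, ⟨h1, h2, -⟩, h3⟩ := huniv M.obj (E.algebraMap M) (E.isAlgebra_algebraMap M) g
  have h2' := congrFun h2 1
  refine ⟨φ, ⟨(E.map_comp_algebraMap_iff d M φ).1 h1, h2'.trans hg⟩, ?_⟩
  rintro ψ ⟨hψ, hψ'⟩
  have h4 := (E.map_comp_algebraMap_iff d M ψ).2 hψ
  have h5 : f.left ≫ ψ = g.left := singleFamily_hom_ext (hψ'.trans hg.symm)
  refine h3 ψ ⟨h4, h5, ?_⟩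
  -- The universal property determines maps of partial algebras on both components; on the pushout
  -- it is enough to compare on terms, where both maps are given by the actions, and on letters.
  have key (fl : singleFamily E.letterFunctor ⟶ D)
      (fr : pushout E.letterTerm E.letterSingleAction ⟶ D)
      (gl : singleFamily E.letterFunctor ⟶ M.obj)
      (gr : pushout E.letterTerm E.letterSingleAction ⟶ M.obj) (ψ : D ⟶ M.obj)
      (h4 : (E.terms E.UnaryAlgebra).map ψ ≫ E.algebraMap M = d ≫ ψ) (h5 : fl ≫ ψ = gl)
      (h6 : (E.terms _).map fl ≫ d = pushout.inl _ _ ≫ fr)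
      (h7 : (E.terms _).map gl ≫ E.algebraMap M = pushout.inl _ _ ≫ gr)
      (h8 : fl = pushout.inr _ _ ≫ fr) (h9 : gl = pushout.inr _ _ ≫ gr) : fr ≫ ψ = gr := by
    refine hP.hom_ext ?_ ?_
    · rw [← h7, ← Category.assoc, ← h6, Category.assoc, ← h4, ← h5, Functor.map_comp,
        Category.assoc]
    · rw [← h9, ← Category.assoc, ← h8, h5]
  exact key f.left f.right g.left g.right ψ h4 h5 f.w g.w (left_eq_of_isAlgebra hP hD f)
    (left_eq_of_isAlgebra hP (E.isAlgebra_algebraMap M) g)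

end Multitensor

/-! ### Vertices of paths that are cut twice. -/

section Vertices

variable {m K N : ℕ} {k : Fin m → ℕ}

theorem cutVertex_cutVertex (hk : ∑ i, k i = K) {l : Fin K → ℕ} (hl : ∑ q, l q = N)
    {n : Fin m → ℕ} (hn : ∀ i, ∑ j, l (pos hk i j) = n i) (hN : ∑ i, n i = N) (t : Fin (m + 1)) :
    cutVertex hl (cutVertex hk t) = cutVertex hN t :=
  Fin.ext (partialSum_cutVertex hk l hn t)

theorem cutVertex_subVertex (hk : ∑ i, k i = K) {l : Fin K → ℕ} (hl : ∑ q, l q = N)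
    {n : Fin m → ℕ} (hn : ∀ i, ∑ j, l (pos hk i j) = n i) (hN : ∑ i, n i = N) (i : Fin m)
    (t : Fin (k i + 1)) :
    cutVertex hl (subVertex hk i t) =
      subVertex hN i (cutVertex (k := fun j => l (pos hk i j)) (hn i) t) := by
  apply Fin.ext
  have h1 := partialSum_subVertex hk l i t
  rw [partialSum_cutVertex hk l hn] at h1
  exact h1

theorem subVertex_subVertex (hk : ∑ i, k i = K) {l : Fin K → ℕ} (hl : ∑ q, l q = N)
    {n : Fin m → ℕ} (hn : ∀ i, ∑ j, l (pos hk i j) = n i) (hN : ∑ i, n i = N) (i : Fin m)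
    (j : Fin (k i)) (t : Fin (l (pos hk i j) + 1)) :
    subVertex hl (pos hk i j) t =
      subVertex hN i (subVertex (k := fun j => l (pos hk i j)) (hn i) j t) := by
  apply Fin.ext
  have h1 := congrArg Fin.val (cutVertex_subVertex hk hl hn hN i j.castSucc)
  change Fin.partialSum l (subVertex hk i j.castSucc) = _ at h1
  change Fin.partialSum l (subVertex hk i j.castSucc) + t = _
  rw [h1]
  exact Nat.add_assoc _ _ _

theorem subVertex_one {n : ℕ} (h : ∑ _i : Fin 1, n = n) (i : Fin 1) (t : Fin (n + 1)) :
    subVertex (k := fun _ => n) h i t = t := by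
  obtain rfl : i = 0 := Subsingleton.elim _ _
  apply Fin.ext
  have : Fin.partialSum (fun _ : Fin 1 => n) (Fin.castSucc 0) = 0 := Fin.partialSum_zero _
  simp only [subVertex, this, Nat.zero_add]

theorem subVertex_const_one {n : ℕ} (h : ∑ _i : Fin n, 1 = n) (i : Fin n) (t : Fin 2) :
    subVertex (k := fun _ => 1) h i t = if t = 0 then i.castSucc else i.succ := by
  apply Fin.ext
  have : Fin.partialSum (fun _ : Fin n => (1 : ℕ)) i.castSucc = i := partialSum_const_one i.castSucc
  fin_cases t <;> simp [subVertex, this]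

theorem cutVertex_const_one {n : ℕ} (h : ∑ _i : Fin n, 1 = n) (t : Fin (n + 1)) :
    cutVertex (k := fun _ => 1) h t = t :=
  Fin.ext (partialSum_const_one t)

end Vertices

/-! ### Composition along cut paths. -/

namespace ECategory

variable {V : Type u} [Category.{w} V] {E : Multitensor V} (X : ECategory E)

/-- The composition along a cut path of given maps into the homs of the subpaths. -/
def cutComp {m N : ℕ} {k : Fin m → ℕ} (h : ∑ i, k i = N) (x : Fin (N + 1) → X.Obj) {B : Fin m → V}
    (t : ∀ i, B i ⟶ X.Hom (x (subVertex h i 0)) (x (subVertex h i (Fin.last (k i))))) :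
    (E.tensor m).obj B ⟶ X.Hom (x 0) (x (Fin.last N)) :=
  (E.tensor m).map (Y := fun i => X.Hom (x (cutVertex h i.castSucc)) (x (cutVertex h i.succ)))
      (fun i => t i ≫ eqToHom (by rw [subVertex_last]; rfl)) ≫
    X.comp (fun t => x (cutVertex h t)) ≫ eqToHom (by rw [cutVertex_zero, cutVertex_last])

theorem map_cutComp {m N : ℕ} {k : Fin m → ℕ} (h : ∑ i, k i = N) (x : Fin (N + 1) → X.Obj)
    {B B' : Fin m → V} (s : B ⟶ B')
    (t : ∀ i, B' i ⟶ X.Hom (x (subVertex h i 0)) (x (subVertex h i (Fin.last (k i))))) :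
    (E.tensor m).map s ≫ X.cutComp h x t = X.cutComp h x fun i => s i ≫ t i := by
  refine (Category.assoc _ _ _).symm.trans (congrArg (· ≫ _) ?_)
  refine ((E.tensor m).map_comp _ _).symm.trans (congrArg _ ?_)
  funext i
  exact (Category.assoc _ _ _).symm

theorem cutComp_heq {m N : ℕ} {k : Fin m → ℕ} (h : ∑ i, k i = N) (x : Fin (N + 1) → X.Obj)
    {B : Fin m → V}
    (t : ∀ i, B i ⟶ X.Hom (x (subVertex h i 0)) (x (subVertex h i (Fin.last (k i)))))
    {B' C' : Fin m → V} (t' : ∀ i, B' i ⟶ C' i) (hB : ∀ i, B i = B' i) (ht : ∀ i, t i ≍ t' i)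
    {y : Fin (m + 1) → X.Obj} (hy : ∀ t, x (cutVertex h t) = y t)
    {D : V} (f : (E.tensor m).obj C' ⟶ D) (hf : X.comp y ≍ f)
    (hC : ∀ i, X.Hom (y i.castSucc) (y i.succ) = C' i) (hD : X.Hom (y 0) (y (Fin.last m)) = D) :
    X.cutComp h x t ≍ (E.tensor m).map t' ≫ f := by
  obtain rfl : (fun t => x (cutVertex h t)) = y := funext hy
  refine heq_comp (congrArg _ (funext hB)) (congrArg _ (funext hC)) ?_ (heq_tensor_map hB hC
    fun i => (comp_eqToHom_heq _ _).trans (ht i)) ((comp_eqToHom_heq _ _).trans hf)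
  rw [← hD]
  beta_reduce
  rw [cutVertex_zero, cutVertex_last]

theorem subst_comp' {m N : ℕ} {k : Fin m → ℕ} (h : ∑ i, k i = N) (x : Fin (N + 1) → X.Obj) :
    E.subst h (fun q => X.Hom (x q.castSucc) (x q.succ)) ≫ X.comp x =
      X.cutComp h x fun i => X.comp fun t => x (subVertex h i t) :=
  X.subst_comp h x

/-- The composition along the trivial cut. -/
theorem cutComp_one {N : ℕ} (h : ∑ _i : Fin 1, N = N) (x : Fin (N + 1) → X.Obj) {B : Fin 1 → V}
    (t : ∀ i, B i ⟶ X.Hom (x (subVertex (k := fun _ => N) h i 0))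
      (x (subVertex (k := fun _ => N) h i (Fin.last N)))) {B' : V}
    (t' : B' ⟶ X.Hom (x 0) (x (Fin.last N))) (hB : ∀ i, B i = B') (ht : ∀ i, t i ≍ t') :
    X.cutComp (k := fun _ => N) h x t ≍
      (E.tensor 1).map (X := fun _ => B') (Y := fun _ => X.Hom (x 0) (x (Fin.last N)))
        (fun _ => t') ≫ X.unaryComp (x 0) (x (Fin.last N)) := by
  have hy : ∀ t : Fin 2, x (cutVertex (k := fun _ => N) h t) = ![x 0, x (Fin.last N)] t := by
    intro t
    fin_cases t
    · exact congrArg x (cutVertex_zero h)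
    · exact congrArg x (cutVertex_last (k := fun _ => N) h)
  exact X.cutComp_heq h x t _ hB ht hy _ (X.heq_unaryComp _ _)
    (fun i => by rw [Subsingleton.elim i 0]; rfl) rfl

theorem unit_cutComp {N : ℕ} (h : ∑ _i : Fin 1, N = N) (x : Fin (N + 1) → X.Obj) {B : Fin 1 → V}
    (t : ∀ i, B i ⟶ X.Hom (x (subVertex (k := fun _ => N) h i 0))
      (x (subVertex (k := fun _ => N) h i (Fin.last N)))) {B' : V}
    (t' : B' ⟶ X.Hom (x 0) (x (Fin.last N))) (hB : ∀ i, B i = B') (ht : ∀ i, t i ≍ t') :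
    E.unit B' ≫ eqToHom (by rw [funext hB]) ≫ X.cutComp (k := fun _ => N) h x t = t' := by
  have h1 : eqToHom (by rw [funext hB]) ≫ X.cutComp (k := fun _ => N) h x t =
      (E.tensor 1).map (X := fun _ => B') (Y := fun _ => X.Hom (x 0) (x (Fin.last N)))
        (fun _ => t') ≫ X.unaryComp (x 0) (x (Fin.last N)) :=
    eq_of_heq ((eqToHom_comp_heq _ _).trans (X.cutComp_one h x t t' hB ht))
  rw [h1, ← Category.assoc, E.unit_naturality, Category.assoc, X.unit_unaryComp, Category.comp_id]

/-- Associativity of the composition, preceded by arbitrary maps into the homs of the subpaths. The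
two sides live along two descriptions of the same doubly cut path, whence the heterogeneous
equality. -/
theorem subst_cutComp {m K N : ℕ} {k : Fin m → ℕ} (hk : ∑ i, k i = K) {l : Fin K → ℕ}
    (hl : ∑ q, l q = N) {n : Fin m → ℕ} (hn : ∀ i, ∑ j, l (pos hk i j) = n i)
    (hN : ∑ i, n i = N) (x : Fin (N + 1) → X.Obj) {B : Fin K → V}
    (t : ∀ q, B q ⟶ X.Hom (x (subVertex hl q 0)) (x (subVertex hl q (Fin.last (l q)))))
    {B' : ∀ i, Fin (k i) → V}
    (t' : ∀ i j, B' i j ⟶ X.Hom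
      (x (subVertex hN i (subVertex (k := fun j => l (pos hk i j)) (hn i) j 0)))
      (x (subVertex hN i (subVertex (k := fun j => l (pos hk i j)) (hn i) j
        (Fin.last (l (pos hk i j)))))))
    (hB : ∀ i j, B (pos hk i j) = B' i j) (ht : ∀ i j, t (pos hk i j) ≍ t' i j) :
    E.subst hk B ≫ X.cutComp hl x t ≍
      X.cutComp hN x fun i => X.cutComp (k := fun j => l (pos hk i j)) (hn i)
        (fun s => x (subVertex hN i s)) (t' i) := by
  let T : Fin K → V := fun q => X.Hom (x (cutVertex hl q.castSucc)) (x (cutVertex hl q.succ))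
  let s : B ⟶ T := fun q => t q ≫ eqToHom (by rw [subVertex_last]; rfl)
  have h1 := E.subst_naturality hk s
  have h2 := X.subst_comp' hk fun t => x (cutVertex hl t)
  have h3 : E.subst hk B ≫ X.cutComp hl x t ≍ E.subst hk B ≫ (E.tensor K).map s ≫
      X.comp (fun t => x (cutVertex hl t)) :=
    heq_comp rfl rfl (by rw [cutVertex_zero, cutVertex_last]) HEq.rfl
      (heq_comp rfl rfl (by rw [cutVertex_zero, cutVertex_last]) HEq.rfl (comp_eqToHom_heq _ _))
  refine h3.trans ?_
  have h4 : E.subst hk B ≫ (E.tensor K).map s ≫ X.comp (fun t => x (cutVertex hl t)) =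
      X.cutComp hk (fun t => x (cutVertex hl t)) fun i => (E.tensor (k i)).map (X := fun j =>
        B (pos hk i j)) (Y := fun j => T (pos hk i j)) (fun j => s (pos hk i j)) ≫
          X.comp fun t => x (cutVertex hl (subVertex hk i t)) := by
    rw [← Category.assoc, ← h1, Category.assoc]
    refine (congrArg (_ ≫ ·) h2).trans ?_
    exact X.map_cutComp hk (fun t => x (cutVertex hl t)) _ _
  refine (heq_of_eq h4).trans ?_
  have hv := cutVertex_subVertex hk hl hn hN
  have hc := cutVertex_cutVertex hk hl hn hN
  have hB' (i : Fin m) : (E.tensor (k i)).obj (fun j => B (pos hk i j)) =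
      (E.tensor (k i)).obj (B' i) := congrArg _ (funext (hB i))
  have hs (i : Fin m) (a b : Fin (k i + 1)) :
      X.Hom (x (cutVertex hl (subVertex hk i a))) (x (cutVertex hl (subVertex hk i b))) =
      X.Hom (x (subVertex hN i (cutVertex (k := fun j => l (pos hk i j)) (hn i) a)))
        (x (subVertex hN i (cutVertex (k := fun j => l (pos hk i j)) (hn i) b))) := by
    rw [hv, hv]
  refine heq_comp (congrArg _ (funext hB')) (congrArg _ (funext fun i => ?_)) ?_
    (heq_tensor_map hB' (fun i => ?_) fun i => ?_) ?_
  · beta_reduce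
    rw [hc, hc]
  · beta_reduce
    rw [cutVertex_zero, cutVertex_last]
  · beta_reduce
    rw [hc, hc]
  · refine (comp_eqToHom_heq _ _).trans ?_
    refine HEq.trans ?_ (comp_eqToHom_heq _ _).symm
    beta_reduce
    unfold cutComp
    refine heq_comp (hB' i) (congrArg _ (funext fun j : Fin (k i) => hs i j.castSucc j.succ)) ?_
      (heq_tensor_map (hB i) (fun j => hs i j.castSucc j.succ) fun j => ?_) ?_
    · rw [hs, cutVertex_zero, cutVertex_last]
    · exact ((comp_eqToHom_heq _ _).trans (ht i j)).trans (comp_eqToHom_heq _ _).symm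
    · exact (X.heq_path fun t => congrArg x (hv i t)).trans (comp_eqToHom_heq _ _).symm
  · refine (comp_eqToHom_heq _ _).trans (HEq.trans ?_ (comp_eqToHom_heq _ _).symm)
    exact X.heq_path fun t => congrArg x (hc t)

end ECategory

/-! ### The path module of an enriched category. -/

namespace ECategory

variable {V : Type u} [Category.{w} V] {E : Multitensor V} (X : ECategory E)
  {A : Type u₁} [Category.{w} A] (G : X.Obj → X.Obj → A)

/-- The paths in the objects of `X` together with maps of a sequence into the entries of `G`. -/
abbrev PathIn {n : ℕ} (Z : Fin n → A) : Type w :=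
  Σ x : Fin (n + 1) → X.Obj, ∀ i, Z i ⟶ G (x i.castSucc) (x i.succ)

variable {X G} in
/-- The restriction of a family of maps along a path to a subpath. -/
def subMaps {m N : ℕ} {k : Fin m → ℕ} (h : ∑ i, k i = N) {Z : Fin N → A} {x : Fin (N + 1) → X.Obj}
    (f : ∀ i, Z i ⟶ G (x i.castSucc) (x i.succ)) (i : Fin m) (j : Fin (k i)) :
    Z (pos h i j) ⟶ G (x (subVertex h i j.castSucc)) (x (subVertex h i j.succ)) :=
  f (pos h i j)

variable {X G} in
theorem heq_pathMap {n : ℕ} {Z : Fin n → A} {x : Fin (n + 1) → X.Obj}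
    (f : ∀ i, Z i ⟶ G (x i.castSucc) (x i.succ)) {i j : Fin n} (h : i = j) : f i ≍ f j := by
  subst h
  rfl

variable [HasLimitsOfSize.{w, w} V]

/-- The functors which send a sequence to the product of the homs of `X` between the endpoints of
the paths it maps to. -/
noncomputable def pathFamily : OpFamily A V := fun n =>
  { obj := fun Z => ∏ᶜ fun p : X.PathIn G Z => X.Hom (p.1 0) (p.1 (Fin.last n))
    map := fun {Z Z'} φ => Pi.lift fun p : X.PathIn G Z' =>
      Pi.π (fun p : X.PathIn G Z => X.Hom (p.1 0) (p.1 (Fin.last n))) ⟨p.1, fun i => φ i ≫ p.2 i⟩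
    map_id := fun Z => Pi.hom_ext _ _ fun p => by
      rw [Pi.lift_π, Category.id_comp]
      congr 2
      funext i
      exact Category.id_comp _
    map_comp := fun {Z Z' Z''} φ ψ => Pi.hom_ext _ _ fun p => by
      rw [Pi.lift_π, Category.assoc, Pi.lift_π, Pi.lift_π]
      congr 2
      funext i
      exact Category.assoc _ _ _ }

/-- The projections of the path family. -/
noncomputable def pathProj {n : ℕ} (Z : Fin n → A) (x : Fin (n + 1) → X.Obj)
    (f : ∀ i, Z i ⟶ G (x i.castSucc) (x i.succ)) :
    (X.pathFamily G n).obj Z ⟶ X.Hom (x 0) (x (Fin.last n)) :=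
  Pi.π (fun p : X.PathIn G Z => X.Hom (p.1 0) (p.1 (Fin.last n))) ⟨x, f⟩

variable {G} in
/-- A map into a value of the path family. -/
noncomputable def pathLift {n : ℕ} {Z : Fin n → A} {B : V} (t : ∀ (x : Fin (n + 1) → X.Obj)
    (_ : ∀ i, Z i ⟶ G (x i.castSucc) (x i.succ)), B ⟶ X.Hom (x 0) (x (Fin.last n))) :
    B ⟶ (X.pathFamily G n).obj Z :=
  Pi.lift fun p : X.PathIn G Z => t p.1 p.2

variable {G}

theorem pathLift_proj {n : ℕ} {Z : Fin n → A} {B : V} (t : ∀ (x : Fin (n + 1) → X.Obj)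
    (_ : ∀ i, Z i ⟶ G (x i.castSucc) (x i.succ)), B ⟶ X.Hom (x 0) (x (Fin.last n)))
    (x : Fin (n + 1) → X.Obj) (f : ∀ i, Z i ⟶ G (x i.castSucc) (x i.succ)) :
    X.pathLift t ≫ X.pathProj G Z x f = t x f :=
  Pi.lift_π _ _

variable {X} in
theorem path_hom_ext {n : ℕ} {Z : Fin n → A} {B : V} {s t : B ⟶ (X.pathFamily G n).obj Z}
    (h : ∀ x f, s ≫ X.pathProj G Z x f = t ≫ X.pathProj G Z x f) : s = t :=
  Pi.hom_ext _ _ fun p => h p.1 p.2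

theorem map_pathProj {n : ℕ} {Z Z' : Fin n → A} (φ : Z ⟶ Z') (x : Fin (n + 1) → X.Obj)
    (f : ∀ i, Z' i ⟶ G (x i.castSucc) (x i.succ)) :
    (X.pathFamily G n).map φ ≫ X.pathProj G Z' x f = X.pathProj G Z x fun i => φ i ≫ f i :=
  Pi.lift_π _ _

theorem pathProj_heq {n n' : ℕ} (hn : n = n') {Z : Fin n → A} {Z' : Fin n' → A}
    (hZ : ∀ i, Z i = Z' (Fin.cast hn i)) {x : Fin (n + 1) → X.Obj} {x' : Fin (n' + 1) → X.Obj}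
    (hx : ∀ t, x t = x' (Fin.cast (congrArg (· + 1) hn) t))
    {f : ∀ i, Z i ⟶ G (x i.castSucc) (x i.succ)} {f' : ∀ i, Z' i ⟶ G (x' i.castSucc) (x' i.succ)}
    (hf : ∀ i, f i ≍ f' (Fin.cast hn i)) : X.pathProj G Z x f ≍ X.pathProj G Z' x' f' := by
  subst hn
  obtain rfl : Z = Z' := funext hZ
  obtain rfl : x = x' := funext hx
  obtain rfl : f = f' := funext fun i => eq_of_heq (hf i)
  rfl

variable (G)

/-- The action on the path family. -/
noncomputable def pathAct {m N : ℕ} {k : Fin m → ℕ} (h : ∑ i, k i = N) (Z : Fin N → A) :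
    ((E.tensor m).obj fun i => (X.pathFamily G (k i)).obj fun j => Z (pos h i j)) ⟶
      (X.pathFamily G N).obj Z :=
  X.pathLift fun x f => X.cutComp h x fun i =>
    X.pathProj G (fun j => Z (pos h i j)) (fun t => x (subVertex h i t)) (subMaps h f i)

theorem pathAct_proj {m N : ℕ} {k : Fin m → ℕ} (h : ∑ i, k i = N) (Z : Fin N → A)
    (x : Fin (N + 1) → X.Obj) (f : ∀ i, Z i ⟶ G (x i.castSucc) (x i.succ)) :
    X.pathAct G h Z ≫ X.pathProj G Z x f = X.cutComp h x fun i =>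
      X.pathProj G (fun j => Z (pos h i j)) (fun t => x (subVertex h i t)) (subMaps h f i) :=
  X.pathLift_proj _ x f

theorem pathAct_naturality {m N : ℕ} {k : Fin m → ℕ} (h : ∑ i, k i = N) {Z Z' : Fin N → A}
    (φ : Z ⟶ Z') :
    (E.tensor m).map (X := fun i => (X.pathFamily G (k i)).obj fun j => Z (pos h i j))
      (Y := fun i => (X.pathFamily G (k i)).obj fun j => Z' (pos h i j))
      (fun i => (X.pathFamily G (k i)).map (X := fun j => Z (pos h i j))
        (Y := fun j => Z' (pos h i j)) fun j => φ (pos h i j)) ≫ X.pathAct G h Z' =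
    X.pathAct G h Z ≫ (X.pathFamily G N).map φ := by
  refine path_hom_ext fun x f => ?_
  rw [Category.assoc, Category.assoc, pathAct_proj, map_pathProj, pathAct_proj, map_cutComp]
  refine congrArg (X.cutComp h x) (funext fun i => ?_)
  exact X.map_pathProj _ _ _

/-- The path family is a module. -/
noncomputable def pathModule : EModule E A where
  obj := X.pathFamily G
  act h :=
    { app := X.pathAct G h
      naturality := fun _ _ φ => X.pathAct_naturality G h φ }
  unit_act {N} h := by
    ext Z
    refine path_hom_ext fun x f => ?_
    refine (Category.assoc _ _ _).trans ((congrArg (_ ≫ ·) (X.pathAct_proj G _ _ x f)).trans ?_)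
    refine (Category.assoc _ _ _).trans (Eq.trans ?_ (Category.id_comp _).symm)
    refine X.unit_cutComp h x _ (X.pathProj G Z x f) (fun i => ?_) fun i => ?_
    · exact congrArg (X.pathFamily G N).obj (funext fun j => congrArg Z (pos_one h i j))
    · exact X.pathProj_heq rfl (fun j => congrArg Z (pos_one h i j))
        (fun t => congrArg x (subVertex_one h i t)) fun j => heq_pathMap f (pos_one h i j)
  -- After projection to a path, the claim is the associativity of the composition of `X` along that
  -- path.
  subst_act {m K N k} hk {l} hl {n} hn hN := by
    ext Z
    refine path_hom_ext fun x f => ?_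
    refine (Category.assoc _ _ _).trans ((congrArg (_ ≫ ·) (X.pathAct_proj G _ _ x f)).trans ?_)
    refine Eq.trans ?_ (Category.assoc _ _ _).symm
    refine Eq.trans ?_ (congrArg (_ ≫ ·) (X.pathAct_proj G _ _ x f).symm)
    refine Eq.trans ?_ (Category.assoc _ _ _).symm
    refine Eq.trans ?_ (congrArg (_ ≫ ·) (X.map_cutComp hN x _ _).symm)
    apply eq_of_heq
    refine HEq.trans ?_ (eqToHom_comp_heq _ _).symm
    refine HEq.trans ?_ (heq_of_eq (congrArg (X.cutComp hN x) (funext fun i =>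
      X.pathAct_proj G (hn i) (fun q => Z (pos hN i q)) (fun t => x (subVertex hN i t))
        (subMaps hN f i))).symm)
    refine X.subst_cutComp hk hl hn hN x _ (fun i j => X.pathProj G
      (fun p => Z (pos hN i (pos (k := fun j => l (pos hk i j)) (hn i) j p)))
      (fun t => x (subVertex hN i (subVertex (k := fun j => l (pos hk i j)) (hn i) j t)))
      (subMaps (Z := fun q => Z (pos hN i q)) (x := fun t => x (subVertex hN i t)) (hn i)
        (subMaps hN f i) j)) (fun i j => ?_)
      fun i j => ?_
    · exact congrArg (X.pathFamily G (l (pos hk i j))).obj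
        (funext fun p => congrArg Z (pos_pos hk hl hn hN i j p))
    · refine X.pathProj_heq (n := l (pos hk i j)) rfl
        (fun p => congrArg Z (pos_pos hk hl hn hN i j p))
        (fun t => congrArg x (subVertex_subVertex hk hl hn hN i j t))
        fun p => heq_pathMap f (pos_pos hk hl hn hN i j p)

end ECategory

open Multitensor

variable {V : Type u} [Category.{w} V] {E : Multitensor V}

/-- The initial module with letters. -/
def Multitensor.Letters.IsInitial {W : EModule E E.UnaryAlgebra} (ι : Letters W) : Prop :=
  ∀ (M : EModule E E.UnaryAlgebra) (lam : Letters M), ∃! φ : W.obj ⟶ M.obj,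
    W.IsHom M φ ∧ ι.nat ≫ φ 1 = lam.nat

/-! ### Interpretations of the initial module along the paths of an enriched category. -/

namespace ECategory

/-- The map of a letter into a hom. -/
def letterMap (X : ECategory E) {G : X.Obj → X.Obj → E.UnaryAlgebra}
    (g : ∀ a b, G a b ⟶ X.homAlgebra a b) {Y : E.UnaryAlgebra} (x : Fin 2 → X.Obj)
    (f : ∀ i : Fin 1, Y ⟶ G (x i.castSucc) (x i.succ)) : Y.A ⟶ X.Hom (x 0) (x (Fin.last 1)) :=
  (f 0 ≫ g _ _).f

/-- A natural interpretation of the operations of a module with letters along the paths of an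
`E`-category. -/
structure PathMaps {W : EModule E E.UnaryAlgebra} (ι : Letters W) (X : ECategory E)
    {G : X.Obj → X.Obj → E.UnaryAlgebra} (g : ∀ a b, G a b ⟶ X.homAlgebra a b) where
  /-- the maps -/
  app {n : ℕ} {Z : Fin n → E.UnaryAlgebra} (x : Fin (n + 1) → X.Obj)
    (f : ∀ i, Z i ⟶ G (x i.castSucc) (x i.succ)) :
    (W.obj n).obj Z ⟶ X.Hom (x 0) (x (Fin.last n))
  naturality {n : ℕ} {Z Z' : Fin n → E.UnaryAlgebra} (φ : Z ⟶ Z') (x : Fin (n + 1) → X.Obj)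
    (f : ∀ i, Z' i ⟶ G (x i.castSucc) (x i.succ)) :
    (W.obj n).map φ ≫ app x f = app x fun i => φ i ≫ f i
  act {m N : ℕ} {k : Fin m → ℕ} (h : ∑ i, k i = N) {Z : Fin N → E.UnaryAlgebra}
    (x : Fin (N + 1) → X.Obj) (f : ∀ i, Z i ⟶ G (x i.castSucc) (x i.succ)) :
    (W.act h).app Z ≫ app x f = X.cutComp h x fun i =>
      app (Z := fun j => Z (pos h i j)) (fun t => x (subVertex h i t)) (subMaps h f i)
  letter {Y : E.UnaryAlgebra} (x : Fin 2 → X.Obj)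
    (f : ∀ i : Fin 1, Y ⟶ G (x i.castSucc) (x i.succ)) :
    ι.nat.app (fun _ => Y) ≫ app x f = X.letterMap g x f

namespace PathMaps

variable {W : EModule E E.UnaryAlgebra} {ι : Letters W} {X : ECategory E}
  {G : X.Obj → X.Obj → E.UnaryAlgebra} {g : ∀ a b, G a b ⟶ X.homAlgebra a b}

variable [HasLimitsOfSize.{w, w} V]

variable (g) in
/-- The letters of the path module, as a natural transformation. -/
noncomputable def pathLetterNat : E.letterFunctor ⟶ X.pathFamily G 1 where
  app Z := X.pathLift fun x f =>
    X.letterMap (Y := Z 0) g x fun i => eqToHom (by rw [Subsingleton.elim i 0]) ≫ f i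
  naturality Z Z' φ := path_hom_ext fun x f => by
    refine (Category.assoc _ _ _).trans (Eq.trans ?_ (Category.assoc _ _ _).symm)
    refine (congrArg (_ ≫ ·) (X.pathLift_proj _ x f)).trans ?_
    refine Eq.trans ?_ (congrArg (_ ≫ ·) (X.map_pathProj φ x f).symm)
    refine Eq.trans ?_ (X.pathLift_proj _ x _).symm
    change (φ 0).f ≫ ((𝟙 _ ≫ f 0) ≫ g _ _).f = ((𝟙 _ ≫ φ 0 ≫ f 0) ≫ g _ _).f
    rw [Category.id_comp, Category.id_comp, Category.assoc]
    rfl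

theorem pathLetterNat_proj {Y : E.UnaryAlgebra} (x : Fin 2 → X.Obj)
    (f : ∀ i : Fin 1, Y ⟶ G (x i.castSucc) (x i.succ)) :
    (pathLetterNat g).app (fun _ => Y) ≫ X.pathProj G (fun _ => Y) x f = X.letterMap g x f := by
  have h1 := X.pathLift_proj (G := G) (Z := fun _ : Fin 1 => Y)
    (fun x f => X.letterMap g x fun i => 𝟙 Y ≫ f i) x f
  refine Eq.trans h1 ?_
  exact congrArg (X.letterMap g x) (funext fun i => Category.id_comp _)

variable (g) in
/-- The letters of the path module. -/
noncomputable def pathLetters : Letters (X.pathModule G) where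
  nat := pathLetterNat g
  linear h Y := by
    refine path_hom_ext fun x f => ?_
    refine (Category.assoc _ _ _).trans (Eq.trans ?_ (Category.assoc _ _ _).symm)
    refine (congrArg (_ ≫ ·) (pathLetterNat_proj x f)).trans ?_
    refine Eq.trans ?_ (congrArg (_ ≫ ·) (X.pathAct_proj G h (fun _ => Y) x f).symm)
    refine Eq.trans ?_ (X.map_cutComp (k := fun _ => 1) h x _ _).symm
    -- The letters are linear because the maps along the path are morphisms of algebras.
    refine (f 0 ≫ g _ _).h.symm.trans ?_
    apply eq_of_heq
    refine HEq.symm (X.cutComp_one (N := 1) h x _ _ (fun _ => rfl) fun i => ?_)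
    refine (heq_of_eq (pathLetterNat_proj (fun t => x (subVertex h i t)) _)).trans ?_
    have hx (i : Fin 1) : (fun t => x (subVertex (k := fun _ => 1) h i t)) = x :=
      funext fun t => congrArg x (subVertex_one h i t)
    have key : ∀ (x' : Fin 2 → X.Obj) (f' : ∀ i : Fin 1, Y ⟶ G (x' i.castSucc) (x' i.succ)),
        x' = x → (∀ i, f' i ≍ f i) → X.letterMap g x' f' ≍ X.letterMap g x f := by
      rintro x' f' rfl hf
      obtain rfl : f' = f := funext fun i => eq_of_heq (hf i)
      rfl
    exact key _ _ (hx i) fun j => heq_pathMap f (pos_one h i j)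

/-- Interpretations are morphisms to the path module. -/
noncomputable def toFamily (P : PathMaps ι X g) : W.obj ⟶ (X.pathModule G).obj := fun _ =>
  { app := fun Z => X.pathLift fun x f => P.app x f
    naturality := fun Z Z' φ => path_hom_ext fun x f => by
      refine (Category.assoc _ _ _).trans (Eq.trans ?_ (Category.assoc _ _ _).symm)
      refine (congrArg (_ ≫ ·) (X.pathLift_proj _ x f)).trans ?_
      refine Eq.trans ?_ (congrArg (_ ≫ ·) (X.map_pathProj φ x f).symm)
      exact (P.naturality φ x f).trans (X.pathLift_proj _ x _).symm }

theorem toFamily_proj (P : PathMaps ι X g) {n : ℕ} {Z : Fin n → E.UnaryAlgebra}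
    (x : Fin (n + 1) → X.Obj) (f : ∀ i, Z i ⟶ G (x i.castSucc) (x i.succ)) :
    (P.toFamily n).app Z ≫ X.pathProj G Z x f = P.app x f :=
  X.pathLift_proj _ x f

/-- The action on the path module was defined by composition along the subpaths, so this is the
`act` axiom of the interpretation seen in each projection. -/
theorem isHom_toFamily (P : PathMaps ι X g) : W.IsHom (X.pathModule G) P.toFamily := by
  intro m N k h
  ext Z
  refine path_hom_ext fun x f => ?_
  refine (Category.assoc _ _ _).trans (Eq.trans ?_ (Category.assoc _ _ _).symm)
  refine (congrArg (_ ≫ ·) (X.pathAct_proj G h Z x f)).trans ?_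
  refine Eq.trans ?_ (congrArg (_ ≫ ·) (P.toFamily_proj x f).symm)
  refine (X.map_cutComp h x _ _).trans (Eq.trans ?_ (P.act h x f).symm)
  exact congrArg (X.cutComp h x) (funext fun i => P.toFamily_proj _ _)

theorem letter_toFamily (P : PathMaps ι X g) : ι.nat ≫ P.toFamily 1 = (pathLetters g).nat := by
  ext Z
  obtain ⟨Y, rfl⟩ : ∃ Y, Z = fun _ => Y := ⟨Z 0, funext fun i => by rw [Subsingleton.elim i 0]⟩
  refine path_hom_ext fun x f => ?_
  refine (Category.assoc _ _ _).trans ((congrArg (_ ≫ ·) (P.toFamily_proj x f)).trans ?_)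
  exact (P.letter x f).trans (pathLetterNat_proj x f).symm

/-- Interpretations of the initial module are unique. -/
theorem eq_of_isInitial (hι : ι.IsInitial) (P Q : PathMaps ι X g) {n : ℕ}
    {Z : Fin n → E.UnaryAlgebra} (x : Fin (n + 1) → X.Obj)
    (f : ∀ i, Z i ⟶ G (x i.castSucc) (x i.succ)) : P.app x f = Q.app x f := by
  have h := (hι (X.pathModule G) (pathLetters g)).unique ⟨P.isHom_toFamily, P.letter_toFamily⟩
    ⟨Q.isHom_toFamily, Q.letter_toFamily⟩
  rw [← P.toFamily_proj, ← Q.toFamily_proj, h]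

variable (X g) in
/-- The initial module has interpretations. -/
theorem nonempty_of_isInitial (hι : ι.IsInitial) : Nonempty (PathMaps ι X g) := by
  obtain ⟨φ, ⟨h1, h2⟩, -⟩ := hι (X.pathModule G) (pathLetters g)
  refine ⟨
    { app := fun {n Z} x f => (φ n).app Z ≫ X.pathProj G Z x f
      naturality := fun {n Z Z'} ψ x f => ?_
      act := fun {m N k} h {Z} x f => ?_
      letter := fun {Y} x f => ?_ }⟩
  · refine (Category.assoc _ _ _).symm.trans ((congrArg (· ≫ _) ((φ n).naturality ψ)).trans ?_)
    exact (Category.assoc _ _ _).trans (congrArg (_ ≫ ·) (X.map_pathProj ψ x f))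
  · have h3 := congrArg (fun α => α.app Z) (h1 h)
    refine (Category.assoc _ _ _).symm.trans ((congrArg (· ≫ _) h3.symm).trans ?_)
    refine (Category.assoc _ _ _).trans ((congrArg (_ ≫ ·) (X.pathAct_proj G h Z x f)).trans ?_)
    exact X.map_cutComp h x _ _
  · have h3 := congrArg (fun α => α.app fun _ => Y) h2
    refine (Category.assoc _ _ _).symm.trans ((congrArg (· ≫ _) h3).trans ?_)
    exact pathLetterNat_proj x f

end PathMaps

end ECategory

open Multitensor

variable {V : Type u} [Category.{w} V] {E : Multitensor V}

/-! ### Naturality and linearity of interpretations. -/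

namespace ECategory

theorem eqToHom_map {X Y : EGraph V} (F : EGraph.Map X Y) {a a' b b' : X.Obj} (ha : a = a')
    (hb : b = b') (h : X.Hom a b = X.Hom a' b') (h' : Y.Hom (F.obj a) (F.obj b) =
      Y.Hom (F.obj a') (F.obj b')) : eqToHom h ≫ F.map a' b' = F.map a b ≫ eqToHom h' := by
  subst ha hb
  simp

theorem cutComp_map {X Y : ECategory E} (F : EFunctor X Y) {m N : ℕ} {k : Fin m → ℕ}
    (h : ∑ i, k i = N) (x : Fin (N + 1) → X.Obj) {B : Fin m → V}
    (t : ∀ i, B i ⟶ X.Hom (x (subVertex h i 0)) (x (subVertex h i (Fin.last (k i))))) :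
    X.cutComp h x t ≫ F.map (x 0) (x (Fin.last N)) =
      Y.cutComp h (fun t => F.obj (x t)) fun i => t i ≫ F.map _ _ := by
  have h1 := F.comp_map fun t => x (cutVertex h t)
  have h2 := eqToHom_map F.toMap (congrArg x (cutVertex_zero h)) (congrArg x (cutVertex_last h))
    (by rw [cutVertex_zero, cutVertex_last]) (by rw [cutVertex_zero, cutVertex_last])
  unfold cutComp
  rw [Category.assoc, Category.assoc, h2, ← Category.assoc (X.comp _), h1, ← Category.assoc,
    ← Category.assoc]
  refine Eq.trans (congrArg (· ≫ _) ?_) (Category.assoc _ _ _)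
  refine congrArg (· ≫ Y.comp fun t => F.obj (x (cutVertex h t))) ?_
  refine ((E.tensor m).map_comp _ _).symm.trans (congrArg _ (funext fun i => ?_))
  have h3 := eqToHom_map F.toMap (congrArg x (show subVertex h i 0 = cutVertex h i.castSucc from rfl))
    (congrArg x (subVertex_last h i)) (by rw [subVertex_last]; rfl) (by rw [subVertex_last]; rfl)
  refine (Category.assoc _ _ _).trans (Eq.trans ?_ (Category.assoc _ _ _).symm)
  exact congrArg (t i ≫ ·) h3

/-- The restriction of an `E`-category along a function on objects. -/
def reindex (Y : ECategory E) {S : Type w} (o : S → Y.Obj) : ECategory E where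
  Obj := S
  Hom a b := Y.Hom (o a) (o b)
  comp x := Y.comp fun t => o (x t)
  unit_comp x := Y.unit_comp fun t => o (x t)
  subst_comp h x := Y.subst_comp h fun t => o (x t)

theorem unaryComp_reindex (Y : ECategory E) {S : Type w} (o : S → Y.Obj) (a b : S) :
    (Y.reindex o).unaryComp a b = Y.unaryComp (o a) (o b) := by
  apply eq_of_heq
  refine ((Y.reindex o).heq_unaryComp a b).symm.trans (HEq.trans ?_ (Y.heq_unaryComp _ _))
  exact Y.heq_path fun t => by fin_cases t <;> rfl

/-- The hom map of an `E`-functor as a morphism of algebras. -/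
def EFunctor.homMap {X Y : ECategory E} (F : EFunctor X Y) (a b : X.Obj) :
    X.homAlgebra a b ⟶ Y.homAlgebra (F.obj a) (F.obj b) where
  f := F.map a b
  h := unaryComp_map F a b

variable {W : EModule E E.UnaryAlgebra} {ι : Letters W} (hι : ι.IsInitial)
  [HasLimitsOfSize.{w, w} V]

/-- The interpretation of the initial module in the homs of an `E`-category. -/
noncomputable def pathMaps (X : ECategory E) :
    PathMaps ι X (fun a b => 𝟙 (X.homAlgebra a b)) :=
  (PathMaps.nonempty_of_isInitial X _ hι).some

/-- The interpretation of the initial module in the homs of an `E`-category along a path. -/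
noncomputable def pathMap (X : ECategory E) {n : ℕ} {Z : Fin n → E.UnaryAlgebra}
    (x : Fin (n + 1) → X.Obj) (f : ∀ i, Z i ⟶ X.homAlgebra (x i.castSucc) (x i.succ)) :
    (W.obj n).obj Z ⟶ X.Hom (x 0) (x (Fin.last n)) :=
  (pathMaps hι X).app x f

variable (X : ECategory E)

theorem map_pathMap {n : ℕ} {Z Z' : Fin n → E.UnaryAlgebra} (φ : Z ⟶ Z')
    (x : Fin (n + 1) → X.Obj) (f : ∀ i, Z' i ⟶ X.homAlgebra (x i.castSucc) (x i.succ)) :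
    (W.obj n).map φ ≫ X.pathMap hι x f = X.pathMap hι x fun i => φ i ≫ f i :=
  (pathMaps hι X).naturality φ x f

theorem act_pathMap {m N : ℕ} {k : Fin m → ℕ} (h : ∑ i, k i = N) {Z : Fin N → E.UnaryAlgebra}
    (x : Fin (N + 1) → X.Obj) (f : ∀ i, Z i ⟶ X.homAlgebra (x i.castSucc) (x i.succ)) :
    (W.act h).app Z ≫ X.pathMap hι x f = X.cutComp h x fun i =>
      X.pathMap hι (Z := fun j => Z (pos h i j)) (fun t => x (subVertex h i t))
        (subMaps (G := X.homAlgebra) h f i) :=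
  (pathMaps hι X).act h x f

theorem letter_pathMap {Y : E.UnaryAlgebra} (x : Fin 2 → X.Obj)
    (f : ∀ i : Fin 1, Y ⟶ X.homAlgebra (x i.castSucc) (x i.succ)) :
    ι.nat.app (fun _ => Y) ≫ X.pathMap hι x f = (f 0).f :=
  ((pathMaps hι X).letter x f).trans (congrArg Monad.Algebra.Hom.f (Category.comp_id (f 0)))

variable {X}

/-- Interpretations are determined by their values on letters. -/
theorem PathMaps.app_eq {G : X.Obj → X.Obj → E.UnaryAlgebra}
    {g : ∀ a b, G a b ⟶ X.homAlgebra a b} (P : PathMaps ι X g) {n : ℕ}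
    {Z : Fin n → E.UnaryAlgebra} (x : Fin (n + 1) → X.Obj)
    (f : ∀ i, Z i ⟶ G (x i.castSucc) (x i.succ)) :
    P.app x f = X.pathMap hι x fun i => f i ≫ g _ _ := by
  let Q : PathMaps ι X g :=
    { app := fun x f => X.pathMap hι x fun i => f i ≫ g _ _
      naturality := fun φ x f => (X.map_pathMap hι φ x _).trans (congrArg (X.pathMap hι x)
        (funext fun i => (Category.assoc _ _ _).symm))
      act := fun {m N k} h {Z} x f => X.act_pathMap hι h x _
      letter := fun x f => X.letter_pathMap hι x _ }
  exact P.eq_of_isInitial hι Q x f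

/-- Interpretations are natural with respect to `E`-functors. -/
theorem pathMap_map {Y : ECategory E} (F : EFunctor X Y) {n : ℕ} {Z : Fin n → E.UnaryAlgebra}
    (x : Fin (n + 1) → X.Obj) (f : ∀ i, Z i ⟶ X.homAlgebra (x i.castSucc) (x i.succ)) :
    X.pathMap hι x f ≫ F.map (x 0) (x (Fin.last n)) =
      Y.pathMap hι (fun t => F.obj (x t)) fun i => f i ≫ F.homMap _ _ := by
  let g (a b : X.Obj) : X.homAlgebra a b ⟶ (Y.reindex F.obj).homAlgebra a b :=
    { f := F.map a b
      h := by
        refine Eq.trans ?_ (unaryComp_map F a b)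
        exact congrArg (_ ≫ ·) (unaryComp_reindex Y F.obj a b) }
  -- Both sides are interpretations in `Y` restricted along the object function of `F`, with letters
  -- sent through the hom maps of `F`; initiality makes them equal.
  let P : PathMaps ι (Y.reindex F.obj) g :=
    { app := fun {n Z} x f => X.pathMap hι x f ≫ F.map (x 0) (x (Fin.last n))
      naturality := fun φ x f => (Category.assoc _ _ _).symm.trans
        (congrArg (· ≫ F.map _ _) (X.map_pathMap hι φ x f))
      act := fun {m N k} h {Z} x f => (Category.assoc _ _ _).symm.trans
        ((congrArg (· ≫ F.map _ _) (X.act_pathMap hι h x f)).trans (cutComp_map F h x _))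
      letter := fun x f => (Category.assoc _ _ _).symm.trans
        (congrArg (· ≫ F.map _ _) (X.letter_pathMap hι x f)) }
  let Q : PathMaps ι (Y.reindex F.obj) g :=
    { app := fun x f => Y.pathMap hι (fun t => F.obj (x t)) fun i => f i ≫ F.homMap _ _
      naturality := fun φ x f => (Y.map_pathMap hι φ _ _).trans (congrArg (Y.pathMap hι _)
        (funext fun i => (Category.assoc _ _ _).symm))
      act := fun {m N k} h {Z} x f => Y.act_pathMap hι h _ _
      letter := fun x f => Y.letter_pathMap hι _ _ }
  exact P.eq_of_isInitial hι Q x f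

/-- Interpretations are linear with respect to the unary operation. -/
theorem unary_pathMap {n : ℕ} (h : ∑ _i : Fin 1, n = n) {Z : Fin n → E.UnaryAlgebra}
    (x : Fin (n + 1) → X.Obj) (f : ∀ i, Z i ⟶ X.homAlgebra (x i.castSucc) (x i.succ)) :
    (E.tensor 1).map (X := fun _ => (W.obj n).obj Z) (Y := fun _ => X.Hom (x 0) (x (Fin.last n)))
      (fun _ => X.pathMap hι x f) ≫ X.unaryComp (x 0) (x (Fin.last n)) =
    (eqToHom (by
        change ((E.tensor 1).obj fun _ => (W.obj n).obj Z) =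
          (E.tensor 1).obj fun i => (W.obj n).obj fun j => Z (pos h i j)
        simp only [pos_one]) ≫ (W.act (k := fun _ => n) h).app Z) ≫
      X.pathMap hι x f := by
  rw [Category.assoc]
  apply eq_of_heq
  refine HEq.symm ((eqToHom_comp_heq _ _).trans ?_)
  refine (heq_of_eq (X.act_pathMap hι (k := fun _ => n) h x f)).trans ?_
  refine X.cutComp_one h x _ (X.pathMap hι x f) (fun i => ?_) fun i => ?_
  · exact congrArg (W.obj n).obj (funext fun j => congrArg Z (pos_one h i j))
  · have key : ∀ (Z' : Fin n → E.UnaryAlgebra) (x' : Fin (n + 1) → X.Obj)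
        (f' : ∀ i, Z' i ⟶ X.homAlgebra (x' i.castSucc) (x' i.succ)),
        Z' = Z → x' = x → (∀ i, f' i ≍ f i) → X.pathMap hι x' f' ≍ X.pathMap hι x f := by
      rintro Z' x' f' rfl rfl hf
      obtain rfl : f' = f := funext fun i => eq_of_heq (hf i)
      rfl
    exact key _ _ _ (funext fun j => congrArg Z (pos_one h i j))
      (funext fun t => congrArg x (subVertex_one h i t))
      fun j => heq_pathMap (G := X.homAlgebra) f (pos_one h i j)

end ECategory

/-! ### Intervals of a finite sequence. -/

section Interval

variable {N : ℕ}

theorem partialSum_step {n : ℕ} {x : Fin (n + 1) → Fin (N + 1)} {k : Fin n → ℕ}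
    (hk : ∀ i, (x i.succ : ℕ) = x i.castSucc + k i) (t : Fin (n + 1)) :
    (x t : ℕ) = x 0 + Fin.partialSum k t := by
  induction t using Fin.induction with
  | zero => rw [Fin.partialSum_zero]; rfl
  | succ i ih => rw [hk, ih, Fin.partialSum_succ, Nat.add_assoc]

theorem sum_step {n : ℕ} {x : Fin (n + 1) → Fin (N + 1)} {k : Fin n → ℕ}
    (hk : ∀ i, (x i.succ : ℕ) = x i.castSucc + k i) :
    ∑ i, k i = x (Fin.last n) - x 0 := by
  rw [partialSum_step hk (Fin.last n), partialSum_last rfl, Nat.add_sub_cancel_left]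

/-- The number of steps between consecutive vertices. -/
abbrev step {n : ℕ} (x : Fin (n + 1) → Fin (N + 1)) (i : Fin n) : ℕ := x i.succ - x i.castSucc

theorem step_eq {n : ℕ} {x : Fin (n + 1) → Fin (N + 1)} (hx : Monotone x) (i : Fin n) :
    (x i.succ : ℕ) = x i.castSucc + step x i :=
  (Nat.add_sub_of_le (Fin.monotone_iff_le_succ.1 hx i)).symm

/-- The entries of a sequence between two vertices. -/
def between {A : Type u₁} (Z : Fin N → A) (a b : Fin (N + 1)) (p : Fin (b - a : ℕ)) : A :=
  Z ⟨a + p, by have := p.2; have := b.2; omega⟩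

/-- Agreement of a sequence with an interval of `Z` is expressed through the numerical values of
positions. Intervals whose lengths are given by different expressions can then be compared without
casts between index types. -/
theorem eq_between {A : Type u₁} {Z : Fin N → A} {a b : Fin (N + 1)} {n : ℕ} {Y : Fin n → A}
    (hY : ∀ (p : Fin n) (q : Fin N), (q : ℕ) = a + p → Y p = Z q)
    (p : Fin n) (p' : Fin (b - a : ℕ)) (hp : (p : ℕ) = p') : Y p = between Z a b p' :=
  hY _ _ (congrArg (fun r => (a : ℕ) + r) hp.symm)

end Interval

namespace Multitensor

variable {V : Type u} [Category.{w} V]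

/-- Each operation has an initial value when one of the entries is initial. -/
def AbsorbsInitial (E : Multitensor V) : Prop :=
  ∀ ⦃n : ℕ⦄ ⦃Z : Fin n → V⦄ (i : Fin n), Nonempty (IsInitial (Z i)) →
    Nonempty (IsInitial ((E.tensor n).obj Z))

end Multitensor

/-! ### The category of intervals of a sequence. -/

namespace EModule

open ECategory

variable {V : Type u} [Category.{w} V] {E : Multitensor V} {A : Type u₁} [Category.{v₁} A]
  (W : EModule E A) {N : ℕ} (Z : Fin N → A) [HasInitial V]

/-- The value of a module on the entries of a sequence between two vertices, initial if there is no
path between them. -/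
noncomputable def intervalHom (a b : Fin (N + 1)) : V :=
  if a ≤ b then (W.obj (b - a : ℕ)).obj (between Z a b) else ⊥_ V

variable {W Z}

omit [HasInitial V] in
theorem obj_heq {n n' : ℕ} {Y : Fin n → A} {Y' : Fin n' → A} (hn : n = n')
    (hY : ∀ (p : Fin _) (p' : Fin _), (p : ℕ) = p' → Y p = Y' p') : (W.obj n).obj Y = (W.obj n').obj Y' := by
  subst hn
  exact congrArg (W.obj n).obj (funext fun p => hY p p rfl)

omit [HasInitial V] in
theorem act_heq {m M M' : ℕ} {k k' : Fin m → ℕ} (h : ∑ i, k i = M) (h' : ∑ i, k' i = M')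
    (hk : ∀ i, k i = k' i) {Y : Fin M → A} {Y' : Fin M' → A}
    (hY : ∀ (p : Fin _) (p' : Fin _), (p : ℕ) = p' → Y p = Y' p') : (W.act h).app Y ≍ (W.act h').app Y' := by
  obtain rfl : k = k' := funext hk
  obtain rfl : M = M' := h.symm.trans h'
  obtain rfl : Y = Y' := funext fun p => hY p p rfl
  rfl

theorem intervalHom_eq {a b : Fin (N + 1)} {n : ℕ} {Y : Fin n → A} (hb : (b : ℕ) = a + n)
    (hY : ∀ (p : Fin n) (q : Fin N), (q : ℕ) = a + p → Y p = Z q) :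
    W.intervalHom Z a b = (W.obj n).obj Y := by
  have h : a ≤ b := Fin.le_def.2 (by omega)
  rw [intervalHom, if_pos h]
  exact (obj_heq (by omega) (eq_between hY)).symm

theorem intervalHom_of_not_le {a b : Fin (N + 1)} (h : ¬a ≤ b) :
    Nonempty (IsInitial (W.intervalHom Z a b)) := by
  rw [intervalHom, if_neg h]
  exact ⟨initialIsInitial⟩

/-- Some step goes backwards, its hom is initial, and `E_n` absorbs it. So along such paths the
composition exists and satisfies every equation automatically. -/
theorem isInitial_of_not_monotone (hE : E.AbsorbsInitial) {n : ℕ} {x : Fin (n + 1) → Fin (N + 1)}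
    (hx : ¬Monotone x) : Nonempty (IsInitial ((E.tensor n).obj fun i =>
      W.intervalHom Z (x i.castSucc) (x i.succ))) := by
  rw [Fin.monotone_iff_le_succ] at hx
  push Not at hx
  obtain ⟨i, hi⟩ := hx
  exact hE i (intervalHom_of_not_le (not_le.2 hi))

theorem intervalHom_block {m M : ℕ} {k : Fin m → ℕ} (h : ∑ i, k i = M)
    {x : Fin (m + 1) → Fin (N + 1)} (hx : ∀ i, (x i.succ : ℕ) = x i.castSucc + k i)
    {Y : Fin M → A} (hY : ∀ (p : Fin M) (q : Fin N), (q : ℕ) = x 0 + p → Y p = Z q) (i : Fin m) :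
    W.intervalHom Z (x i.castSucc) (x i.succ) = (W.obj (k i)).obj fun j => Y (pos h i j) := by
  refine intervalHom_eq (hx i) fun p q hq => hY _ _ ?_
  rw [hq, partialSum_step hx, Nat.add_assoc]
  rfl

variable (W Z) in
open Classical in
/-- The composition along a path of vertices. -/
noncomputable def intervalComp (hE : E.AbsorbsInitial) {n : ℕ} (x : Fin (n + 1) → Fin (N + 1)) :
    ((E.tensor n).obj fun i => W.intervalHom Z (x i.castSucc) (x i.succ)) ⟶
      W.intervalHom Z (x 0) (x (Fin.last n)) :=
  if hx : Monotone x then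
    eqToHom (congrArg (E.tensor n).obj (funext fun i => intervalHom_block (sum_step (step_eq hx))
        (step_eq hx) (Y := between Z (x 0) (x (Fin.last n))) (fun _ _ hq => congrArg Z (Fin.ext hq.symm)) i)) ≫
      (show ((E.tensor n).obj fun i => (W.obj (step x i)).obj fun j =>
          between Z (x 0) (x (Fin.last n)) (pos (sum_step (step_eq hx)) i j)) ⟶ _ from
        (W.act (sum_step (step_eq hx))).app (between Z (x 0) (x (Fin.last n)))) ≫
      eqToHom (if_pos (hx (Fin.zero_le _))).symm
  else (isInitial_of_not_monotone hE hx).some.to _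

/-- Along a monotone path the composition is the action of `W`, whatever expressions are used for
the step lengths and the entries. Later computations go through this lemma instead of the
definition. -/
theorem intervalComp_heq (hE : E.AbsorbsInitial) {m M : ℕ} {k : Fin m → ℕ} (h : ∑ i, k i = M)
    {x : Fin (m + 1) → Fin (N + 1)} (hx : ∀ i, (x i.succ : ℕ) = x i.castSucc + k i)
    {Y : Fin M → A} (hY : ∀ (p : Fin M) (q : Fin N), (q : ℕ) = x 0 + p → Y p = Z q) :
    W.intervalComp Z hE x ≍ (W.act h).app Y := by
  have hm : Monotone x := Fin.monotone_iff_le_succ.2 fun i => Fin.le_def.2 (by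
    rw [hx]
    exact Nat.le_add_right _ _)
  have hM : M = x (Fin.last m) - x 0 := h.symm.trans (sum_step hx)
  have hM' := Fin.le_def.1 (hm (Fin.zero_le (Fin.last m)))
  rw [intervalComp, dif_pos hm]
  refine (eqToHom_comp_heq _ _).trans ((comp_eqToHom_heq _ _).trans ?_)
  refine act_heq _ _ (fun i => by have := hx i; unfold step; omega) fun p p' hp => ?_
  exact (eq_between hY p' p hp.symm).symm

theorem unit_intervalComp (hE : E.AbsorbsInitial) (x : Fin 2 → Fin (N + 1)) :
    E.unit (W.intervalHom Z (x 0) (x 1)) ≫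
      eqToHom (by congr 1; funext i; rw [Subsingleton.elim i 0]; rfl) ≫
        W.intervalComp Z hE x = 𝟙 _ := by
  by_cases hx : x 0 ≤ x 1
  · have hx' : (x 1 : ℕ) = x 0 + (x 1 - x 0) := (Nat.add_sub_of_le hx).symm
    have hY : ∀ (p : Fin (x 1 - x 0 : ℕ)) (q : Fin N), (q : ℕ) = x 0 + p →
        between Z (x 0) (x 1) p = Z q := fun _ _ hq => congrArg Z (Fin.ext hq.symm)
    have h := Multitensor.sum_const_one_eq (x 1 - x 0 : ℕ)
    have h0 (i : Fin 1) : (x i.succ : ℕ) = x i.castSucc + (x 1 - x 0) := by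
      rw [Subsingleton.elim i 0]
      exact hx'
    have h1 := congrArg (fun α => α.app (between Z (x 0) (x 1))) (W.unit_act h)
    have h2 : W.intervalHom Z (x 0) (x 1) = _ := intervalHom_eq hx' hY
    have h3 := intervalComp_heq (W := W) hE h (x := x) h0 hY
    have key : ∀ (B B' : V) (hB : B = B'), E.unit B ≍ E.unit B' := by
      rintro B _ rfl
      rfl
    apply eq_of_heq
    refine HEq.trans ?_ ((heq_of_eq h1).trans ?_)
    · refine ECategory.heq_comp h2 ?_ h2 ((key _ _ h2).trans (comp_eqToHom_heq _ _).symm)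
        ((eqToHom_comp_heq _ _).trans h3)
      refine congrArg (E.tensor 1).obj (funext fun i => ?_)
      obtain rfl : i = 0 := Subsingleton.elim _ _
      exact intervalHom_block h h0 hY 0
    · have key2 : ∀ (B B' : V) (hB : B = B'), 𝟙 B ≍ 𝟙 B' := by
        rintro B _ rfl
        rfl
      exact (key2 _ _ h2).symm
  · exact (intervalHom_of_not_le hx).some.hom_ext _ _

/-- On monotone paths this is the associativity of the module for the sequence between the
endpoints, doubly cut by the vertices of the path; on the other paths the source is initial. -/
theorem subst_intervalComp (hE : E.AbsorbsInitial) {m K : ℕ} {k : Fin m → ℕ} (hk : ∑ i, k i = K)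
    (x : Fin (K + 1) → Fin (N + 1)) :
    E.subst hk (fun q => W.intervalHom Z (x q.castSucc) (x q.succ)) ≫ W.intervalComp Z hE x =
      (E.tensor m).map
          (X := fun i => (E.tensor (k i)).obj fun j =>
            W.intervalHom Z (x (subVertex hk i j.castSucc)) (x (subVertex hk i j.succ)))
          (Y := fun i =>
            W.intervalHom Z (x (cutVertex hk i.castSucc)) (x (cutVertex hk i.succ)))
          (fun i => W.intervalComp Z hE (fun t => x (subVertex hk i t)) ≫
            eqToHom (by rw [subVertex_last]; rfl)) ≫
        W.intervalComp Z hE (fun t => x (cutVertex hk t)) ≫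
        eqToHom (by rw [cutVertex_zero, cutVertex_last]) := by
  by_cases hx : Monotone x
  · let l := step x
    let Y := between Z (x 0) (x (Fin.last K))
    have hl : ∑ q, l q = x (Fin.last K) - x 0 := sum_step (step_eq hx)
    have hl' := step_eq hx
    have hc : Monotone fun t => x (cutVertex hk t) := hx.comp (Fin.monotone_iff_le_succ.2
      fun i => Fin.le_def.2 (partialSum_castSucc_le k i))
    let n := step fun t => x (cutVertex hk t)
    -- A coarse step has as its length the telescoping sum of the fine steps inside it.
    have hn (i : Fin m) : ∑ j, l (pos hk i j) = n i := by
      refine (sum_step (x := fun t => x (subVertex hk i t)) fun j => hl' (pos hk i j)).trans ?_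
      change (x (subVertex hk i (Fin.last (k i))) - _ : ℕ) = x (cutVertex hk i.succ) - _
      rw [subVertex_last]
      rfl
    have hn' := step_eq hc
    have hN : ∑ i, n i = x (Fin.last K) - x 0 := by
      refine (sum_step (x := fun t => x (cutVertex hk t)) hn').trans ?_
      rw [cutVertex_zero, cutVertex_last]
    have hY : ∀ (p : Fin (x (Fin.last K) - x 0 : ℕ)) (q : Fin N), (q : ℕ) = x 0 + p →
      Y p = Z q := fun _ _ hq => congrArg Z (Fin.ext hq.symm)
    have hY' : ∀ (p : Fin (x (Fin.last K) - x 0 : ℕ)) (q : Fin N),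
        (q : ℕ) = x (cutVertex hk 0) + p → Y p = Z q := by
      rw [cutVertex_zero]
      exact hY
    have hYi (i : Fin m) (p : Fin (n i)) (q : Fin N) (hq : (q : ℕ) = x (subVertex hk i 0) + p) :
        Y (pos hN i p) = Z q := by
      refine hY' _ _ ?_
      have h1 := partialSum_step (x := fun t => x (cutVertex hk t)) hn' i.castSucc
      rw [hq]
      refine (congrArg (· + (p : ℕ)) h1).trans ?_
      rw [ Nat.add_assoc]
      rfl
    have hb (i : Fin m) (j : Fin (k i)) : W.intervalHom Z (x (subVertex hk i j.castSucc))
        (x (subVertex hk i j.succ)) = (W.obj (l (pos hk i j))).obj fun p =>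
          Y (pos hN i (pos (k := fun j => l (pos hk i j)) (hn i) j p)) :=
      intervalHom_block (x := fun t => x (subVertex hk i t)) (hn i) (fun j => hl' (pos hk i j))
        (hYi i) j
    have hb' (i : Fin m) : W.intervalHom Z (x (cutVertex hk i.castSucc))
        (x (cutVertex hk i.succ)) = (W.obj (n i)).obj fun p => Y (pos hN i p) :=
      intervalHom_block (x := fun t => x (cutVertex hk t)) hN hn' hY' i
    have hb'' (q : Fin K) : W.intervalHom Z (x q.castSucc) (x q.succ) = _ :=
      intervalHom_block hl hl' hY q
    have h0 : W.intervalHom Z (x 0) (x (Fin.last K)) = (W.obj _).obj Y :=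
      intervalHom_eq (Nat.add_sub_of_le (hx (Fin.zero_le _))).symm hY
    have key := congrArg (fun α => α.app Y) (W.subst_act hk hl hn hN)
    apply eq_of_heq
    refine HEq.trans ?_ ((heq_of_eq key).trans ?_)
    · exact ECategory.heq_comp (congrArg _ (funext fun i => congrArg _ (funext fun j => hb'' _)))
        (congrArg _ (funext hb'')) h0 (heq_subst hk hb'') (intervalComp_heq hE hl hl' hY)
    · refine HEq.symm (ECategory.heq_comp
        (f' := (E.evalBlock hk hl hn hN fun i => W.act (hn i)).app Y) (g' := (W.act hN).app Y)
        (congrArg _ (funext fun i => congrArg _ (funext fun j => hb'' _)))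
        (congrArg _ (funext hb')) h0 ?_
        ((comp_eqToHom_heq _ _).trans (intervalComp_heq hE hN hn' hY')))
      refine HEq.trans ?_ (eqToHom_comp_heq _ _).symm
      refine heq_tensor_map (fun i => congrArg _ (funext fun j => hb i j)) hb' fun i => ?_
      exact (comp_eqToHom_heq _ _).trans (intervalComp_heq (x := fun t => x (subVertex hk i t)) hE
        (hn i) (fun j => hl' (pos hk i j)) (hYi i))
  · rw [Fin.monotone_iff_le_succ] at hx
    push Not at hx
    obtain ⟨q, hq⟩ := hx
    obtain ⟨i, j, rfl⟩ := exists_pos_eq hk q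
    -- The backward step makes the inner tensor of its block initial, and therefore the outer one.
    obtain ⟨h⟩ := hE (Z := fun i => (E.tensor (k i)).obj fun j =>
      W.intervalHom Z (x (pos hk i j).castSucc) (x (pos hk i j).succ)) i
        (hE j (intervalHom_of_not_le (not_le.2 hq)))
    exact h.hom_ext _ _

variable (W Z) in
/-- The `E`-category of the intervals of a sequence. -/
noncomputable def intervals (hE : E.AbsorbsInitial) : ECategory E where
  Obj := ULift.{w} (Fin (N + 1))
  Hom a b := W.intervalHom Z a.down b.down
  comp x := W.intervalComp Z hE fun t => (x t).down
  unit_comp x := unit_intervalComp hE fun t => (x t).down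
  subst_comp h x := subst_intervalComp hE h fun t => (x t).down

end EModule

open ECategory

variable {V : Type u} [Category.{w} V] {E : Multitensor V} {A : Type u₁} [Category.{w} A]

/-! ### Functors out of categories of intervals. -/

/-- An interpretation of the operations of a module along the paths of an `E`-category. -/
structure Interpretation (W : EModule E A) (X : ECategory E) (G : X.Obj → X.Obj → A) where
  /-- the maps -/
  app {n : ℕ} {Z : Fin n → A} (x : Fin (n + 1) → X.Obj)
    (f : ∀ i, Z i ⟶ G (x i.castSucc) (x i.succ)) :
    (W.obj n).obj Z ⟶ X.Hom (x 0) (x (Fin.last n))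
  naturality {n : ℕ} {Z Z' : Fin n → A} (φ : Z ⟶ Z') (x : Fin (n + 1) → X.Obj)
    (f : ∀ i, Z' i ⟶ G (x i.castSucc) (x i.succ)) :
    (W.obj n).map φ ≫ app x f = app x fun i => φ i ≫ f i
  act {m N : ℕ} {k : Fin m → ℕ} (h : ∑ i, k i = N) {Z : Fin N → A}
    (x : Fin (N + 1) → X.Obj) (f : ∀ i, Z i ⟶ G (x i.castSucc) (x i.succ)) :
    (W.act h).app Z ≫ app x f = X.cutComp h x fun i =>
      app (Z := fun j => Z (pos h i j)) (fun t => x (subVertex h i t)) (subMaps h f i)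

theorem Interpretation.app_heq {W : EModule E A} {X : ECategory E} {G : X.Obj → X.Obj → A}
    (P : Interpretation W X G) {n n' : ℕ} (hn : n = n') {Z : Fin n → A} {Z' : Fin n' → A}
    (hZ : ∀ (i : Fin n) (i' : Fin n'), (i : ℕ) = i' → Z i = Z' i')
    {x : Fin (n + 1) → X.Obj} {x' : Fin (n' + 1) → X.Obj}
    (hx : ∀ (t : Fin (n + 1)) (t' : Fin (n' + 1)), (t : ℕ) = t' → x t = x' t')
    {f : ∀ i, Z i ⟶ G (x i.castSucc) (x i.succ)} {f' : ∀ i, Z' i ⟶ G (x' i.castSucc) (x' i.succ)}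
    (hf : ∀ (i : Fin n) (i' : Fin n'), (i : ℕ) = i' → f i ≍ f' i') : P.app x f ≍ P.app x' f' := by
  subst hn
  obtain rfl : Z = Z' := funext fun i => hZ i i rfl
  obtain rfl : x = x' := funext fun t => hx t t rfl
  obtain rfl : f = f' := funext fun i => eq_of_heq (hf i i rfl)
  rfl

/-- The interpretation underlying a family of path maps. -/
def ECategory.PathMaps.toInterpretation {W : EModule E E.UnaryAlgebra} {ι : Multitensor.Letters W}
    {X : ECategory E} {G : X.Obj → X.Obj → E.UnaryAlgebra} {g : ∀ a b, G a b ⟶ X.homAlgebra a b}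
    (P : PathMaps ι X g) : Interpretation W X G where
  app := P.app
  naturality := P.naturality
  act := P.act

namespace EModule

variable (W : EModule E A) {N : ℕ} (Z : Fin N → A) [HasInitial V] (hE : E.AbsorbsInitial)

theorem step_le {n : ℕ} {x : Fin (n + 1) → Fin (N + 1)} (hx : Monotone x) (i : Fin n) :
    x i.castSucc ≤ x i.succ :=
  Fin.monotone_iff_le_succ.1 hx i

variable {W Z}

open Classical in
/-- An `E`-functor out of the category of intervals. -/
noncomputable def intervalsDesc {X : ECategory E} (o : Fin (N + 1) → X.Obj)
    (t : ∀ a b : Fin (N + 1), a ≤ b → (W.intervalHom Z a b ⟶ X.Hom (o a) (o b)))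
    (ht : ∀ {n : ℕ} (x : Fin (n + 1) → Fin (N + 1)) (hx : Monotone x),
      W.intervalComp Z hE x ≫ t _ _ (hx (Fin.zero_le _)) =
        (E.tensor n).map (X := fun i => W.intervalHom Z (x i.castSucc) (x i.succ))
            (Y := fun i => X.Hom (o (x i.castSucc)) (o (x i.succ)))
            (fun i => t _ _ (step_le hx i)) ≫
          X.comp fun s => o (x s)) :
    EFunctor (W.intervals Z hE) X where
  obj a := o a.down
  map a b := if h : a.down ≤ b.down then t _ _ h else (intervalHom_of_not_le h).some.to _
  comp_map {n} x := by
    by_cases hx : Monotone fun s => (x s).down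
    · refine (congrArg (W.intervalComp Z hE (fun s => (x s).down) ≫ ·)
        (dif_pos (hx (Fin.zero_le _)))).trans ((ht _ hx).trans ?_)
      refine congrArg (· ≫ X.comp fun s => o (x s).down) (congrArg _ (funext fun i => ?_))
      exact (dif_pos (step_le hx i)).symm
    · exact (isInitial_of_not_monotone hE hx).some.hom_ext _ _

/-- The vertices between two vertices. -/
def vertexBetween (a b : Fin (N + 1)) (h : a ≤ b) (s : Fin ((b - a : ℕ) + 1)) : Fin (N + 1) :=
  ⟨a + s, by have := s.2; have := b.2; have := Fin.le_def.1 h; omega⟩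

variable {hE}

section Eval

variable {X : ECategory E} {G : X.Obj → X.Obj → A} (P : Interpretation W X G)
  (x : Fin (N + 1) → X.Obj) (f : ∀ i, Z i ⟶ G (x i.castSucc) (x i.succ))

/-- The value of an interpretation on an interval. -/
noncomputable def intervalEval (a b : Fin (N + 1)) (h : a ≤ b) :
    W.intervalHom Z a b ⟶ X.Hom (x a) (x b) :=
  eqToHom (if_pos h) ≫
    P.app (Z := between Z a b) (fun s => x (vertexBetween a b h s))
      (fun p => f ⟨a + p, by have := p.2; have := b.2; omega⟩) ≫
    eqToHom (congrArg₂ X.Hom (congrArg x (Fin.ext (Nat.add_zero _)))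
      (congrArg x (Fin.ext (Nat.add_sub_of_le h))))

theorem intervalEval_heq {a b : Fin (N + 1)} (h : a ≤ b) {n : ℕ} {Y : Fin n → A}
    (hb : (b : ℕ) = a + n)
    (hY : ∀ (p : Fin n) (q : Fin N), (q : ℕ) = a + p → Y p = Z q) (y : Fin (n + 1) → X.Obj)
    (hy : ∀ (s : Fin (n + 1)) (r : Fin (N + 1)), (r : ℕ) = a + s → y s = x r)
    (g : ∀ i, Y i ⟶ G (y i.castSucc) (y i.succ))
    (hg : ∀ (p : Fin n) (q : Fin N), (q : ℕ) = a + p → g p ≍ f q) :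
    intervalEval P x f a b h ≍ P.app y g := by
  refine (eqToHom_comp_heq _ _).trans ((comp_eqToHom_heq _ _).trans (HEq.symm ?_))
  refine P.app_heq (by omega) (eq_between hY) (fun t t' ht => ?_) fun i i' hi => ?_
  · exact hy _ _ (congrArg (fun r => (a : ℕ) + r) ht.symm)
  · exact hg _ _ (congrArg (fun r => (a : ℕ) + r) hi.symm)

-- This is the `act` axiom of the interpretation for the part of the sequence from `y 0` to the last
-- vertex of `y`, cut at the intermediate vertices. It makes the evaluation on intervals a functor.
variable (hE) in
theorem intervalComp_intervalEval {n : ℕ} (y : Fin (n + 1) → Fin (N + 1)) (hy : Monotone y) :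
    W.intervalComp Z hE y ≫ intervalEval P x f _ _ (hy (Fin.zero_le _)) =
      (E.tensor n).map (X := fun i => W.intervalHom Z (y i.castSucc) (y i.succ))
          (Y := fun i => X.Hom (x (y i.castSucc)) (x (y i.succ)))
          (fun i => intervalEval P x f _ _ (step_le hy i)) ≫
        X.comp fun s => x (y s) := by
  have hl := step_eq hy
  have hs : ∑ i, step y i = y (Fin.last n) - y 0 := sum_step hl
  have h0 : (y (Fin.last n) : ℕ) = y 0 + (y (Fin.last n) - y 0) :=
    (Nat.add_sub_of_le (hy (Fin.zero_le _))).symm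
  let Y := between Z (y 0) (y (Fin.last n))
  let x' := fun s => x (vertexBetween (y 0) (y (Fin.last n)) (hy (Fin.zero_le _)) s)
  let f' : ∀ p, Y p ⟶ G (x' p.castSucc) (x' p.succ) := fun p =>
    f ⟨y 0 + p, by have := p.2; have := (y (Fin.last n)).2; omega⟩
  have hY : ∀ (p : Fin (y (Fin.last n) - y 0 : ℕ)) (q : Fin N), (q : ℕ) = y 0 + p → Y p = Z q :=
    fun _ _ hq => congrArg Z (Fin.ext hq.symm)
  have hv (s : Fin (n + 1)) : x (y s) = x' (cutVertex hs s) :=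
    congrArg x (Fin.ext (partialSum_step hl s))
  have hsub (i : Fin n) (j : ℕ) (r : ℕ) (hr : r = y i.castSucc + j) :
      r = y 0 + (Fin.partialSum (step y) i.castSucc + j) := by
    rw [hr, partialSum_step hl i.castSucc, Nat.add_assoc]
  have hYi (i : Fin n) (p : Fin (step y i)) (q : Fin N) (hq : (q : ℕ) = y i.castSucc + p) :
      Y (pos hs i p) = Z q := hY _ _ (hsub i p q hq)
  have h1 := P.act hs x' f'
  apply eq_of_heq
  refine HEq.trans ?_ ((heq_of_eq h1).trans ?_)
  · refine ECategory.heq_comp ?_ (intervalHom_eq h0 hY) ?_ (intervalComp_heq hE hs hl hY) ?_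
    · exact congrArg (E.tensor n).obj (funext (intervalHom_block hs hl hY))
    · exact congrArg₂ X.Hom (congrArg x (Fin.ext rfl)) (congrArg x (Fin.ext h0))
    · exact intervalEval_heq P x f _ h0 hY _ (fun s r hr => congrArg x (Fin.ext hr.symm)) _
        fun p q hq => heq_pathMap f (Fin.ext hq.symm)
  · refine X.cutComp_heq hs x' _ _ (fun i => ?_) (fun i => ?_) (fun s => (hv s).symm) _ HEq.rfl
      (fun _ => rfl) rfl
    · exact (intervalHom_block hs hl hY i).symm
    · refine HEq.symm (intervalEval_heq P x f _ (hl i) (hYi i) _ (fun s r hr => ?_) _ fun p q hq => ?_)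
      · exact congrArg x (Fin.ext (hsub i s r hr).symm)
      · exact heq_pathMap f (Fin.ext (hsub i p q hq).symm)

variable (hE) in
/-- The evaluation of the intervals along a path. -/
noncomputable def evalFunctor : EFunctor (W.intervals Z hE) X :=
  intervalsDesc hE x (intervalEval P x f) (intervalComp_intervalEval hE P x f)

theorem evalFunctor_map_heq {a b : (W.intervals Z hE).Obj} {n : ℕ} {Y : Fin n → A}
    (hb : (b.down : ℕ) = a.down + n)
    (hY : ∀ (p : Fin n) (q : Fin N), (q : ℕ) = a.down + p → Y p = Z q) (y : Fin (n + 1) → X.Obj)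
    (hy : ∀ (s : Fin (n + 1)) (r : Fin (N + 1)), (r : ℕ) = a.down + s → y s = x r)
    (g : ∀ i, Y i ⟶ G (y i.castSucc) (y i.succ))
    (hg : ∀ (p : Fin n) (q : Fin N), (q : ℕ) = a.down + p → g p ≍ f q) :
    (evalFunctor hE P x f).map a b ≍ P.app y g := by
  have h : a.down ≤ b.down := Fin.le_def.2 (by omega)
  exact (heq_of_eq (dif_pos h)).trans (intervalEval_heq P x f h hb hY y hy g hg)

end Eval

section Inclusion

variable {M : ℕ} {Y : Fin M → A} (c : ℕ) (hc : c + M ≤ N)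
  (φ : ∀ (p : Fin M) (q : Fin N), (q : ℕ) = c + p → (Y p ⟶ Z q))

/-- The inclusion of the vertices of a subsequence. -/
def shiftVertex (a : Fin (M + 1)) : Fin (N + 1) := ⟨c + a, by have := a.2; omega⟩

/-- The map of intervals induced by maps into the entries of a subsequence. -/
noncomputable def intervalMap (a b : Fin (M + 1)) (h : a ≤ b) :
    W.intervalHom Y a b ⟶ W.intervalHom Z (shiftVertex c hc a) (shiftVertex c hc b) :=
  eqToHom (if_pos h) ≫
    (W.obj (b - a : ℕ)).map (X := between Y a b)
      (Y := fun p => Z ⟨c + a + p, by have := p.2; have := b.2; omega⟩)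
      (fun p => φ _ _ (Nat.add_assoc c a p)) ≫
    eqToHom (intervalHom_eq (by
      have := Fin.le_def.1 h
      change c + (b : ℕ) = c + a + (b - a)
      omega) fun p q hq => congrArg Z (Fin.ext hq.symm)).symm

omit [HasInitial V] in
theorem map_heq {n n' : ℕ} (hn : n = n') {S T : Fin n → A} {S' T' : Fin n' → A}
    (hS : ∀ (p : Fin n) (p' : Fin n'), (p : ℕ) = p' → S p = S' p')
    (hT : ∀ (p : Fin n) (p' : Fin n'), (p : ℕ) = p' → T p = T' p') {f : S ⟶ T} {f' : S' ⟶ T'}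
    (hf : ∀ (p : Fin n) (p' : Fin n'), (p : ℕ) = p' → f p ≍ f' p') :
    (W.obj n).map f ≍ (W.obj n').map f' := by
  subst hn
  obtain rfl : S = S' := funext fun i => hS i i rfl
  obtain rfl : T = T' := funext fun i => hT i i rfl
  obtain rfl : f = f' := funext fun i => eq_of_heq (hf i i rfl)
  rfl

omit [HasInitial V] in
theorem heq_between_map {p p' : Fin M} (hp : p = p') {q q' : Fin N} (hq : q = q')
    (h : (q : ℕ) = c + p) (h' : (q' : ℕ) = c + p') : φ p q h ≍ φ p' q' h' := by
  subst hp hq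
  rfl

theorem intervalMap_heq {a b : Fin (M + 1)} (h : a ≤ b) {n : ℕ} {S T : Fin n → A}
    (hb : (b : ℕ) = a + n)
    (hS : ∀ (p : Fin n) (q : Fin M), (q : ℕ) = a + p → S p = Y q)
    (hT : ∀ (p : Fin n) (q : Fin N), (q : ℕ) = c + a + p → T p = Z q) (f : S ⟶ T)
    (hf : ∀ (p : Fin n) (q : Fin M) (q' : Fin N) (_ : (q : ℕ) = a + p) (h : (q' : ℕ) = c + q),
      f p ≍ φ q q' h) :
    intervalMap (W := W) c hc φ a b h ≍ (W.obj n).map f := by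
  refine (eqToHom_comp_heq _ _).trans ((comp_eqToHom_heq _ _).trans (HEq.symm ?_))
  refine map_heq (by omega) (eq_between hS) (fun p p' hp => ?_) fun p p' hp => ?_
  · exact hT _ _ (congrArg (fun r => c + (a : ℕ) + r) hp.symm)
  · exact hf _ _ _ (congrArg (fun r => (a : ℕ) + r) hp.symm) _

-- Naturality of the action in the sequence, applied to the entries met by the path `y`; the shift
-- by `c` only renumbers vertices.
variable (hE) in
theorem intervalComp_intervalMap {n : ℕ} (y : Fin (n + 1) → Fin (M + 1)) (hy : Monotone y) :
    W.intervalComp Y hE y ≫ intervalMap c hc φ _ _ (hy (Fin.zero_le _)) =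
      (E.tensor n).map (X := fun i => W.intervalHom Y (y i.castSucc) (y i.succ))
          (Y := fun i => W.intervalHom Z (shiftVertex c hc (y i.castSucc))
            (shiftVertex c hc (y i.succ)))
          (fun i => intervalMap c hc φ _ _ (step_le hy i)) ≫
        W.intervalComp Z hE fun s => shiftVertex c hc (y s) := by
  have hl := step_eq hy
  have hl' (i : Fin n) : (shiftVertex c hc (y i.succ) : ℕ) =
      shiftVertex c hc (y i.castSucc) + step y i := by
    change c + _ = c + _ + _
    rw [hl, Nat.add_assoc]
  have hs : ∑ i, step y i = y (Fin.last n) - y 0 := sum_step hl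
  have h0 : (y (Fin.last n) : ℕ) = y 0 + (y (Fin.last n) - y 0) :=
    (Nat.add_sub_of_le (hy (Fin.zero_le _))).symm
  have h0' : (shiftVertex c hc (y (Fin.last n)) : ℕ) =
      shiftVertex c hc (y 0) + (y (Fin.last n) - y 0) := by
    change c + _ = c + _ + _
    omega
  let S := between Y (y 0) (y (Fin.last n))
  have hS : ∀ (p : Fin (y (Fin.last n) - y 0 : ℕ)) (q : Fin M), (q : ℕ) = y 0 + p → S p = Y q :=
    fun _ _ hq => congrArg Y (Fin.ext hq.symm)
  let T : Fin (y (Fin.last n) - y 0 : ℕ) → A := fun p =>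
    Z ⟨c + y 0 + p, by have := p.2; have := (y (Fin.last n)).2; omega⟩
  have hT : ∀ (p : Fin (y (Fin.last n) - y 0 : ℕ)) (q : Fin N), (q : ℕ) = c + y 0 + p → T p = Z q :=
    fun _ _ hq => congrArg Z (Fin.ext hq.symm)
  let f : S ⟶ T := fun p => φ _ _ (Nat.add_assoc c _ p)
  have hf (p : Fin (y (Fin.last n) - y 0 : ℕ)) (q : Fin M) (q' : Fin N) (h : (q : ℕ) = y 0 + p)
      (h' : (q' : ℕ) = c + q) : f p ≍ φ q q' h' :=
    heq_between_map c φ (Fin.ext h.symm) (Fin.ext (by rw [h', h]; exact Nat.add_assoc _ _ _)) _ _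
  have hsub (i : Fin n) (j : ℕ) (r : ℕ) (hr : r = y i.castSucc + j) :
      r = y 0 + (Fin.partialSum (step y) i.castSucc + j) := by
    rw [hr, partialSum_step hl i.castSucc, Nat.add_assoc]
  have hsub' (i : Fin n) (j : ℕ) (r : ℕ) (hr : r = c + y i.castSucc + j) :
      r = c + y 0 + (Fin.partialSum (step y) i.castSucc + j) := by
    rw [hr, partialSum_step hl i.castSucc, Nat.add_assoc, Nat.add_assoc, Nat.add_assoc]
  have h1 := (W.act hs).naturality f
  apply eq_of_heq
  refine HEq.trans ?_ ((heq_of_eq h1.symm).trans ?_)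
  · refine ECategory.heq_comp ?_ (intervalHom_eq h0 hS) (intervalHom_eq h0' hT)
      (intervalComp_heq hE hs hl hS) (intervalMap_heq c hc φ _ h0 hS hT f hf)
    exact congrArg (E.tensor n).obj (funext (intervalHom_block hs hl hS))
  · refine HEq.symm (ECategory.heq_comp ?_ ?_ (intervalHom_eq h0' hT) ?_
      (intervalComp_heq hE hs (x := fun s => shiftVertex c hc (y s)) hl' hT))
    · exact congrArg (E.tensor n).obj (funext (intervalHom_block hs hl hS))
    · exact congrArg (E.tensor n).obj (funext
        (intervalHom_block (x := fun s => shiftVertex c hc (y s)) hs hl' hT))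
    · refine heq_tensor_map (intervalHom_block hs hl hS)
        (intervalHom_block (x := fun s => shiftVertex c hc (y s)) hs hl' hT) fun i => ?_
      refine intervalMap_heq c hc φ _ (hl i) (fun p q hq => ?_) (fun p q hq => ?_)
        (fun j => f (pos hs i j)) fun p q q' hq hq' => ?_
      · exact hS _ _ (hsub i p q hq)
      · exact hT _ _ (hsub' i p q hq)
      · exact hf _ _ _ (hsub i p q hq) hq'

variable (hE) in
/-- The `E`-functor induced by maps into the entries of a subsequence. -/
noncomputable def inclusionFunctor : EFunctor (W.intervals Y hE) (W.intervals Z hE) :=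
  intervalsDesc hE (fun a => ⟨shiftVertex c hc a⟩) (intervalMap c hc φ)
    (intervalComp_intervalMap hE c hc φ)

theorem inclusionFunctor_map_heq {a b : (W.intervals Y hE).Obj} {n : ℕ} {S T : Fin n → A}
    (hb : (b.down : ℕ) = a.down + n)
    (hS : ∀ (p : Fin n) (q : Fin M), (q : ℕ) = a.down + p → S p = Y q)
    (hT : ∀ (p : Fin n) (q : Fin N), (q : ℕ) = c + a.down + p → T p = Z q) (f : S ⟶ T)
    (hf : ∀ (p : Fin n) (q : Fin M) (q' : Fin N) (_ : (q : ℕ) = a.down + p)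
      (h : (q' : ℕ) = c + q), f p ≍ φ q q' h) :
    (inclusionFunctor hE c hc φ).map a b ≍ (W.obj n).map f := by
  have h : a.down ≤ b.down := Fin.le_def.2 (by omega)
  exact (heq_of_eq (dif_pos h)).trans (intervalMap_heq c hc φ h hb hS hT f hf)

end Inclusion

end EModule

open ECategory Multitensor

/-! ### Modules with values in `E_1`-algebras. -/

section Algebras

variable {V : Type u} [Category.{w} V] {T : Monad V}

theorem algebra_ext {X Y : T.Algebra} (hA : X.A = Y.A) (ha : X.a ≍ Y.a) : X = Y := by
  cases X
  cases Y
  cases hA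
  cases ha
  rfl

theorem algebra_hom_heq {X X' Y Y' : T.Algebra} (hX : X = X') (hY : Y = Y') {f : X ⟶ Y}
    {f' : X' ⟶ Y'} (hf : f.f ≍ f'.f) : f ≍ f' := by
  subst hX hY
  exact heq_of_eq (Monad.Algebra.Hom.ext (eq_of_heq hf))

theorem algebra_hom_f_heq {X X' Y Y' : T.Algebra} (hX : X = X') (hY : Y = Y') {f : X ⟶ Y}
    {f' : X' ⟶ Y'} (hf : f ≍ f') : f.f ≍ f'.f := by
  subst hX hY hf
  rfl

end Algebras

namespace EModule

variable {V : Type u} [Category.{w} V] {E : Multitensor V} {A : Type u₁} [Category.{v₁} A]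
  (W : EModule E A)

/-- The action of the unary operation. -/
def unaryAct {n : ℕ} (Z : Fin n → A) :
    ((E.tensor 1).obj fun _ => (W.obj n).obj Z) ⟶ (W.obj n).obj Z :=
  eqToHom (by
    change _ = (E.tensor 1).obj fun i => (W.obj n).obj fun j => Z (pos (sum_const_one_eq n) i j)
    simp only [pos_one]) ≫ (W.act (k := fun _ => n) (sum_const_one_eq n)).app Z

theorem unaryAct_heq {n : ℕ} (Z : Fin n → A) :
    W.unaryAct Z ≍ (W.act (k := fun _ => n) (sum_const_one_eq n)).app Z :=
  eqToHom_comp_heq _ _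

/-- The values of a module as algebras of the unary operation. -/
def algebra {n : ℕ} (Z : Fin n → A) : E.UnaryAlgebra where
  A := (W.obj n).obj Z
  a := W.unaryAct Z
  unit := by
    have h := congrArg (fun α => α.app Z) (W.unit_act (sum_const_one_eq n))
    exact (Category.assoc _ _ _).symm.trans h
  assoc := by
    have h := congrArg (fun α => α.app Z) (W.subst_act (k := fun _ => 1) (sum_const_one_eq 1)
      (l := fun _ => n) (sum_const_one_eq n) (n := fun _ => n) (fun _ => sum_const_one_eq n)
      (sum_const_one_eq n))
    have hB (i : Fin 1) : (W.obj n).obj (fun j => Z (pos (k := fun _ => n) (sum_const_one_eq n) i j))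
        = (W.obj n).obj Z :=
      congrArg _ (funext fun j => congrArg Z (pos_one _ i j))
    apply eq_of_heq
    refine HEq.trans (HEq.symm ?_) ((heq_of_eq h).trans ?_)
    · exact ECategory.heq_comp
        (f := E.subst (k := fun _ => 1) (sum_const_one_eq 1) fun i => (W.obj n).obj fun j =>
          Z (pos (k := fun _ => n) (sum_const_one_eq n) i j))
        (g := (W.act (k := fun _ => n) (sum_const_one_eq n)).app Z)
        (f' := E.subst (k := fun _ => 1) (sum_const_one_eq 1) fun _ => (W.obj n).obj Z)
        (congrArg _ (funext fun i => congrArg _ (funext fun j => hB _)))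
        (congrArg _ (funext hB)) rfl (heq_subst _ hB) (W.unaryAct_heq Z).symm
    · refine ECategory.heq_comp
        (f := (E.evalBlock (k := fun _ => 1) (sum_const_one_eq 1) (l := fun _ => n)
          (sum_const_one_eq n) (n := fun _ => n) (fun _ => sum_const_one_eq n)
          (sum_const_one_eq n) fun i => W.act _).app Z)
        (g := (W.act (k := fun _ => n) (sum_const_one_eq n)).app Z)
        (f' := (E.tensor 1).map (X := fun _ => (E.tensor 1).obj fun _ => (W.obj n).obj Z)
          (Y := fun _ => (W.obj n).obj Z) fun _ => W.unaryAct Z)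
        (congrArg _ (funext fun i => congrArg _ (funext fun j => hB _)))
        (congrArg _ (funext hB)) rfl ((eqToHom_comp_heq _ _).trans ?_) (W.unaryAct_heq Z).symm
      have hZ (i : Fin 1) : (fun q => Z (pos (k := fun _ => n) (sum_const_one_eq n) i q)) = Z :=
        funext fun q => congrArg Z (pos_one _ i q)
      refine heq_tensor_map (fun i => ?_) hB fun i => ?_
      · refine congrArg (E.tensor 1).obj (funext fun j => congrArg (W.obj n).obj (funext fun p => ?_))
        exact congrArg Z ((pos_one _ i _).trans (pos_one _ j p))
      · exact (heq_app _ (hZ i)).trans (W.unaryAct_heq Z).symm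

/-- This is naturality of the action for the trivial cut into one block. It makes the functors of a
module take values in morphisms of algebras. -/
theorem unaryAct_naturality {n : ℕ} {Z Z' : Fin n → A} (φ : Z ⟶ Z') :
    (E.tensor 1).map (X := fun _ => (W.obj n).obj Z) (Y := fun _ => (W.obj n).obj Z')
      (fun _ => (W.obj n).map φ) ≫ W.unaryAct Z' = W.unaryAct Z ≫ (W.obj n).map φ := by
  have h := (W.act (k := fun _ => n) (sum_const_one_eq n)).naturality φ
  have hp (Z : Fin n → A) (i : Fin 1) :
      (W.obj n).obj (fun q => Z (pos (k := fun _ => n) (sum_const_one_eq n) i q)) =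
        (W.obj n).obj Z :=
    congrArg (W.obj n).obj (funext fun q => congrArg Z (pos_one _ i q))
  apply eq_of_heq
  refine HEq.trans ?_ ((heq_of_eq h).trans ?_)
  · refine ECategory.heq_comp (congrArg _ (funext fun i => (hp Z i).symm))
      (congrArg _ (funext fun i => (hp Z' i).symm)) rfl ?_ (W.unaryAct_heq Z')
    refine heq_tensor_map (fun i => (hp Z i).symm) (fun i => (hp Z' i).symm) fun i => ?_
    exact heq_map _ (funext fun q => congrArg Z (pos_one _ i q).symm)
      (funext fun q => congrArg Z' (pos_one _ i q).symm) fun q => heq_pi_app φ (pos_one _ i q).symm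
  · exact ECategory.heq_comp (congrArg _ (funext fun i => hp Z i)) rfl rfl (W.unaryAct_heq Z).symm
      HEq.rfl

/-- The functors of a module with values in the algebras of the unary operation. -/
def lift : OpFamily A E.UnaryAlgebra := fun n =>
  { obj := fun Z => W.algebra Z
    map := fun φ => { f := (W.obj n).map φ, h := W.unaryAct_naturality φ }
    map_id := fun Z => Monad.Algebra.Hom.ext ((W.obj n).map_id Z)
    map_comp := fun φ ψ => Monad.Algebra.Hom.ext ((W.obj n).map_comp φ ψ) }

/-- The homs of the category of intervals as algebras. -/
theorem homAlgebra_intervals [HasInitial V] (hE : E.AbsorbsInitial) {N : ℕ} {Z : Fin N → A}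
    {a b : (W.intervals Z hE).Obj} {n : ℕ} {Y : Fin n → A} (hb : (b.down : ℕ) = a.down + n)
    (hY : ∀ (p : Fin n) (q : Fin N), (q : ℕ) = a.down + p → Y p = Z q) :
    (W.intervals Z hE).homAlgebra a b = (W.lift n).obj Y := by
  refine algebra_ext (intervalHom_eq hb hY) ?_
  refine ((W.intervals Z hE).heq_unaryComp a b).symm.trans (HEq.trans ?_ (W.unaryAct_heq Y).symm)
  exact intervalComp_heq hE (sum_const_one_eq n) (fun i => by
    rw [Subsingleton.elim i 0]
    exact hb) hY

end EModule

/-! ### Interpretations as morphisms of algebras. -/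

namespace ECategory

variable {V : Type u} [Category.{w} V] {E : Multitensor V} {W : EModule E E.UnaryAlgebra}
  {ι : Letters W} (hι : ι.IsInitial) [HasLimitsOfSize.{w, w} V] (X : ECategory E)

/-- The interpretation along a path as a morphism of algebras. -/
noncomputable def pathHom {n : ℕ} {Z : Fin n → E.UnaryAlgebra} (x : Fin (n + 1) → X.Obj)
    (f : ∀ i, Z i ⟶ X.homAlgebra (x i.castSucc) (x i.succ)) :
    (W.lift n).obj Z ⟶ X.homAlgebra (x 0) (x (Fin.last n)) where
  f := X.pathMap hι x f
  h := X.unary_pathMap hι (sum_const_one_eq n) x f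

theorem map_pathHom {n : ℕ} {Z Z' : Fin n → E.UnaryAlgebra} (φ : Z ⟶ Z') (x : Fin (n + 1) → X.Obj)
    (f : ∀ i, Z' i ⟶ X.homAlgebra (x i.castSucc) (x i.succ)) :
    (W.lift n).map φ ≫ X.pathHom hι x f = X.pathHom hι x fun i => φ i ≫ f i :=
  Monad.Algebra.Hom.ext (X.map_pathMap hι φ x f)

variable {X}

theorem pathHom_map {Y : ECategory E} (F : EFunctor X Y) {n : ℕ} {Z : Fin n → E.UnaryAlgebra}
    (x : Fin (n + 1) → X.Obj) (f : ∀ i, Z i ⟶ X.homAlgebra (x i.castSucc) (x i.succ)) :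
    X.pathHom hι x f ≫ F.homMap _ _ =
      Y.pathHom hι (fun t => F.obj (x t)) fun i => f i ≫ F.homMap _ _ :=
  Monad.Algebra.Hom.ext (pathMap_map hι F x f)

variable (X)

theorem pathHom_heq {n n' : ℕ} (hn : n = n') {Z : Fin n → E.UnaryAlgebra}
    {Z' : Fin n' → E.UnaryAlgebra} (hZ : ∀ (i : Fin n) (i' : Fin n'), (i : ℕ) = i' → Z i = Z' i')
    {x : Fin (n + 1) → X.Obj} {x' : Fin (n' + 1) → X.Obj}
    (hx : ∀ (t : Fin (n + 1)) (t' : Fin (n' + 1)), (t : ℕ) = t' → x t = x' t')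
    {f : ∀ i, Z i ⟶ X.homAlgebra (x i.castSucc) (x i.succ)}
    {f' : ∀ i, Z' i ⟶ X.homAlgebra (x' i.castSucc) (x' i.succ)}
    (hf : ∀ (i : Fin n) (i' : Fin n'), (i : ℕ) = i' → f i ≍ f' i') :
    X.pathHom hι x f ≍ X.pathHom hι x' f' := by
  subst hn
  obtain rfl : Z = Z' := funext fun i => hZ i i rfl
  obtain rfl : x = x' := funext fun t => hx t t rfl
  obtain rfl : f = f' := funext fun i => eq_of_heq (hf i i rfl)
  rfl

end ECategory

/-- The letters as morphisms of algebras. -/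
def Multitensor.Letters.hom {V : Type u} [Category.{w} V] {E : Multitensor V}
    {W : EModule E E.UnaryAlgebra} (ι : Letters W) (Y : E.UnaryAlgebra) :
    Y ⟶ (W.lift 1).obj fun _ => Y where
  f := ι.nat.app fun _ => Y
  h := by
    refine Eq.trans ?_ (ι.linear (sum_const_one_eq 1) Y).symm
    exact congrArg (_ ≫ ·) (Category.id_comp _)

namespace Multitensor.Letters

variable {V : Type u} [Category.{w} V] {E : Multitensor V} {W : EModule E E.UnaryAlgebra}
  (ι : Letters W)

theorem hom_naturality {Y Y' : E.UnaryAlgebra} (f : Y ⟶ Y') :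
    f ≫ ι.hom Y' = ι.hom Y ≫ (W.lift 1).map (X := fun _ => Y) (Y := fun _ => Y') fun _ => f :=
  Monad.Algebra.Hom.ext (ι.nat.naturality (X := fun _ => Y) (Y := fun _ => Y') fun _ => f)

theorem hom_pathHom (hι : ι.IsInitial) [HasLimitsOfSize.{w, w} V] (X : ECategory E)
    {Y : E.UnaryAlgebra} (x : Fin 2 → X.Obj)
    (f : ∀ i : Fin 1, Y ⟶ X.homAlgebra (x i.castSucc) (x i.succ)) :
    ι.hom Y ≫ X.pathHom hι x f = f 0 :=
  Monad.Algebra.Hom.ext (X.letter_pathMap hι x f)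

end Multitensor.Letters

open ECategory Multitensor EModule

/-! ### Interpretations detect maps into the initial module. -/

namespace Multitensor.Letters

variable {V : Type u} [Category.{w} V] {E : Multitensor V} {W : EModule E E.UnaryAlgebra}
  {ι : Letters W} (hι : ι.IsInitial) [HasLimitsOfSize.{w, w} V] [HasInitial V]
  (hE : E.AbsorbsInitial)

variable (W) in
/-- The path of all vertices. -/
def allVertices {N : ℕ} (Z : Fin N → E.UnaryAlgebra) (t : Fin (N + 1)) :
    (W.intervals Z hE).Obj := ⟨t⟩

omit [HasLimitsOfSize.{w, w} V] in
theorem homAlgebra_step {N : ℕ} (Z : Fin N → E.UnaryAlgebra) (i : Fin N) :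
    ((W.lift 1).obj fun _ => Z i) = (W.intervals Z hE).homAlgebra
      (allVertices W hE Z i.castSucc) (allVertices W hE Z i.succ) :=
  (W.homAlgebra_intervals hE rfl fun p q hq => congrArg Z (Fin.ext (by
    rw [hq, Subsingleton.elim p 0]
    rfl))).symm

variable (ι) in
/-- The letters in the category of intervals. -/
noncomputable def generator {N : ℕ} (Z : Fin N → E.UnaryAlgebra) (i : Fin N) :
    Z i ⟶ (W.intervals Z hE).homAlgebra (allVertices W hE Z i.castSucc) (allVertices W hE Z i.succ) :=
  ι.hom (Z i) ≫ eqToHom (homAlgebra_step hE Z i)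

omit [HasLimitsOfSize.{w, w} V] in
theorem intervalHom_all {N : ℕ} (Z : Fin N → E.UnaryAlgebra) :
    (W.intervals Z hE).Hom (allVertices W hE Z 0) (allVertices W hE Z (Fin.last N)) =
      (W.obj N).obj Z :=
  intervalHom_eq (a := 0) (b := Fin.last N) (Nat.zero_add N).symm fun p _ hq =>
    congrArg Z (Fin.ext ((Nat.zero_add (p : ℕ)).symm.trans hq.symm))

/-- The interpretation of the initial module in the intervals along all vertices. -/
noncomputable def reflectMap {N : ℕ} (Z : Fin N → E.UnaryAlgebra) :
    (W.obj N).obj Z ⟶ (W.obj N).obj Z :=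
  (W.intervals Z hE).pathMap hι (allVertices W hE Z) (ι.generator hE Z) ≫
    eqToHom (intervalHom_all hE Z)

-- On one-step intervals the inclusion is `W_1` of the given map, so the claim is the naturality of
-- the letters.
omit [HasLimitsOfSize.{w, w} V] in
theorem generator_inclusion {M N : ℕ} {Y : Fin M → E.UnaryAlgebra} {Z : Fin N → E.UnaryAlgebra}
    (c : ℕ) (hc : c + M ≤ N) (φ : ∀ (p : Fin M) (q : Fin N), (q : ℕ) = c + p → (Y p ⟶ Z q))
    (i : Fin M) (q : Fin N) (hq : (q : ℕ) = c + i) :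
    ι.generator hE Y i ≫ (inclusionFunctor (W := W) hE c hc φ).homMap _ _ ≍
      φ i q hq ≫ ι.generator hE Z q := by
  have h1 := ι.hom_naturality (φ i q hq)
  have hY : ((W.lift 1).obj fun _ => Y i) = _ := homAlgebra_step hE Y i
  have hZ : (W.intervals Z hE).homAlgebra ((inclusionFunctor (W := W) hE c hc φ).obj (allVertices W hE Y i.castSucc))
      ((inclusionFunctor (W := W) hE c hc φ).obj (allVertices W hE Y i.succ)) = (W.lift 1).obj fun _ => Z q :=
    W.homAlgebra_intervals hE (show c + ((i : ℕ) + 1) = c + i + 1 from rfl) fun p r hr =>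
      congrArg Z (Fin.ext (by
        rw [hr, Subsingleton.elim p 0, hq]
        rfl))
  have h2 : (inclusionFunctor (W := W) hE c hc φ).homMap (allVertices W hE Y i.castSucc)
      (allVertices W hE Y i.succ) ≍
      (W.lift 1).map (X := fun _ => Y i) (Y := fun _ => Z q) fun _ => φ i q hq := by
    refine algebra_hom_heq hY.symm hZ ?_
    refine inclusionFunctor_map_heq c hc φ rfl (fun p r hr => ?_) (fun p r hr => ?_) _
      fun p r r' hr hr' => ?_
    · exact congrArg Y (Fin.ext (by rw [hr, Subsingleton.elim p 0]; rfl))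
    · refine congrArg Z (Fin.ext ?_)
      rw [hr, Subsingleton.elim p 0, hq]
      rfl
    · refine heq_between_map c φ (Fin.ext ?_) (Fin.ext ?_) _ _
      · rw [hr, Subsingleton.elim p 0]
        rfl
      · rw [hr', hr, Subsingleton.elim p 0, hq]
        rfl
  have hZ' : ((W.lift 1).obj fun _ => Z q) = _ := homAlgebra_step hE Z q
  refine HEq.trans (ECategory.heq_comp rfl hY.symm hZ (comp_eqToHom_heq _ _) h2) ?_
  refine (heq_of_eq h1.symm).trans ?_
  exact ECategory.heq_comp rfl rfl hZ' HEq.rfl (comp_eqToHom_heq _ _).symm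

/-- The interpretation in the intervals along consecutive vertices. -/
theorem pathMap_intervals {M N : ℕ} {Y : Fin M → E.UnaryAlgebra} {Z : Fin N → E.UnaryAlgebra}
    (c : ℕ) (hc : c + M ≤ N) (φ : ∀ (p : Fin M) (q : Fin N), (q : ℕ) = c + p → (Y p ⟶ Z q))
    (x : Fin (M + 1) → (W.intervals Z hE).Obj) (hx : ∀ t, ((x t).down : ℕ) = c + t)
    (f : ∀ i, Y i ⟶ (W.intervals Z hE).homAlgebra (x i.castSucc) (x i.succ))
    (hf : ∀ (i : Fin M) (q : Fin N) (hq : (q : ℕ) = c + i), f i ≍ φ i q hq ≫ ι.generator hE Z q)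
    {T : Fin M → E.UnaryAlgebra} (hT : ∀ (p : Fin M) (q : Fin N), (q : ℕ) = c + p → T p = Z q)
    (g : Y ⟶ T) (hg : ∀ (i : Fin M) (q : Fin N) (hq : (q : ℕ) = c + i), g i ≍ φ i q hq) :
    (W.intervals Z hE).pathMap hι x f ≍ reflectMap hι hE Y ≫ (W.obj M).map g := by
  -- The vertices of `x` are consecutive from `c`, so the path is the image of the full path of `Y`
  -- under the inclusion, and interpretations are natural in enriched functors.
  obtain rfl : x = fun t => (inclusionFunctor (W := W) hE c hc φ).obj (allVertices W hE Y t) :=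
    funext fun t => congrArg ULift.up (Fin.ext (hx t))
  have h1 := pathMap_map hι (inclusionFunctor (W := W) hE c hc φ) (allVertices W hE Y) (ι.generator hE Y)
  have h2 : f = fun i => ι.generator hE Y i ≫ (inclusionFunctor (W := W) hE c hc φ).homMap _ _ := by
    funext i
    refine eq_of_heq ((hf i ⟨c + i, by omega⟩ rfl).trans ?_)
    exact (generator_inclusion hE c hc φ i _ rfl).symm
  rw [h2, ← h1]
  refine ECategory.heq_comp rfl (intervalHom_all hE Y) ?_ (comp_eqToHom_heq _ _).symm ?_
  · refine intervalHom_eq ?_ hT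
    change c + M = c + 0 + M
    rfl
  · refine inclusionFunctor_map_heq c hc φ (Nat.zero_add M).symm (fun p q hq => ?_) hT g
      fun p q q' h h' => ?_
    · exact congrArg Y (Fin.ext (hq.trans (Nat.zero_add _)).symm)
    · have hpq : q = p := Fin.ext (h.trans (Nat.zero_add _))
      subst hpq
      exact hg q q' h'

/-- The interpretation in the intervals as a natural transformation. -/
noncomputable def reflect : W.obj ⟶ W.obj := fun _ =>
  { app := fun Z => reflectMap hι hE Z
    naturality := fun Y Z g => by
      have h1 := pathMap_intervals (ι := ι) hι hE 0 (Nat.zero_add _).le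
        (fun p q hq => g p ≫ eqToHom (congrArg Z (Fin.ext (hq.trans (Nat.zero_add _)).symm)))
        (allVertices W hE Z) (fun t => (Nat.zero_add _).symm) (fun i => g i ≫ ι.generator hE Z i)
        (fun i q hq => by
          obtain rfl : q = i := Fin.ext (hq.trans (Nat.zero_add _))
          simp) (fun p q hq => congrArg Z (Fin.ext (hq.trans (Nat.zero_add _)).symm)) g
        fun i q hq => (comp_eqToHom_heq _ _).symm
      apply eq_of_heq
      refine HEq.trans ?_ h1
      refine HEq.trans (heq_of_eq (Category.assoc _ _ _).symm) ((comp_eqToHom_heq _ _).trans ?_)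
      exact heq_of_eq ((W.intervals Z hE).map_pathMap hι g _ _) }

/-- The composition of the category of intervals is the action of `W`. The interpretation along the
vertices of one block is, by `pathMap_intervals`, the reflection of that block alone, so the `act`
axiom of interpretations is the required compatibility. -/
theorem isHom_reflect : W.IsHom W (reflect hι hE) := by
  intro m N k h
  ext Z
  have h1 := (W.intervals Z hE).act_pathMap hι h (allVertices W hE Z) (ι.generator hE Z)
  apply eq_of_heq
  refine HEq.trans (HEq.symm ?_) (((heq_of_eq h1).symm.trans (comp_eqToHom_heq _ _).symm).trans
    (heq_of_eq (Category.assoc _ _ _)))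
  have hY (p : Fin N) (q : Fin N) (hq : (q : ℕ) = 0 + p) : Z p = Z q :=
    congrArg Z (Fin.ext (hq.trans (Nat.zero_add _)).symm)
  have hk (i : Fin m) : (cutVertex h i.succ : ℕ) = cutVertex h i.castSucc + k i :=
    Fin.partialSum_succ k i
  have h0 : cutVertex h 0 = 0 := cutVertex_zero h
  have hY' (p : Fin N) (q : Fin N) (hq : (q : ℕ) = cutVertex h 0 + p) : Z p = Z q := by
    rw [h0] at hq
    exact hY p q hq
  refine (W.intervals Z hE).cutComp_heq h _ _ (fun i => (reflectMap hι hE fun j => Z (pos h i j)))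
    (fun i => rfl) (fun i => ?_) (fun t => rfl) _ (intervalComp_heq hE h hk hY')
    (fun i => intervalHom_block h hk hY' i) (intervalHom_eq (by
      change (cutVertex h (Fin.last m) : ℕ) = cutVertex h 0 + N
      rw [cutVertex_last, cutVertex_zero]
      exact (Nat.zero_add N).symm) hY')
  have hT (p : Fin (k i)) (q : Fin N) (hq : (q : ℕ) = Fin.partialSum k i.castSucc + p) :
      Z (pos h i p) = Z q := congrArg Z (Fin.ext hq.symm)
  refine (pathMap_intervals (ι := ι) hι hE (Fin.partialSum k i.castSucc) (partialSum_add_le h i)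
    (fun p q hq => eqToHom (hT p q hq)) (fun t => allVertices W hE Z (subVertex h i t))
    (fun t => rfl) (subMaps h (ι.generator hE Z) i) (fun j q hq => ?_) hT (𝟙 _)
    fun j q hq => ?_).trans ?_
  · obtain rfl : q = pos h i j := Fin.ext hq
    exact heq_of_eq (Category.id_comp _).symm
  · obtain rfl : q = pos h i j := Fin.ext hq
    rfl
  · exact heq_of_eq ((congrArg (_ ≫ ·) ((W.obj (k i)).map_id _)).trans (Category.comp_id _))

/-- Both are endomorphisms of the initial module that fix the letters. -/
theorem reflect_eq_id : reflect hι hE = 𝟙 W.obj := by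
  refine (hι W ι).unique ⟨isHom_reflect hι hE, ?_⟩ ⟨?_, Category.comp_id _⟩
  · ext Z
    obtain ⟨X, rfl⟩ : ∃ X, Z = fun _ => X := ⟨Z 0, funext fun i => by rw [Subsingleton.elim i 0]⟩
    have h1 := (W.intervals (fun _ : Fin 1 => X) hE).letter_pathMap hι (allVertices W hE _)
      (ι.generator hE fun _ => X)
    apply eq_of_heq
    refine ((heq_of_eq (Category.assoc _ _ _).symm).trans (comp_eqToHom_heq _ _)).trans ?_
    refine (heq_of_eq h1).trans ?_
    refine (algebra_hom_f_heq rfl (homAlgebra_step hE (fun _ => X) 0).symm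
      (comp_eqToHom_heq (ι.hom X) _)).trans ?_
    rfl
  · intro m N k h
    exact (congrArg (· ≫ _) ((blockOp h (E.tensor m)).map_id _)).trans
      ((Category.id_comp _).trans (Category.comp_id _).symm)

/-- The interpretation in the intervals along all vertices is trivial. -/
theorem pathMap_allVertices {N : ℕ} (Z : Fin N → E.UnaryAlgebra) :
    (W.intervals Z hE).pathMap hι (allVertices W hE Z) (ι.generator hE Z) =
      eqToHom (intervalHom_all hE Z).symm := by
  have h := congrArg (fun α => (α N).app Z) (reflect_eq_id hι hE)
  exact (comp_eqToHom_iff _ _ _).1 h |>.trans (Category.id_comp _)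

/-- Morphisms into a value of the initial module are detected by its interpretations. -/
theorem lift_hom_ext (hι : ι.IsInitial) (hE : E.AbsorbsInitial) {N : ℕ}
    {Z : Fin N → E.UnaryAlgebra} {B : E.UnaryAlgebra} {s t : B ⟶ (W.lift N).obj Z}
    (h : ∀ (X : ECategory E) (x : Fin (N + 1) → X.Obj)
      (f : ∀ i, Z i ⟶ X.homAlgebra (x i.castSucc) (x i.succ)),
      s ≫ X.pathHom hι x f = t ≫ X.pathHom hι x f) : s = t := by
  have h1 := congrArg Monad.Algebra.Hom.f (h (W.intervals Z hE) (allVertices W hE Z)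
    (ι.generator hE Z))
  refine Monad.Algebra.Hom.ext ?_
  have h2 : s.f ≫ (W.intervals Z hE).pathMap hι (allVertices W hE Z) (ι.generator hE Z) =
    t.f ≫ (W.intervals Z hE).pathMap hι (allVertices W hE Z) (ι.generator hE Z) := h1
  rw [pathMap_allVertices hι hE] at h2
  exact (cancel_mono (eqToHom (intervalHom_all hE Z).symm)).1 h2

end Multitensor.Letters

open ECategory Multitensor EModule

variable {V : Type u} [Category.{w} V] {E : Multitensor V} {W : EModule E E.UnaryAlgebra}
  {ι : Letters W} (hι : ι.IsInitial) [HasLimitsOfSize.{w, w} V]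

/-! ### Substitution of the operations of the initial module. -/

namespace ECategory

variable (X : ECategory E)

/-- The interpretation along a cut path of given maps into the homs of the subpaths. -/
noncomputable def cutHom {m N : ℕ} {k : Fin m → ℕ} (h : ∑ i, k i = N) (x : Fin (N + 1) → X.Obj)
    {B : Fin m → E.UnaryAlgebra} (t : ∀ i, B i ⟶
      X.homAlgebra (x (subVertex h i 0)) (x (subVertex h i (Fin.last (k i))))) :
    (W.lift m).obj B ⟶ X.homAlgebra (x 0) (x (Fin.last N)) :=
  X.pathHom hι (fun t => x (cutVertex h t))
      (fun i => t i ≫ eqToHom (by rw [subVertex_last]; rfl)) ≫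
    eqToHom (by rw [cutVertex_zero, cutVertex_last])

theorem map_cutHom {m N : ℕ} {k : Fin m → ℕ} (h : ∑ i, k i = N) (x : Fin (N + 1) → X.Obj)
    {B B' : Fin m → E.UnaryAlgebra} (s : B ⟶ B') (t : ∀ i, B' i ⟶
      X.homAlgebra (x (subVertex h i 0)) (x (subVertex h i (Fin.last (k i))))) :
    (W.lift m).map s ≫ X.cutHom hι h x t = X.cutHom hι h x fun i => s i ≫ t i := by
  refine (Category.assoc _ _ _).symm.trans (congrArg (· ≫ _) ?_)
  refine (X.map_pathHom hι s _ _).trans (congrArg (X.pathHom hι _) (funext fun i => ?_))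
  exact (Category.assoc _ _ _).symm

theorem cutHom_heq {m N : ℕ} {k : Fin m → ℕ} (h : ∑ i, k i = N) (x : Fin (N + 1) → X.Obj)
    {B B' : Fin m → E.UnaryAlgebra} (t : ∀ i, B i ⟶
      X.homAlgebra (x (subVertex h i 0)) (x (subVertex h i (Fin.last (k i)))))
    (hB : ∀ i, B i = B' i) {y : Fin (m + 1) → X.Obj} (hy : ∀ t, x (cutVertex h t) = y t)
    (t' : ∀ i, B' i ⟶ X.homAlgebra (y i.castSucc) (y i.succ)) (ht : ∀ i, t i ≍ t' i) :
    X.cutHom hι h x t ≍ X.pathHom hι y t' := by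
  refine (comp_eqToHom_heq _ _).trans (X.pathHom_heq hι rfl (fun i i' hi => ?_) (fun s s' hs => ?_)
    fun i i' hi => ?_)
  · obtain rfl := Fin.ext hi
    exact hB i
  · obtain rfl := Fin.ext hs
    exact hy s
  · obtain rfl := Fin.ext hi
    exact (comp_eqToHom_heq _ _).trans (ht i)

end ECategory

namespace Multitensor.Letters

variable [HasInitial V] (hE : E.AbsorbsInitial)

omit [HasLimitsOfSize.{w, w} V] in
/-- The algebras between the vertices of a cut. -/
theorem homAlgebra_cut {m N : ℕ} {k : Fin m → ℕ} (h : ∑ i, k i = N)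
    (Z : Fin N → E.UnaryAlgebra) (i : Fin m) :
    ((W.lift (k i)).obj fun j => Z (pos h i j)) = (W.intervals Z hE).homAlgebra
      (allVertices W hE Z (cutVertex h i.castSucc)) (allVertices W hE Z (cutVertex h i.succ)) :=
  (W.homAlgebra_intervals hE (a := allVertices W hE Z (cutVertex h i.castSucc))
    (b := allVertices W hE Z (cutVertex h i.succ)) (Fin.partialSum_succ k i) fun _ _ hq =>
      congrArg Z (Fin.ext hq.symm)).symm

omit [HasLimitsOfSize.{w, w} V] in
theorem homAlgebra_cut_all {m N : ℕ} {k : Fin m → ℕ} (h : ∑ i, k i = N)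
    (Z : Fin N → E.UnaryAlgebra) :
    (W.intervals Z hE).homAlgebra (allVertices W hE Z (cutVertex h 0))
      (allVertices W hE Z (cutVertex h (Fin.last m))) = (W.lift N).obj Z := by
  rw [cutVertex_zero, cutVertex_last]
  exact W.homAlgebra_intervals hE (Nat.zero_add N).symm fun p q hq =>
    congrArg Z (Fin.ext ((Nat.zero_add (p : ℕ)).symm.trans hq.symm))

/-- The substitution of operations of the initial module. -/
noncomputable def substHom {m N : ℕ} {k : Fin m → ℕ} (h : ∑ i, k i = N)
    (Z : Fin N → E.UnaryAlgebra) :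
    ((W.lift m).obj fun i => (W.lift (k i)).obj fun j => Z (pos h i j)) ⟶ (W.lift N).obj Z :=
  (W.intervals Z hE).pathHom hι (fun t => allVertices W hE Z (cutVertex h t))
      (fun i => eqToHom (homAlgebra_cut hE h Z i)) ≫
    eqToHom (homAlgebra_cut_all hE h Z)

/-- The family `f` extends to a functor from the category of intervals to `X`. Pushing the
interpretation that defines the substitution along this functor gives the interpretation in `X`
along the cut path. With `lift_hom_ext`, this reduces every axiom of the multitensor to a statement
about interpretations. -/
theorem substHom_pathHom (X : ECategory E) {m N : ℕ} {k : Fin m → ℕ} (h : ∑ i, k i = N)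
    {Z : Fin N → E.UnaryAlgebra} (x : Fin (N + 1) → X.Obj)
    (f : ∀ i, Z i ⟶ X.homAlgebra (x i.castSucc) (x i.succ)) :
    substHom hι hE h Z ≫ X.pathHom hι x f = X.cutHom hι h x fun i =>
      X.pathHom hι (Z := fun j => Z (pos h i j)) (fun t => x (subVertex h i t))
        (subMaps (G := X.homAlgebra) h f i) := by
  -- On the whole interval `F` is the interpretation along `x`, and on each block it is the
  -- interpretation along the corresponding subpath; `h2` and `h3` record this.
  let F := evalFunctor hE (pathMaps hι X).toInterpretation x f
  have h1 := pathHom_map hι F (fun t => allVertices W hE Z (cutVertex h t))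
    (fun i => eqToHom (homAlgebra_cut hE h Z i))
  have h2 : F.homMap (allVertices W hE Z (cutVertex h 0))
      (allVertices W hE Z (cutVertex h (Fin.last m))) ≍ X.pathHom hι x f := by
    refine algebra_hom_heq (homAlgebra_cut_all hE h Z) (congrArg₂ X.homAlgebra
      (congrArg x (cutVertex_zero h)) (congrArg x (cutVertex_last h))) ?_
    refine evalFunctor_map_heq (a := allVertices W hE Z (cutVertex h 0))
      (b := allVertices W hE Z (cutVertex h (Fin.last m)))
      (pathMaps hι X).toInterpretation x f (n := N) ?_ (fun p q hq => ?_) x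
      (fun s r hr => congrArg x (Fin.ext (hr.trans ?_).symm)) f fun p q hq => ?_
    · change (cutVertex h (Fin.last m) : ℕ) = cutVertex h 0 + N
      rw [cutVertex_zero, cutVertex_last]
      exact (Nat.zero_add N).symm
    · refine congrArg Z (Fin.ext (hq.trans ?_).symm)
      change (cutVertex h 0 : ℕ) + p = p
      rw [cutVertex_zero]
      exact Nat.zero_add _
    · change (cutVertex h 0 : ℕ) + s = s
      rw [cutVertex_zero]
      exact Nat.zero_add _
    · refine heq_pathMap (G := X.homAlgebra) f (Fin.ext (hq.trans ?_).symm)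
      change (cutVertex h 0 : ℕ) + p = p
      rw [cutVertex_zero]
      exact Nat.zero_add _
  have h3 (i : Fin m) : F.homMap (allVertices W hE Z (cutVertex h i.castSucc))
      (allVertices W hE Z (cutVertex h i.succ)) ≍
      X.pathHom hι (Z := fun j => Z (pos h i j)) (fun t => x (subVertex h i t))
        (subMaps (G := X.homAlgebra) h f i) := by
    refine algebra_hom_heq (homAlgebra_cut hE h Z i).symm (congrArg (X.homAlgebra _)
      (congrArg x (subVertex_last h i).symm)) ?_
    exact evalFunctor_map_heq (pathMaps hι X).toInterpretation x f (n := k i)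
      (Fin.partialSum_succ k i) (fun p q hq => congrArg Z (Fin.ext hq.symm)) _
      (fun s r hr => congrArg x (Fin.ext hr.symm)) _
      fun p q hq => heq_pathMap (G := X.homAlgebra) f (Fin.ext hq.symm)
  apply eq_of_heq
  have h4 : X.homAlgebra (x (cutVertex h 0)) (x (cutVertex h (Fin.last m))) =
      X.homAlgebra (x 0) (x (Fin.last N)) := by rw [cutVertex_zero, cutVertex_last]
  refine HEq.trans (ECategory.heq_comp rfl (homAlgebra_cut_all hE h Z).symm h4.symm
    (comp_eqToHom_heq _ _) h2.symm) ((heq_of_eq h1).trans (HEq.symm ?_))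
  refine X.cutHom_heq hι h x _ (fun i => rfl) (fun t => rfl) _ fun i => ?_
  exact ((eqToHom_comp_heq _ _).trans (h3 i)).symm

/-- The associative law as seen in `X`: interpreting a substitution and then cutting is the same as
cutting twice. The maps `t` into the homs are arbitrary, so that it also applies to interpretations
of inner operations. -/
theorem substHom_cutHom (X : ECategory E) {m K N : ℕ} {k : Fin m → ℕ} (hk : ∑ i, k i = K)
    {l : Fin K → ℕ} (hl : ∑ q, l q = N) {n : Fin m → ℕ} (hn : ∀ i, ∑ j, l (pos hk i j) = n i)
    (hN : ∑ i, n i = N) (x : Fin (N + 1) → X.Obj) {B : Fin K → E.UnaryAlgebra}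
    (t : ∀ q, B q ⟶ X.homAlgebra (x (subVertex hl q 0)) (x (subVertex hl q (Fin.last (l q)))))
    {B' : ∀ i, Fin (k i) → E.UnaryAlgebra}
    (t' : ∀ i j, B' i j ⟶ X.homAlgebra
      (x (subVertex hN i (subVertex (k := fun j => l (pos hk i j)) (hn i) j 0)))
      (x (subVertex hN i (subVertex (k := fun j => l (pos hk i j)) (hn i) j
        (Fin.last (l (pos hk i j)))))))
    (hB : ∀ i j, B (pos hk i j) = B' i j) (ht : ∀ i j, t (pos hk i j) ≍ t' i j) :
    substHom hι hE hk B ≫ X.cutHom hι hl x t ≍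
      X.cutHom hι hN x fun i => X.cutHom hι (k := fun j => l (pos hk i j)) (hn i)
        (fun s => x (subVertex hN i s)) (t' i) := by
  have hv := cutVertex_subVertex hk hl hn hN
  have hc := cutVertex_cutVertex hk hl hn hN
  refine (heq_of_eq (Category.assoc _ _ _).symm).trans ((comp_eqToHom_heq _ _).trans ?_)
  refine (heq_of_eq (substHom_pathHom hι hE X hk (fun t => x (cutVertex hl t)) _)).trans ?_
  refine HEq.trans ?_ (comp_eqToHom_heq _ _).symm
  refine X.cutHom_heq hι hk _ _ (fun i => congrArg (W.lift (k i)).obj (funext (hB i)))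
    (fun t => congrArg x (hc t)) _ fun i => ?_
  refine HEq.trans (HEq.symm ?_) (comp_eqToHom_heq _ _).symm
  refine X.cutHom_heq hι (hn i) (fun s => x (subVertex hN i s)) (t' i) (fun j => (hB i j).symm)
    (fun t => congrArg x (hv i t).symm) _ fun j => ?_
  exact (ht i j).symm.trans (comp_eqToHom_heq _ _).symm

variable {hE}

theorem substHom_naturality {m N : ℕ} {k : Fin m → ℕ} (h : ∑ i, k i = N)
    {Z Z' : Fin N → E.UnaryAlgebra} (φ : Z ⟶ Z') :
    (W.lift m).map (X := fun i => (W.lift (k i)).obj fun j => Z (pos h i j))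
        (Y := fun i => (W.lift (k i)).obj fun j => Z' (pos h i j))
        (fun i => (W.lift (k i)).map (X := fun j => Z (pos h i j)) (Y := fun j => Z' (pos h i j))
          fun j => φ (pos h i j)) ≫ substHom hι hE h Z' =
      substHom hι hE h Z ≫ (W.lift N).map φ := by
  refine lift_hom_ext hι hE fun X x f => ?_
  rw [Category.assoc, Category.assoc, substHom_pathHom, X.map_pathHom, substHom_pathHom]
  refine (X.map_cutHom hι h x _ _).trans (congrArg (X.cutHom hι h x) (funext fun i => ?_))
  exact X.map_pathHom hι _ _ _

/-- In `X` the substitution along the trivial cut is the interpretation of a single letter, and a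
letter is interpreted by the map assigned to it. -/
theorem unit_substHom {n : ℕ} (h : ∑ _i : Fin 1, n = n) (Z : Fin n → E.UnaryAlgebra) :
    ι.hom ((W.lift n).obj Z) ≫ eqToHom (by simp only [pos_one]) ≫
      substHom hι hE (k := fun _ => n) h Z = 𝟙 ((W.lift n).obj Z) := by
  refine lift_hom_ext hι hE fun X x f => ?_
  rw [Category.assoc, Category.assoc, substHom_pathHom, Category.id_comp]
  have hB (i : Fin 1) : ((W.lift n).obj fun j => Z (pos (k := fun _ => n) h i j)) =
      (W.lift n).obj Z := congrArg (W.lift n).obj (funext fun j => congrArg Z (pos_one h i j))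
  let y : Fin 2 → X.Obj := ![x 0, x (Fin.last n)]
  have hy : ∀ t : Fin 2, x (cutVertex (k := fun _ => n) h t) = y t := by
    intro t
    fin_cases t
    · exact congrArg x (cutVertex_zero h)
    · exact congrArg x (cutVertex_last (k := fun _ => n) h)
  have hf (i : Fin 1) : X.homAlgebra (x 0) (x (Fin.last n)) =
      X.homAlgebra (y i.castSucc) (y i.succ) := by
    rw [Subsingleton.elim i 0]
    rfl
  have h1 := X.cutHom_heq hι (k := fun _ => n) h x (fun i =>
      X.pathHom hι (Z := fun j => Z (pos h i j)) (fun t => x (subVertex h i t))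
        (subMaps (G := X.homAlgebra) h f i)) hB hy
      (fun i => X.pathHom hι x f ≫ eqToHom (hf i)) fun i => ?_
  · apply eq_of_heq
    refine HEq.trans (ECategory.heq_comp rfl rfl rfl HEq.rfl
      ((eqToHom_comp_heq _ _).trans h1)) ?_
    refine (heq_of_eq (ι.hom_pathHom hι X y _)).trans ?_
    exact comp_eqToHom_heq _ _
  · refine HEq.trans ?_ (comp_eqToHom_heq _ _).symm
    refine X.pathHom_heq hι rfl (fun j j' hj => ?_) (fun t t' ht => ?_) fun j j' hj => ?_
    · exact congrArg Z ((pos_one h i j).trans (Fin.ext hj))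
    · exact congrArg x ((subVertex_one h i t).trans (Fin.ext ht))
    · exact heq_pathMap (G := X.homAlgebra) f ((pos_one h i j).trans (Fin.ext hj))

/-- In `X` each block consists of one edge, and a letter is interpreted by the map assigned to that
edge; what remains is the interpretation along `x`. -/
theorem map_unit_substHom {n : ℕ} (h : ∑ _i : Fin n, 1 = n) (Z : Fin n → E.UnaryAlgebra) :
    (W.lift n).map (X := Z) (Y := fun i => (W.lift 1).obj fun _ => Z i) (fun i => ι.hom (Z i)) ≫
      eqToHom (by simp only [pos_const_one]) ≫
      substHom hι hE (k := fun _ => 1) h Z = 𝟙 ((W.lift n).obj Z) := by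
  refine lift_hom_ext hι hE fun X x f => ?_
  rw [Category.assoc, Category.assoc, substHom_pathHom, Category.id_comp]
  have hB (i : Fin n) : ((W.lift 1).obj fun j => Z (pos (k := fun _ => 1) h i j)) =
      (W.lift 1).obj fun _ => Z i :=
    congrArg (W.lift 1).obj (funext fun j => congrArg Z (pos_const_one h i j))
  have hs0 (i : Fin n) : subVertex (k := fun _ => 1) h i 0 = i.castSucc := subVertex_const_one h i 0
  have hs1 (i : Fin n) : subVertex (k := fun _ => 1) h i (Fin.last 1) = i.succ :=
    subVertex_const_one h i 1
  let y (i : Fin n) : Fin 2 → X.Obj := ![x i.castSucc, x i.succ]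
  have hf (i : Fin n) (j : Fin 1) : X.homAlgebra (x i.castSucc) (x i.succ) =
      X.homAlgebra (y i j.castSucc) (y i j.succ) := by
    rw [Subsingleton.elim j 0]
    rfl
  let f' (i : Fin n) : ((W.lift 1).obj fun _ => Z i) ⟶ X.homAlgebra (x i.castSucc) (x i.succ) :=
    X.pathHom hι (Z := fun _ : Fin 1 => Z i) (y i) (fun j => f i ≫ eqToHom (hf i j))
  have h1 := X.cutHom_heq hι (k := fun _ => 1) h x (fun i =>
      X.pathHom hι (Z := fun j => Z (pos h i j)) (fun t => x (subVertex h i t))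
        (subMaps (G := X.homAlgebra) h f i)) hB (fun t => congrArg x (cutVertex_const_one h t))
      f' fun i => ?_
  · have h2 := X.map_pathHom hι (fun i => ι.hom (Z i)) x f'
    have h3 : (fun i => ι.hom (Z i) ≫ f' i) = f := by
      funext i
      refine (ι.hom_pathHom hι X (y i) _).trans ?_
      exact Category.comp_id _
    rw [h3] at h2
    refine Eq.trans (congrArg (_ ≫ ·) (eq_of_heq ?_)) h2
    exact (eqToHom_comp_heq _ _).trans h1
  · refine X.pathHom_heq hι rfl (fun j j' hj => ?_) (fun t t' ht => ?_) fun j j' hj => ?_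
    · exact congrArg Z (pos_const_one h i j)
    · obtain rfl := Fin.ext ht
      fin_cases t
      · exact congrArg x (hs0 i)
      · exact congrArg x (hs1 i)
    · exact (heq_pathMap (G := X.homAlgebra) f (pos_const_one h i j)).trans
        (comp_eqToHom_heq _ _).symm

theorem substHom_substHom {m K N : ℕ} {k : Fin m → ℕ} (hk : ∑ i, k i = K) {l : Fin K → ℕ}
    (hl : ∑ q, l q = N) {n : Fin m → ℕ} (hn : ∀ i, ∑ j, l (pos hk i j) = n i)
    (hN : ∑ i, n i = N) (Z : Fin N → E.UnaryAlgebra) :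
    substHom hι hE hk (fun q => (W.lift (l q)).obj fun p => Z (pos hl q p)) ≫
        substHom hι hE hl Z =
      eqToHom (by simp only [pos_pos hk hl hn hN]) ≫
        (W.lift m).map
          (X := fun i => (W.lift (k i)).obj fun j => (W.lift (l (pos hk i j))).obj fun p =>
            Z (pos hN i (pos (k := fun j => l (pos hk i j)) (hn i) j p)))
          (Y := fun i => (W.lift (n i)).obj fun q => Z (pos hN i q))
          (fun i => substHom hι hE (k := fun j => l (pos hk i j)) (hn i) fun q => Z (pos hN i q)) ≫
        substHom hι hE hN Z := by
  refine lift_hom_ext hι hE fun X x f => ?_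
  rw [Category.assoc, Category.assoc, Category.assoc, substHom_pathHom, substHom_pathHom,
    X.map_cutHom]
  apply eq_of_heq
  refine HEq.trans ?_ (eqToHom_comp_heq _ _).symm
  refine HEq.trans ?_ (heq_of_eq (congrArg (X.cutHom hι hN x) (funext fun i =>
    substHom_pathHom hι hE X (hn i) (fun t => x (subVertex hN i t))
      (subMaps (G := X.homAlgebra) hN f i)))).symm
  refine substHom_cutHom hι hE X hk hl hn hN x _ _ (fun i j => ?_) fun i j => ?_
  · exact congrArg (W.lift (l (pos hk i j))).obj
      (funext fun p => congrArg Z (pos_pos hk hl hn hN i j p))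
  · refine X.pathHom_heq hι rfl (fun p p' hp => ?_) (fun t t' ht => ?_) fun p p' hp => ?_
    · obtain rfl := Fin.ext hp
      exact congrArg Z (pos_pos hk hl hn hN i j p)
    · obtain rfl := Fin.ext ht
      exact congrArg x (subVertex_subVertex hk hl hn hN i j t)
    · obtain rfl := Fin.ext hp
      exact heq_pathMap (G := X.homAlgebra) f (pos_pos hk hl hn hN i j p)

variable (hE)

/-- The multitensor of the initial module. -/
noncomputable def multitensor : Multitensor E.UnaryAlgebra where
  tensor := W.lift
  unit := ι.hom
  subst := substHom hι hE
  unit_naturality f := (ι.hom_naturality f).symm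
  subst_naturality h _ _ f := substHom_naturality hι h f
  unit_subst h Z := unit_substHom hι h Z
  tensor_unit_subst h Z := map_unit_substHom hι h Z
  subst_subst hk _ hl _ hn hN Z := substHom_substHom hι hk hl hn hN Z

end Multitensor.Letters

open ECategory Multitensor EModule

theorem algebra_eqToHom_f {V : Type u} [Category.{w} V] {T : Monad V} {X Y : T.Algebra}
    (h : X = Y) : (eqToHom h).f = eqToHom (congrArg Monad.Algebra.A h) := by
  subst h
  rfl

/-! ### Equality of enriched categories and functors from equality of their compositions. -/

namespace ECategory

variable {V : Type u} [Category.{w} V] {E : Multitensor V}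

theorem ext_of_heq {X Y : ECategory E} (hO : X.Obj = Y.Obj) (hH : X.Hom ≍ Y.Hom)
    (hc : @ECategory.comp V _ E X ≍ @ECategory.comp V _ E Y) : X = Y := by
  obtain ⟨⟨O, H⟩, c, _, _⟩ := X
  obtain ⟨⟨O', H'⟩, c', _, _⟩ := Y
  cases hO
  cases hH
  cases hc
  rfl

theorem comp_heq_of_forall {S : Type w} {H H' : S → S → V} (hH : H = H')
    {c : ∀ {n : ℕ} (x : Fin (n + 1) → S), ((E.tensor n).obj fun i => H (x i.castSucc) (x i.succ)) ⟶
      H (x 0) (x (Fin.last n))}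
    {c' : ∀ {n : ℕ} (x : Fin (n + 1) → S),
      ((E.tensor n).obj fun i => H' (x i.castSucc) (x i.succ)) ⟶ H' (x 0) (x (Fin.last n))}
    (h : ∀ {n : ℕ} (x : Fin (n + 1) → S), c x ≍ c' x) : @c ≍ @c' := by
  subst hH
  refine heq_of_eq ?_
  funext n x
  exact eq_of_heq (h x)

theorem EFunctor.heq_of_toMap {X X' Y Y' : ECategory E} (hX : X = X') (hY : Y = Y')
    {f : EFunctor X Y} {f' : EFunctor X' Y'} (h : f.toMap ≍ f'.toMap) : f ≍ f' := by
  subst hX hY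
  exact heq_of_eq (EFunctor.ext (eq_of_heq h))

theorem map_heq_of_forall {S S' : Type w} {H H₁ : S → S → V} {H' H₁' : S' → S' → V} (hH : H = H₁)
    (hH' : H' = H₁') {o : S → S'} {m : ∀ a b, H a b ⟶ H' (o a) (o b)}
    {m₁ : ∀ a b, H₁ a b ⟶ H₁' (o a) (o b)} (h : ∀ a b, m a b ≍ m₁ a b) :
    (EGraph.Map.mk o m : EGraph.Map ⟨S, H⟩ ⟨S', H'⟩) ≍
      (EGraph.Map.mk o m₁ : EGraph.Map ⟨S, H₁⟩ ⟨S', H₁'⟩) := by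
  subst hH hH'
  obtain rfl : m = m₁ := funext fun a => funext fun b => eq_of_heq (h a b)
  rfl

end ECategory

/-! ### The isomorphism between `E`-categories and categories enriched in the lift. -/

namespace Multitensor.Letters

variable {V : Type u} [Category.{w} V] {E : Multitensor V} {W : EModule E E.UnaryAlgebra}
  {ι : Letters W} (hι : ι.IsInitial) [HasLimitsOfSize.{w, w} V] [HasInitial V]
  (hE : E.AbsorbsInitial)

/-- An `E`-category as a category enriched in the multitensor of the initial module. -/
noncomputable def enrichObj (X : ECategory E) : ECategory (multitensor hι hE) where
  Obj := X.Obj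
  Hom := X.homAlgebra
  comp {n} x := X.pathHom hι x fun i => 𝟙 (X.homAlgebra (x i.castSucc) (x i.succ))
  unit_comp x := by
    have e : (fun _ : Fin 1 => X.homAlgebra (x 0) (x 1)) =
        fun i : Fin 1 => X.homAlgebra (x i.castSucc) (x i.succ) := by
      funext i
      rw [Subsingleton.elim i 0]
      rfl
    have h1 := ι.hom_pathHom hι X x fun i => eqToHom (congrFun e i)
    refine Eq.trans (congrArg (ι.hom _ ≫ ·) (eq_of_heq ?_)) h1
    refine (eqToHom_comp_heq _ _).trans (X.pathHom_heq hι rfl (fun i i' hi => ?_)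
      (fun t t' ht => congrArg x (Fin.ext ht)) fun i i' hi => ?_)
    · obtain rfl := Fin.ext hi
      exact (congrFun e i).symm
    · obtain rfl := Fin.ext hi
      have key : ∀ {B B' : E.UnaryAlgebra} (h : B = B'), 𝟙 B' ≍ eqToHom h := by
        rintro B _ rfl
        rfl
      exact key _
  subst_comp {m k N} h x := by
    refine (substHom_pathHom hι hE X h x _).trans ?_
    refine Eq.trans ?_ (Category.assoc _ _ _)
    refine congrArg (· ≫ _) (Eq.symm ?_)
    refine (X.map_pathHom hι _ _ _).trans (congrArg (X.pathHom hι _) (funext fun i => ?_))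
    exact Category.comp_id _

/-- `E`-categories as categories enriched in the multitensor of the initial module. -/
noncomputable def enrich : ECategory E ⥤ ECategory (multitensor hι hE) where
  obj X := enrichObj hι hE X
  map {X Y} F :=
    { obj := F.obj
      map := F.homMap
      comp_map := fun {n} x => by
        refine (pathHom_map hι F x _).trans (Eq.symm ?_)
        refine (Y.map_pathHom hι _ _ _).trans (congrArg (Y.pathHom hι _) (funext fun i => ?_))
        exact (Category.comp_id _).trans (Category.id_comp _).symm }

variable (ι)

theorem sum_one_eq (n : ℕ) : ∑ _i : Fin n, 1 = n := by simp

/-- The operations of `E` applied to letters. -/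
noncomputable def letterOp {n : ℕ} (Z : Fin n → E.UnaryAlgebra) :
    ((E.tensor n).obj fun i => (Z i).A) ⟶ (W.obj n).obj Z :=
  (E.tensor n).map (X := fun i => (Z i).A) (Y := fun i => (W.obj 1).obj fun _ => Z i)
      (fun i => ι.nat.app fun _ => Z i) ≫
    eqToHom (by
      change _ = (E.tensor n).obj fun i => (W.obj 1).obj fun j => Z (pos (sum_one_eq n) i j)
      simp only [pos_const_one]) ≫
    (W.act (k := fun _ => 1) (sum_one_eq n)).app Z

omit [HasLimitsOfSize.{w, w} V] [HasInitial V] in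
theorem letterOp_naturality {n : ℕ} {Z Z' : Fin n → E.UnaryAlgebra} (φ : Z ⟶ Z') :
    (E.tensor n).map (X := fun i => (Z i).A) (Y := fun i => (Z' i).A) (fun i => (φ i).f) ≫
      ι.letterOp Z' = ι.letterOp Z ≫ (W.obj n).map φ := by
  have h1 := (W.act (k := fun _ => 1) (sum_one_eq n)).naturality φ
  have h2 : (E.tensor n).map (X := fun i => (Z i).A) (Y := fun i => (Z' i).A) (fun i => (φ i).f) ≫
      (E.tensor n).map (Y := fun i => (W.obj 1).obj fun _ => Z' i)
        (fun i => ι.nat.app fun _ => Z' i) =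
      (E.tensor n).map (X := fun i => (Z i).A) (Y := fun i => (W.obj 1).obj fun _ => Z i)
        (fun i => ι.nat.app fun _ => Z i) ≫
      (E.tensor n).map (Y := fun i => (W.obj 1).obj fun _ => Z' i)
        (fun i => (W.obj 1).map (X := fun _ => Z i) (Y := fun _ => Z' i) fun _ => φ i) := by
    refine ((E.tensor n).map_comp _ _).symm.trans (Eq.trans ?_ ((E.tensor n).map_comp _ _))
    exact congrArg _ (funext fun i => ι.nat.naturality (X := fun _ => Z i) (Y := fun _ => Z' i)
      fun _ => φ i)
  have hp (Z : Fin n → E.UnaryAlgebra) (i : Fin n) :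
      (fun j => Z (pos (k := fun _ => 1) (sum_one_eq n) i j)) = fun _ => Z i :=
    funext fun j => congrArg Z (pos_const_one _ i j)
  have hB (Z : Fin n → E.UnaryAlgebra) (i : Fin n) := congrArg (W.obj 1).obj (hp Z i)
  unfold letterOp
  rw [← Category.assoc, h2, Category.assoc, Category.assoc, Category.assoc]
  refine congrArg (_ ≫ ·) (eq_of_heq ?_)
  refine HEq.trans ?_ ((heq_of_eq h1).trans (eqToHom_comp_heq _ _).symm)
  refine ECategory.heq_comp (congrArg _ (funext fun i => (hB Z i).symm))
    (congrArg _ (funext fun i => (hB Z' i).symm)) rfl ?_ (eqToHom_comp_heq _ _)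
  exact heq_tensor_map (fun i => (hB Z i).symm) (fun i => (hB Z' i).symm) fun i =>
    heq_map _ (hp Z i).symm (hp Z' i).symm fun j => heq_pi_app φ (pos_const_one _ i j).symm

omit [HasLimitsOfSize.{w, w} V] [HasInitial V] in
theorem unit_letterOp (Z : E.UnaryAlgebra) :
    E.unit Z.A ≫ ι.letterOp (fun _ : Fin 1 => Z) = ι.nat.app fun _ => Z := by
  have h1 := E.unit_naturality (ι.nat.app fun _ => Z)
  have h2 := congrArg (fun α => α.app fun _ => Z) (W.unit_act (sum_one_eq 1))
  refine (Category.assoc _ _ _).symm.trans ((congrArg (· ≫ _) h1).trans ?_)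
  refine (Category.assoc _ _ _).trans ?_
  refine (congrArg (ι.nat.app (fun _ => Z) ≫ ·) ?_).trans (Category.comp_id _)
  exact (Category.assoc _ _ _).symm.trans h2

-- After naturality of the substitution of `E` at the letters, this is the associativity of the
-- module for the double cut whose innermost blocks have length one.
omit [HasLimitsOfSize.{w, w} V] [HasInitial V] in
theorem subst_letterOp {m N : ℕ} {k : Fin m → ℕ} (h : ∑ i, k i = N) (Z : Fin N → E.UnaryAlgebra) :
    E.subst h (fun p => (Z p).A) ≫ ι.letterOp Z =
      (E.tensor m).map (X := fun i => (E.tensor (k i)).obj fun j => (Z (pos h i j)).A)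
        (Y := fun i => (W.obj (k i)).obj fun j => Z (pos h i j))
        (fun i => ι.letterOp fun j => Z (pos h i j)) ≫ (W.act h).app Z := by
  have h1 := E.subst_naturality h (W := fun p => (Z p).A)
    (W' := fun p => (W.obj 1).obj fun _ => Z p) fun p => ι.nat.app fun _ => Z p
  have h2 := congrArg (fun α => α.app Z) (W.subst_act (l := fun _ => 1) h (sum_one_eq N)
    (n := k) (fun i => sum_one_eq (k i)) h)
  have hB (q : Fin N) : ((W.obj 1).obj fun j => Z (pos (k := fun _ => 1) (sum_one_eq N) q j)) =
      (W.obj 1).obj fun _ => Z q :=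
    congrArg (W.obj 1).obj (funext fun j => congrArg Z (pos_const_one _ q j))
  have hB' (i : Fin m) (j : Fin (k i)) : ((W.obj 1).obj fun p =>
      Z (pos h i (pos (k := fun _ => 1) (sum_one_eq (k i)) j p))) =
      (W.obj 1).obj fun _ => Z (pos h i j) :=
    congrArg (W.obj 1).obj (funext fun p => congrArg (fun r => Z (pos h i r)) (pos_const_one _ j p))
  have h3 : E.subst h (fun p => (W.obj 1).obj fun _ => Z p) ≫
      eqToHom (congrArg _ (funext fun q => (hB q).symm)) ≫
      (W.act (k := fun _ => 1) (sum_one_eq N)).app Z =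
      ((E.tensor m).map (X := fun i => (E.tensor (k i)).obj fun j => (W.obj 1).obj fun _ =>
          Z (pos h i j)) (Y := fun i => (W.obj (k i)).obj fun j => Z (pos h i j))
        fun i => eqToHom (congrArg _ (funext fun j => (hB' i j).symm)) ≫
          (W.act (k := fun _ => 1) (sum_one_eq (k i))).app fun j => Z (pos h i j)) ≫
      (W.act h).app Z := by
    apply eq_of_heq
    refine HEq.trans ?_ ((heq_of_eq h2).trans ?_)
    · exact ECategory.heq_comp (congrArg _ (funext fun i => congrArg _ (funext fun j => (hB _).symm)))
        (congrArg _ (funext fun q => (hB q).symm)) rfl (heq_subst h fun q => (hB q).symm)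
        (eqToHom_comp_heq _ _)
    · refine ECategory.heq_comp (f := (E.evalBlock h (l := fun _ => 1) (sum_one_eq N)
        (n := k) (fun i => sum_one_eq (k i)) h fun i => W.act (sum_one_eq (k i))).app Z)
        (congrArg _ (funext fun i => congrArg _ (funext fun j => hB _))) rfl rfl
        ((eqToHom_comp_heq _ _).trans ?_) HEq.rfl
      exact heq_tensor_map (fun i => congrArg _ (funext fun j => hB' i j)) (fun i => rfl)
        fun i => (eqToHom_comp_heq _ _).symm
  refine (Category.assoc _ _ _).symm.trans ((congrArg (· ≫ _) h1.symm).trans ?_)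
  refine (Category.assoc _ _ _).trans ((congrArg (_ ≫ ·) h3).trans ?_)
  refine (Category.assoc _ _ _).symm.trans (congrArg (· ≫ (W.act h).app Z) ?_)
  exact ((E.tensor m).map_comp _ _).symm

variable {ι}

-- The path is cut into its edges: interpretations respect the action, and each letter is
-- interpreted by its own map, so an operation of `E` on letters becomes the composition of `X`.
omit [HasInitial V] in
theorem letterOp_pathMap (X : ECategory E) {n : ℕ} {Z : Fin n → E.UnaryAlgebra}
    (x : Fin (n + 1) → X.Obj) (f : ∀ i, Z i ⟶ X.homAlgebra (x i.castSucc) (x i.succ)) :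
    ι.letterOp Z ≫ X.pathMap hι x f =
      (E.tensor n).map (X := fun i => (Z i).A) (Y := fun i => X.Hom (x i.castSucc) (x i.succ))
        (fun i => (f i).f) ≫ X.comp x := by
  let h := sum_one_eq n
  have h1 := X.act_pathMap hι (k := fun _ => 1) h x f
  have hB (i : Fin n) : ((W.obj 1).obj fun j => Z (pos (k := fun _ => 1) h i j)) =
      (W.obj 1).obj fun _ => Z i :=
    congrArg (W.obj 1).obj (funext fun j => congrArg Z (pos_const_one h i j))
  let y (i : Fin n) : Fin 2 → X.Obj := ![x i.castSucc, x i.succ]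
  have hf (i : Fin n) (j : Fin 1) : X.homAlgebra (x i.castSucc) (x i.succ) =
      X.homAlgebra (y i j.castSucc) (y i j.succ) := by
    rw [Subsingleton.elim j 0]
    rfl
  let f' (i : Fin n) : ((W.obj 1).obj fun _ => Z i) ⟶ X.Hom (x i.castSucc) (x i.succ) :=
    X.pathMap hι (Z := fun _ : Fin 1 => Z i) (y i) (fun j => f i ≫ eqToHom (hf i j))
  have h2 : (W.act (k := fun _ => 1) h).app Z ≫ X.pathMap hι x f ≍
      (E.tensor n).map (X := fun i => (W.obj 1).obj fun _ => Z i)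
        (Y := fun i => X.Hom (x i.castSucc) (x i.succ)) f' ≫ X.comp x := by
    refine (heq_of_eq h1).trans ?_
    refine X.cutComp_heq (k := fun _ => 1) h x _ _ hB (fun i => ?_)
      (fun t => congrArg x (cutVertex_const_one h t)) _ HEq.rfl (fun _ => rfl) rfl
    refine (pathMaps hι X).toInterpretation.app_heq rfl (fun j j' hj => ?_) (fun t t' ht => ?_)
      fun j j' hj => ?_
    · exact congrArg Z (pos_const_one h i j)
    · obtain rfl := Fin.ext ht
      fin_cases t
      · exact congrArg x (subVertex_const_one h i 0)
      · exact congrArg x (subVertex_const_one h i 1)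
    · exact (heq_pathMap (G := X.homAlgebra) f (pos_const_one h i j)).trans
        (comp_eqToHom_heq _ _).symm
  have h3 (i : Fin n) : ι.nat.app (fun _ => Z i) ≫ f' i = (f i).f := by
    refine (X.letter_pathMap hι (y i) _).trans ?_
    exact congrArg Monad.Algebra.Hom.f (Category.comp_id (f i))
  have h4 : (E.tensor n).map (X := fun i => (Z i).A) (Y := fun i => (W.obj 1).obj fun _ => Z i)
      (fun i => ι.nat.app fun _ => Z i) ≫ (E.tensor n).map f' =
      (E.tensor n).map fun i => (f i).f :=
    ((E.tensor n).map_comp _ _).symm.trans (congrArg _ (funext h3))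
  refine Eq.trans ?_ ((Category.assoc _ _ _).symm.trans (congrArg (· ≫ X.comp x) h4))
  refine (Category.assoc _ _ _).trans (congrArg (_ ≫ ·) ?_)
  refine (Category.assoc _ _ _).trans (eq_of_heq ?_)
  exact (eqToHom_comp_heq _ _).trans h2

/-- The substitution is an interpretation in the category of intervals. By `letterOp_pathMap`,
preceding it by the operation on letters yields the composition of that category, which is the
action. -/
theorem letterOp_substHom {m N : ℕ} {k : Fin m → ℕ} (h : ∑ i, k i = N)
    (Z : Fin N → E.UnaryAlgebra) :
    ι.letterOp (fun i => (W.lift (k i)).obj fun j => Z (pos h i j)) ≫ (substHom hι hE h Z).f =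
      (W.act h).app Z := by
  have h1 := letterOp_pathMap hι (W.intervals Z hE) (fun t => allVertices W hE Z (cutVertex h t))
    (fun i => eqToHom (homAlgebra_cut hE h Z i))
  have h2 : (substHom hι hE h Z).f = (W.intervals Z hE).pathMap hι
      (fun t => allVertices W hE Z (cutVertex h t)) (fun i => eqToHom (homAlgebra_cut hE h Z i)) ≫
        eqToHom (congrArg Monad.Algebra.A (homAlgebra_cut_all hE h Z)) :=
    congrArg (_ ≫ ·) (algebra_eqToHom_f _)
  rw [h2, ← Category.assoc, h1]
  apply eq_of_heq
  refine (comp_eqToHom_heq _ _).trans ?_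
  have h0 : cutVertex h 0 = 0 := cutVertex_zero h
  have h3 : (W.intervals Z hE).comp (fun t => allVertices W hE Z (cutVertex h t)) ≍
      (W.act h).app Z :=
    intervalComp_heq hE h (fun i => Fin.partialSum_succ k i) fun p q hq => by
      have hq' : (q : ℕ) = cutVertex h 0 + p := hq
      rw [h0] at hq'
      exact congrArg Z (Fin.ext (hq'.trans (Nat.zero_add _)).symm)
  have h4 : ((E.tensor m).map (X := fun i => (W.obj (k i)).obj fun j => Z (pos h i j))
      (Y := fun i => (W.intervals Z hE).Hom (allVertices W hE Z (cutVertex h i.castSucc))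
        (allVertices W hE Z (cutVertex h i.succ)))
      fun i => (eqToHom (homAlgebra_cut hE h Z i)).f) ≍ 𝟙 ((blockOp h (E.tensor m)).obj W.obj |>.obj Z) := by
    refine HEq.trans (b := (E.tensor m).map (𝟙 fun i => (W.obj (k i)).obj fun j => Z (pos h i j))) ?_
      (heq_of_eq ((E.tensor m).map_id _))
    refine heq_tensor_map (fun _ => rfl)
      (fun i => (congrArg Monad.Algebra.A (homAlgebra_cut hE h Z i)).symm) fun i => ?_
    rw [algebra_eqToHom_f]
    have key : ∀ {B B' : V} (h : B = B'), eqToHom h ≍ 𝟙 B := by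
      rintro B _ rfl
      rfl
    exact key _
  refine (ECategory.heq_comp rfl (congrArg _ (funext fun i =>
    (congrArg Monad.Algebra.A (homAlgebra_cut hE h Z i)).symm))
    (congrArg Monad.Algebra.A (homAlgebra_cut_all hE h Z)) h4 h3).trans ?_
  exact heq_of_eq (Category.id_comp _)

/-- The action followed by the composition of a category enriched in the multitensor of the initial
module. -/
theorem act_comp (Y : ECategory (multitensor hι hE)) {m N : ℕ} {k : Fin m → ℕ} (h : ∑ i, k i = N)
    (x : Fin (N + 1) → Y.Obj) :
    (W.act h).app (fun q => Y.Hom (x q.castSucc) (x q.succ)) ≫ (Y.comp x).f =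
      (E.tensor m).map
          (X := fun i => (W.obj (k i)).obj fun j =>
            Y.Hom (x (subVertex h i j.castSucc)) (x (subVertex h i j.succ)))
          (Y := fun i => (Y.Hom (x (cutVertex h i.castSucc)) (x (cutVertex h i.succ))).A)
          (fun i => (Y.comp fun t => x (subVertex h i t)).f ≫
            eqToHom (by rw [subVertex_last]; rfl)) ≫
        (ι.letterOp (fun i => Y.Hom (x (cutVertex h i.castSucc)) (x (cutVertex h i.succ))) ≫
          (Y.comp fun t => x (cutVertex h t)).f) ≫
        eqToHom (by rw [cutVertex_zero, cutVertex_last]) := by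
  have h1 := congrArg Monad.Algebra.Hom.f (Y.subst_comp h x)
  have h2 := letterOp_substHom hι hE h (fun q => Y.Hom (x q.castSucc) (x q.succ))
  let s (i : Fin m) : ((W.lift (k i)).obj fun j =>
      Y.Hom (x (subVertex h i j.castSucc)) (x (subVertex h i j.succ))) ⟶
      Y.Hom (x (cutVertex h i.castSucc)) (x (cutVertex h i.succ)) :=
    Y.comp (fun t => x (subVertex h i t)) ≫ eqToHom (by rw [subVertex_last]; rfl)
  have h3 := ι.letterOp_naturality s
  have h4 (i : Fin m) : (s i).f = (Y.comp fun t => x (subVertex h i t)).f ≫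
      eqToHom (by rw [subVertex_last]; rfl) :=
    congrArg (_ ≫ ·) (algebra_eqToHom_f _)
  refine (congrArg (· ≫ (Y.comp x).f) h2.symm).trans ?_
  refine (Category.assoc _ _ _).trans ((congrArg (_ ≫ ·) h1).trans ?_)
  refine Eq.trans (Category.assoc _ _ _).symm ?_
  refine (congrArg (· ≫ _) h3.symm).trans ?_
  refine (Category.assoc _ _ _).trans ?_
  refine (congrArg (· ≫ _) (congrArg _ (funext h4))).trans (congrArg (_ ≫ ·) ?_)
  refine Eq.trans ?_ (Category.assoc _ _ _).symm
  refine congrArg (_ ≫ ·) ?_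
  exact congrArg (_ ≫ ·) (algebra_eqToHom_f _)

/-- The letters are the unit of the lifted multitensor, so this is the underlying map of the unit
law of `Y`. -/
theorem nat_comp (Y : ECategory (multitensor hι hE)) (x : Fin 2 → Y.Obj)
    (h : ((W.obj 1).obj fun _ => Y.Hom (x 0) (x 1)) =
      (W.obj 1).obj fun i => Y.Hom (x i.castSucc) (x i.succ)) :
    ι.nat.app (fun _ => Y.Hom (x 0) (x 1)) ≫ eqToHom h ≫ (Y.comp x).f =
      𝟙 (Y.Hom (x 0) (x 1)).A := by
  have e : (fun _ : Fin 1 => Y.Hom (x 0) (x 1)) = fun i => Y.Hom (x i.castSucc) (x i.succ) := by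
    funext i
    rw [Subsingleton.elim i 0]
    rfl
  have h1 : (eqToHom (congrArg (W.lift 1).obj e)).f = eqToHom h := algebra_eqToHom_f _
  exact (congrArg (fun r => ι.nat.app (fun _ => Y.Hom (x 0) (x 1)) ≫ r ≫ (Y.comp x).f)
    h1.symm).trans (congrArg Monad.Algebra.Hom.f (Y.unit_comp x))

/-- A category enriched in the multitensor of the initial module as an `E`-category. -/
noncomputable def unenrichObj (Y : ECategory (multitensor hι hE)) : ECategory E where
  Obj := Y.Obj
  Hom a b := (Y.Hom a b).A
  comp {n} x := ι.letterOp (fun i => Y.Hom (x i.castSucc) (x i.succ)) ≫ (Y.comp x).f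
  unit_comp x := by
    have e : (fun _ : Fin 1 => Y.Hom (x 0) (x 1)) = fun i => Y.Hom (x i.castSucc) (x i.succ) := by
      funext i
      rw [Subsingleton.elim i 0]
      rfl
    have h2 := ι.unit_letterOp (Y.Hom (x 0) (x 1))
    have h3 : ∀ {Z Z' : Fin 1 → E.UnaryAlgebra} (h : Z = Z') (h') (h''),
        eqToHom h' ≫ ι.letterOp Z' = ι.letterOp Z ≫ eqToHom h'' := by
      rintro Z _ rfl _ _
      exact (Category.id_comp _).trans (Category.comp_id _).symm
    refine Eq.trans ?_ (nat_comp hι hE Y x (congrArg (W.obj 1).obj e))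
    refine (congrArg (_ ≫ ·) ((Category.assoc _ _ _).symm.trans
      (congrArg (· ≫ (Y.comp x).f) (h3 e _ (congrArg (W.obj 1).obj e))))).trans ?_
    refine (congrArg (_ ≫ ·) (Category.assoc _ _ _)).trans ?_
    exact (Category.assoc _ _ _).symm.trans (congrArg (· ≫ _) h2)
  subst_comp h x := by
    refine (Category.assoc _ _ _).symm.trans ((congrArg (· ≫ (Y.comp x).f)
      (ι.subst_letterOp h fun q => Y.Hom (x q.castSucc) (x q.succ))).trans ?_)
    refine (Category.assoc _ _ _).trans ((congrArg (_ ≫ ·) (act_comp hι hE Y h x)).trans ?_)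
    refine (Category.assoc _ _ _).symm.trans (congrArg (· ≫ _) ?_)
    refine ((E.tensor _).map_comp _ _).symm.trans (congrArg _ (funext fun i => ?_))
    exact (Category.assoc _ _ _).symm

/-- The categories enriched in the multitensor of the initial module as `E`-categories. -/
noncomputable def unenrich : ECategory (multitensor hι hE) ⥤ ECategory E where
  obj Y := unenrichObj hι hE Y
  map {Y Y'} F :=
    { obj := F.obj
      map := fun a b => (F.map a b).f
      comp_map := fun {n} x => by
        have h1 := congrArg Monad.Algebra.Hom.f (F.comp_map x)
        have h2 := ι.letterOp_naturality (Z := fun i => Y.Hom (x i.castSucc) (x i.succ))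
          (Z' := fun i => Y'.Hom (F.obj (x i.castSucc)) (F.obj (x i.succ)))
          fun i => F.map (x i.castSucc) (x i.succ)
        refine (Category.assoc _ _ _).trans ((congrArg (_ ≫ ·) h1).trans ?_)
        refine (Category.assoc _ _ _).symm.trans ((congrArg (· ≫ _) h2.symm).trans ?_)
        exact Category.assoc _ _ _ }

/-- Interpreting along identities and preceding by the operation on letters returns the composition
of `X`, by `letterOp_pathMap`. -/
theorem unenrichObj_enrichObj (X : ECategory E) :
    unenrichObj hι hE (enrichObj hι hE X) = X := by
  refine ext_of_heq rfl HEq.rfl (comp_heq_of_forall rfl fun {n} x => heq_of_eq ?_)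
  refine (letterOp_pathMap hι X x _).trans ?_
  refine (congrArg (· ≫ X.comp x) ?_).trans (Category.id_comp _)
  exact (E.tensor n).map_id _

theorem enrich_unenrich : enrich hι hE ⋙ unenrich hι hE = 𝟭 (ECategory E) :=
  CategoryTheory.Functor.hext (unenrichObj_enrichObj hι hE) fun X Y _ =>
    EFunctor.heq_of_toMap (unenrichObj_enrichObj hι hE X) (unenrichObj_enrichObj hι hE Y) HEq.rfl

omit [HasLimitsOfSize.{w, w} V] [HasInitial V] in
theorem letterOp_const (Z : E.UnaryAlgebra) :
    ι.letterOp (fun _ : Fin 1 => Z) = Z.a ≫ ι.nat.app fun _ => Z := by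
  refine Eq.trans ?_ (ι.linear (sum_one_eq 1) Z).symm
  exact congrArg (_ ≫ ·) (Category.id_comp _)

/-- A unary operation applied to a letter is the algebra action followed by the letter, by
linearity; the unit law of `Y` then removes the letter. So the given algebra structures are
recovered, not only the underlying objects. -/
theorem homAlgebra_unenrichObj (Y : ECategory (multitensor hι hE)) (a b : Y.Obj) :
    (unenrichObj hι hE Y).homAlgebra a b = Y.Hom a b := by
  refine algebra_ext rfl (heq_of_eq ?_)
  have e : (fun _ : Fin 1 => Y.Hom a b) =
      fun i : Fin 1 => Y.Hom (![a, b] i.castSucc) (![a, b] i.succ) := by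
    funext i
    rw [Subsingleton.elim i 0]
    rfl
  have h3 : ∀ {Z Z' : Fin 1 → E.UnaryAlgebra} (h : Z = Z') (h') (h''),
      eqToHom h' ≫ ι.letterOp Z' = ι.letterOp Z ≫ eqToHom h'' := by
    rintro Z _ rfl _ _
    exact (Category.id_comp _).trans (Category.comp_id _).symm
  refine ((Category.assoc _ _ _).symm.trans
      (congrArg (· ≫ (Y.comp ![a, b]).f) (h3 e _ (congrArg (W.obj 1).obj e)))).trans ?_
  refine (congrArg (fun r => (r ≫ _) ≫ _) (letterOp_const (Y.Hom a b))).trans ?_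
  refine (Category.assoc _ _ _).trans ((Category.assoc _ _ _).trans ?_)
  exact (congrArg (_ ≫ ·) (nat_comp hι hE Y ![a, b] (congrArg (W.obj 1).obj e))).trans
    (Category.comp_id _)

/-- The functoriality of `W` followed by the composition of `Y` is an interpretation with the same
letters, so it is the one given by initiality. -/
theorem pathMap_unenrichObj (Y : ECategory (multitensor hι hE)) {n : ℕ}
    (x : Fin (n + 1) → Y.Obj) :
    (unenrichObj hι hE Y).pathMap hι (W := W)
        (Z := fun i => Y.Hom (x i.castSucc) (x i.succ)) x
        (fun _ => eqToHom (homAlgebra_unenrichObj hι hE Y _ _).symm) = (Y.comp x).f := by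
  let P : PathMaps ι (unenrichObj hι hE Y) (G := Y.Hom)
      (fun a b => eqToHom (homAlgebra_unenrichObj hι hE Y a b).symm) :=
    { app := fun {n Z} x f => (W.obj n).map (Y := fun i => Y.Hom (x i.castSucc) (x i.succ)) f ≫
        (Y.comp x).f
      naturality := fun {n Z Z'} φ x f => by
        refine (Category.assoc _ _ _).symm.trans (congrArg (· ≫ (Y.comp x).f) ?_)
        exact ((W.obj n).map_comp _ _).symm
      -- Naturality of the action moves the maps `f` past it; `act_comp` then says that the action
      -- followed by the composition of `Y` is composition along the cut.
      act := fun {m N k} h {Z} x f => by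
        have h1 := (W.act h).naturality (Y := fun i => Y.Hom (x i.castSucc) (x i.succ)) f
        refine (Category.assoc _ _ _).symm.trans ((congrArg (· ≫ (Y.comp x).f) h1.symm).trans ?_)
        refine (Category.assoc _ _ _).trans ((congrArg (_ ≫ ·) (act_comp hι hE Y h x)).trans ?_)
        refine (Category.assoc _ _ _).symm.trans (congrArg (· ≫ _) ?_)
        refine ((E.tensor _).map_comp _ _).symm.trans (congrArg _ (funext fun i => ?_))
        exact (Category.assoc _ _ _).symm
      letter := fun {Z} x f => by
        have e : (fun _ : Fin 1 => Y.Hom (x 0) (x 1)) =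
            fun i => Y.Hom (x i.castSucc) (x i.succ) := by
          funext i
          rw [Subsingleton.elim i 0]
          rfl
        have h1 := ι.nat.naturality (X := fun _ => Z) (Y := fun _ => Y.Hom (x 0) (x 1))
          fun _ => f 0
        have h2 : (W.obj 1).map (Y := fun i => Y.Hom (x i.castSucc) (x i.succ)) f =
            (W.obj 1).map (X := fun _ => Z) (Y := fun _ => Y.Hom (x 0) (x 1)) (fun _ => f 0) ≫
              eqToHom (congrArg (W.obj 1).obj e) := by
          refine eq_of_heq (HEq.trans ?_ (comp_eqToHom_heq _ _).symm)
          refine heq_map _ rfl e.symm fun i => ?_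
          obtain rfl : i = 0 := Subsingleton.elim _ _
          rfl
        refine (congrArg (fun r => _ ≫ r ≫ (Y.comp x).f) h2).trans ?_
        refine (congrArg (_ ≫ ·) (Category.assoc _ _ _)).trans ?_
        refine (Category.assoc _ _ _).symm.trans ((congrArg (· ≫ _) h1.symm).trans ?_)
        refine (Category.assoc _ _ _).trans ?_
        refine (congrArg (_ ≫ ·) (nat_comp hι hE Y x (congrArg (W.obj 1).obj e))).trans ?_
        have h3 : (f 0 ≫ eqToHom (homAlgebra_unenrichObj hι hE Y (x 0) (x 1)).symm).f =
            (f 0).f ≫ 𝟙 _ := congrArg ((f 0).f ≫ ·) (algebra_eqToHom_f _)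
        exact h3.symm }
  have h := P.app_eq hι x fun i => 𝟙 _
  refine Eq.trans ?_ (h.symm.trans ?_)
  · exact congrArg _ (funext fun i => (Category.id_comp _).symm)
  · exact (congrArg (· ≫ (Y.comp x).f) ((W.obj n).map_id _)).trans (Category.id_comp _)

theorem enrichObj_unenrichObj (Y : ECategory (multitensor hι hE)) :
    enrichObj hι hE (unenrichObj hι hE Y) = Y := by
  have hH : (unenrichObj hι hE Y).homAlgebra = Y.Hom :=
    funext fun a => funext fun b => homAlgebra_unenrichObj hι hE Y a b
  refine ext_of_heq rfl (heq_of_eq hH) (comp_heq_of_forall hH fun {n} x => ?_)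
  refine algebra_hom_heq (congrArg (W.lift n).obj (funext fun i => congrFun (congrFun hH _) _))
    (congrFun (congrFun hH _) _) ?_
  refine HEq.trans ?_ (heq_of_eq (pathMap_unenrichObj hι hE Y x))
  refine (pathMaps hι (unenrichObj hι hE Y)).toInterpretation.app_heq rfl (fun i i' hi => ?_)
    (fun t t' ht => congrArg x (Fin.ext ht)) fun i i' hi => ?_
  · obtain rfl := Fin.ext hi
    exact congrFun (congrFun hH _) _
  · obtain rfl := Fin.ext hi
    have key : ∀ {B B' : E.UnaryAlgebra} (h : B = B'), 𝟙 B' ≍ eqToHom h := by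
      rintro B _ rfl
      rfl
    exact key _

theorem unenrich_enrich :
    unenrich hι hE ⋙ enrich hι hE = 𝟭 (ECategory (multitensor hι hE)) :=
  CategoryTheory.Functor.hext (enrichObj_unenrichObj hι hE) fun X Y F =>
    EFunctor.heq_of_toMap (enrichObj_unenrichObj hι hE X) (enrichObj_unenrichObj hι hE Y) (by
      refine map_heq_of_forall (o := F.obj)
        (funext fun a => funext fun b => homAlgebra_unenrichObj hι hE X a b)
        (funext fun a => funext fun b => homAlgebra_unenrichObj hι hE Y a b) fun a b => ?_
      exact algebra_hom_heq (homAlgebra_unenrichObj hι hE X a b)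
        (homAlgebra_unenrichObj hι hE Y _ _) HEq.rfl)

/-- The isomorphism between `E`-categories and the categories enriched in the multitensor of the
initial module. -/
noncomputable def enrichIso :
    IsoOver (forgetToUnary E) (forget (multitensor hι hE)) where
  hom := enrich hι hE
  inv := unenrich hι hE
  hom_inv := enrich_unenrich hι hE
  inv_hom := unenrich_enrich hι hE
  comm := rfl

end Multitensor.Letters

open ECategory Multitensor EModule

/-! ### Gluing modules in low and high degrees. -/

/-- The data for gluing a retract of a module in low degrees to another module in high degrees. -/
structure GluingData {V : Type u} [Category.{w} V] {E : Multitensor V} {A : Type u₁}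
    [Category.{v₁} A] (T W : EModule E A) where
  /-- a morphism of modules -/
  hom : T.obj ⟶ W.obj
  isHom : T.IsHom W hom
  /-- the glued family -/
  obj : OpFamily A V
  /-- the maps to the module -/
  out : obj ⟶ W.obj
  /-- the degrees in which the retract is used -/
  low : ℕ → Prop
  low_of_sum {m N : ℕ} {k : Fin m → ℕ} (h : ∑ i, k i = N) (hN : low N) (i : Fin m) : low (k i)
  /-- the retraction -/
  ret (n : ℕ) (hn : low n) : T.obj n ⟶ obj n
  /-- the section -/
  sec (n : ℕ) (hn : low n) : obj n ⟶ T.obj n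
  sec_ret (n : ℕ) (hn : low n) : sec n hn ≫ ret n hn = 𝟙 _
  ret_out (n : ℕ) (hn : low n) : ret n hn ≫ out n = hom n
  /-- the inverse in high degrees -/
  high (n : ℕ) (hn : ¬low n) : W.obj n ⟶ obj n
  out_high (n : ℕ) (hn : ¬low n) : out n ≫ high n hn = 𝟙 _
  high_out (n : ℕ) (hn : ¬low n) : high n hn ≫ out n = 𝟙 _
  act_ret {m N : ℕ} {k : Fin m → ℕ} (h : ∑ i, k i = N) (hN : low N) :
    blockMap h (E.tensor m) (fun i => ret _ (low_of_sum h hN i) ≫ sec _ (low_of_sum h hN i)) ≫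
      T.act h ≫ ret N hN = T.act h ≫ ret N hN

namespace GluingData

variable {V : Type u} [Category.{w} V] {E : Multitensor V} {A : Type u₁} [Category.{v₁} A]
  {T W : EModule E A} (D : GluingData T W)

open Classical in
/-- The action on the glued family. -/
noncomputable def act {m N : ℕ} {k : Fin m → ℕ} (h : ∑ i, k i = N) :
    (blockOp h (E.tensor m)).obj D.obj ⟶ D.obj N :=
  if hN : D.low N then
    blockMap h (E.tensor m) (fun i => D.sec _ (D.low_of_sum h hN i)) ≫ T.act h ≫ D.ret N hN
  else (blockOp h (E.tensor m)).map D.out ≫ W.act h ≫ D.high N hN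

/-- The glued action first applies the sections. Replacing each entry by its image under the
idempotent `ret ≫ sec` is invisible after the outer retraction, by `act_ret`, so the retractions
commute with the actions. -/
theorem ret_act {m N : ℕ} {k : Fin m → ℕ} (h : ∑ i, k i = N) (hN : D.low N) :
    blockMap h (E.tensor m) (fun i => D.ret _ (D.low_of_sum h hN i)) ≫ D.act h =
      T.act h ≫ D.ret N hN := by
  rw [act, dif_pos hN, ← Category.assoc, ← blockMap_comp]
  exact D.act_ret h hN

/-- In low degrees the retraction followed by `out` is the morphism `hom`, which respects the
actions; in high degrees the glued action is defined by passing through `W`. -/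
theorem act_out {m N : ℕ} {k : Fin m → ℕ} (h : ∑ i, k i = N) :
    (blockOp h (E.tensor m)).map D.out ≫ W.act h = D.act h ≫ D.out N := by
  by_cases hN : D.low N
  · have hl := D.low_of_sum h hN
    have h1 : blockMap h (E.tensor m) (fun i => D.sec _ (hl i)) ≫
        (blockOp h (E.tensor m)).map D.hom = (blockOp h (E.tensor m)).map D.out := by
      rw [← blockMap_eq_map, ← blockMap_eq_map, ← blockMap_comp]
      refine congrArg (blockMap h (E.tensor m)) (funext fun i => ?_)
      rw [← D.ret_out _ (hl i), ← Category.assoc, D.sec_ret, Category.id_comp]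
    rw [act, dif_pos hN, Category.assoc, Category.assoc, D.ret_out, ← D.isHom h, ← Category.assoc,
      h1]
  · rw [act, dif_neg hN, Category.assoc, Category.assoc, D.high_out, Category.comp_id]

/-- The glued module. -/
noncomputable def module : EModule E A where
  obj := D.obj
  act := D.act
  unit_act {N} h := by
    by_cases hN : D.low N
    · rw [act, dif_pos hN, ← Category.assoc, ← E.unitBlock_blockMap h (D.sec N hN), Category.assoc,
        ← Category.assoc (E.unitBlock h T.obj), T.unit_act, Category.id_comp, D.sec_ret]
    · rw [act, dif_neg hN, ← Category.assoc, ← E.unitBlock_naturality, Category.assoc,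
        ← Category.assoc (E.unitBlock h W.obj), W.unit_act, Category.id_comp, D.out_high]
  subst_act {m K N k} hk {l} hl {n} hn hN := by
    by_cases h : D.low N
    -- All blocks are low as well. The associativity of `T` is transported through the sections, and
    -- the retraction after each inner action is absorbed by `ret_act`.
    · have hn' := D.low_of_sum hN h
      have hl' := D.low_of_sum hl h
      have h1 := E.blockMap_evalBlock hk hl hn hN
        (fun i => blockMap (hn i) (E.tensor (k i)) (fun j => D.sec _ (hl' (pos hk i j))) ≫ T.act (hn i))
        (fun i => T.act (hn i)) (fun q => D.sec _ (hl' q)) (fun i => 𝟙 _)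
        fun i => (Category.comp_id _).symm
      have h2 := E.blockMap_evalBlock hk hl hn hN
        (fun i => blockMap (hn i) (E.tensor (k i)) (fun j => D.sec _ (hl' (pos hk i j))) ≫ T.act (hn i))
        (fun i => D.act (hn i)) (fun q => 𝟙 (D.obj (l q))) (fun i => D.ret _ (hn' i)) fun i => by
          rw [blockMap_id, Category.id_comp, act, dif_pos (hn' i), Category.assoc]
      rw [blockMap_id, Category.id_comp] at h2
      rw [blockMap_id, Category.comp_id] at h1
      rw [h2, Category.assoc, D.ret_act hN h, ← h1, act, dif_pos h, ← Category.assoc,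
        ← blockMap_substBlock, Category.assoc, Category.assoc, ← Category.assoc (E.substBlock _ _ _),
        T.subst_act hk hl hn hN, Category.assoc]
    -- The total degree is high, though blocks may be low; `act_out` maps all inner actions to `W`,
    -- whose associativity is then used.
    · have h1 := E.evalBlock_naturality hk hl hn hN (fun i => D.act (hn i)) (fun i => W.act (hn i))
        D.out D.out fun i => D.act_out (hn i)
      rw [act, dif_neg h, act, dif_neg h, ← Category.assoc, ← E.substBlock_naturality,
        Category.assoc, ← Category.assoc (E.substBlock _ _ _), W.subst_act hk hl hn hN,
        Category.assoc, ← Category.assoc, h1, Category.assoc]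

theorem isHom_out : D.module.IsHom W D.out := fun _ _ _ h => D.act_out h

end GluingData

open ECategory Multitensor EModule

namespace EModule

variable {V : Type u} [Category.{w} V] {E : Multitensor V} {A : Type u₁} [Category.{v₁} A]

theorem isHom_id (M : EModule E A) : M.IsHom M (𝟙 _) := fun m N k h => by
  refine (congrArg (· ≫ _) ((blockOp h (E.tensor m)).map_id _)).trans ?_
  exact (Category.id_comp _).trans (Category.comp_id _).symm

theorem IsHom.comp {M M' M'' : EModule E A} {φ : M.obj ⟶ M'.obj} {ψ : M'.obj ⟶ M''.obj}
    (hφ : M.IsHom M' φ) (hψ : M'.IsHom M'' ψ) : M.IsHom M'' (φ ≫ ψ) := fun m N k h => by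
  refine (congrArg (· ≫ _) ((blockOp h (E.tensor m)).map_comp _ _)).trans ?_
  refine (Category.assoc _ _ _).trans ((congrArg (_ ≫ ·) (hψ h)).trans ?_)
  refine (Category.assoc _ _ _).symm.trans ((congrArg (· ≫ _) (hφ h)).trans ?_)
  exact Category.assoc _ _ _

end EModule

/-! ### Invertibility of the letters of the initial module. -/

namespace Multitensor

variable {V : Type u} [Category.{w} V] (E : Multitensor V)

/-- The operations `E_n` applied to the values of a functor, as a module. -/
def selfModule {A : Type u₁} [Category.{v₁} A] (U : A ⥤ V) : EModule E A where
  obj n := (Functor.pi' fun i => Pi.eval _ i ⋙ U) ⋙ E.tensor n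
  act {m N k} h :=
    { app := fun Z => E.subst h fun p => U.obj (Z p)
      naturality := fun Z Z' f => E.subst_naturality h fun p => U.map (f p) }
  unit_act {N} h := by
    ext Z
    exact (Category.assoc _ _ _).trans (E.unit_subst h _)
  subst_act hk l hl n hn hN := by
    ext Z
    exact (E.subst_subst hk hl hn hN fun p => U.obj (Z p)).trans (Category.assoc _ _ _).symm

variable {E} {W : EModule E E.UnaryAlgebra} (ι : Letters W)

namespace Letters

/-- The morphism from the free operations to a module with letters. -/
noncomputable def fromFree : (E.selfModule E.unaryMonad.forget).obj ⟶ W.obj := fun _ =>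
  { app := fun Z => ι.letterOp Z
    naturality := fun _ _ φ => ι.letterOp_naturality φ }

theorem isHom_fromFree : (E.selfModule E.unaryMonad.forget).IsHom W ι.fromFree := fun m N k h => by
  ext Z
  exact (ι.subst_letterOp h Z).symm

/-- The operations of a module with the letters themselves in degree one, and the free operation in
degree zero. -/
def normalFamily (W : EModule E E.UnaryAlgebra) : OpFamily E.UnaryAlgebra V
  | 0 => (E.selfModule E.unaryMonad.forget).obj 0
  | 1 => E.letterFunctor
  | n + 2 => W.obj (n + 2)

/-- The retraction of the free operations in low degrees. -/
def normalRet (W : EModule E E.UnaryAlgebra) :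
    ∀ n, n ≤ 1 → ((E.selfModule E.unaryMonad.forget).obj n ⟶ normalFamily W n)
  | 0, _ => 𝟙 _
  | 1, _ =>
    { app := fun Z => eqToHom (congrArg (E.tensor 1).obj
          (funext fun i => congrArg (fun i => (Z i).A) (Subsingleton.elim i 0))) ≫ (Z 0).a
      naturality := fun Z Z' f => by
        obtain ⟨X, rfl⟩ : ∃ X, Z = fun _ => X :=
          ⟨Z 0, funext fun i => by rw [Subsingleton.elim i 0]⟩
        obtain ⟨X', rfl⟩ : ∃ X, Z' = fun _ => X :=
          ⟨Z' 0, funext fun i => by rw [Subsingleton.elim i 0]⟩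
        obtain ⟨f, rfl⟩ : ∃ g : X ⟶ X', f = fun _ => g :=
          ⟨f 0, funext fun i => by rw [Subsingleton.elim i 0]⟩
        refine (congrArg (_ ≫ ·) (Category.id_comp _)).trans ?_
        exact f.h.trans (congrArg (· ≫ f.f) (Category.id_comp _).symm) }

/-- The section of the retraction of the free operations. -/
def normalSec (W : EModule E E.UnaryAlgebra) :
    ∀ n, n ≤ 1 → (normalFamily W n ⟶ (E.selfModule E.unaryMonad.forget).obj n)
  | 0, _ => 𝟙 _
  | 1, _ =>
    { app := fun Z => E.unit (Z 0).A ≫ eqToHom (congrArg (E.tensor 1).obj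
          (funext fun i => congrArg (fun i => (Z i).A) (Subsingleton.elim 0 i)))
      naturality := fun Z Z' f => by
        obtain ⟨X, rfl⟩ : ∃ X, Z = fun _ => X :=
          ⟨Z 0, funext fun i => by rw [Subsingleton.elim i 0]⟩
        obtain ⟨X', rfl⟩ : ∃ X, Z' = fun _ => X :=
          ⟨Z' 0, funext fun i => by rw [Subsingleton.elim i 0]⟩
        obtain ⟨f, rfl⟩ : ∃ g : X ⟶ X', f = fun _ => g :=
          ⟨f 0, funext fun i => by rw [Subsingleton.elim i 0]⟩
        refine (congrArg (_ ≫ ·) (Category.comp_id _)).trans ?_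
        refine (E.unit_naturality f.f).symm.trans ?_
        exact congrArg (· ≫ _) (Category.comp_id _).symm }

/-- The map of the family with letters in degree one to the module. -/
noncomputable def normalOut : normalFamily W ⟶ W.obj
  | 0 => ι.fromFree 0
  | 1 => ι.nat
  | _ + 2 => 𝟙 _

theorem normalSec_ret : ∀ (n : ℕ) (hn : n ≤ 1), normalSec W n hn ≫ normalRet W n hn = 𝟙 _
  | 0, _ => Category.id_comp _
  | 1, _ => by
    ext Z
    obtain ⟨X, rfl⟩ : ∃ X, Z = fun _ => X := ⟨Z 0, funext fun i => by rw [Subsingleton.elim i 0]⟩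
    refine Eq.trans ?_ X.unit
    refine (congrArg (_ ≫ ·) (Category.id_comp _)).trans ?_
    exact congrArg (· ≫ X.a) (Category.comp_id _)

theorem normalRet_out : ∀ (n : ℕ) (hn : n ≤ 1), normalRet W n hn ≫ ι.normalOut n = ι.fromFree n
  | 0, _ => Category.id_comp _
  | 1, _ => by
    ext Z
    obtain ⟨X, rfl⟩ : ∃ X, Z = fun _ => X := ⟨Z 0, funext fun i => by rw [Subsingleton.elim i 0]⟩
    refine Eq.trans ?_ (ι.letterOp_const X).symm
    exact congrArg (· ≫ _) (Category.id_comp _)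

theorem normalRet_sec_of_eq_zero :
    ∀ (n : ℕ) (hn : n ≤ 1), n = 0 → normalRet W n hn ≫ normalSec W n hn = 𝟙 _
  | 0, _, _ => Category.id_comp _

/-- In degrees zero and one the idempotent is written uniformly as a section of the substitution
followed by the action of `X` on all entries. In degree zero the section is the identification of
the two empty tensors, in degree one it is the unit. -/
theorem exists_section (X : E.UnaryAlgebra) : ∀ (n : ℕ) (hn : n ≤ 1),
    ∃ θ : (E.tensor n).obj (fun _ => X.A) ⟶ (E.tensor n).obj fun _ => (E.tensor 1).obj fun _ => X.A,
      θ ≫ E.subst (k := fun _ => 1) (sum_one_eq n) (fun _ => X.A) = 𝟙 _ ∧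
      (normalRet W n hn ≫ normalSec W n hn).app (fun _ => X) =
        θ ≫ (E.tensor n).map (X := fun _ => (E.tensor 1).obj fun _ => X.A) (Y := fun _ => X.A)
          fun _ => X.a
  | 0, _ => by
    have e : (fun _ : Fin 0 => X.A) = fun _ => (E.tensor 1).obj fun _ => X.A :=
      funext fun i => i.elim0
    refine ⟨(E.tensor 0).map fun i => i.elim0, ?_, ?_⟩
    · have h1 := E.tensor_unit_subst (sum_one_eq 0) fun _ => X.A
      refine Eq.trans ?_ h1
      refine Eq.trans ?_ (congrArg (_ ≫ ·) (Category.id_comp _)).symm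
      exact congrArg (· ≫ _) (congrArg _ (funext fun i => i.elim0))
    · refine (Category.id_comp _).trans (Eq.trans ?_ ((E.tensor 0).map_comp _ _))
      exact ((E.tensor 0).map_id _).symm.trans (congrArg _ (funext fun i => i.elim0))
  | 1, _ => by
    refine ⟨E.unit _, ?_, ?_⟩
    · have h1 := E.unit_subst (sum_one_eq 1) fun _ => X.A
      exact (congrArg (_ ≫ ·) (Category.id_comp _)).symm.trans h1
    · refine Eq.trans ?_ (E.unit_naturality X.a).symm
      refine (congrArg (· ≫ _) (Category.id_comp _)).trans ?_
      exact congrArg (_ ≫ ·) (Category.comp_id _)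

/-- By associativity of the algebra `X`, acting inside the blocks before substituting and acting
again is the same as substituting at the inner level and acting once. The substitution at the inner
level is cancelled by `θ`. -/
theorem section_subst_a (X : E.UnaryAlgebra) {m : ℕ} {k : Fin m → ℕ} (h : ∑ i, k i = 1)
    (θ : ∀ i, (E.tensor (k i)).obj (fun _ => X.A) ⟶
      (E.tensor (k i)).obj fun _ => (E.tensor 1).obj fun _ => X.A)
    (hθ : ∀ i, θ i ≫ E.subst (k := fun _ => 1) (sum_one_eq (k i)) (fun _ => X.A) = 𝟙 _) :
    (E.tensor m).map (X := fun i => (E.tensor (k i)).obj fun _ => X.A)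
        (Y := fun i => (E.tensor (k i)).obj fun _ => X.A)
        (fun i => θ i ≫ (E.tensor (k i)).map (X := fun _ => (E.tensor 1).obj fun _ => X.A)
          (Y := fun _ => X.A) fun _ => X.a) ≫ E.subst h (fun _ => X.A) ≫ X.a =
      E.subst h (fun _ => X.A) ≫ X.a := by
  have h1 := E.subst_naturality h (W := fun _ => (E.tensor 1).obj fun _ => X.A)
    (W' := fun _ => X.A) fun _ => X.a
  have h2 := E.subst_subst h (l := fun _ => 1) (sum_one_eq 1) (n := k) (fun i => sum_one_eq (k i)) h
    fun _ => X.A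
  have h3 : E.subst (k := fun _ => 1) (sum_one_eq 1) (fun _ => X.A) ≫ X.a =
    (E.tensor 1).map (X := fun _ => (E.tensor 1).obj fun _ => X.A)
      (Y := fun _ => X.A) (fun _ => X.a) ≫ X.a := X.assoc
  have h4 := (E.tensor m).map_comp (X := fun i => (E.tensor (k i)).obj fun _ => X.A)
    (Y := fun i => (E.tensor (k i)).obj fun _ => (E.tensor 1).obj fun _ => X.A)
    (Z := fun i => (E.tensor (k i)).obj fun _ => X.A) θ
    (fun i => (E.tensor (k i)).map (X := fun _ => (E.tensor 1).obj fun _ => X.A)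
          (Y := fun _ => X.A) fun _ => X.a)
  have h5 := (E.tensor m).map_comp (X := fun i => (E.tensor (k i)).obj fun _ => X.A)
    (Y := fun i => (E.tensor (k i)).obj fun _ => (E.tensor 1).obj fun _ => X.A)
    (Z := fun i => (E.tensor (k i)).obj fun _ => X.A) θ
    (fun i => E.subst (k := fun _ => 1) (sum_one_eq (k i)) (fun _ => X.A))
  have h6 : (E.tensor m).map (X := fun i => (E.tensor (k i)).obj fun _ => X.A)
    (Y := fun i => (E.tensor (k i)).obj fun _ => X.A) (fun i => θ i ≫ E.subst (k := fun _ => 1)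
      (sum_one_eq (k i)) (fun _ => X.A)) = 𝟙 _ :=
    (congrArg _ (funext hθ)).trans ((E.tensor m).map_id _)
  refine (congrArg (· ≫ _) h4).trans ((Category.assoc _ _ _).trans ?_)
  refine (congrArg (_ ≫ ·) ((Category.assoc _ _ _).symm.trans (congrArg (· ≫ X.a) h1))).trans ?_
  refine (congrArg (_ ≫ ·) ((Category.assoc _ _ _).trans (congrArg (_ ≫ ·) h3.symm))).trans ?_
  refine (congrArg (_ ≫ ·) ((Category.assoc _ _ _).symm.trans (congrArg (· ≫ X.a) h2))).trans ?_
  refine (congrArg (_ ≫ ·) (congrArg (· ≫ X.a) (Category.id_comp _))).trans ?_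
  refine (congrArg (_ ≫ ·) (Category.assoc _ _ _)).trans ?_
  refine (Category.assoc _ _ _).symm.trans ?_
  exact (congrArg (· ≫ _) (h5.symm.trans h6)).trans (Category.id_comp _)

theorem le_one_of_sum {m N : ℕ} {k : Fin m → ℕ} (h : ∑ i, k i = N) (hN : N ≤ 1) (i : Fin m) :
    k i ≤ 1 :=
  (Finset.single_le_sum (fun _ _ => Nat.zero_le _) (Finset.mem_univ i)).trans (h.trans_le hN)

theorem act_normalRet (W : EModule E E.UnaryAlgebra) {m : ℕ} {k : Fin m → ℕ} :
    ∀ {N : ℕ} (h : ∑ i, k i = N) (hN : N ≤ 1),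
    blockMap h (E.tensor m) (fun i => normalRet W _ (le_one_of_sum h hN i) ≫
      normalSec W _ (le_one_of_sum h hN i)) ≫
      (E.selfModule E.unaryMonad.forget).act h ≫ normalRet W N hN =
        (E.selfModule E.unaryMonad.forget).act h ≫ normalRet W N hN
  -- All blocks are empty, and in degree zero the retraction and the section are identities.
  | 0, h, hN => by
    have h1 (i : Fin m) : k i = 0 :=
      Nat.le_zero.1 ((Finset.single_le_sum (fun _ _ => Nat.zero_le _)
        (Finset.mem_univ i)).trans h.le)
    have h2 : (fun i => normalRet W _ (le_one_of_sum h hN i) ≫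
      normalSec W _ (le_one_of_sum h hN i)) = fun i => 𝟙 _ :=
      funext fun i => normalRet_sec_of_eq_zero _ _ (h1 i)
    rw [h2, blockMap_id, Category.id_comp]
  | 1, h, hN => by
    ext Z
    obtain ⟨X, rfl⟩ : ∃ X, Z = fun _ => X := ⟨Z 0, funext fun i => by rw [Subsingleton.elim i 0]⟩
    choose θ hθ hθ' using fun i => exists_section (W := W) X (k i) (le_one_of_sum h hN i)
    have h1 := section_subst_a X h θ hθ
    have h2 := fun g => congrArg (E.subst h (fun _ => X.A) ≫ ·) (Category.id_comp (g : _ ⟶ X.A))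
    refine Eq.trans ?_ (h1.trans (h2 X.a).symm)
    refine (congrArg (_ ≫ ·) (h2 X.a)).trans (congrArg (· ≫ _) ?_)
    exact congrArg _ (funext hθ')

/-- The module with the letters themselves in degree one. -/
noncomputable def normalData : GluingData (E.selfModule E.unaryMonad.forget) W where
  hom := ι.fromFree
  isHom := ι.isHom_fromFree
  obj := normalFamily W
  out := ι.normalOut
  low n := n ≤ 1
  low_of_sum h hN i := le_one_of_sum h hN i
  ret := normalRet W
  sec := normalSec W
  sec_ret := normalSec_ret
  ret_out := ι.normalRet_out
  high
    | _ + 2, _ => 𝟙 _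
    | 0, hn => absurd (Nat.zero_le 1) hn
    | 1, hn => absurd le_rfl hn
  out_high
    | _ + 2, _ => Category.comp_id _
    | 0, hn => absurd (Nat.zero_le 1) hn
    | 1, hn => absurd le_rfl hn
  high_out
    | _ + 2, _ => Category.comp_id _
    | 0, hn => absurd (Nat.zero_le 1) hn
    | 1, hn => absurd le_rfl hn
  act_ret h hN := act_normalRet W h hN

/-- The letters of the module with the letters themselves in degree one. -/
noncomputable def normalLetters : Letters ι.normalData.module where
  nat := 𝟙 _
  linear h X := by
    have h1 := congrArg (fun α => α.app fun _ => X) (ι.normalData.ret_act h (le_refl 1))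
    have h2 : ((E.selfModule E.unaryMonad.forget).act h ≫ normalRet W 1 le_rfl).app (fun _ => X) =
        (E.tensor 1).map (X := fun _ => (E.tensor 1).obj fun _ => X.A)
      (Y := fun _ => X.A) (fun _ => X.a) ≫ X.a :=
      (congrArg (_ ≫ ·) (Category.id_comp X.a)).trans X.assoc
    have h3 := h1.trans h2
    have h4 : (normalRet W 1 le_rfl).app (fun _ => X) = X.a := Category.id_comp X.a
    have h5 : (E.tensor 1).map (X := fun _ => (E.tensor 1).obj fun _ => X.A)
      (Y := fun _ => X.A) (fun _ => X.a) ≫ (ι.normalData.act h).app (fun _ => X) =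
      (E.tensor 1).map (X := fun _ => (E.tensor 1).obj fun _ => X.A)
      (Y := fun _ => X.A) (fun _ => X.a) ≫ X.a := by
      refine Eq.trans ?_ h3
      refine congrArg (· ≫ (ι.normalData.act h).app (fun _ => X)) ?_
      exact congrArg _ (funext fun _ => h4.symm)
    have h6 : (E.tensor 1).map (X := fun _ => X.A) (Y := fun _ => (E.tensor 1).obj fun _ => X.A)
      (fun _ => E.unit X.A) ≫ (E.tensor 1).map (X := fun _ => (E.tensor 1).obj fun _ => X.A)
      (Y := fun _ => X.A) (fun _ => X.a) = 𝟙 _ := by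
      refine ((E.tensor 1).map_comp _ _).symm.trans (Eq.trans ?_ ((E.tensor 1).map_id _))
      exact congrArg _ (funext fun _ => X.unit)
    have h7 : (ι.normalData.act h).app (fun _ => X) = X.a := by
      -- `E_1` of the algebra action is a split epimorphism, with `E_1` of the unit as section, so
      -- it can be cancelled in `h5`.
      have key : ∀ {P Q R : V} {s : P ⟶ Q} {r : Q ⟶ P} {f g : P ⟶ R}, s ≫ r = 𝟙 P →
          r ≫ f = r ≫ g → f = g := fun {P Q R s r f g} h h' => by
        rw [← Category.id_comp f, ← h, Category.assoc, h', ← Category.assoc, h, Category.id_comp]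
      exact key h6 h5
    refine (Category.comp_id _).trans ?_
    refine Eq.trans ?_ (congrArg (· ≫ (ι.normalData.act h).app (fun _ => X))
      ((E.tensor 1).map_id (fun _ => X.A)).symm)
    exact h7.symm.trans (Category.id_comp _).symm

/-- The glued module has `Z` in degree one, identities as letters, and a morphism to `W` whose
component in degree one is the letter map. Initiality gives a morphism back from `W` that carries
the letters to identities, and shows that the composite endomorphism of `W` is the identity. In
degree one these are the two inverse laws. -/
theorem isIso_nat (hι : ι.IsInitial) : IsIso ι.nat := by
  obtain ⟨φ, ⟨h1, h2⟩, -⟩ := hι _ ι.normalLetters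
  obtain ⟨ψ, -, h3⟩ := hι W ι
  have h4 : φ ≫ ι.normalData.out = 𝟙 W.obj := by
    refine (h3 _ ⟨h1.comp ι.normalData.isHom_out, ?_⟩).trans (h3 _ ⟨W.isHom_id, ?_⟩).symm
    · refine (Category.assoc _ _ _).symm.trans ((congrArg (· ≫ ι.nat) h2).trans ?_)
      exact Category.id_comp _
    · exact Category.comp_id _
  exact ⟨φ 1, h2, congrFun h4 1⟩

end Letters

end Multitensor

open ECategory Multitensor EModule

/-- Isomorphisms of categories over a category compose. -/
def IsoOver.trans {A : Type u₁} [Category.{v₁} A] {B : Type u₂} [Category.{v₂} B]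
    {C : Type u₃} [Category.{v₃} C] {D : Type u} [Category.{w} D] {P : A ⥤ C} {Q : B ⥤ C}
    {R : D ⥤ C} (φ : IsoOver P Q) (ψ : IsoOver Q R) : IsoOver P R where
  hom := φ.hom ⋙ ψ.hom
  inv := ψ.inv ⋙ φ.inv
  hom_inv := by
    have h : φ.hom ⋙ (ψ.hom ⋙ ψ.inv) ⋙ φ.inv = 𝟭 A := by
      rw [ψ.hom_inv, Functor.id_comp, φ.hom_inv]
    exact h
  inv_hom := by
    have h : ψ.inv ⋙ (φ.inv ⋙ φ.hom) ⋙ ψ.hom = 𝟭 D := by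
      rw [φ.inv_hom, Functor.id_comp, ψ.inv_hom]
    exact h
  comm := by
    have h : φ.hom ⋙ ψ.hom ⋙ R = P := by rw [ψ.comm, φ.comm]
    exact h

/-! ### Isomorphisms of multitensors and transport of structure. -/

namespace Multitensor

variable {C : Type u} [Category.{w} C]

namespace Iso

variable {E F : Multitensor C}

/-- The inverse of an isomorphism of multitensors. -/
def symm (φ : E.Iso F) : F.Iso E where
  iso n := (φ.iso n).symm
  unit_iso X := by
    rw [← φ.unit_iso, Category.assoc]
    exact (congrArg (_ ≫ ·) ((φ.iso 1).hom_inv_id_app _)).trans (Category.comp_id _)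
  subst_iso {m k N} h W := by
    have h1 := φ.subst_iso h W
    have h2 : (F.tensor m).map (X := fun i => (F.tensor (k i)).obj fun j => W (pos h i j))
          (Y := fun i => (E.tensor (k i)).obj fun j => W (pos h i j))
          (fun i => (φ.iso (k i)).inv.app fun j => W (pos h i j)) ≫
        (φ.iso m).inv.app (fun i => (E.tensor (k i)).obj fun j => W (pos h i j)) ≫
        (E.tensor m).map (X := fun i => (E.tensor (k i)).obj fun j => W (pos h i j))
          (Y := fun i => (F.tensor (k i)).obj fun j => W (pos h i j))
          (fun i => (φ.iso (k i)).hom.app fun j => W (pos h i j)) ≫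
        (φ.iso m).hom.app (fun i => (F.tensor (k i)).obj fun j => W (pos h i j)) = 𝟙 _ := by
      have h3 := (φ.iso m).hom.naturality (X := fun i => (E.tensor (k i)).obj fun j => W (pos h i j))
          (Y := fun i => (F.tensor (k i)).obj fun j => W (pos h i j))
          (fun i => (φ.iso (k i)).hom.app fun j => W (pos h i j))
      have h4 := (φ.iso m).inv_hom_id_app fun i => (E.tensor (k i)).obj fun j => W (pos h i j)
      refine (congrArg (fun r => _ ≫ _ ≫ r) h3).trans ?_
      refine (congrArg (_ ≫ ·) (Category.assoc _ _ _).symm).trans ?_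
      refine (congrArg (fun r => _ ≫ r ≫ _) h4).trans ?_
      refine (congrArg (_ ≫ ·) (Category.id_comp _)).trans ?_
      refine ((F.tensor m).map_comp _ _).symm.trans (Eq.trans ?_ ((F.tensor m).map_id _))
      exact congrArg _ (funext fun i => (φ.iso (k i)).inv_hom_id_app _)
    have h5 : F.subst h W = (_ ≫ _ ≫ _ ≫ _) ≫ F.subst h W :=
      (Category.id_comp _).symm.trans (congrArg (· ≫ F.subst h W) h2.symm)
    refine (congrArg (· ≫ _) h5).trans ?_
    have h6 := (φ.iso N).hom_inv_id_app W
    simp only [Category.assoc]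
    refine congrArg (fun r => _ ≫ _ ≫ r) ?_
    refine Eq.trans ?_ ((congrArg (E.subst h W ≫ ·) h6).trans (Category.comp_id _))
    refine Eq.trans ?_ (Category.assoc _ _ _)
    exact (congrArg (_ ≫ ·) (Category.assoc _ _ _).symm).trans
      ((Category.assoc _ _ _).symm.trans (congrArg (· ≫ _) h1.symm))

theorem pullback_symm_pullback (φ : E.Iso F) : φ.pullback ⋙ φ.symm.pullback = 𝟭 _ := by
  have h (X : ECategory F) : φ.symm.pullback.obj (φ.pullback.obj X) = X := by
    refine ext_of_heq rfl HEq.rfl (comp_heq_of_forall rfl fun {n} x => heq_of_eq ?_)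
    refine (Category.assoc _ _ _).symm.trans ?_
    exact (congrArg (· ≫ X.comp x) ((φ.iso n).inv_hom_id_app _)).trans (Category.id_comp _)
  exact CategoryTheory.Functor.hext h fun X Y f => EFunctor.heq_of_toMap (h X) (h Y) HEq.rfl

/-- Isomorphic multitensors have isomorphic categories of enriched categories. -/
def pullbackIso (φ : E.Iso F) : IsoOver (forget F) (forget E) where
  hom := φ.pullback
  inv := φ.symm.pullback
  hom_inv := φ.pullback_symm_pullback
  inv_hom := φ.symm.pullback_symm_pullback
  comm := rfl

end Iso

section Transport

variable (F : Multitensor C) {T : OpFamily C C} (α : ∀ n, T n ≅ F.tensor n)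

/-- The substitution of a multitensor transported along isomorphisms. -/
def transportSubst {m N : ℕ} {k : Fin m → ℕ} (Q : ∀ i, Fin (k i) → C) {W : Fin N → C}
    (S : ((F.tensor m).obj fun i => (F.tensor (k i)).obj (Q i)) ⟶ (F.tensor N).obj W) :
    ((T m).obj fun i => (T (k i)).obj (Q i)) ⟶ (T N).obj W :=
  (T m).map (X := fun i => (T (k i)).obj (Q i)) (Y := fun i => (F.tensor (k i)).obj (Q i))
      (fun i => (α (k i)).hom.app (Q i)) ≫
    (α m).hom.app (fun i => (F.tensor (k i)).obj (Q i)) ≫ S ≫ (α N).inv.app W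

/-- The inner sequences `Q` are arbitrary up to an equality, and eliminating the equality removes
the re-indexing. What remains is the unit law of `F`, with the isomorphisms cancelled by naturality.
The next two lemmas have the same form. -/
theorem unit_transportSubst {n : ℕ} {Q : Fin 1 → Fin n → C} {W : Fin n → C} (hQ : Q = fun _ => W)
    (S : ((F.tensor 1).obj fun i => (F.tensor n).obj (Q i)) ⟶ (F.tensor n).obj W)
    (e : (F.tensor 1).obj (fun _ => (F.tensor n).obj W) =
      (F.tensor 1).obj fun i => (F.tensor n).obj (Q i))
    (hS : F.unit ((F.tensor n).obj W) ≫ eqToHom e ≫ S = 𝟙 _)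
    (e' : (T 1).obj (fun _ => (T n).obj W) = (T 1).obj fun i => (T n).obj (Q i)) :
    (F.unit ((T n).obj W) ≫ (α 1).inv.app fun _ => (T n).obj W) ≫ eqToHom e' ≫
      F.transportSubst α (k := fun _ => n) Q S = 𝟙 _ := by
  subst hQ
  have h1 := F.unit_naturality ((α n).hom.app W)
  have h2 := (α 1).inv.naturality (X := fun _ => (T n).obj W) (Y := fun _ => (F.tensor n).obj W)
    fun _ => (α n).hom.app W
  have h3 := (α 1).inv_hom_id_app fun _ => (F.tensor n).obj W
  rw [eqToHom_refl, Category.id_comp] at hS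
  rw [eqToHom_refl, Category.id_comp]
  refine (Category.assoc _ _ _).trans ?_
  refine (congrArg (_ ≫ ·) ((Category.assoc _ _ _).symm.trans (congrArg (· ≫ _) h2.symm))).trans ?_
  refine (congrArg (_ ≫ ·) ((Category.assoc _ _ _).trans (congrArg (_ ≫ ·)
    ((Category.assoc _ _ _).symm.trans (congrArg (· ≫ _) h3))))).trans ?_
  refine (Category.assoc _ _ _).symm.trans ((congrArg (· ≫ _) h1).trans ?_)
  refine (Category.assoc _ _ _).trans ?_
  refine (congrArg (_ ≫ ·) ((congrArg (_ ≫ ·) (Category.id_comp _)).trans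
    (Category.assoc _ _ _).symm)).trans ?_
  refine (congrArg (_ ≫ ·) ((congrArg (· ≫ _) hS).trans (Category.id_comp _))).trans ?_
  exact (α n).hom_inv_id_app W

theorem map_unit_transportSubst {n : ℕ} {Q : Fin n → Fin 1 → C} {W : Fin n → C}
    (hQ : Q = fun i _ => W i)
    (S : ((F.tensor n).obj fun i => (F.tensor 1).obj (Q i)) ⟶ (F.tensor n).obj W)
    (e : ((F.tensor n).obj fun i => (F.tensor 1).obj fun _ => W i) =
      (F.tensor n).obj fun i => (F.tensor 1).obj (Q i))
    (hS : (F.tensor n).map (X := W) (Y := fun i => (F.tensor 1).obj fun _ => W i)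
      (fun i => F.unit (W i)) ≫ eqToHom e ≫ S = 𝟙 _)
    (e' : ((T n).obj fun i => (T 1).obj fun _ => W i) = (T n).obj fun i => (T 1).obj (Q i)) :
    (T n).map (X := W) (Y := fun i => (T 1).obj fun _ => W i)
      (fun i => F.unit (W i) ≫ (α 1).inv.app fun _ => W i) ≫ eqToHom e' ≫
      F.transportSubst α (k := fun _ => 1) Q S = 𝟙 _ := by
  subst hQ
  rw [eqToHom_refl, Category.id_comp] at hS
  rw [eqToHom_refl, Category.id_comp]
  have h1 : (T n).map (X := W) (Y := fun i => (T 1).obj fun _ => W i)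
      (fun i => F.unit (W i) ≫ (α 1).inv.app fun _ => W i) ≫
      (T n).map (X := fun i => (T 1).obj fun _ => W i) (Y := fun i => (F.tensor 1).obj fun _ => W i)
        (fun i => (α 1).hom.app fun _ => W i) =
      (T n).map (X := W) (Y := fun i => (F.tensor 1).obj fun _ => W i) fun i => F.unit (W i) := by
    refine ((T n).map_comp _ _).symm.trans (congrArg _ (funext fun i => ?_))
    refine (Category.assoc _ _ _).trans ?_
    exact (congrArg (_ ≫ ·) ((α 1).inv_hom_id_app _)).trans (Category.comp_id _)
  have h2 := (α n).hom.naturality (X := W) (Y := fun i => (F.tensor 1).obj fun _ => W i)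
    fun i => F.unit (W i)
  refine (Category.assoc _ _ _).symm.trans ((congrArg (· ≫ _) h1).trans ?_)
  refine (Category.assoc _ _ _).symm.trans ((congrArg (· ≫ _) h2).trans ?_)
  refine (Category.assoc _ _ _).trans ?_
  refine (congrArg (_ ≫ ·) (Category.assoc _ _ _).symm).trans ?_
  refine (congrArg (_ ≫ ·) ((congrArg (· ≫ _) hS).trans (Category.id_comp _))).trans ?_
  exact (α n).hom_inv_id_app W

theorem transportSubst_transportSubst {m K N : ℕ} {k : Fin m → ℕ} (hk : ∑ i, k i = K)
    {l : Fin K → ℕ} {n : Fin m → ℕ} {W : Fin N → C} {Q : ∀ q, Fin (l q) → C}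
    {R : ∀ i, Fin (n i) → C} {Q' : ∀ i (j : Fin (k i)), Fin (l (pos hk i j)) → C}
    (hQ : (fun i j => Q (pos hk i j)) = Q')
    (S : ((F.tensor K).obj fun q => (F.tensor (l q)).obj (Q q)) ⟶ (F.tensor N).obj W)
    (S' : ∀ i, ((F.tensor (k i)).obj fun j => (F.tensor (l (pos hk i j))).obj (Q' i j)) ⟶
      (F.tensor (n i)).obj (R i))
    (S'' : ((F.tensor m).obj fun i => (F.tensor (n i)).obj (R i)) ⟶ (F.tensor N).obj W)
    (e : ((F.tensor m).obj fun i => (F.tensor (k i)).obj fun j =>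
        (F.tensor (l (pos hk i j))).obj (Q (pos hk i j))) =
      ((F.tensor m).obj fun i => (F.tensor (k i)).obj fun j =>
        (F.tensor (l (pos hk i j))).obj (Q' i j)))
    (hS : F.subst hk (fun q => (F.tensor (l q)).obj (Q q)) ≫ S = eqToHom e ≫
      (F.tensor m).map (X := fun i => (F.tensor (k i)).obj fun j =>
        (F.tensor (l (pos hk i j))).obj (Q' i j)) (Y := fun i => (F.tensor (n i)).obj (R i)) S' ≫ S'')
    (e' : ((T m).obj fun i => (T (k i)).obj fun j =>
        (T (l (pos hk i j))).obj (Q (pos hk i j))) =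
      ((T m).obj fun i => (T (k i)).obj fun j => (T (l (pos hk i j))).obj (Q' i j))) :
    F.transportSubst α (fun i j => (T (l (pos hk i j))).obj (Q (pos hk i j)))
        (F.subst hk fun q => (T (l q)).obj (Q q)) ≫ F.transportSubst α Q S =
      eqToHom e' ≫ (T m).map (X := fun i => (T (k i)).obj fun j =>
          (T (l (pos hk i j))).obj (Q' i j)) (Y := fun i => (T (n i)).obj (R i))
        (fun i => F.transportSubst α (k := fun j => l (pos hk i j)) (Q' i) (S' i)) ≫
        F.transportSubst α R S'' := by
  subst hQ
  rw [eqToHom_refl, Category.id_comp] at hS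
  rw [eqToHom_refl, Category.id_comp]
  have h1 := (α K).inv.naturality (X := fun q => (T (l q)).obj (Q q))
    (Y := fun q => (F.tensor (l q)).obj (Q q)) fun q => (α (l q)).hom.app (Q q)
  have h2 := (α K).inv_hom_id_app fun q => (F.tensor (l q)).obj (Q q)
  have h3 := F.subst_naturality hk (W := fun q => (T (l q)).obj (Q q))
    (W' := fun q => (F.tensor (l q)).obj (Q q)) fun q => (α (l q)).hom.app (Q q)
  let B (i : Fin m) := (F.tensor (k i)).map (X := fun j => (T (l (pos hk i j))).obj (Q (pos hk i j)))
    (Y := fun j => (F.tensor (l (pos hk i j))).obj (Q (pos hk i j)))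
    fun j => (α (l (pos hk i j))).hom.app (Q (pos hk i j))
  have h4 : (T m).map (X := fun i => (T (k i)).obj fun j =>
          (T (l (pos hk i j))).obj (Q (pos hk i j))) (Y := fun i => (T (n i)).obj (R i))
        (fun i => F.transportSubst α (k := fun j => l (pos hk i j)) (fun j => Q (pos hk i j))
          (S' i)) ≫
      (T m).map (X := fun i => (T (n i)).obj (R i)) (Y := fun i => (F.tensor (n i)).obj (R i))
        (fun i => (α (n i)).hom.app (R i)) =
      (T m).map (X := fun i => (T (k i)).obj fun j =>
          (T (l (pos hk i j))).obj (Q (pos hk i j)))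
          (Y := fun i => (F.tensor (k i)).obj fun j => (T (l (pos hk i j))).obj (Q (pos hk i j)))
          (fun i => (α (k i)).hom.app fun j => (T (l (pos hk i j))).obj (Q (pos hk i j))) ≫
        (T m).map (X := fun i => (F.tensor (k i)).obj fun j =>
            (T (l (pos hk i j))).obj (Q (pos hk i j))) (Y := fun i => (F.tensor (n i)).obj (R i))
          fun i => B i ≫ S' i := by
    refine ((T m).map_comp _ _).symm.trans (Eq.trans ?_ ((T m).map_comp _ _))
    refine congrArg _ (funext fun i => ?_)
    have h5 := (α (k i)).hom.naturality (X := fun j => (T (l (pos hk i j))).obj (Q (pos hk i j)))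
      (Y := fun j => (F.tensor (l (pos hk i j))).obj (Q (pos hk i j)))
      fun j => (α (l (pos hk i j))).hom.app (Q (pos hk i j))
    have h6 := (α (n i)).inv_hom_id_app (R i)
    refine (congrArg (· ≫ _) ((Category.assoc _ _ _).symm.trans (congrArg (· ≫ _) h5))).trans ?_
    refine (Category.assoc _ _ _).trans ?_
    refine (congrArg (_ ≫ ·) ((Category.assoc _ _ _).trans (congrArg (_ ≫ ·) h6))).trans ?_
    refine (congrArg (_ ≫ ·) (Category.comp_id _)).trans ?_
    exact Category.assoc _ _ _
  have h7 := (α m).hom.naturality (X := fun i => (F.tensor (k i)).obj fun j =>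
      (T (l (pos hk i j))).obj (Q (pos hk i j))) (Y := fun i => (F.tensor (n i)).obj (R i))
    fun i => B i ≫ S' i
  have h8 := (F.tensor m).map_comp (X := fun i => (F.tensor (k i)).obj fun j =>
      (T (l (pos hk i j))).obj (Q (pos hk i j))) (Y := fun i => (F.tensor (k i)).obj fun j =>
        (F.tensor (l (pos hk i j))).obj (Q (pos hk i j))) (Z := fun i => (F.tensor (n i)).obj (R i))
    B S'
  have h9 : F.transportSubst α (fun i j => (T (l (pos hk i j))).obj (Q (pos hk i j)))
        (F.subst hk fun q => (T (l q)).obj (Q q)) ≫ F.transportSubst α Q S =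
      (T m).map (X := fun i => (T (k i)).obj fun j =>
          (T (l (pos hk i j))).obj (Q (pos hk i j)))
          (Y := fun i => (F.tensor (k i)).obj fun j => (T (l (pos hk i j))).obj (Q (pos hk i j)))
          (fun i => (α (k i)).hom.app fun j => (T (l (pos hk i j))).obj (Q (pos hk i j))) ≫
        (α m).hom.app (fun i => (F.tensor (k i)).obj fun j =>
          (T (l (pos hk i j))).obj (Q (pos hk i j))) ≫ (F.tensor m).map B ≫
        (F.subst hk (fun q => (F.tensor (l q)).obj (Q q)) ≫ S) ≫ (α N).inv.app W := by
    refine (Category.assoc _ _ _).trans (congrArg (_ ≫ ·) ?_)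
    refine (Category.assoc _ _ _).trans (congrArg (_ ≫ ·) ?_)
    refine (Category.assoc _ _ _).trans ?_
    refine (congrArg (_ ≫ ·) ((Category.assoc _ _ _).symm.trans
      (congrArg (· ≫ _) h1.symm))).trans ?_
    refine (congrArg (_ ≫ ·) ((Category.assoc _ _ _).trans (congrArg (_ ≫ ·)
      ((Category.assoc _ _ _).symm.trans (congrArg (· ≫ _) h2))))).trans ?_
    refine (congrArg (_ ≫ ·) (congrArg (_ ≫ ·) (Category.id_comp _))).trans ?_
    refine (Category.assoc _ _ _).symm.trans ((congrArg (· ≫ _) h3.symm).trans ?_)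
    refine (Category.assoc _ _ _).trans (congrArg (_ ≫ ·) ?_)
    exact (Category.assoc _ _ _).symm
  refine h9.trans (Eq.trans ?_ ((congrArg (· ≫ _) h4.symm).trans (Category.assoc _ _ _)))
  refine Eq.trans ?_ (Category.assoc _ _ _).symm
  refine congrArg (_ ≫ ·) (Eq.symm ?_)
  refine (Category.assoc _ _ _).symm.trans ((congrArg (· ≫ _) h7).trans ?_)
  refine (Category.assoc _ _ _).trans (congrArg (_ ≫ ·) ?_)
  refine (congrArg (· ≫ _) h8).trans ((Category.assoc _ _ _).trans (congrArg (_ ≫ ·) ?_))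
  exact (Category.assoc _ _ _).symm.trans (congrArg (· ≫ _) hS.symm)

/-- A multitensor transported along isomorphisms of its functors. -/
def transport : Multitensor C where
  tensor := T
  unit X := F.unit X ≫ (α 1).inv.app fun _ => X
  subst h W := F.transportSubst α (fun i j => W (pos h i j)) (F.subst h W)
  unit_naturality {X Y} f := by
    have h1 := (α 1).inv.naturality (X := fun _ => X) (Y := fun _ => Y) fun _ => f
    refine (Category.assoc _ _ _).trans ((congrArg (_ ≫ ·) h1.symm).trans ?_)
    refine (Category.assoc _ _ _).symm.trans ((congrArg (· ≫ _) (F.unit_naturality f)).trans ?_)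
    exact Category.assoc _ _ _
  subst_naturality {m k N} h {W W'} f := by
    have h1 := F.subst_naturality h f
    have h2 := (α N).inv.naturality f
    have h3 := (α m).hom.naturality (X := fun i => (F.tensor (k i)).obj fun j => W (pos h i j))
        (Y := fun i => (F.tensor (k i)).obj fun j => W' (pos h i j))
        (fun i => (F.tensor (k i)).map (X := fun j => W (pos h i j)) (Y := fun j => W' (pos h i j))
          fun j => f (pos h i j))
    have h4 : (T m).map (X := fun i => (T (k i)).obj fun j => W (pos h i j))
        (Y := fun i => (T (k i)).obj fun j => W' (pos h i j))
        (fun i => (T (k i)).map (X := fun j => W (pos h i j)) (Y := fun j => W' (pos h i j))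
          fun j => f (pos h i j)) ≫
        (T m).map (Y := fun i => (F.tensor (k i)).obj fun j => W' (pos h i j))
          (fun i => (α (k i)).hom.app fun j => W' (pos h i j)) =
        (T m).map (X := fun i => (T (k i)).obj fun j => W (pos h i j))
          (Y := fun i => (F.tensor (k i)).obj fun j => W (pos h i j))
          (fun i => (α (k i)).hom.app fun j => W (pos h i j)) ≫
        (T m).map (Y := fun i => (F.tensor (k i)).obj fun j => W' (pos h i j))
          (fun i => (F.tensor (k i)).map (X := fun j => W (pos h i j))
            (Y := fun j => W' (pos h i j)) fun j => f (pos h i j)) := by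
      refine ((T m).map_comp _ _).symm.trans (Eq.trans ?_ ((T m).map_comp _ _))
      exact congrArg _ (funext fun i => (α (k i)).hom.naturality _)
    refine (Category.assoc _ _ _).symm.trans ((congrArg (· ≫ _) h4).trans ?_)
    refine (Category.assoc _ _ _).trans (Eq.trans ?_ (Category.assoc _ _ _).symm)
    refine congrArg (_ ≫ ·) ?_
    refine (Category.assoc _ _ _).symm.trans ((congrArg (· ≫ _) h3).trans ?_)
    refine (Category.assoc _ _ _).trans (Eq.trans ?_ (Category.assoc _ _ _).symm)
    refine congrArg (_ ≫ ·) ?_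
    refine (Category.assoc _ _ _).symm.trans ((congrArg (· ≫ _) h1).trans ?_)
    refine (Category.assoc _ _ _).trans (Eq.trans ?_ (Category.assoc _ _ _).symm)
    exact congrArg (_ ≫ ·) h2
  unit_subst {n} h W :=
    F.unit_transportSubst α (Q := fun i j => W (pos (k := fun _ => n) h i j))
      (funext fun i => funext fun j => by rw [pos_one]) (F.subst h W) _ (F.unit_subst h W) _
  tensor_unit_subst h W :=
    F.map_unit_transportSubst α (Q := fun i j => W (pos (k := fun _ => 1) h i j))
      (funext fun i => funext fun j => by rw [pos_const_one]) (F.subst h W) _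
      (F.tensor_unit_subst h W) _
  subst_subst {m K N k} hk {l} hl {n} hn hN W :=
    F.transportSubst_transportSubst α hk (Q := fun q p => W (pos hl q p))
      (R := fun i q => W (pos hN i q))
      (Q' := fun i j p => W (pos hN i (pos (k := fun j => l (pos hk i j)) (hn i) j p)))
      (funext fun i => funext fun j => funext fun p => by rw [pos_pos hk hl hn hN])
      (F.subst hl W) (fun i => F.subst (hn i) fun q => W (pos hN i q)) (F.subst hN W) _
      (F.subst_subst hk hl hn hN W) _

/-- The transported multitensor is isomorphic to the original one. -/
def transportIso : (F.transport α).Iso F where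
  iso := α
  unit_iso X := (Category.assoc _ _ _).trans
    ((congrArg (_ ≫ ·) ((α 1).inv_hom_id_app _)).trans (Category.comp_id _))
  subst_iso {m k N} h W := by
    have h1 := (α N).inv_hom_id_app W
    refine (Category.assoc _ _ _).trans (congrArg (_ ≫ ·) ?_)
    refine (Category.assoc _ _ _).trans (congrArg (_ ≫ ·) ?_)
    exact (Category.assoc _ _ _).trans ((congrArg (_ ≫ ·) h1).trans (Category.comp_id _))

end Transport

/-! ### Normalization of a multitensor with invertible unit. -/

section Normalize

variable (F : Multitensor C) (hF : ∀ X, IsIso (F.unit X))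

/-- The functors of a multitensor with an invertible unit, with the identity in degree one. -/
def normalTensor (F : Multitensor C) : OpFamily C C
  | 1 => Pi.eval _ 0
  | 0 => F.tensor 0
  | n + 2 => F.tensor (n + 2)

/-- The unit as an isomorphism. -/
noncomputable def unitIso : Pi.eval (fun _ => C) (0 : Fin 1) ≅ F.tensor 1 :=
  NatIso.ofComponents (fun Z =>
    @asIso _ _ _ _ (F.unit (Z 0)) (hF (Z 0)) ≪≫ eqToIso (congrArg _ (funext fun i => congrArg Z (Subsingleton.elim 0 i))))
    fun {Z Z'} f => by
      obtain ⟨X, rfl⟩ : ∃ X, Z = fun _ => X := ⟨Z 0, funext fun i => by rw [Subsingleton.elim i 0]⟩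
      obtain ⟨X', rfl⟩ : ∃ X, Z' = fun _ => X := ⟨Z' 0, funext fun i => by rw [Subsingleton.elim i 0]⟩
      obtain ⟨f, rfl⟩ : ∃ g : X ⟶ X', f = fun _ => g :=
        ⟨f 0, funext fun i => by rw [Subsingleton.elim i 0]⟩
      refine (congrArg (_ ≫ ·) (Category.comp_id _)).trans ?_
      refine (F.unit_naturality f).symm.trans ?_
      exact congrArg (· ≫ _) (Category.comp_id _).symm

/-- The isomorphisms along which a multitensor with an invertible unit is normalized. -/
noncomputable def normalTensorIso : ∀ n, F.normalTensor n ≅ F.tensor n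
  | 1 => F.unitIso hF
  | 0 => Iso.refl _
  | _ + 2 => Iso.refl _

/-- The transported unit is the unit of `F` followed by the inverse of the isomorphism in degree
one, and that isomorphism is the unit of `F` itself. -/
theorem isNormal_transport : (F.transport (F.normalTensorIso hF)).IsNormal := fun X => by
  refine ⟨rfl, ?_⟩
  have h1 := ((F.unitIso hF).hom_inv_id_app fun _ => X)
  refine Eq.trans ?_ h1
  exact congrArg (· ≫ _) (Category.comp_id (F.unit X)).symm

end Normalize

end Multitensor

open ECategory Multitensor EModule

/-! ### Existence of a distributive lift. -/

namespace Multitensor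

variable {V : Type u} [Category.{w} V] {E : Multitensor V}

theorem IsDistributive.hasInitial (hd : E.IsDistributive) : HasInitial V := by
  have := hd.1 PEmpty
  exact hasColimitsOfShape_of_equivalence (Discrete.equivalence (Equiv.equivPEmpty PEmpty.{w + 1}))

/-- An initial object is an empty coproduct, and empty coproducts are among those preserved in each
variable. -/
theorem absorbsInitial_of_preservesCoproductsInVariables
    (hd : preservesCoproductsInVariables E.tensor) : E.AbsorbsInitial := by
  rintro n Z i ⟨hi⟩
  have := hd n Z i PEmpty
  have : PreservesColimitsOfShape (Discrete PEmpty.{1}) (variableAt Z i ⋙ E.tensor n) :=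
    preservesColimitsOfShape_of_equiv (Discrete.equivalence (Equiv.equivPEmpty PEmpty.{w + 1})) _
  have h := hi.isInitialObj (variableAt Z i ⋙ E.tensor n)
  have e : (variableAt Z i).obj (Z i) = Z := by
    funext j
    by_cases hj : j = i
    · subst hj
      exact congrArg (fun F : V ⥤ V => F.obj (Z j)) (variableAt_eval_self Z j)
    · exact congrArg (fun F : V ⥤ V => F.obj (Z i)) (variableAt_eval_of_ne Z hj)
  exact ⟨h.ofIso (eqToIso (congrArg (E.tensor n).obj e))⟩

section Existence

variable [HasColimitsOfSize.{w, w} V] [HasInitial V]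

omit [HasColimitsOfSize.{w, w} V] in
theorem preservesCoproducts_unaryMonad (hd : preservesCoproductsInVariables E.tensor)
    (J : Type w) : PreservesColimitsOfShape (Discrete J) E.unaryMonad.toFunctor :=
  E.preservesColimitsOfShape_unaryMonad fun Z i => hd 1 Z i J

/-- The monad `E_1` preserves coproducts, so the forgetful functor from its algebras creates them.
-/
theorem hasCoproducts_unaryAlgebra (hd : preservesCoproductsInVariables E.tensor) :
    HasCoproducts.{w} E.UnaryAlgebra := fun J =>
  have := preservesCoproducts_unaryMonad hd J
  hasColimitsOfShape_of_hasColimitsOfShape_createsColimitsOfShape E.unaryMonad.forget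

/-- The forgetful functor from algebras preserves the coproducts and reflects isomorphisms, so it
reflects them; it is therefore enough to look at the underlying functors. -/
theorem preservesCoproductsInVariables_lift (hd : preservesCoproductsInVariables E.tensor)
    {W : EModule E E.UnaryAlgebra} (hW : preservesCoproductsInVariables W.obj) :
    preservesCoproductsInVariables W.lift := fun n Z i J => by
  have := preservesCoproducts_unaryMonad hd J
  have := hasCoproducts_unaryAlgebra hd J
  have : PreservesColimitsOfShape (Discrete J) ((variableAt Z i ⋙ W.lift n) ⋙ E.unaryMonad.forget) :=
    hW n Z i J
  have : ReflectsColimitsOfShape (Discrete J) E.unaryMonad.forget :=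
    reflectsColimitsOfShape_of_reflectsIsomorphisms
  exact preservesColimitsOfShape_of_reflects_of_preserves _ E.unaryMonad.forget

end Existence

theorem preservesCoproductsInVariables_of_iso {A : Type u₁} [Category.{v₁} A] {X Y : OpFamily A V}
    (e : ∀ n, X n ≅ Y n) (hX : preservesCoproductsInVariables X) :
    preservesCoproductsInVariables Y := fun n Z i J => by
  have := hX n Z i J
  exact preservesColimitsOfShape_of_natIso (Functor.isoWhiskerLeft (variableAt Z i) (e n))

theorem exists_lift [IsLocallyPresentable.{w} V] (hd : E.IsDistributive)
    (ha : E.IsAccessibleInEachVariable) : ∃ L : Lift E, L.lifted.IsDistributive := by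
  have hd' : preservesCoproductsInVariables E.tensor := hd.2
  obtain ⟨κ, _, _⟩ := IsLocallyPresentable.exists_cardinal.{w} V
  have : HasColimitsOfSize.{w, w} V := inferInstance
  have := hd.hasInitial
  have := hasLimitsOfSize_of_isLocallyPresentable V
  have hE := absorbsInitial_of_preservesCoproductsInVariables hd'
  obtain ⟨W, ι, hW, hι⟩ := E.exists_initial_module hd' ha
  have hι : ι.IsInitial := hι
  -- The underlying map of the unit is a component of the letter map, and the forgetful functor from
  -- algebras reflects isomorphisms.
  have hu (X : E.UnaryAlgebra) : IsIso ((Letters.multitensor hι hE).unit X) := by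
    have := ι.isIso_nat hι
    have : IsIso (E.unaryMonad.forget.map (ι.hom X)) :=
      inferInstanceAs (IsIso (ι.nat.app fun _ => X))
    exact isIso_of_reflects_iso (ι.hom X) E.unaryMonad.forget
  let F := Letters.multitensor hι hE
  let φ := F.transportIso (F.normalTensorIso hu)
  refine ⟨⟨F.transport (F.normalTensorIso hu), F.isNormal_transport hu,
    (Letters.enrichIso hι hE).trans φ.pullbackIso⟩, hasCoproducts_unaryAlgebra hd', ?_⟩
  exact preservesCoproductsInVariables_of_iso (fun n => (F.normalTensorIso hu n).symm)
    (preservesCoproductsInVariables_lift hd' hW)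

end Multitensor

open ECategory Multitensor EModule

/-! ### The enriched category freely generated by a path. -/

namespace ECategory

variable {V : Type u} [Category.{w} V] {F : Multitensor V}

/-- The composition of maps into the homs along a path. -/
def compose (X : ECategory F) {n : ℕ} {Z : Fin n → V} (x : Fin (n + 1) → X.Obj)
    (f : ∀ i, Z i ⟶ X.Hom (x i.castSucc) (x i.succ)) :
    (F.tensor n).obj Z ⟶ X.Hom (x 0) (x (Fin.last n)) :=
  (F.tensor n).map (Y := fun i => X.Hom (x i.castSucc) (x i.succ)) f ≫ X.comp x

variable (X : ECategory F)

theorem map_compose {n : ℕ} {Z Z' : Fin n → V} (φ : Z ⟶ Z') (x : Fin (n + 1) → X.Obj)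
    (f : ∀ i, Z' i ⟶ X.Hom (x i.castSucc) (x i.succ)) :
    (F.tensor n).map φ ≫ X.compose x f = X.compose x fun i => φ i ≫ f i :=
  (Category.assoc _ _ _).symm.trans (congrArg (· ≫ X.comp x) ((F.tensor n).map_comp _ _).symm)

theorem compose_map {X Y : ECategory F} (G : EFunctor X Y) {n : ℕ} {Z : Fin n → V}
    (x : Fin (n + 1) → X.Obj) (f : ∀ i, Z i ⟶ X.Hom (x i.castSucc) (x i.succ)) :
    X.compose x f ≫ G.map _ _ = Y.compose (fun t => G.obj (x t)) fun i => f i ≫ G.map _ _ := by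
  refine (Category.assoc _ _ _).trans ((congrArg (_ ≫ ·) (G.comp_map x)).trans ?_)
  exact Y.map_compose (Z' := fun i => X.Hom (x i.castSucc) (x i.succ)) f (fun t => G.obj (x t))
    fun i => G.map _ _

theorem unit_compose {Z : V} (x : Fin 2 → X.Obj)
    (f : ∀ i : Fin 1, Z ⟶ X.Hom (x i.castSucc) (x i.succ)) :
    F.unit Z ≫ X.compose (Z := fun _ => Z) x f = f 0 := by
  have e : (fun _ : Fin 1 => X.Hom (x 0) (x 1)) = fun i => X.Hom (x i.castSucc) (x i.succ) := by
    funext i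
    rw [Subsingleton.elim i 0]
    rfl
  have h1 := F.unit_naturality (f 0)
  have h2 : (F.tensor 1).map (Y := fun i => X.Hom (x i.castSucc) (x i.succ)) f =
      (F.tensor 1).map (X := fun _ => Z) (Y := fun _ => X.Hom (x 0) (x 1)) (fun _ => f 0) ≫
        eqToHom (congrArg (F.tensor 1).obj e) := by
    refine eq_of_heq (HEq.trans ?_ (comp_eqToHom_heq _ _).symm)
    refine heq_tensor_map (fun _ => rfl) (fun i => (congrFun e i).symm) fun i => ?_
    obtain rfl : i = 0 := Subsingleton.elim _ _
    rfl
  refine (congrArg (fun r => _ ≫ r ≫ X.comp x) h2).trans ?_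
  refine (congrArg (_ ≫ ·) (Category.assoc _ _ _)).trans ?_
  refine (Category.assoc _ _ _).symm.trans ((congrArg (· ≫ _) h1).trans ?_)
  refine (Category.assoc _ _ _).trans ?_
  exact (congrArg (_ ≫ ·) (X.unit_comp x)).trans (Category.comp_id _)

theorem subst_compose {m N : ℕ} {k : Fin m → ℕ} (h : ∑ i, k i = N) {Z : Fin N → V}
    (x : Fin (N + 1) → X.Obj) (f : ∀ i, Z i ⟶ X.Hom (x i.castSucc) (x i.succ)) :
    F.subst h Z ≫ X.compose x f = X.cutComp h x fun i =>
      X.compose (Z := fun j => Z (pos h i j)) (fun t => x (subVertex h i t))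
        fun j => f (pos h i j) := by
  have h1 := F.subst_naturality h (W' := fun i => X.Hom (x i.castSucc) (x i.succ)) f
  refine (Category.assoc _ _ _).symm.trans ((congrArg (· ≫ X.comp x) h1.symm).trans ?_)
  refine (Category.assoc _ _ _).trans ((congrArg (_ ≫ ·) (X.subst_comp' h x)).trans ?_)
  exact X.map_cutComp h x (B' := fun i => (F.tensor (k i)).obj fun j =>
    X.Hom (x (subVertex h i j.castSucc)) (x (subVertex h i j.succ))) _ _

/-- The composition as an interpretation of the operations themselves. -/
def composeInterpretation : Interpretation (F.selfModule (𝟭 V)) X X.Hom where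
  app := X.compose
  naturality φ x f := X.map_compose φ x f
  act h _ x f := X.subst_compose h x f

variable [HasInitial V] (hF : F.AbsorbsInitial) {N : ℕ} (Z : Fin N → V)

/-- The category freely generated by a path. -/
noncomputable abbrev freePath : ECategory F := (F.selfModule (𝟭 V)).intervals Z hF

/-- The vertices of a path. -/
def pathVertices (t : Fin (N + 1)) : (freePath hF Z).Obj := ⟨t⟩

theorem freePath_step (i : Fin N) :
    (freePath hF Z).Hom (pathVertices hF Z i.castSucc) (pathVertices hF Z i.succ) =
      (F.tensor 1).obj fun _ => Z i :=
  intervalHom_eq (W := F.selfModule (𝟭 V)) (Y := fun _ => Z i) rfl fun p q hq =>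
    congrArg Z (Fin.ext (by rw [hq, Subsingleton.elim p 0]; rfl))

theorem freePath_all :
    (freePath hF Z).Hom (pathVertices hF Z 0) (pathVertices hF Z (Fin.last N)) =
      (F.tensor N).obj Z :=
  intervalHom_eq (W := F.selfModule (𝟭 V)) (a := 0) (b := Fin.last N) (Nat.zero_add N).symm
    fun p _ hq => congrArg Z (Fin.ext ((Nat.zero_add (p : ℕ)).symm.trans hq.symm))

/-- The steps of a path as maps into the category which it generates. -/
noncomputable def pathStep (i : Fin N) :
    Z i ⟶ (freePath hF Z).Hom (pathVertices hF Z i.castSucc) (pathVertices hF Z i.succ) :=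
  F.unit (Z i) ≫ eqToHom (freePath_step hF Z i).symm

/-- The value of the composition of the steps of a path. -/
noncomputable def pathAll :
    (freePath hF Z).Hom (pathVertices hF Z 0) (pathVertices hF Z (Fin.last N)) ⟶
      (F.tensor N).obj Z :=
  eqToHom (freePath_all hF Z)

/-- The composition along all vertices is the substitution for the cut into single entries and the
steps are units, so this is a unit law of `F`. It exhibits `F_N(Z)` as the value of the generic
composite. -/
theorem compose_pathStep :
    (freePath hF Z).compose (pathVertices hF Z) (pathStep hF Z) ≫ pathAll hF Z = 𝟙 _ := by
  have h1 := F.tensor_unit_subst (Letters.sum_one_eq N) Z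
  have h2 : (freePath hF Z).comp (pathVertices hF Z) ≍
      F.subst (k := fun _ => 1) (Letters.sum_one_eq N) Z :=
    intervalComp_heq (W := F.selfModule (𝟭 V)) (Z := Z) hF (k := fun _ => 1)
      (Letters.sum_one_eq N) (x := id) (fun i => rfl) (Y := Z) fun p q hq =>
        congrArg Z (Fin.ext ((Nat.zero_add (p : ℕ)).symm.trans hq.symm))
  refine Eq.trans (eq_of_heq ?_) h1
  have hp (i : Fin N) : ((F.tensor 1).obj fun j => Z (pos (k := fun _ => 1)
      (Letters.sum_one_eq N) i j)) = (F.tensor 1).obj fun _ => Z i :=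
    congrArg _ (funext fun j => congrArg Z (pos_const_one _ i j))
  refine (comp_eqToHom_heq _ _).trans ?_
  refine ECategory.heq_comp rfl (congrArg _ (funext (freePath_step hF Z))) (freePath_all hF Z)
    (heq_tensor_map (fun _ => rfl) (freePath_step hF Z) fun i => comp_eqToHom_heq _ _) ?_
  exact h2.trans (eqToHom_comp_heq _ _).symm

variable {X} (x : Fin (N + 1) → X.Obj) (f : ∀ i, Z i ⟶ X.Hom (x i.castSucc) (x i.succ))

/-- The functor out of a freely generated category. -/
noncomputable def freePathDesc : EFunctor (freePath hF Z) X :=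
  evalFunctor hF X.composeInterpretation x f

/-- The functor induced by `f` is the unary composite on a one-step interval, and the unit law of
`X` reduces it to `f i` on the step. -/
theorem pathStep_desc (i : Fin N) :
    pathStep hF Z i ≫ (freePathDesc hF Z x f).map (pathVertices hF Z i.castSucc)
      (pathVertices hF Z i.succ) = f i := by
  let y : Fin 2 → X.Obj := ![x i.castSucc, x i.succ]
  have hf (j : Fin 1) : X.Hom (x i.castSucc) (x i.succ) = X.Hom (y j.castSucc) (y j.succ) := by
    rw [Subsingleton.elim j 0]
    rfl
  have h1 : (freePathDesc hF Z x f).map (pathVertices hF Z i.castSucc) (pathVertices hF Z i.succ) ≍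
      X.compose (Z := fun _ => Z i) y fun j => f i ≫ eqToHom (hf j) := by
    refine evalFunctor_map_heq X.composeInterpretation x f (n := 1) (Y := fun _ => Z i) rfl
      (fun p q hq => ?_) y (fun s r hr => ?_) _ fun p q hq => ?_
    · exact congrArg Z (Fin.ext (by rw [hq, Subsingleton.elim p 0]; rfl))
    · fin_cases s
      · exact congrArg x (Fin.ext hr.symm)
      · exact congrArg x (Fin.ext hr.symm)
    · refine (comp_eqToHom_heq _ _).trans (heq_pathMap f (Fin.ext ?_))
      rw [hq, Subsingleton.elim p 0]
      rfl
  have h2 := X.unit_compose y fun j => f i ≫ eqToHom (hf j)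
  refine Eq.trans (eq_of_heq ?_) (h2.trans (Category.comp_id (f i)))
  refine ECategory.heq_comp rfl (freePath_step hF Z i) rfl (comp_eqToHom_heq _ _) h1

/-- Every composite in `X` along maps `f` is the image of the generic composite under the functor
induced by `f`. -/
theorem pathAll_compose :
    pathAll hF Z ≫ X.compose x f = (freePathDesc hF Z x f).map (pathVertices hF Z 0)
      (pathVertices hF Z (Fin.last N)) := by
  have h1 : (freePathDesc hF Z x f).map (pathVertices hF Z 0) (pathVertices hF Z (Fin.last N)) ≍
      X.compose x f := by
    have h0 (j : ℕ) (r : ℕ) (hr : r = 0 + j) : j = r := by omega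
    refine evalFunctor_map_heq X.composeInterpretation x f (Nat.zero_add N).symm
      (fun p q hq => ?_) x (fun s r hr => ?_) _ fun p q hq => ?_
    · exact congrArg Z (Fin.ext (h0 _ _ hq))
    · exact congrArg x (Fin.ext (h0 _ _ hr))
    · exact heq_pathMap f (Fin.ext (h0 _ _ hq))
  exact eq_of_heq ((eqToHom_comp_heq _ _).trans h1.symm)

end ECategory

open ECategory Multitensor EModule

/-! ### Enriched structures on a prescribed graph. -/

namespace ECategory

variable {V : Type u} [Category.{w} V] {F : Multitensor V}

/-- An enriched category with its graph replaced by an equal one. -/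
abbrev withGraph (X : ECategory F) {G : EGraph V} (h : X.toEGraph = G) : ECategory F where
  toEGraph := G
  comp := h.rec (motive := fun G _ => ∀ {n : ℕ} (x : Fin (n + 1) → G.Obj),
    ((F.tensor n).obj fun i => G.Hom (x i.castSucc) (x i.succ)) ⟶ G.Hom (x 0) (x (Fin.last n))) X.comp
  unit_comp := by
    subst h
    exact X.unit_comp
  subst_comp := by
    subst h
    exact X.subst_comp

theorem withGraph_eq (X : ECategory F) {G : EGraph V} (h : X.toEGraph = G) : X.withGraph h = X := by
  subst h
  rfl

theorem withGraph_comp {X Y : ECategory F} (e : X = Y) (h : X.toEGraph = Y.toEGraph) {n : ℕ}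
    (x : Fin (n + 1) → Y.Obj) : (X.withGraph h).comp x = Y.comp x := by
  subst e
  rfl

/-- An isomorphism over graphs preserves underlying graphs and maps only up to equality. Eliminating
these equalities shows that the prescribed map of graphs respects the compositions. -/
theorem withGraph_comp_map {X Y : ECategory F} (f : EFunctor X Y) {G H : EGraph V}
    (hX : X.toEGraph = G) (hY : Y.toEGraph = H) {g : EGraph.Map G H} (hg : f.toMap ≍ g) {n : ℕ}
    (x : Fin (n + 1) → G.Obj) :
    (X.withGraph hX).comp x ≫ g.map (x 0) (x (Fin.last n)) =
      (F.tensor n).map (X := fun i => G.Hom (x i.castSucc) (x i.succ))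
          (Y := fun i => H.Hom (g.obj (x i.castSucc)) (g.obj (x i.succ)))
          (fun i => g.map (x i.castSucc) (x i.succ)) ≫
        (Y.withGraph hY).comp (fun t => g.obj (x t)) := by
  subst hX hY
  obtain rfl := eq_of_heq hg
  exact f.comp_map x

end ECategory

/-! ### Recovering a multitensor from its enriched categories. -/

namespace IsoOver

variable {V : Type u} [Category.{w} V] {F F' : Multitensor V} (K : IsoOver (forget F') (forget F))

/-- The inverse of an isomorphism over a category. -/
def symm {A : Type u₁} [Category.{v₁} A] {B : Type u₂} [Category.{v₂} B] {C : Type u₃}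
    [Category.{v₃} C] {P : A ⥤ C} {Q : B ⥤ C} (K : IsoOver P Q) : IsoOver Q P where
  hom := K.inv
  inv := K.hom
  hom_inv := K.inv_hom
  inv_hom := K.hom_inv
  comm := by
    have h : K.inv ⋙ K.hom ⋙ Q = Q := by
      rw [← Functor.assoc, K.inv_hom, Functor.id_comp]
    rwa [K.comm] at h

theorem toEGraph_hom_obj (X : ECategory F') : (K.hom.obj X).toEGraph = X.toEGraph :=
  Functor.congr_obj K.comm X

theorem toMap_hom_map {X Y : ECategory F'} (f : X ⟶ Y) :
    (K.hom.map f).toMap ≍ EFunctor.toMap f :=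
  Functor.hcongr_hom K.comm f

/-- The image of an enriched category, with the same graph. -/
abbrev obj (X : ECategory F') : ECategory F :=
  (K.hom.obj X).withGraph (K.toEGraph_hom_obj X)

/-- The image of an enriched functor. -/
def map {X Y : ECategory F'} (f : EFunctor X Y) : EFunctor (K.obj X) (K.obj Y) where
  toMap := f.toMap
  comp_map x := withGraph_comp_map (K.hom.map (X := X) (Y := Y) f) (K.toEGraph_hom_obj X)
    (K.toEGraph_hom_obj Y) (K.toMap_hom_map (X := X) (Y := Y) f) x

theorem obj_symm_obj_comp (X : ECategory F) {n : ℕ} (x : Fin (n + 1) → X.Obj) :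
    (K.obj (K.symm.obj X)).comp x = X.comp x := by
  have h : K.hom.obj (K.symm.obj X) = X :=
    (congrArg K.hom.obj (withGraph_eq _ _)).trans (Functor.congr_obj K.inv_hom X)
  exact withGraph_comp h (K.toEGraph_hom_obj (K.symm.obj X)) x

variable [HasInitial V] (hF' : F'.AbsorbsInitial)

/-- The comparison of the operations of two multitensors with isomorphic categories of enriched
categories. -/
noncomputable def comparison {n : ℕ} (Z : Fin n → V) : (F.tensor n).obj Z ⟶ (F'.tensor n).obj Z :=
  (K.obj (freePath hF' Z)).compose (pathVertices hF' Z) (pathStep hF' Z) ≫ pathAll hF' Z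

/-- The functor out of the free category on `Z` given by `f` stays a functor for the `F`-structures,
so it carries the generic `F`-composite to the `F`-composite of `f` in `X`. Thus the comparison
converts compositions of `F'`-categories into those of their images, and this property yields all
the others. -/
theorem comparison_compose (X : ECategory F') {n : ℕ} {Z : Fin n → V} (x : Fin (n + 1) → X.Obj)
    (f : ∀ i, Z i ⟶ X.Hom (x i.castSucc) (x i.succ)) :
    K.comparison hF' Z ≫ X.compose x f = (K.obj X).compose x f := by
  have h1 := (K.obj (freePath hF' Z)).compose_map (Y := K.obj X) (K.map (freePathDesc hF' Z x f))
    (pathVertices hF' Z) (pathStep hF' Z)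
  refine (Category.assoc _ _ _).trans ((congrArg (_ ≫ ·) (pathAll_compose hF' Z x f)).trans ?_)
  refine h1.trans ?_
  exact congrArg ((K.obj X).compose x) (funext (pathStep_desc hF' Z x f))

/-- Both sides are obtained by composing, in the free category on `Z'`, the steps preceded by `φ`:
once in the `F`-structure, once in the `F'`-structure. -/
theorem comparison_naturality {n : ℕ} {Z Z' : Fin n → V} (φ : Z ⟶ Z') :
    (F.tensor n).map φ ≫ K.comparison hF' Z' = K.comparison hF' Z ≫ (F'.tensor n).map φ := by
  have h1 := K.comparison_compose hF' (freePath hF' Z') (pathVertices hF' Z')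
    fun i => φ i ≫ pathStep hF' Z' i
  have h2 := (freePath hF' Z').map_compose φ (pathVertices hF' Z') (pathStep hF' Z')
  have h3 := (K.obj (freePath hF' Z')).map_compose φ (pathVertices hF' Z') (pathStep hF' Z')
  have h4 := compose_pathStep hF' Z'
  refine (Category.assoc _ _ _).symm.trans ((congrArg (· ≫ _) (h3.trans h1.symm)).trans ?_)
  refine (Category.assoc _ _ _).trans (congrArg (_ ≫ ·) ?_)
  refine (congrArg (· ≫ _) h2.symm).trans ((Category.assoc _ _ _).trans ?_)
  exact (congrArg (_ ≫ ·) h4).trans (Category.comp_id _)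

/-- In both structures the composite of one step along the unit is the step itself. -/
theorem unit_comparison (Z : V) : F.unit Z ≫ K.comparison hF' (fun _ : Fin 1 => Z) = F'.unit Z := by
  let P := freePath hF' fun _ : Fin 1 => Z
  have h1 := (K.obj P).unit_compose (pathVertices hF' fun _ : Fin 1 => Z)
    (pathStep hF' fun _ : Fin 1 => Z)
  have h2 := P.unit_compose (pathVertices hF' fun _ : Fin 1 => Z)
    (pathStep hF' fun _ : Fin 1 => Z)
  refine (Category.assoc _ _ _).symm.trans ((congrArg (· ≫ _) (h1.trans h2.symm)).trans ?_)
  refine (Category.assoc _ _ _).trans ?_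
  exact (congrArg (_ ≫ ·) (compose_pathStep hF' _)).trans (Category.comp_id _)

/-- Compute in the free `F'`-category on `Z`: there the `F`-composite of the whole path is the
`F`-composite of the composites of its blocks. `comparison_compose` replaces `F` by `F'` first
inside each block and then for the outer composite, and the substitution law of the `F'`-structure
reassembles the path. -/
theorem subst_comparison {m N : ℕ} {k : Fin m → ℕ} (h : ∑ i, k i = N) (Z : Fin N → V) :
    F.subst h Z ≫ K.comparison hF' Z =
      (F.tensor m).map (X := fun i => (F.tensor (k i)).obj fun j => Z (pos h i j))
          (Y := fun i => (F'.tensor (k i)).obj fun j => Z (pos h i j))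
          (fun i => K.comparison hF' fun j => Z (pos h i j)) ≫
        K.comparison hF' (fun i => (F'.tensor (k i)).obj fun j => Z (pos h i j)) ≫
          F'.subst h Z := by
  let P := freePath hF' Z
  let v := pathVertices hF' Z
  let t (i : Fin m) : ((F'.tensor (k i)).obj fun j => Z (pos h i j)) ⟶
      P.Hom (v (subVertex h i 0)) (v (subVertex h i (Fin.last (k i)))) :=
    P.compose (Z := fun j => Z (pos h i j)) (fun s => v (subVertex h i s))
      fun j => pathStep hF' Z (pos h i j)
  have h1 := (K.obj P).subst_compose h v (pathStep hF' Z)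
  have h2 := P.subst_compose h v (pathStep hF' Z)
  have h3 (i : Fin m) : (K.obj P).compose (Z := fun j => Z (pos h i j))
      (fun s => v (subVertex h i s)) (fun j => pathStep hF' Z (pos h i j)) =
      K.comparison hF' (fun j => Z (pos h i j)) ≫ t i :=
    (K.comparison_compose hF' P _ _).symm
  have h4 := (K.obj P).map_cutComp h v
    (B := fun i => (F.tensor (k i)).obj fun j => Z (pos h i j))
    (B' := fun i => (F'.tensor (k i)).obj fun j => Z (pos h i j))
    (fun i => K.comparison hF' fun j => Z (pos h i j)) t
  have h5 : K.comparison hF' (fun i => (F'.tensor (k i)).obj fun j => Z (pos h i j)) ≫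
      P.cutComp h v t = (K.obj P).cutComp h v t := by
    have h6 := K.comparison_compose hF' P (fun s => v (cutVertex h s))
      (fun i => t i ≫ eqToHom (by rw [subVertex_last]; rfl))
    refine Eq.trans ?_ ((congrArg (· ≫ eqToHom (by rw [cutVertex_zero, cutVertex_last])) h6).trans
      (Category.assoc _ _ _))
    exact (congrArg (_ ≫ ·) (Category.assoc _ _ _).symm).trans (Category.assoc _ _ _).symm
  refine (Category.assoc _ _ _).symm.trans ((congrArg (· ≫ pathAll hF' Z) h1).trans ?_)
  refine (congrArg (· ≫ pathAll hF' Z) (congrArg ((K.obj P).cutComp h v) (funext h3))).trans ?_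
  refine (congrArg (· ≫ pathAll hF' Z) h4.symm).trans ((Category.assoc _ _ _).trans ?_)
  refine congrArg (_ ≫ ·) ?_
  refine (congrArg (· ≫ pathAll hF' Z) h5.symm).trans ((Category.assoc _ _ _).trans ?_)
  refine congrArg (_ ≫ ·) ?_
  refine (congrArg (· ≫ pathAll hF' Z) h2.symm).trans ((Category.assoc _ _ _).trans ?_)
  exact (congrArg (_ ≫ ·) (compose_pathStep hF' Z)).trans (Category.comp_id _)

/-- Apply `comparison_compose` to the free `F`-category regarded as an `F'`-category. Its image
under `K` has the original composition, so the composite map is the generic one, which is the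
identity. -/
theorem comparison_comparison (hF : F.AbsorbsInitial) {n : ℕ} (Z : Fin n → V) :
    K.comparison hF' Z ≫ K.symm.comparison hF Z = 𝟙 _ := by
  have h1 := K.comparison_compose hF' (K.symm.obj (freePath hF Z)) (pathVertices hF Z)
    (pathStep hF Z)
  have h2 : (K.obj (K.symm.obj (freePath hF Z))).compose (pathVertices hF Z) (pathStep hF Z) =
      (freePath hF Z).compose (pathVertices hF Z) (pathStep hF Z) :=
    congrArg (_ ≫ ·) (K.obj_symm_obj_comp (freePath hF Z) (pathVertices hF Z))
  refine (Category.assoc _ _ _).symm.trans ((congrArg (· ≫ _) (h1.trans h2)).trans ?_)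
  exact compose_pathStep hF Z

/-- Multitensors which preserve initial objects and have isomorphic categories of enriched
categories are isomorphic. -/
noncomputable def multitensorIso (hF : F.AbsorbsInitial) : F.Iso F' where
  iso _ := NatIso.ofComponents (fun Z =>
    { hom := K.comparison hF' Z
      inv := K.symm.comparison hF Z
      hom_inv_id := K.comparison_comparison hF' hF Z
      inv_hom_id := K.symm.comparison_comparison hF hF' Z }) (K.comparison_naturality hF')
  unit_iso := K.unit_comparison hF'
  subst_iso := K.subst_comparison hF'

/-- On objects this is `comparison_compose` for identity maps along a path; on morphisms both
functors keep the underlying map of graphs. -/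
theorem multitensorIso_pullback (hF : F.AbsorbsInitial) :
    (K.multitensorIso hF' hF).pullback = K.hom := by
  have h (X : ECategory F') : (K.multitensorIso hF' hF).pullback.obj X = K.hom.obj X := by
    refine Eq.trans (b := K.obj X) ?_ (withGraph_eq _ _)
    refine ext_of_heq rfl HEq.rfl (comp_heq_of_forall rfl fun {n} x => heq_of_eq ?_)
    have h1 := K.comparison_compose hF' X x fun i => 𝟙 _
    refine Eq.trans ?_ (h1.trans ?_)
    · refine congrArg (K.comparison hF' _ ≫ ·) ?_
      refine (Category.id_comp _).symm.trans (congrArg (· ≫ X.comp x) ?_)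
      exact ((F'.tensor n).map_id _).symm
    · refine (congrArg (· ≫ (K.obj X).comp x) ?_).trans (Category.id_comp _)
      exact (F.tensor n).map_id _
  exact CategoryTheory.Functor.hext h fun X Y f =>
    EFunctor.heq_of_toMap (h X) (h Y) (K.toMap_hom_map f).symm

end IsoOver

namespace Multitensor

variable {V : Type u} [Category.{w} V] {E : Multitensor V}

/-- The composite of the inverse of one lift's isomorphism with the other's is an isomorphism of
categories of enriched categories over graphs, so it is induced by an isomorphism of multitensors.
Cancelling the inverse gives the compatibility. -/
theorem exists_iso_of_lifts (L L' : Lift E) (hL : L.lifted.IsDistributive)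
    (hL' : L'.lifted.IsDistributive) :
    ∃ φ : L.lifted.Iso L'.lifted, L'.enrichIso.hom ⋙ φ.pullback = L.enrichIso.hom := by
  have := hL.hasInitial
  have hF := absorbsInitial_of_preservesCoproductsInVariables (E := L.lifted) hL.2
  have hF' := absorbsInitial_of_preservesCoproductsInVariables (E := L'.lifted) hL'.2
  let K := L'.enrichIso.symm.trans L.enrichIso
  refine ⟨K.multitensorIso hF' hF, ?_⟩
  rw [K.multitensorIso_pullback hF' hF]
  change (L'.enrichIso.hom ⋙ L'.enrichIso.inv) ⋙ L.enrichIso.hom = _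
  rw [L'.enrichIso.hom_inv, Functor.id_comp]

end Multitensor

end MultitensorLifting

theorem mainTheorem1 {V : Type u} [Category.{w} V] [IsLocallyPresentable.{w} V]
    (E : MultitensorLifting.Multitensor V) (hd : E.IsDistributive)
    (ha : E.IsAccessibleInEachVariable) :
    (∃ L : MultitensorLifting.Lift E, L.lifted.IsDistributive) ∧
      ∀ L L' : MultitensorLifting.Lift E, L.lifted.IsDistributive → L'.lifted.IsDistributive →
        ∃ φ : L.lifted.Iso L'.lifted, L'.enrichIso.hom ⋙ φ.pullback = L.enrichIso.hom := by
  exact ⟨MultitensorLifting.Multitensor.exists_lift hd ha,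
    MultitensorLifting.Multitensor.exists_iso_of_lifts⟩
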